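/- **Theorem 1.** Let $(M,\omega)$ be a compact Hermitian manifold of complex dimension $n$ and let $1\le k\le n$. Let $\chi(z,s)$, $(z,s)\in M\times\mathbb R$, be a family of real $(1,1)$-forms on $M$ which is smooth in $(z,s)$, let $\psi=\psi(z,v,s)$ be a positive smooth function on $(T^{1,0}M)^*\times\mathbb R$, and let $\varepsilon>0$. Then for all $A,B\in\mathbb R$ there is a constant $C$, depending only on $(M,\omega)$, $\varepsilon$, $n$, $k$, $\chi$, $\psi$, $A$ and $B$, with the following property. Let $u\in C^4(M)$ be a real function which is $\chi$-plurisubharmonic, i.e. $\chi(z,u)+\sqrt{-1}\,\partial\bar\partial u>0$ on $M$, which solves the complex Hessian equation $$(\chi(z,u)+\sqrt{-1}\,\partial\bar\partial u)^k\wedge\omega^{n-k}=\psi(z,Du,u)\,\omega^n\quad\text{on } M,$$ where $Du=\partial u=\sum_j u_j\,dz^j$, and for which $\chi(z,u(z))\ge\varepsilon\,\omega$ on $M$, $\sup_M|u|\le A$ and $\sup_M|Du|_\omega\le B$. Then $$|D\bar D u|_\omega\le C\quad\text{on } M,$$ where $D\bar Du=(u_{i\bar j})$ is the complex Hessian of $u$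 and $|D\bar Du|_\omega^2=\omega^{i\bar l}\omega^{p\bar j}u_{i\bar j}u_{p\bar l}$. -/

import Mathlib

open scoped Manifold ContDiff ComplexOrder Matrix

noncomputable section

namespace HessianEstimate

/-- The model space `ℂⁿ`. -/
abbrev Cn (n : ℕ) : Type := EuclideanSpace ℂ (Fin n)

section Euclidean

variable {n : ℕ}

/-- The Wirtinger derivative `∂f/∂zʲ = (∂f/∂xʲ - √-1 ∂f/∂yʲ) / 2`. -/
def wirtinger (j : Fin n) (f : Cn n → ℂ) (x : Cn n) : ℂ :=
  (1 / 2 : ℂ) * (fderiv ℝ f x (EuclideanSpace.single j 1)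
    - Complex.I * fderiv ℝ f x (EuclideanSpace.single j Complex.I))

/-- The Wirtinger derivative `∂f/∂z̄ʲ = (∂f/∂xʲ + √-1 ∂f/∂yʲ) / 2`. -/
def wirtingerBar (j : Fin n) (f : Cn n → ℂ) (x : Cn n) : ℂ :=
  (1 / 2 : ℂ) * (fderiv ℝ f x (EuclideanSpace.single j 1)
    + Complex.I * fderiv ℝ f x (EuclideanSpace.single j Complex.I))

/-- Complex-valued real-linear forms on `ℂⁿ`: the complexified cotangent space. -/
abbrev Covector (n : ℕ) : Type := Cn n →ₗ[ℝ] ℂ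

/-- The covector `dzʲ`. -/
def dzForm (j : Fin n) : Covector n where
  toFun v := v j
  map_add' _ _ := rfl
  map_smul' _ _ := rfl

/-- The covector `dz̄ʲ`. -/
def dzBarForm (j : Fin n) : Covector n where
  toFun v := (starRingEnd ℂ) (v j)
  map_add' v w := by simp
  map_smul' c v := by simp

/-- The `(1,1)`-form `√-1 ∑ⱼₖ Hⱼₖ dzʲ ∧ dz̄ᵏ` as an element of the exterior algebra of the
complexified cotangent space; the product there is the wedge product. -/
def oneOneForm (H : Matrix (Fin n) (Fin n) ℂ) : ExteriorAlgebra ℂ (Covector n) :=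
  ∑ j, ∑ k, (Complex.I * H j k) •
    (ExteriorAlgebra.ι ℂ (dzForm j) * ExteriorAlgebra.ι ℂ (dzBarForm k))

end Euclidean

section Complex

variable {n : ℕ} {M : Type*} [TopologicalSpace M] [ChartedSpace (Cn n) M]

/-- `T_z M` with its complex structure, which is also (canonically) `T_z^{1,0} M`. -/
abbrev Tangent (n : ℕ) {M : Type*} [TopologicalSpace M] [ChartedSpace (Cn n) M] (z : M) : Type :=
  TangentSpace 𝓘(ℂ, Cn n) z

/-- The space of `(1,0)`-covectors `(T_z^{1,0} M)^*` at `z`. -/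
abbrev Cotangent (n : ℕ) {M : Type*} [TopologicalSpace M] [ChartedSpace (Cn n) M] (z : M) : Type :=
  Tangent n z →L[ℂ] ℂ

/-- Sesquilinear forms on `T_z M`, linear in the first and conjugate-linear in the second
variable. The Hermitian symmetric ones are the real `(1,1)`-covectors at `z`: in holomorphic
coordinates `h` corresponds to `√-1 ∑ⱼₖ hⱼₖ dzʲ ∧ dz̄ᵏ` with `hⱼₖ = h (∂/∂zʲ) (∂/∂zᵏ)`. -/
abbrev SesqForm (n : ℕ) {M : Type*} [TopologicalSpace M] [ChartedSpace (Cn n) M] (z : M) : Type :=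
  Tangent n z →ₗ[ℂ] Tangent n z →ₗ⋆[ℂ] ℂ

/-- The holomorphic charts of `M` (all charts of the maximal holomorphic atlas). -/
def holCharts (n : ℕ) (M : Type*) [TopologicalSpace M] [ChartedSpace (Cn n) M] :
    Set (OpenPartialHomeomorph M (Cn n)) :=
  IsManifold.maximalAtlas 𝓘(ℂ, Cn n) ω M

/-- The coordinate vector `∂/∂zʲ` of the chart `e` at the point with coordinates `x`. -/
def coordVec (e : OpenPartialHomeomorph M (Cn n)) (x : Cn n) (j : Fin n) :
    Tangent n (e.symm x) :=
  mfderiv 𝓘(ℂ, Cn n) 𝓘(ℂ, Cn n) e.symm x (EuclideanSpace.single j (1 : ℂ) : Cn n)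

/-- The `(1,0)`-covector `∑ⱼ aⱼ dzʲ` at the point with coordinates `x` in the chart `e`. -/
def coordCovec (e : OpenPartialHomeomorph M (Cn n)) (x : Cn n) (a : Fin n → ℂ) :
    Cotangent n (e.symm x) :=
  ∑ j, a j • ((EuclideanSpace.proj j : Cn n →L[ℂ] ℂ).comp
    (mfderiv 𝓘(ℂ, Cn n) 𝓘(ℂ, Cn n) e (e.symm x)))

/-- The coefficients `hⱼₖ = h (∂/∂zʲ) (∂/∂zᵏ)` in the chart `e`. -/
def coeff (e : OpenPartialHomeomorph M (Cn n)) (x : Cn n) (h : SesqForm n (e.symm x)) :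
    Matrix (Fin n) (Fin n) ℂ :=
  Matrix.of fun j k => h (coordVec e x j) (coordVec e x k)

/-- A smooth Hermitian metric, i.e. a smooth positive real `(1,1)`-form `ω` on `M`. -/
structure HermitianMetric (n : ℕ) (M : Type*) [TopologicalSpace M] [ChartedSpace (Cn n) M] where
  form : (z : M) → SesqForm n z
  hermitian : ∀ z v w, form z w v = (starRingEnd ℂ) (form z v w)
  pos : ∀ z v, v ≠ 0 → 0 < (form z v v).re
  smooth : ∀ e ∈ holCharts n M, ∀ j k,
    ContDiffOn ℝ ∞ (fun x => coeff e x (form (e.symm x)) j k) e.target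

/-- A family `χ(z, s)` of real `(1,1)`-forms, smooth in `(z, s) ∈ M × ℝ`. -/
structure RealFormFamily (n : ℕ) (M : Type*) [TopologicalSpace M] [ChartedSpace (Cn n) M] where
  form : (z : M) → ℝ → SesqForm n z
  hermitian : ∀ z s v w, form z s w v = (starRingEnd ℂ) (form z s v w)
  smooth : ∀ e ∈ holCharts n M, ∀ j k,
    ContDiffOn ℝ ∞ (fun p : Cn n × ℝ => coeff e p.1 (form (e.symm p.1) p.2) j k)
      (e.target ×ˢ Set.univ)

/-- A positive smooth function `ψ(z, v, s)` on `(T^{1,0} M)^* × ℝ`. -/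
structure PositiveRHS (n : ℕ) (M : Type*) [TopologicalSpace M] [ChartedSpace (Cn n) M] where
  toFun : (z : M) → Cotangent n z → ℝ → ℝ
  pos : ∀ z v s, 0 < toFun z v s
  smooth : ∀ e ∈ holCharts n M,
    ContDiffOn ℝ ∞ (fun p : Cn n × (Fin n → ℂ) × ℝ =>
      toFun (e.symm p.1) (coordCovec e p.1 p.2.1) p.2.2) (e.target ×ˢ Set.univ)

/-- The components `uⱼ = ∂u/∂zʲ` of `Du` in the chart `e`. -/
def grad (u : M → ℝ) (e : OpenPartialHomeomorph M (Cn n)) (x : Cn n) : Fin n → ℂ :=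
  fun j => wirtinger j (fun y => (u (e.symm y) : ℂ)) x

/-- The components `uⱼₖ = ∂²u/∂zʲ∂z̄ᵏ` of the complex Hessian of `u` in the chart `e`. -/
def hess (u : M → ℝ) (e : OpenPartialHomeomorph M (Cn n)) (x : Cn n) :
    Matrix (Fin n) (Fin n) ℂ :=
  Matrix.of fun j k => wirtingerBar k (wirtinger j (fun y => (u (e.symm y) : ℂ))) x

/-- The coefficients in the chart `e` of `χ(z, u) + √-1 ∂∂̄u`. -/
def gMatrix (χ : RealFormFamily n M) (u : M → ℝ) (e : OpenPartialHomeomorph M (Cn n))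
    (x : Cn n) : Matrix (Fin n) (Fin n) ℂ :=
  coeff e x (χ.form (e.symm x) (u (e.symm x))) + hess u e x

/-- `u` is `χ`-plurisubharmonic: `χ(z, u) + √-1 ∂∂̄u > 0`. -/
def IsChiPSH (χ : RealFormFamily n M) (u : M → ℝ) : Prop :=
  ∀ e ∈ holCharts n M, ∀ x ∈ e.target, (gMatrix χ u e x).PosDef

/-- `(χ(z, u) + √-1 ∂∂̄u)ᵏ ∧ ωⁿ⁻ᵏ = ψ(z, Du, u) ωⁿ`. -/
def SolvesHessianEq (met : HermitianMetric n M) (χ : RealFormFamily n M) (ψ : PositiveRHS n M)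
    (k : ℕ) (u : M → ℝ) : Prop :=
  ∀ e ∈ holCharts n M, ∀ x ∈ e.target,
    oneOneForm (gMatrix χ u e x) ^ k * oneOneForm (coeff e x (met.form (e.symm x))) ^ (n - k) =
      ((ψ.toFun (e.symm x) (coordCovec e x (grad u e x)) (u (e.symm x)) : ℝ) : ℂ) •
        oneOneForm (coeff e x (met.form (e.symm x))) ^ n

/-- `χ(z, u) ≥ ε ω`. -/
def ChiGe (met : HermitianMetric n M) (χ : RealFormFamily n M) (ε : ℝ) (u : M → ℝ) : Prop :=
  ∀ (z : M) (v : Tangent n z), ε * (met.form z v v).re ≤ (χ.form z (u z) v v).re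

/-- `|Du|_ω = (ω^{j k̄} uⱼ u_k̄)^{1/2}`. -/
def gradNorm (met : HermitianMetric n M) (u : M → ℝ) (e : OpenPartialHomeomorph M (Cn n))
    (x : Cn n) : ℝ :=
  √((star (grad u e x) ⬝ᵥ ((coeff e x (met.form (e.symm x)))⁻¹ *ᵥ grad u e x)).re)

/-- `|D D̄ u|_ω = (ω^{i l̄} ω^{p j̄} u_{i j̄} u_{p l̄})^{1/2}`. -/
def hessNorm (met : HermitianMetric n M) (u : M → ℝ) (e : OpenPartialHomeomorph M (Cn n))
    (x : Cn n) : ℝ :=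
  √(((coeff e x (met.form (e.symm x)))⁻¹ * hess u e x *
    (coeff e x (met.form (e.symm x)))⁻¹ * hess u e x).trace.re)

end Complex

end HessianEstimate

end

/-!
The estimate follows from the maximum principle applied to the function
`log λ + N |∂u|² + exp (L (A + 1 - u))` on `M`, where `λ` is the largest eigenvalue of
`g = χ(·, u) + √-1 ∂∂̄u` with respect to `ω`. To avoid the regularity problems of `λ`, the Rayleigh
quotient `g(y, y) / ω(y, y)` is maximized over points and tangent vectors `y` at the same time.
Since `χ(·, u)` and `|u|` are bounded and `g > 0`, an upper bound for `λ` bounds `∂∂̄u`, and since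
`|u|` and `|∂u|` are bounded, it is enough to bound `λ` at a maximum point. Everything happens in a
frame of constant vector fields of a chart which is orthonormal for `ω` and diagonalizes `g` at that
point; with `σ = e_k` the elementary symmetric function, the equation is `σ(λ₁, …, λₙ) = Ψ` there,
where `Ψ` is `ψ` up to a binomial coefficient. Set `Fᵢ = ∂σ/∂λᵢ`, and let `κ` denote
`N |∂u|² + exp (L (A + 1 - u))`.

*Third derivatives* (`max_principle`, `equation_deriv`, `third_order_at_max`). The condition for a
maximum, tested along a vector `y` that varies to first order in the optimal way, gives
`∂ᵢ g_{m m̄} = -λ_m ∂ᵢκ` up to metric terms, and good squares of the `∂ᵢ g_{b m̄}`, `∂ᵢ g_{m b̄}`. The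
twice differentiated equation supplies the second derivatives of `σ`. When `λ_m` is large,
`-∂² log σ` is almost as large in the direction `m` as for a product of the eigenvalues; this is
`concavity_real`, which rests on the concavity of `log e_k`, itself a consequence of the
Marcus–Lopes inequality `elemSymm_div_superadditive`. All third derivatives are thereby absorbed, and
only `2 δ |∂κ|²` with small `δ` is left (`third_order_estimate`). Terms from the torsion of `ω` are
of lower order, since `∂∂̄u` is closed.

*Lower order terms* (`le_sum_lap_gradSq`, `le_lap_rhs`). The linearized operator on `|∂u|²` yields all
squares of second derivatives of `u`. The right hand side depends on `∂u`, so its second derivatives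
contain `∂_p Ψ` contracted with third derivatives of `u`. The same contraction comes with the
opposite sign from `|∂u|²`, by the first order condition, and cancels. Because `χ ≥ ε ω`, the
exponential of `-u` yields `ε L ∑ Fᵢ` up to a factor. With `N`, and then `L`, large enough
(`sum_deriv_le_of_absorption`) all this bounds `∑ Fᵢ`. But `∑ Fᵢ` tends to infinity with `λ_m` while
`σ` stays bounded below (`elemSymm_le_mul_sum_erase`), unless `k = 1`, when the equation itself bounds
`λ_m`. Hence `λ_m` is bounded (`exists_eigenvalue_bound`).

*Uniformity.* `M` is covered by finitely many compact subsets of charts, over which the data of the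
equation are bounded in all orthonormal frames and on the bounded set of 1-jets in question
(`exists_jet_bound`, `exists_maxPointData`). The test function is independent of the chart, as `g`
and `ω` transform as Hermitian forms. The equation between exterior powers is turned into one between
mixed discriminants by comparing coefficients in `(t g + ω)ⁿ` (`mixedDet_of_oneOneForm`).
-/

noncomputable section

namespace HessianEstimate

/-! ### Elementary symmetric functions -/

section ElemSymm

variable {ι : Type*}

/-- The elementary symmetric function of degree `k` in the variables `x i`, `i ∈ s`. -/
def elemSymm (k : ℕ) (s : Finset ι) (x : ι → ℝ) : ℝ :=
  ∑ T ∈ s.powersetCard k, ∏ i ∈ T, x i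

@[simp] lemma elemSymm_zero (s : Finset ι) (x : ι → ℝ) : elemSymm 0 s x = 1 := by
  simp [elemSymm]

lemma elemSymm_nonneg (k : ℕ) {s : Finset ι} {x : ι → ℝ} (hx : ∀ i ∈ s, 0 < x i) :
    0 ≤ elemSymm k s x :=
  Finset.sum_nonneg fun _ hT =>
    Finset.prod_nonneg fun i hi => (hx i ((Finset.mem_powersetCard.1 hT).1 hi)).le

lemma elemSymm_pos {k : ℕ} {s : Finset ι} {x : ι → ℝ} (hx : ∀ i ∈ s, 0 < x i)
    (hk : k ≤ s.card) : 0 < elemSymm k s x :=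
  Finset.sum_pos (fun _ hT => Finset.prod_pos fun i hi =>
    hx i ((Finset.mem_powersetCard.1 hT).1 hi)) (Finset.powersetCard_nonempty.2 hk)

lemma elemSymm_eq_zero {k : ℕ} {s : Finset ι} (x : ι → ℝ) (hk : s.card < k) :
    elemSymm k s x = 0 := by
  simp [elemSymm, Finset.powersetCard_eq_empty.2 hk]

lemma elemSymm_smul (k : ℕ) (s : Finset ι) (c : ℝ) (x : ι → ℝ) :
    elemSymm k s (c • x) = c ^ k * elemSymm k s x := by
  unfold elemSymm
  rw [Finset.mul_sum]
  refine Finset.sum_congr rfl fun T hT => ?_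
  simp only [Pi.smul_apply, smul_eq_mul]
  rw [Finset.prod_mul_distrib, Finset.prod_const, (Finset.mem_powersetCard.1 hT).2]

lemma elemSymm_succ_empty (k : ℕ) (x : ι → ℝ) : elemSymm (k + 1) ∅ x = 0 := by
  exact elemSymm_eq_zero x (by simp)

variable [DecidableEq ι]

lemma elemSymm_insert (k : ℕ) {a : ι} {s : Finset ι} (ha : a ∉ s) (x : ι → ℝ) :
    elemSymm (k + 1) (insert a s) x = elemSymm (k + 1) s x + x a * elemSymm k s x := by
  unfold elemSymm
  rw [Finset.powersetCard_succ_insert ha, Finset.sum_union, Finset.sum_image, Finset.mul_sum]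
  · congr 1
    refine Finset.sum_congr rfl fun T hT => ?_
    rw [Finset.prod_insert]
    exact fun h => ha ((Finset.mem_powersetCard.1 hT).1 h)
  · intro T hT T' hT' h
    have h1 : a ∉ T := fun h => ha ((Finset.mem_powersetCard.1 hT).1 h)
    have h2 : a ∉ T' := fun h => ha ((Finset.mem_powersetCard.1 hT').1 h)
    rw [← Finset.erase_insert h1, ← Finset.erase_insert h2, h]
  · rw [Finset.disjoint_left]
    intro T hT hT'
    obtain ⟨T', _, rfl⟩ := Finset.mem_image.1 hT'
    exact ha ((Finset.mem_powersetCard.1 hT).1 (Finset.mem_insert_self _ _))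

lemma elemSymm_erase (k : ℕ) {a : ι} {s : Finset ι} (ha : a ∈ s) (x : ι → ℝ) :
    elemSymm (k + 1) s x = elemSymm (k + 1) (s.erase a) x + x a * elemSymm k (s.erase a) x := by
  rw [← elemSymm_insert k (Finset.notMem_erase a s) x, Finset.insert_erase ha]

lemma sum_powersetCard_sum_erase {R : Type*} [AddCommMonoid R] (k : ℕ) (s : Finset ι)
    (f : ι → Finset ι → R) :
    ∑ S ∈ s.powersetCard (k + 1), ∑ a ∈ S, f a (S.erase a) =
      ∑ a ∈ s, ∑ T ∈ (s.erase a).powersetCard k, f a T := by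
  rw [Finset.sum_sigma', Finset.sum_sigma']
  refine Finset.sum_bij' (fun p _ => ⟨p.2, p.1.erase p.2⟩) (fun p _ => ⟨insert p.1 p.2, p.1⟩)
    ?_ ?_ ?_ ?_ ?_
  · rintro ⟨S, a⟩ h
    simp only [Finset.mem_sigma, Finset.mem_powersetCard] at h ⊢
    refine ⟨h.1.1 h.2, Finset.erase_subset_erase _ h.1.1, ?_⟩
    rw [Finset.card_erase_of_mem h.2, h.1.2]; rfl
  · rintro ⟨a, T⟩ h
    simp only [Finset.mem_sigma, Finset.mem_powersetCard] at h ⊢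
    have haT : a ∉ T := fun h' => Finset.notMem_erase a s (h.2.1 h')
    refine ⟨⟨Finset.insert_subset h.1 (h.2.1.trans (Finset.erase_subset _ _)), ?_⟩,
      Finset.mem_insert_self _ _⟩
    rw [Finset.card_insert_of_notMem haT, h.2.2]
  · rintro ⟨S, a⟩ h
    simp only [Finset.mem_sigma, Finset.mem_powersetCard] at h
    simp [Finset.insert_erase h.2]
  · rintro ⟨a, T⟩ h
    simp only [Finset.mem_sigma, Finset.mem_powersetCard] at h
    have haT : a ∉ T := fun h' => Finset.notMem_erase a s (h.2.1 h')
    simp [Finset.erase_insert haT]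
  · rintro ⟨S, a⟩ h
    rfl

lemma sum_mul_elemSymm_erase (k : ℕ) (s : Finset ι) (x : ι → ℝ) :
    ∑ a ∈ s, x a * elemSymm k (s.erase a) x = (k + 1) * elemSymm (k + 1) s x := by
  unfold elemSymm
  simp_rw [Finset.mul_sum]
  rw [← sum_powersetCard_sum_erase k s fun a T => x a * ∏ i ∈ T, x i]
  refine Finset.sum_congr rfl fun S hS => ?_
  rw [Finset.sum_congr rfl fun a ha => Finset.mul_prod_erase S x ha, Finset.sum_const,
    (Finset.mem_powersetCard.1 hS).2]
  simp

/-- Log-concavity of the sequence of elementary symmetric functions of positive numbers. -/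
lemma elemSymm_mul_le {s : Finset ι} {x : ι → ℝ} (hx : ∀ i ∈ s, 0 < x i) :
    ∀ i j, i ≤ j → elemSymm i s x * elemSymm (j + 2) s x ≤
      elemSymm (i + 1) s x * elemSymm (j + 1) s x := by
  induction s using Finset.induction_on with
  | empty =>
    intro i j _
    simp [elemSymm_succ_empty]
  | insert a s ha ih =>
    have hxs : ∀ i ∈ s, 0 < x i := fun i hi => hx i (Finset.mem_insert_of_mem hi)
    have hxa : 0 < x a := hx a (Finset.mem_insert_self _ _)
    have IH := ih hxs
    intro i j hij
    rcases i with _ | i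
    · rw [elemSymm_insert _ ha, elemSymm_insert _ ha, elemSymm_insert _ ha]
      simp only [elemSymm_zero, zero_add]
      have h0 := IH 0 j (Nat.zero_le _)
      simp only [elemSymm_zero, zero_add] at h0
      have e1 := elemSymm_nonneg 1 hxs
      have e2 := elemSymm_nonneg j hxs
      have e3 := elemSymm_nonneg (j + 1) hxs
      have : 0 ≤ elemSymm 1 s x * (x a * elemSymm j s x) := by positivity
      have : 0 ≤ x a * (x a * elemSymm j s x) := by positivity
      nlinarith
    · obtain ⟨j, rfl⟩ : ∃ j', j = j' + 1 := ⟨j - 1, by omega⟩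
      rw [elemSymm_insert _ ha, elemSymm_insert _ ha, elemSymm_insert _ ha, elemSymm_insert _ ha]
      have h0 := IH (i + 1) (j + 1) hij
      have h1 := IH i (j + 1) (by omega)
      have h2 := IH i j (by omega)
      have h3 : elemSymm (i + 1) s x * elemSymm (j + 2) s x ≤
          elemSymm (i + 2) s x * elemSymm (j + 1) s x := by
        rcases Nat.lt_or_ge i j with h | h
        · exact IH (i + 1) j (by omega)
        · obtain rfl : i = j := by omega
          exact le_of_eq (mul_comm _ _)
      have g2 : 0 ≤ x a * x a := by positivity
      nlinarith [mul_le_mul_of_nonneg_left h2 g2, mul_le_mul_of_nonneg_left (h1.trans h3) hxa.le]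

/-- If the `(k+1)`-st elementary symmetric function is small, so is its quotient by the
`k`-th one: the successive quotients decrease, and their product is `elemSymm (k + 1)`. -/
lemma elemSymm_succ_le_of_le_pow {s : Finset ι} {x : ι → ℝ} (hx : ∀ i ∈ s, 0 < x i) {k : ℕ}
    {τ : ℝ} (hτ : 0 ≤ τ) (h : elemSymm (k + 1) s x ≤ τ ^ (k + 1)) :
    elemSymm (k + 1) s x ≤ τ * elemSymm k s x := by
  rcases Nat.lt_or_ge s.card (k + 1) with hk | hk
  · rw [elemSymm_eq_zero x hk]
    exact mul_nonneg hτ (elemSymm_nonneg _ hx)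
  have hpos : ∀ i, i ≤ k + 1 → 0 < elemSymm i s x := fun i hi => elemSymm_pos hx (hi.trans hk)
  set r := elemSymm (k + 1) s x / elemSymm k s x with hr
  have hr0 : 0 < r := div_pos (hpos _ le_rfl) (hpos _ (Nat.le_succ _))
  -- the quotient of index `i ≤ k` is at least `r`
  have hq : ∀ i ≤ k, r * elemSymm i s x ≤ elemSymm (i + 1) s x := by
    intro i hi
    rw [hr, div_mul_eq_mul_div, div_le_iff₀ (hpos _ (Nat.le_succ _))]
    rcases Nat.lt_or_ge i k with h' | h'
    · obtain ⟨j, rfl⟩ : ∃ j, k = j + 1 := ⟨k - 1, by omega⟩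
      have := elemSymm_mul_le hx i j (by omega)
      linarith [mul_comm (elemSymm i s x) (elemSymm (j + 2) s x)]
    · obtain rfl : i = k := by omega
      exact le_rfl
  have hp : ∀ i ≤ k + 1, r ^ i ≤ elemSymm i s x := by
    intro i
    induction i with
    | zero => intro; simp
    | succ i ih =>
      intro hi
      calc r ^ (i + 1) = r * r ^ i := by ring
        _ ≤ r * elemSymm i s x := by gcongr; exact ih (by omega)
        _ ≤ _ := hq i (by omega)
  have h1 : r ≤ τ := by
    have := (hp _ le_rfl).trans h
    exact le_of_pow_le_pow_left₀ (Nat.succ_ne_zero k) hτ this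
  have h2 := mul_le_mul_of_nonneg_right h1 (hpos k (Nat.le_succ _)).le
  rwa [hr, div_mul_cancel₀ _ (hpos k (Nat.le_succ _)).ne'] at h2

/-- The parallel sum `y z / (y + z)` of nonnegative numbers is superadditive and increasing in `z`. -/
lemma parallelSum_superadditive {y₁ y₂ z₁ z₂ z : ℝ} (hy₁ : 0 < y₁) (hy₂ : 0 < y₂)
    (hz₁ : 0 ≤ z₁) (hz₂ : 0 ≤ z₂) (hz : z₁ + z₂ ≤ z) :
    y₁ * z₁ / (y₁ + z₁) + y₂ * z₂ / (y₂ + z₂) ≤ (y₁ + y₂) * z / (y₁ + y₂ + z) := by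
  have h1 : (y₁ + y₂) * (z₁ + z₂) / (y₁ + y₂ + (z₁ + z₂)) ≤ (y₁ + y₂) * z / (y₁ + y₂ + z) := by
    rw [div_le_div_iff₀ (by positivity) (by linarith)]
    nlinarith [mul_le_mul_of_nonneg_left hz (by positivity : 0 ≤ (y₁ + y₂) * (y₁ + y₂))]
  refine le_trans ?_ h1
  rw [div_add_div _ _ (by positivity) (by positivity), div_le_div_iff₀ (by positivity)
    (by positivity)]
  have : (y₁ + y₂) * (z₁ + z₂) * ((y₁ + z₁) * (y₂ + z₂)) -
    (y₁ * z₁ * (y₂ + z₂) + (y₁ + z₁) * (y₂ * z₂)) * (y₁ + y₂ + (z₁ + z₂)) =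
      (y₁ * z₂ - y₂ * z₁) ^ 2 := by ring
  nlinarith [sq_nonneg (y₁ * z₂ - y₂ * z₁)]

/-- The Marcus–Lopes inequality: on positive vectors the quotient of consecutive elementary
symmetric functions is superadditive. It follows by induction from the identity
`(k+2) e_{k+2} / e_{k+1} = ∑ xᵢ qᵢ / (xᵢ + qᵢ)`, with `qᵢ` the quotient of one degree less in the
remaining variables. Where the denominator vanishes, so does the numerator. -/
lemma elemSymm_div_superadditive (k : ℕ) : ∀ (s : Finset ι) {x y : ι → ℝ},
    (∀ i ∈ s, 0 < x i) → (∀ i ∈ s, 0 < y i) →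
    elemSymm (k + 1) s x / elemSymm k s x + elemSymm (k + 1) s y / elemSymm k s y ≤
      elemSymm (k + 1) s (x + y) / elemSymm k s (x + y) := by
  induction k with
  | zero =>
    intro s x y _ _
    simp [elemSymm, Finset.powersetCard_one, Finset.sum_add_distrib]
  | succ k ih =>
    intro s x y hx hy
    have key : ∀ z : ι → ℝ, (∀ i ∈ s, 0 < z i) →
        elemSymm (k + 2) s z / elemSymm (k + 1) s z = (1 / (k + 2 : ℝ)) * ∑ a ∈ s,
          z a * (elemSymm (k + 1) (s.erase a) z / elemSymm k (s.erase a) z) /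
            (z a + elemSymm (k + 1) (s.erase a) z / elemSymm k (s.erase a) z) := by
      intro z hz
      have h1 := sum_mul_elemSymm_erase (k + 1) s z
      have h2 : elemSymm (k + 2) s z =
          (1 / (k + 2 : ℝ)) * ∑ a ∈ s, z a * elemSymm (k + 1) (s.erase a) z := by
        rw [h1]; push_cast; field_simp; ring
      rw [h2, mul_div_assoc, Finset.sum_div]
      congr 1
      refine Finset.sum_congr rfl fun a ha => ?_
      have hz' : ∀ i ∈ s.erase a, 0 < z i := fun i hi => hz i (Finset.mem_of_mem_erase hi)
      rcases Nat.lt_or_ge (s.erase a).card k with hc | hc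
      · rw [elemSymm_eq_zero z hc, elemSymm_eq_zero z (hc.trans (Nat.lt_succ_self k))]
        simp
      · rw [elemSymm_erase k ha z]
        have hp := elemSymm_pos hz' hc
        have hp' := elemSymm_nonneg (k + 1) hz'
        have hza := hz a ha
        have : z a + elemSymm (k + 1) (s.erase a) z / elemSymm k (s.erase a) z ≠ 0 := by
          positivity
        have : elemSymm (k + 1) (s.erase a) z + z a * elemSymm k (s.erase a) z ≠ 0 := by
          positivity
        field_simp
        rw [add_comm (z a * _)]
    rw [key x hx, key y hy, key (x + y) (fun i hi => add_pos (hx i hi) (hy i hi)), ← mul_add,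
      ← Finset.sum_add_distrib]
    refine mul_le_mul_of_nonneg_left (Finset.sum_le_sum fun a ha => ?_) (by positivity)
    have hx' : ∀ i ∈ s.erase a, 0 < x i := fun i hi => hx i (Finset.mem_of_mem_erase hi)
    have hy' : ∀ i ∈ s.erase a, 0 < y i := fun i hi => hy i (Finset.mem_of_mem_erase hi)
    exact parallelSum_superadditive (hx a ha) (hy a ha)
      (div_nonneg (elemSymm_nonneg _ hx') (elemSymm_nonneg _ hx'))
      (div_nonneg (elemSymm_nonneg _ hy') (elemSymm_nonneg _ hy'))
      (ih (s.erase a) hx' hy')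

/-- Midpoint log-concavity of elementary symmetric functions on positive vectors. -/
lemma elemSymm_mul_le_sq (k : ℕ) (s : Finset ι) {x y z : ι → ℝ} (hx : ∀ i ∈ s, 0 < x i)
    (hy : ∀ i ∈ s, 0 < y i) (hz : x + y = (2 : ℝ) • z) :
    elemSymm k s x * elemSymm k s y ≤ elemSymm k s z ^ 2 := by
  have hzp : ∀ i ∈ s, 0 < z i := fun i hi => by
    have := congrFun hz i
    simp only [Pi.add_apply, Pi.smul_apply, smul_eq_mul] at this
    linarith [hx i hi, hy i hi]
  induction k with
  | zero => simp
  | succ k ih =>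
    rcases Nat.lt_or_ge s.card (k + 1) with hk | hk
    · simp [elemSymm_eq_zero _ hk]
    have hk' : k ≤ s.card := (Nat.le_succ k).trans hk
    have h := elemSymm_div_superadditive k s hx hy
    have px := elemSymm_pos hx hk'
    have py := elemSymm_pos hy hk'
    have pz := elemSymm_pos hzp hk'
    rw [hz, elemSymm_smul, elemSymm_smul] at h
    -- with the quotients `a`, `b`, `c` of `x`, `y`, `z`, superadditivity gives `a b ≤ c ^ 2`
    set a := elemSymm (k + 1) s x / elemSymm k s x with ha
    set b := elemSymm (k + 1) s y / elemSymm k s y with hb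
    have e1 : elemSymm (k + 1) s x = a * elemSymm k s x := by rw [ha]; field_simp
    have e2 : elemSymm (k + 1) s y = b * elemSymm k s y := by rw [hb]; field_simp
    set c := elemSymm (k + 1) s z / elemSymm k s z with hc
    have e3 : elemSymm (k + 1) s z = c * elemSymm k s z := by rw [hc]; field_simp
    have h' : a + b ≤ 2 * c := by
      refine h.trans (le_of_eq ?_)
      rw [e3]; field_simp; ring
    have a0 : 0 ≤ a := div_nonneg (elemSymm_nonneg _ hx) px.le
    have b0 : 0 ≤ b := div_nonneg (elemSymm_nonneg _ hy) py.le
    have hab : a * b ≤ c ^ 2 := by nlinarith [sq_nonneg (a - b)]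
    rw [e1, e2, e3]
    calc a * elemSymm k s x * (b * elemSymm k s y)
        = (a * b) * (elemSymm k s x * elemSymm k s y) := by ring
      _ ≤ c ^ 2 * elemSymm k s z ^ 2 :=
        mul_le_mul hab ih (mul_pos px py).le (sq_nonneg c)
      _ = _ := by ring

lemma hasDerivAt_elemSymm_line (k : ℕ) (s : Finset ι) (x ξ : ι → ℝ) (t : ℝ) :
    HasDerivAt (fun t : ℝ => elemSymm (k + 1) s (x + t • ξ))
      (∑ a ∈ s, ξ a * elemSymm k (s.erase a) (x + t • ξ)) t := by
  unfold elemSymm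
  simp_rw [Finset.mul_sum]
  rw [← sum_powersetCard_sum_erase k s fun a T => ξ a * ∏ i ∈ T, (x + t • ξ) i]
  refine HasDerivAt.fun_sum fun S _ => ?_
  have h : ∀ i ∈ S, HasDerivAt (fun t : ℝ => (x + t • ξ) i) (ξ i) t := by
    intro i _
    simpa using ((hasDerivAt_id t).mul_const (ξ i)).const_add (x i)
  have := HasDerivAt.fun_finsetProd h
  refine this.congr_deriv ?_
  exact Finset.sum_congr rfl fun a _ => by rw [smul_eq_mul, mul_comm]

/-- The Hessian inequality expressing the concavity of `log (elemSymm k)` on positive vectors. -/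
lemma elemSymm_hessian_le (k : ℕ) (s : Finset ι) {x : ι → ℝ} (hx : ∀ i ∈ s, 0 < x i)
    (ξ : ι → ℝ) :
    elemSymm (k + 2) s x *
      ∑ a ∈ s, ξ a * ∑ b ∈ s.erase a, ξ b * elemSymm k ((s.erase a).erase b) x ≤
      (∑ a ∈ s, ξ a * elemSymm (k + 1) (s.erase a) x) ^ 2 := by
  set p : ℝ → ℝ := fun t => elemSymm (k + 2) s (x + t • ξ) with hp
  set p' : ℝ → ℝ := fun t => ∑ a ∈ s, ξ a * elemSymm (k + 1) (s.erase a) (x + t • ξ) with hp'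
  set p'' : ℝ → ℝ := fun t => ∑ a ∈ s, ξ a * ∑ b ∈ s.erase a,
    ξ b * elemSymm k ((s.erase a).erase b) (x + t • ξ) with hp''
  have d1 : ∀ t, HasDerivAt p (p' t) t := fun t => hasDerivAt_elemSymm_line (k + 1) s x ξ t
  have d2 : ∀ t, HasDerivAt p' (p'' t) t := fun t =>
    HasDerivAt.fun_sum fun a _ => (hasDerivAt_elemSymm_line k (s.erase a) x ξ t).const_mul (ξ a)
  -- `t ↦ p t * p (-t)` has a local maximum at `0`
  set h : ℝ → ℝ := fun t => p t * p (-t) with hh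
  have dh : ∀ t, HasDerivAt h (p' t * p (-t) - p t * p' (-t)) t := fun t => by
    have := (d1 t).mul ((d1 (-t)).scomp t (hasDerivAt_neg t))
    refine this.congr_deriv ?_
    simp; ring
  have dh' : HasDerivAt (fun t => p' t * p (-t) - p t * p' (-t))
      (2 * (p'' 0 * p 0 - p' 0 ^ 2)) 0 := by
    have e1 := (d2 0).mul ((d1 (-0)).scomp 0 (hasDerivAt_neg 0))
    have e2 := (d1 0).mul ((d2 (-0)).scomp 0 (hasDerivAt_neg 0))
    refine (e1.sub e2).congr_deriv ?_
    simp; ring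
  have hmax : IsLocalMax h 0 := by
    have hpos : ∀ᶠ t : ℝ in nhds 0, ∀ i ∈ s, 0 < (x + t • ξ) i ∧ 0 < (x + (-t) • ξ) i := by
      rw [Filter.eventually_all_finset]
      intro i hi
      have c1 : Continuous fun t : ℝ => (x + t • ξ) i := by
        simp only [Pi.add_apply, Pi.smul_apply]; fun_prop
      have c2 : Continuous fun t : ℝ => (x + (-t) • ξ) i := by
        simp only [Pi.add_apply, Pi.smul_apply]; fun_prop
      exact (c1.continuousAt.eventually_const_lt (by simpa using hx i hi)).and
        (c2.continuousAt.eventually_const_lt (by simpa using hx i hi))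
    filter_upwards [hpos] with t ht
    have := elemSymm_mul_le_sq (k + 2) s (fun i hi => (ht i hi).1) (fun i hi => (ht i hi).2)
      (z := x) (by rw [neg_smul, two_smul]; abel)
    simpa [hh, hp, sq] using this
  have hder : deriv h = fun t => p' t * p (-t) - p t * p' (-t) := funext fun t => (dh t).deriv
  have hdd : deriv (deriv h) 0 = 2 * (p'' 0 * p 0 - p' 0 ^ 2) := by rw [hder]; exact dh'.deriv
  -- a positive second derivative would make `0` a local minimum as well, so `h` locally constant
  have hle : deriv (deriv h) 0 ≤ 0 := by
    by_contra hcon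
    push Not at hcon
    have hmin := isLocalMin_of_deriv_deriv_pos hcon hmax.deriv_eq_zero (dh 0).continuousAt
    have hev : h =ᶠ[nhds 0] fun _ => h 0 := by
      filter_upwards [hmin, hmax] with t h1 h2 using le_antisymm h2 h1
    have : deriv (deriv h) 0 = 0 := by
      rw [hev.deriv.deriv_eq]; simp
    linarith
  rw [hdd] at hle
  have e0 : p 0 = elemSymm (k + 2) s x := by simp [hp]
  have e1 : p' 0 = ∑ a ∈ s, ξ a * elemSymm (k + 1) (s.erase a) x := by simp [hp']
  have e2 : p'' 0 = ∑ a ∈ s, ξ a * ∑ b ∈ s.erase a, ξ b * elemSymm k ((s.erase a).erase b) x := by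
    simp [hp'']
  rw [← e0, ← e1, ← e2]
  linarith

end ElemSymm

/-! ### Concavity of the Hessian operator in the regime of one large eigenvalue -/

section Concavity

variable {ι : Type*} [DecidableEq ι]

/-- The quotient following a small quotient of elementary symmetric functions is small as well, by
log-concavity. -/
lemma elemSymm_succ_succ_le_of_le_pow {s : Finset ι} {x : ι → ℝ} (hx : ∀ i ∈ s, 0 < x i) {k : ℕ}
    {τ : ℝ} (hτ : 0 ≤ τ) (h : elemSymm (k + 1) s x ≤ τ ^ (k + 1)) :
    elemSymm (k + 2) s x ≤ τ * elemSymm (k + 1) s x := by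
  rcases Nat.lt_or_ge s.card (k + 2) with hk | hk
  · rw [elemSymm_eq_zero x hk]
    exact mul_nonneg hτ (elemSymm_nonneg _ hx)
  have h1 := elemSymm_succ_le_of_le_pow hx hτ h
  have h2 := elemSymm_mul_le hx k k le_rfl
  have p0 : 0 < elemSymm k s x := elemSymm_pos hx (by omega)
  have p1 : 0 < elemSymm (k + 1) s x := elemSymm_pos hx (by omega)
  by_contra hcon
  push Not at hcon
  nlinarith [mul_lt_mul_of_pos_left hcon p0, mul_le_mul_of_nonneg_right h1 p1.le]

/-- A mixed term of the second derivative of `log σ` absorbed by completing the square. In the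
application `a`, `b`, `c` are consecutive elementary symmetric functions of the variables other
than `xm` and `xp`, so that `Fm` and `Fp` are the derivatives of `σ` in these two variables. The
mixed coefficient equals `(b² - a c) / σ`, which is at most `b² / σ`. -/
lemma mixed_term_bound {a b c xm xp τ c₀ Fm Fp σ : ℝ} (ha : 0 < a) (hb : 0 ≤ b) (hc : 0 ≤ c)
    (hac : a * c ≤ b * b) (hm : 0 < xm) (hp : 0 < xp) (hτ : 0 ≤ τ) (hc₀ : 0 < c₀)
    (hbτ : b ≤ τ * a) (eFm : Fm = b + xp * a) (eFp : Fp = b + xm * a)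
    (eσ : σ = c + xp * b + xm * Fm) (y z : ℝ) :
    -(τ * Fm / (c₀ * xm ^ 2) * y ^ 2) ≤
      2 * y * z * (Fm * Fp / σ - a) + c₀ * (Fp * z ^ 2 / xm) := by
  have hF1 : 0 < Fm := by rw [eFm]; positivity
  have hF2 : 0 < Fp := by rw [eFp]; positivity
  have hσ0 : 0 < σ := by rw [eσ]; positivity
  have hbF : b ≤ Fm := by rw [eFm]; exact le_add_of_nonneg_right (mul_pos hp ha).le
  have hσm : xm * Fm ≤ σ := by
    rw [eσ]; exact le_add_of_nonneg_left (add_nonneg hc (mul_nonneg hp.le hb))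
  have hbb : 0 ≤ b ^ 2 - a * c := by nlinarith only [hac]
  have eβ : Fm * Fp / σ - a = (b ^ 2 - a * c) / σ := by
    rw [eq_div_iff hσ0.ne', sub_mul, div_mul_cancel₀ _ hσ0.ne', eσ, eFm, eFp]; ring
  generalize hβ : Fm * Fp / σ - a = β at *
  have hβ0 : 0 ≤ β := by rw [eβ]; exact div_nonneg hbb hσ0.le
  have hβ1 : β * σ ≤ b ^ 2 := by
    rw [eβ, div_mul_cancel₀ _ hσ0.ne']
    exact sub_le_self _ (mul_nonneg ha.le hc)
  -- the discriminant condition for the square below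
  have hβ2 : β ^ 2 * xm ^ 3 ≤ Fp * (τ * Fm) := by
    have i1 : (β * σ) ^ 2 ≤ (b ^ 2) ^ 2 := by gcongr
    have i2 : b ^ 4 ≤ τ * a * Fm * Fm ^ 2 := by
      calc b ^ 4 = b * b * b ^ 2 := by ring
        _ ≤ τ * a * Fm * Fm ^ 2 := by gcongr
    have i3 : (xm * Fm) ^ 2 ≤ σ ^ 2 := by gcongr
    have i4 : β ^ 2 * xm ^ 2 * Fm ^ 2 ≤ τ * a * Fm * Fm ^ 2 := by
      calc β ^ 2 * xm ^ 2 * Fm ^ 2 = β ^ 2 * (xm * Fm) ^ 2 := by ring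
        _ ≤ β ^ 2 * σ ^ 2 := by gcongr
        _ = (β * σ) ^ 2 := by ring
        _ ≤ (b ^ 2) ^ 2 := i1
        _ = b ^ 4 := by ring
        _ ≤ _ := i2
    have i5 : β ^ 2 * xm ^ 2 ≤ τ * a * Fm := le_of_mul_le_mul_right i4 (by positivity)
    calc β ^ 2 * xm ^ 3 = (β ^ 2 * xm ^ 2) * xm := by ring
      _ ≤ (τ * a * Fm) * xm := by gcongr
      _ = (xm * a) * (τ * Fm) := by ring
      _ ≤ Fp * (τ * Fm) := by
        gcongr; rw [eFp]; exact le_add_of_nonneg_left hb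
  have e1 : 2 * y * z * β + c₀ * (Fp * z ^ 2 / xm) + β ^ 2 * xm / (c₀ * Fp) * y ^ 2
      = (c₀ * Fp / xm) * (z + β * xm / (c₀ * Fp) * y) ^ 2 := by
    field_simp; ring
  have e2 : 0 ≤ (c₀ * Fp / xm) * (z + β * xm / (c₀ * Fp) * y) ^ 2 := by positivity
  have e3 : β ^ 2 * xm / (c₀ * Fp) ≤ τ * Fm / (c₀ * xm ^ 2) := by
    rw [div_le_div_iff₀ (by positivity) (by positivity)]
    calc β ^ 2 * xm * (c₀ * xm ^ 2) = c₀ * (β ^ 2 * xm ^ 3) := by ring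
      _ ≤ c₀ * (Fp * (τ * Fm)) := by gcongr
      _ = _ := by ring
  have e4 := mul_le_mul_of_nonneg_right e3 (sq_nonneg y)
  linarith

variable [Fintype ι] {x : ι → ℝ} {m : ι} {j : ℕ}

lemma elemSymm_erase_sub_erase {p : ι} (hp : p ≠ m) :
    elemSymm (j + 1) (Finset.univ.erase p) x - elemSymm (j + 1) (Finset.univ.erase m) x =
      (x m - x p) * elemSymm j ((Finset.univ.erase p).erase m) x := by
  rw [elemSymm_erase j (a := m) (s := Finset.univ.erase p) (by simp [hp.symm]),
    elemSymm_erase j (a := p) (s := Finset.univ.erase m) (by simp [hp]),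
    Finset.erase_right_comm (a := m)]
  ring

lemma mul_elemSymm_erase_le (hx : ∀ i, 0 < x i) (m : ι) :
    x m * elemSymm (j + 1) (Finset.univ.erase m) x ≤ elemSymm (j + 2) Finset.univ x := by
  rw [elemSymm_erase (j + 1) (Finset.mem_univ m)]
  linarith [elemSymm_nonneg (j + 2) (s := Finset.univ.erase m) fun i _ => hx i]

lemma elemSymm_erase_le_pow (hx : ∀ i, 0 < x i) {τ : ℝ}
    (h : elemSymm (j + 2) Finset.univ x ≤ τ ^ (j + 1) * x m) :
    elemSymm (j + 1) (Finset.univ.erase m) x ≤ τ ^ (j + 1) := by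
  have h1 := (mul_elemSymm_erase_le (j := j) hx m).trans h
  rw [mul_comm (τ ^ (j + 1))] at h1
  exact le_of_mul_le_mul_left h1 (hx m)

/-- Up to a relative error that tends to `0` as `x m` grows, the derivative of `elemSymm` in the
direction of the largest variable is the value divided by that variable. -/
lemma le_mul_elemSymm_erase (hx : ∀ i, 0 < x i) {τ : ℝ} (hτ : 0 ≤ τ)
    (h : elemSymm (j + 2) Finset.univ x ≤ τ ^ (j + 1) * x m) :
    elemSymm (j + 2) Finset.univ x * (1 - τ / x m) ≤
      x m * elemSymm (j + 1) (Finset.univ.erase m) x := by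
  have h1 := elemSymm_succ_succ_le_of_le_pow (k := j) (s := Finset.univ.erase m)
    (fun i _ => hx i) hτ (elemSymm_erase_le_pow hx h)
  have h2 := mul_elemSymm_erase_le (j := j) hx m
  have h3 := elemSymm_erase (j + 1) (Finset.mem_univ m) x
  have hm := hx m
  have h4 : τ * elemSymm (j + 1) (Finset.univ.erase m) x ≤
      elemSymm (j + 2) Finset.univ x * (τ / x m) := by
    rw [mul_div_assoc', le_div_iff₀ hm]
    nlinarith
  linarith

/-- The sum of the first derivatives of `elemSymm (j + 2)` tends to infinity with `x m`. -/
lemma elemSymm_le_mul_sum_erase (hx : ∀ i, 0 < x i) (hj : j + 2 ≤ Fintype.card ι) {τ : ℝ}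
    (hτ : 0 ≤ τ) (h : elemSymm (j + 2) Finset.univ x ≤ τ ^ (j + 1) * x m) :
    elemSymm (j + 2) Finset.univ x ≤
      τ * ∑ a, elemSymm (j + 1) (Finset.univ.erase a) x := by
  have hF := elemSymm_erase_le_pow (j := j) hx h
  have h1 := elemSymm_succ_succ_le_of_le_pow (k := j) (s := Finset.univ.erase m)
    (fun i _ => hx i) hτ hF
  have h2 := elemSymm_succ_le_of_le_pow (k := j) (s := Finset.univ.erase m)
    (fun i _ => hx i) hτ hF
  have h3 := elemSymm_erase (j + 1) (Finset.mem_univ m) x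
  have h4 := elemSymm_erase j (Finset.mem_univ m) x
  have h5 : elemSymm (j + 2) Finset.univ x ≤ τ * elemSymm (j + 1) Finset.univ x := by
    rw [h3, h4]
    nlinarith [mul_le_mul_of_nonneg_left h2 (hx m).le]
  refine h5.trans (mul_le_mul_of_nonneg_left ?_ hτ)
  have h6 := sum_mul_elemSymm_erase j Finset.univ x
  have h7 : ∑ a, elemSymm (j + 1) (Finset.univ.erase a) x =
      Fintype.card ι * elemSymm (j + 1) Finset.univ x -
        ∑ a, x a * elemSymm j (Finset.univ.erase a) x := by
    rw [eq_sub_iff_add_eq, ← Finset.sum_add_distrib,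
      Finset.sum_congr rfl fun a ha => (elemSymm_erase j ha x).symm]
    simp
  rw [h7, h6]
  have h8 : (0 : ℝ) ≤ elemSymm (j + 1) Finset.univ x := elemSymm_nonneg _ fun i _ => hx i
  have h9 : (j + 2 : ℝ) ≤ Fintype.card ι := by exact_mod_cast hj
  nlinarith

/-- The second derivative of `log (elemSymm (j + 2))`, corrected by a multiple of the terms
`F_p ξ_p² / x_m`, `p ≠ m`, is as negative as in the case of a product of variables. The form is
split along `ξ_m`: on the remaining variables it is nonnegative by concavity, and the mixed
coefficients `(b² - a c) / σ` are small. -/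
lemma concavity_real (hx : ∀ i, 0 < x i) (hj : j + 2 ≤ Fintype.card ι) {τ δ c₀ : ℝ}
    (hτ : 0 ≤ τ) (hc₀ : 0 < c₀) (h : elemSymm (j + 2) Finset.univ x ≤ τ ^ (j + 1) * x m)
    (hδ : (1 + Fintype.card ι / c₀) * τ ≤ δ * x m) (ξ : ι → ℝ) :
    (1 - δ) * (elemSymm (j + 1) (Finset.univ.erase m) x * ξ m ^ 2 / x m) ≤
      (∑ a, ξ a * elemSymm (j + 1) (Finset.univ.erase a) x) ^ 2 / elemSymm (j + 2) Finset.univ x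
      - ∑ a, ξ a * ∑ b ∈ Finset.univ.erase a,
          ξ b * elemSymm j ((Finset.univ.erase a).erase b) x
      + c₀ * ∑ p ∈ Finset.univ.erase m,
          elemSymm (j + 1) (Finset.univ.erase p) x * ξ p ^ 2 / x m := by
  set σ := elemSymm (j + 2) Finset.univ x with hσ
  set F : ι → ℝ := fun a => elemSymm (j + 1) (Finset.univ.erase a) x with hF
  set G : ι → ι → ℝ := fun a b => elemSymm j ((Finset.univ.erase a).erase b) x with hG
  have hm := hx m
  have hσ0 : 0 < σ := elemSymm_pos (fun i _ => hx i) (by simpa using hj)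
  have hcard : ∀ a : ι, (Finset.univ.erase a).card = Fintype.card ι - 1 := fun a => by
    rw [Finset.card_erase_of_mem (Finset.mem_univ a)]; rfl
  have hF0 : ∀ a, 0 < F a := fun a => elemSymm_pos (fun i _ => hx i) (by rw [hcard]; omega)
  have hGs : ∀ a b, G a b = G b a := fun a b => by simp only [hG, Finset.erase_right_comm]
  set E := Finset.univ.erase m with hE
  have hσm : x m * F m ≤ σ := mul_elemSymm_erase_le hx m
  -- splitting of the first and second derivatives along the variable `m`
  have hS1 : ∑ a, ξ a * F a = ξ m * F m + ∑ a ∈ E, ξ a * F a :=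
    (Finset.add_sum_erase _ _ (Finset.mem_univ m)).symm
  set ξ' := Function.update ξ m 0 with hξ'
  have hξm : ξ' m = 0 := by simp [hξ']
  have hξE : ∀ a, a ≠ m → ξ' a = ξ a := fun a ha => by simp [hξ', ha]
  have hH := elemSymm_hessian_le j Finset.univ (fun i _ => hx i) ξ'
  have hS1' : ∑ a, ξ' a * F a = ∑ a ∈ E, ξ a * F a := by
    rw [← Finset.add_sum_erase _ _ (Finset.mem_univ m), hξm, zero_mul, zero_add]
    exact Finset.sum_congr rfl fun a ha => by rw [hξE a (Finset.ne_of_mem_erase ha)]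
  set S2' := ∑ a, ξ' a * ∑ b ∈ Finset.univ.erase a, ξ' b * G a b with hS2'
  have hS2 : ∑ a, ξ a * ∑ b ∈ Finset.univ.erase a, ξ b * G a b =
      S2' + 2 * ξ m * ∑ p ∈ E, ξ p * G m p := by
    rw [hS2', ← Finset.add_sum_erase _ _ (Finset.mem_univ m),
      ← Finset.add_sum_erase (a := m) _ (fun a => ξ' a * _) (Finset.mem_univ m), hξm]
    have : ∀ a ∈ E, ξ a * ∑ b ∈ Finset.univ.erase a, ξ b * G a b =
        ξ' a * ∑ b ∈ Finset.univ.erase a, ξ' b * G a b + ξ m * (ξ a * G m a) := by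
      intro a ha
      have ham := Finset.ne_of_mem_erase ha
      have hma : m ∈ Finset.univ.erase a := by simp [ham.symm]
      rw [← Finset.add_sum_erase _ _ hma, ← Finset.add_sum_erase _ (fun b => ξ' b * _) hma, hξm,
        hξE a ham, hGs a m]
      have : ∑ b ∈ (Finset.univ.erase a).erase m, ξ b * G a b =
          ∑ b ∈ (Finset.univ.erase a).erase m, ξ' b * G a b :=
        Finset.sum_congr rfl fun b hb => by rw [hξE b (Finset.ne_of_mem_erase hb)]
      rw [this]; ring
    rw [Finset.sum_congr rfl this, Finset.sum_add_distrib, ← Finset.mul_sum]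
    ring
  -- the part of the form in the variables other than `ξ m`
  have hpos : 0 ≤ (∑ a ∈ E, ξ a * F a) ^ 2 / σ - S2' := by
    rw [sub_nonneg, le_div_iff₀ hσ0, mul_comm, ← hS1']
    exact hH
  -- the mixed terms
  have hmix : ∀ p ∈ E, -(τ * F m / (c₀ * x m ^ 2) * ξ m ^ 2) ≤
      2 * ξ m * ξ p * (F m * F p / σ - G m p) + c₀ * (F p * ξ p ^ 2 / x m) := by
    intro p hp
    have hpm := Finset.ne_of_mem_erase hp
    have hxp := hx p
    set a := G m p with ha
    set b := elemSymm (j + 1) (E.erase p) x with hb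
    set c := elemSymm (j + 2) (E.erase p) x with hc
    have hpE : p ∈ E := hp
    have hmp : m ∈ Finset.univ.erase p := by simp [hpm.symm]
    have eFm : F m = b + x p * a := elemSymm_erase j hpE x
    have eFp : F p = b + x m * a := by
      have := elemSymm_erase j hmp x
      rw [Finset.erase_right_comm] at this
      exact this
    have eσ : σ = c + x p * b + x m * F m := by
      rw [hσ, elemSymm_erase (j + 1) (Finset.mem_univ m) x, elemSymm_erase (j + 1) hpE x]
    have ha0 : 0 < a := elemSymm_pos (fun i _ => hx i) (by
      rw [Finset.card_erase_of_mem hpE, hE, hcard]; omega)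
    have hb0 : 0 ≤ b := elemSymm_nonneg _ fun i _ => hx i
    have hc0 : 0 ≤ c := elemSymm_nonneg _ fun i _ => hx i
    refine mixed_term_bound ha0 hb0 hc0 (elemSymm_mul_le (fun i _ => hx i) j j le_rfl) hm hxp
      hτ hc₀ ?_ eFm eFp eσ (ξ m) (ξ p)
    refine elemSymm_succ_le_of_le_pow (fun i _ => hx i) hτ
      (le_trans ?_ (elemSymm_erase_le_pow hx h))
    change b ≤ F m
    rw [eFm]
    exact le_add_of_nonneg_right (mul_pos hxp ha0).le
  have hsum := Finset.sum_le_sum hmix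
  rw [Finset.sum_const, Finset.sum_add_distrib, ← Finset.mul_sum] at hsum
  have hcE : (E.card : ℝ) ≤ Fintype.card ι := by
    rw [hE]; exact_mod_cast Finset.card_le_univ _
  have hsplit : ∑ p ∈ E, 2 * ξ m * ξ p * (F m * F p / σ - G m p) =
      2 * ξ m * F m / σ * ∑ p ∈ E, ξ p * F p - 2 * ξ m * ∑ p ∈ E, ξ p * G m p := by
    rw [Finset.mul_sum, Finset.mul_sum, ← Finset.sum_sub_distrib]
    exact Finset.sum_congr rfl fun p _ => by ring
  rw [hS1, hS2]
  have hsq : (ξ m * F m + ∑ a ∈ E, ξ a * F a) ^ 2 / σ =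
      F m ^ 2 / σ * ξ m ^ 2 + 2 * ξ m * F m / σ * (∑ p ∈ E, ξ p * F p) +
        (∑ a ∈ E, ξ a * F a) ^ 2 / σ := by ring
  have hFm := hF0 m
  -- the coefficient of `ξ m ^ 2`
  have hdiag : (1 - τ / x m) * (F m / x m) ≤ F m ^ 2 / σ := by
    have := le_mul_elemSymm_erase (j := j) hx hτ h
    rw [le_div_iff₀ hσ0]
    calc (1 - τ / x m) * (F m / x m) * σ = (σ * (1 - τ / x m)) * (F m / x m) := by ring
      _ ≤ (x m * F m) * (F m / x m) := by gcongr
      _ = F m ^ 2 := by field_simp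
  -- the cost of the mixed terms is covered by `δ`
  have hN : (E.card : ℝ) * (τ * F m / (c₀ * x m ^ 2) * ξ m ^ 2) ≤
      (Fintype.card ι : ℝ) * (τ * F m / (c₀ * x m ^ 2) * ξ m ^ 2) := by gcongr
  have hδ' : (1 - δ) * (F m * ξ m ^ 2 / x m) + (Fintype.card ι : ℝ) *
      (τ * F m / (c₀ * x m ^ 2) * ξ m ^ 2) ≤ (1 - τ / x m) * (F m / x m) * ξ m ^ 2 := by
    have : 0 ≤ (δ * x m - (1 + Fintype.card ι / c₀) * τ) * (F m * ξ m ^ 2 / x m ^ 2) :=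
      mul_nonneg (by linarith) (by positivity)
    have e : (δ * x m - (1 + Fintype.card ι / c₀) * τ) * (F m * ξ m ^ 2 / x m ^ 2) =
      (1 - τ / x m) * (F m / x m) * ξ m ^ 2 - ((1 - δ) * (F m * ξ m ^ 2 / x m) +
        (Fintype.card ι : ℝ) * (τ * F m / (c₀ * x m ^ 2) * ξ m ^ 2)) := by
      field_simp; ring
    linarith
  have hd2 := mul_le_mul_of_nonneg_right hdiag (sq_nonneg (ξ m))
  rw [hsplit] at hsum
  simp only [nsmul_eq_mul, mul_neg] at hsum
  rw [hsq]
  linarith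

/-- The complex form of `concavity_real`: the estimate for the real and imaginary parts. -/
lemma concavity_complex (hx : ∀ i, 0 < x i) (hj : j + 2 ≤ Fintype.card ι) {τ δ c₀ : ℝ}
    (hτ : 0 ≤ τ) (hc₀ : 0 < c₀) (h : elemSymm (j + 2) Finset.univ x ≤ τ ^ (j + 1) * x m)
    (hδ : (1 + Fintype.card ι / c₀) * τ ≤ δ * x m) (ξ : ι → ℂ) :
    (1 - δ) * (elemSymm (j + 1) (Finset.univ.erase m) x * ‖ξ m‖ ^ 2 / x m) ≤
      ‖∑ a, (elemSymm (j + 1) (Finset.univ.erase a) x : ℂ) * ξ a‖ ^ 2 /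
        elemSymm (j + 2) Finset.univ x
      - ∑ a, ∑ b ∈ Finset.univ.erase a,
          elemSymm j ((Finset.univ.erase a).erase b) x * (ξ a * (starRingEnd ℂ) (ξ b)).re
      + c₀ * ∑ p ∈ Finset.univ.erase m,
          elemSymm (j + 1) (Finset.univ.erase p) x * ‖ξ p‖ ^ 2 / x m := by
  have h1 := concavity_real hx hj hτ hc₀ h hδ fun a => (ξ a).re
  have h2 := concavity_real hx hj hτ hc₀ h hδ fun a => (ξ a).im
  have hn : ∀ z : ℂ, ‖z‖ ^ 2 = z.re ^ 2 + z.im ^ 2 := fun z => by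
    rw [Complex.sq_norm, Complex.normSq_apply]; ring
  have hF : ‖∑ a, (elemSymm (j + 1) (Finset.univ.erase a) x : ℂ) * ξ a‖ ^ 2 =
      (∑ a, elemSymm (j + 1) (Finset.univ.erase a) x * (ξ a).re) ^ 2 +
      (∑ a, elemSymm (j + 1) (Finset.univ.erase a) x * (ξ a).im) ^ 2 := by
    rw [hn]; simp only [Complex.re_sum, Complex.im_sum, Complex.re_ofReal_mul,
      Complex.im_ofReal_mul]
  rw [hF]
  simp only [hn, Complex.mul_re, Complex.conj_re, Complex.conj_im]
  have e1 : ∀ (f : ι → ℝ), ∑ a, f a * elemSymm (j + 1) (Finset.univ.erase a) x =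
      ∑ a, elemSymm (j + 1) (Finset.univ.erase a) x * f a :=
    fun f => Finset.sum_congr rfl fun a _ => mul_comm _ _
  rw [e1] at h1 h2
  have e2 : ∑ a, ∑ b ∈ Finset.univ.erase a, elemSymm j ((Finset.univ.erase a).erase b) x *
      ((ξ a).re * (ξ b).re - (ξ a).im * -(ξ b).im) =
      ∑ a, (ξ a).re * ∑ b ∈ Finset.univ.erase a,
          (ξ b).re * elemSymm j ((Finset.univ.erase a).erase b) x +
      ∑ a, (ξ a).im * ∑ b ∈ Finset.univ.erase a,
          (ξ b).im * elemSymm j ((Finset.univ.erase a).erase b) x := by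
    rw [← Finset.sum_add_distrib]
    refine Finset.sum_congr rfl fun a _ => ?_
    rw [Finset.mul_sum, Finset.mul_sum, ← Finset.sum_add_distrib]
    exact Finset.sum_congr rfl fun b _ => by ring
  have e3 : ∑ p ∈ Finset.univ.erase m, elemSymm (j + 1) (Finset.univ.erase p) x *
      ((ξ p).re ^ 2 + (ξ p).im ^ 2) / x m =
      ∑ p ∈ Finset.univ.erase m, elemSymm (j + 1) (Finset.univ.erase p) x * (ξ p).re ^ 2 / x m +
      ∑ p ∈ Finset.univ.erase m,
        elemSymm (j + 1) (Finset.univ.erase p) x * (ξ p).im ^ 2 / x m := by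
    rw [← Finset.sum_add_distrib]
    exact Finset.sum_congr rfl fun b _ => by ring
  rw [e2, e3]
  have e4 : ∀ A B S : ℝ, (A ^ 2 + B ^ 2) / S = A ^ 2 / S + B ^ 2 / S := fun A B S => add_div _ _ _
  rw [e4]
  have e5 : elemSymm (j + 1) (Finset.univ.erase m) x * ((ξ m).re ^ 2 + (ξ m).im ^ 2) / x m =
    elemSymm (j + 1) (Finset.univ.erase m) x * (ξ m).re ^ 2 / x m +
    elemSymm (j + 1) (Finset.univ.erase m) x * (ξ m).im ^ 2 / x m := by ring
  rw [e5]
  linarith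

end Concavity

/-! ### Absorption of the third order terms -/

section Absorption

variable {ι : Type*} [DecidableEq ι] [Fintype ι]

/-- Young's inequality: a bound up to an additive constant gives one for `(1 - δ) k ^ 2`. -/
lemma one_sub_mul_sq_le {y k C δ : ℝ} (hk0 : 0 ≤ k) (hk : k ≤ y + C) (hδ : 0 < δ) (hδ1 : δ ≤ 1) :
    (1 - δ) * k ^ 2 ≤ y ^ 2 + C ^ 2 / δ := by
  have h1 : (1 - δ) * k ^ 2 ≤ (1 - δ) * (y + C) ^ 2 := by
    have : 0 ≤ 1 - δ := by linarith
    gcongr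
  refine h1.trans ?_
  have : y ^ 2 + C ^ 2 / δ - (1 - δ) * (y + C) ^ 2 =
      ((δ * y - (1 - δ) * C) ^ 2 + δ * C ^ 2) / δ := by field_simp; ring
  have : 0 ≤ ((δ * y - (1 - δ) * C) ^ 2 + δ * C ^ 2) / δ := by positivity
  linarith

set_option maxHeartbeats 1000000 in
/-- The third order terms of the maximum principle. Here `x` are the eigenvalues of `g`, `x m` is
the largest one, `r b i` and `r' b i` stand for the derivatives of the entries `g_{m b̄}` and
`g_{b m̄}`, `b ≠ m`, which the test function turns into good terms, `t a b` for the covariant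
derivative of `g_{a b̄}` in the direction `m`, and `κ` for the gradient of the lower order part of
the test function, to which the derivatives of `g_{m m̄}` are equal up to sign at the maximum. The
estimate says that these terms contribute nothing worse than a small multiple of `|κ|²`. -/
lemma third_order_estimate {x : ι → ℝ} {m : ι} {j : ℕ} (hx : ∀ i, 0 < x i)
    (hx1 : 1 ≤ x m) (hj : j + 2 ≤ Fintype.card ι) {τ δ C : ℝ} (hτ : 0 ≤ τ)
    (hσ : elemSymm (j + 2) Finset.univ x ≤ τ ^ (j + 1) * x m)
    (hδ0 : 0 < δ) (hδ1 : δ ≤ 1) (hδ : (1 + 8 * Fintype.card ι) * τ ≤ δ * x m) (hC : 1 ≤ C)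
    {κ : ι → ℂ} {r r' t γ : ι → ι → ℂ} {Lg Lκ : ι → ℝ} {Lψ : ℝ} {dψ : ℂ}
    (hmaxprin : ∀ i, Lg i + (∑ b ∈ Finset.univ.erase m, (‖r b i‖ ^ 2 + ‖r' b i‖ ^ 2)) / x m +
      x m * (Lκ i - ‖κ i‖ ^ 2 - C * ‖κ i‖) - C * x m ≤ 0)
    (heq : Lψ + ∑ a, ∑ b ∈ Finset.univ.erase a, elemSymm j ((Finset.univ.erase a).erase b) x *
        (‖t a b‖ ^ 2 - (t a a * (starRingEnd ℂ) (t b b)).re) ≤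
      ∑ a, elemSymm (j + 1) (Finset.univ.erase a) x * Lg a
      + C * ∑ a, elemSymm (j + 1) (Finset.univ.erase a) x * ∑ c, ‖γ a c‖
      + C * x m * ∑ a, elemSymm (j + 1) (Finset.univ.erase a) x + C)
    (hγ : ∀ a, ∀ c ≠ m, ‖γ a c‖ ≤ ‖r c a‖ + C * x m)
    (hγm : ∀ a, ‖γ a m‖ ≤ x m * ‖κ a‖ + C * x m)
    (htr : ∀ p ≠ m, ‖t p p - r p p‖ ≤ C * x m)
    (htr' : ∀ p ≠ m, t p m = r' p m) (hrκ : ∀ p ≠ m, ‖r' p m + x m * κ p‖ ≤ C * x m)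
    (htm : t m m = -(x m * κ m))
    (hdψ : ∑ a, (elemSymm (j + 1) (Finset.univ.erase a) x : ℂ) * t a a = dψ) :
    Lψ / x m - ‖dψ‖ ^ 2 / (elemSymm (j + 2) Finset.univ x * x m)
      + ∑ i, elemSymm (j + 1) (Finset.univ.erase i) x * (Lκ i - 2 * δ * ‖κ i‖ ^ 2)
      ≤ (2 * Fintype.card ι + 5) * C ^ 2 / δ * ∑ i, elemSymm (j + 1) (Finset.univ.erase i) x
        + C := by
  set F : ι → ℝ := fun a => elemSymm (j + 1) (Finset.univ.erase a) x with hF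
  set σ := elemSymm (j + 2) Finset.univ x with hσdef
  set E := Finset.univ.erase m with hE
  have hm := hx m
  have hF0 : ∀ a, 0 ≤ F a := fun a => elemSymm_nonneg _ fun i _ => hx i
  have hFm : ∀ p, p ≠ m → F p - F m ≤ elemSymm j ((Finset.univ.erase p).erase m) x * x m := by
    intro p hp
    rw [hF]
    simp only
    rw [elemSymm_erase_sub_erase hp]
    have : 0 ≤ elemSymm j ((Finset.univ.erase p).erase m) x := elemSymm_nonneg _ fun i _ => hx i
    nlinarith [hx p]
  set n : ℝ := (Fintype.card ι : ℝ) with hn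
  set FF := ∑ i, F i with hFF
  have hFF0 : 0 ≤ FF := Finset.sum_nonneg fun i _ => hF0 i
  -- the good terms
  set R : ι → ℝ := fun i => ∑ b ∈ E, ‖r b i‖ ^ 2 / x m ^ 2 with hR
  set R' : ι → ℝ := fun i => ∑ b ∈ E, ‖r' b i‖ ^ 2 / x m ^ 2 with hR'
  have hR0 : ∀ i, 0 ≤ R i := fun i => Finset.sum_nonneg fun b _ => by positivity
  have hR'0 : ∀ i, 0 ≤ R' i := fun i => Finset.sum_nonneg fun b _ => by positivity
  have hA : ∑ i, F i * Lg i / x m + ∑ i, F i * R i + ∑ i, F i * R' i +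
      ∑ i, F i * (Lκ i - ‖κ i‖ ^ 2 - C * ‖κ i‖) - C * FF ≤ 0 := by
    rw [hFF, Finset.mul_sum, ← Finset.sum_add_distrib, ← Finset.sum_add_distrib,
      ← Finset.sum_add_distrib, ← Finset.sum_sub_distrib]
    refine Finset.sum_nonpos fun i _ => ?_
    have e : F i * Lg i / x m + F i * R i + F i * R' i +
        F i * (Lκ i - ‖κ i‖ ^ 2 - C * ‖κ i‖) - C * F i =
        F i / x m * (Lg i + (∑ b ∈ E, (‖r b i‖ ^ 2 + ‖r' b i‖ ^ 2)) / x m +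
          x m * (Lκ i - ‖κ i‖ ^ 2 - C * ‖κ i‖) - C * x m) := by
      rw [hR, hR', Finset.sum_add_distrib]
      simp only
      rw [← Finset.sum_div, ← Finset.sum_div]
      field_simp
      ring
    rw [e]
    exact mul_nonpos_of_nonneg_of_nonpos (div_nonneg (hF0 i) hm.le) (hmaxprin i)
  -- the terms linear in the derivatives of `g`, which come from the torsion of the metric
  have hB : ∀ a, C / x m * ∑ c, ‖γ a c‖ ≤ 1 / 4 * R a + 2 * n * C ^ 2 + C * ‖κ a‖ := by
    intro a
    rw [← Finset.add_sum_erase _ _ (Finset.mem_univ m), mul_add]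
    have h1 : C / x m * ‖γ a m‖ ≤ C * ‖κ a‖ + C ^ 2 := by
      calc C / x m * ‖γ a m‖ ≤ C / x m * (x m * ‖κ a‖ + C * x m) := by gcongr; exact hγm a
        _ = _ := by field_simp
    have h2 : C / x m * ∑ c ∈ E, ‖γ a c‖ ≤ 1 / 4 * R a + ∑ c ∈ E, 2 * C ^ 2 := by
      rw [hR, Finset.mul_sum, Finset.mul_sum, ← Finset.sum_add_distrib]
      refine Finset.sum_le_sum fun c hc => ?_
      calc C / x m * ‖γ a c‖ ≤ C / x m * (‖r c a‖ + C * x m) := by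
            gcongr; exact hγ a c (Finset.ne_of_mem_erase hc)
        _ = C * (‖r c a‖ / x m) + C ^ 2 := by field_simp
        _ ≤ 1 / 4 * (‖r c a‖ / x m) ^ 2 + 2 * C ^ 2 := by
            nlinarith [sq_nonneg (1 / 2 * (‖r c a‖ / x m) - C)]
        _ = _ := by rw [div_pow]
    have h3 : (∑ c ∈ E, 2 * C ^ 2) + C ^ 2 ≤ 2 * n * C ^ 2 := by
      have hc : (E.card : ℝ) = n - 1 := by
        rw [hE, Finset.card_erase_of_mem (Finset.mem_univ m), hn,
          Nat.cast_sub (Finset.card_pos.2 ⟨m, Finset.mem_univ m⟩)]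
        simp
      rw [Finset.sum_const, nsmul_eq_mul, hc]
      nlinarith [sq_nonneg C]
    linarith
  have hB' : C / x m * ∑ a, F a * ∑ c, ‖γ a c‖ ≤
      1 / 4 * ∑ a, F a * R a + 2 * n * C ^ 2 * FF + C * ∑ a, F a * ‖κ a‖ := by
    rw [hFF, Finset.mul_sum, Finset.mul_sum, Finset.mul_sum, Finset.mul_sum,
      ← Finset.sum_add_distrib, ← Finset.sum_add_distrib]
    refine Finset.sum_le_sum fun a _ => ?_
    have := mul_le_mul_of_nonneg_left (hB a) (hF0 a)
    linarith
  -- the off-diagonal part of the second derivative of the operator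
  have hS1 : ∑ p ∈ E, (F p - F m) * ‖r' p m‖ ^ 2 / x m ≤
      ∑ a, ∑ b ∈ Finset.univ.erase a,
        elemSymm j ((Finset.univ.erase a).erase b) x * ‖t a b‖ ^ 2 := by
    have h0 : ∀ a b, 0 ≤ elemSymm j ((Finset.univ.erase a).erase b) x * ‖t a b‖ ^ 2 :=
      fun a b => mul_nonneg (elemSymm_nonneg _ fun i _ => hx i) (sq_nonneg _)
    calc ∑ p ∈ E, (F p - F m) * ‖r' p m‖ ^ 2 / x m
        ≤ ∑ p ∈ E, ∑ b ∈ Finset.univ.erase p,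
          elemSymm j ((Finset.univ.erase p).erase b) x * ‖t p b‖ ^ 2 := by
          refine Finset.sum_le_sum fun p hp => ?_
          have hpm := Finset.ne_of_mem_erase hp
          refine le_trans ?_ (Finset.single_le_sum (fun b _ => h0 p b)
            (show m ∈ Finset.univ.erase p by simp [hpm.symm]))
          rw [htr' p hpm, div_le_iff₀ hm]
          have := mul_le_mul_of_nonneg_right (hFm p hpm) (sq_nonneg ‖r' p m‖)
          linarith
      _ ≤ _ := Finset.sum_le_sum_of_subset_of_nonneg (Finset.erase_subset _ _)
          fun a _ _ => Finset.sum_nonneg fun b _ => h0 a b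
  -- the good terms in the direction `m` complete `F p - F m` to `F p`
  have hR'm : ∑ p ∈ E, F m * ‖r' p m‖ ^ 2 / x m ^ 2 ≤ ∑ i, F i * R' i := by
    refine le_trans (le_of_eq ?_) (Finset.single_le_sum
      (fun i _ => mul_nonneg (hF0 i) (hR'0 i)) (Finset.mem_univ m))
    rw [hR', Finset.mul_sum]
    exact Finset.sum_congr rfl fun p _ => by ring
  have hoff : ∑ p ∈ E, F p * ((1 - δ) * ‖κ p‖ ^ 2 - C ^ 2 / δ) ≤
      (∑ p ∈ E, (F p - F m) * ‖r' p m‖ ^ 2 / x m) / x m +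
        ∑ p ∈ E, F m * ‖r' p m‖ ^ 2 / x m ^ 2 := by
    rw [Finset.sum_div, ← Finset.sum_add_distrib]
    refine Finset.sum_le_sum fun p hp => ?_
    have e : (F p - F m) * ‖r' p m‖ ^ 2 / x m / x m + F m * ‖r' p m‖ ^ 2 / x m ^ 2 =
        F p * (‖r' p m‖ / x m) ^ 2 := by field_simp; ring
    rw [e]
    refine mul_le_mul_of_nonneg_left ?_ (hF0 p)
    have hk : ‖κ p‖ ≤ ‖r' p m‖ / x m + C := by
      have h1 := hrκ p (Finset.ne_of_mem_erase hp)
      have h2 : ‖(x m : ℂ) * κ p‖ ≤ ‖r' p m‖ + C * x m := by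
        calc ‖(x m : ℂ) * κ p‖ = ‖(r' p m + x m * κ p) - r' p m‖ := by ring_nf
          _ ≤ ‖r' p m + x m * κ p‖ + ‖r' p m‖ := norm_sub_le _ _
          _ ≤ _ := by linarith
      rw [norm_mul, Complex.norm_real, Real.norm_eq_abs, abs_of_pos hm] at h2
      have e : ‖r' p m‖ / x m + C = (‖r' p m‖ + C * x m) / x m := by field_simp
      rw [e, le_div_iff₀ hm]
      linarith
    linarith [one_sub_mul_sq_le (norm_nonneg _) hk hδ0 hδ1]
  -- the diagonal part of the second derivative of the operator
  have hdiag := concavity_complex (δ := δ) hx hj hτ (by norm_num : (0 : ℝ) < 1 / 8) hσ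
    (by rw [← hn]; linarith) (fun a => t a a)
  rw [hdψ, htm, norm_neg, norm_mul, Complex.norm_real, Real.norm_eq_abs, abs_of_pos hm] at hdiag
  -- `t p p` and `r p p` differ by torsion terms, so the correction in the concavity inequality is
  -- absorbed by a quarter of the good terms `R`
  have htpp : ∑ p ∈ E, F p * ‖t p p‖ ^ 2 / x m ^ 2 ≤ 2 * ∑ i, F i * R i + 2 * C ^ 2 * FF := by
    have h1 : ∀ p ∈ E, F p * ‖t p p‖ ^ 2 / x m ^ 2 ≤ 2 * (F p * R p) + 2 * C ^ 2 * F p := by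
      intro p hp
      have h2 : ‖t p p‖ ≤ ‖r p p‖ + C * x m := by
        calc ‖t p p‖ = ‖r p p + (t p p - r p p)‖ := by ring_nf
          _ ≤ ‖r p p‖ + ‖t p p - r p p‖ := norm_add_le _ _
          _ ≤ _ := by linarith [htr p (Finset.ne_of_mem_erase hp)]
      have h3 : ‖t p p‖ ^ 2 ≤ 2 * ‖r p p‖ ^ 2 + 2 * (C * x m) ^ 2 := by
        nlinarith [norm_nonneg (t p p), sq_nonneg (‖r p p‖ - C * x m), pow_le_pow_left₀
          (norm_nonneg (t p p)) h2 2]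
      have h4 : ‖r p p‖ ^ 2 / x m ^ 2 ≤ R p :=
        Finset.single_le_sum (f := fun b => ‖r b p‖ ^ 2 / x m ^ 2)
          (fun b _ => by positivity) hp
      have h5 : ‖t p p‖ ^ 2 / x m ^ 2 ≤ 2 * R p + 2 * C ^ 2 := by
        calc ‖t p p‖ ^ 2 / x m ^ 2 ≤ (2 * ‖r p p‖ ^ 2 + 2 * (C * x m) ^ 2) / x m ^ 2 := by gcongr
          _ = 2 * (‖r p p‖ ^ 2 / x m ^ 2) + 2 * C ^ 2 := by field_simp
          _ ≤ _ := by linarith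
      have := mul_le_mul_of_nonneg_left h5 (hF0 p)
      rw [mul_div_assoc]; linarith
    refine (Finset.sum_le_sum h1).trans ?_
    rw [Finset.sum_add_distrib, ← Finset.mul_sum, ← Finset.mul_sum]
    have s1 : ∑ i ∈ E, F i * R i ≤ ∑ i, F i * R i :=
      Finset.sum_le_sum_of_subset_of_nonneg (Finset.erase_subset _ _)
        fun a _ _ => mul_nonneg (hF0 a) (hR0 a)
    have s2 : ∑ i ∈ E, F i ≤ FF :=
      Finset.sum_le_sum_of_subset_of_nonneg (Finset.erase_subset _ _) fun a _ _ => hF0 a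
    have := mul_le_mul_of_nonneg_left s2 (by positivity : 0 ≤ 2 * C ^ 2)
    linarith
  -- combination
  have hsum : ∑ a, ∑ b ∈ Finset.univ.erase a, elemSymm j ((Finset.univ.erase a).erase b) x *
        (‖t a b‖ ^ 2 - (t a a * (starRingEnd ℂ) (t b b)).re) =
      (∑ a, ∑ b ∈ Finset.univ.erase a, elemSymm j ((Finset.univ.erase a).erase b) x *
        ‖t a b‖ ^ 2) - ∑ a, ∑ b ∈ Finset.univ.erase a,
        elemSymm j ((Finset.univ.erase a).erase b) x *
          (t a a * (starRingEnd ℂ) (t b b)).re := by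
    simp only [mul_sub, Finset.sum_sub_distrib]
  rw [hsum] at heq
  set S1 := ∑ a, ∑ b ∈ Finset.univ.erase a, elemSymm j ((Finset.univ.erase a).erase b) x *
        ‖t a b‖ ^ 2
  set S2 := ∑ a, ∑ b ∈ Finset.univ.erase a,
        elemSymm j ((Finset.univ.erase a).erase b) x * (t a a * (starRingEnd ℂ) (t b b)).re
  have heq' : Lψ / x m + S1 / x m - S2 / x m ≤ ∑ i, F i * Lg i / x m +
      C / x m * (∑ a, F a * ∑ c, ‖γ a c‖) + C * FF + C / x m := by
    have := div_le_div_of_nonneg_right heq hm.le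
    calc Lψ / x m + S1 / x m - S2 / x m = (Lψ + (S1 - S2)) / x m := by ring
      _ ≤ _ := this
      _ = _ := by rw [← Finset.sum_div]; field_simp; rfl
  have hCx : C / x m ≤ C := div_le_self (by linarith) hx1
  have hdiag' : (1 - δ) * (F m * ‖κ m‖ ^ 2) ≤
      ‖dψ‖ ^ 2 / (σ * x m) - S2 / x m + 1 / 8 * ∑ p ∈ E, F p * ‖t p p‖ ^ 2 / x m ^ 2 := by
    have := div_le_div_of_nonneg_right hdiag hm.le
    calc (1 - δ) * (F m * ‖κ m‖ ^ 2) = (1 - δ) * (F m * (x m * ‖κ m‖) ^ 2 / x m) / x m := by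
          field_simp
      _ ≤ _ := this
      _ = _ := by
        have : ∑ p ∈ E, F p * ‖t p p‖ ^ 2 / x m ^ 2 = (∑ p ∈ E, F p * ‖t p p‖ ^ 2 / x m) / x m := by
          rw [Finset.sum_div]
          exact Finset.sum_congr rfl fun p _ => by field_simp
        rw [this]
        change (‖dψ‖ ^ 2 / σ - S2 + 1 / 8 * ∑ p ∈ E, F p * ‖t p p‖ ^ 2 / x m) / x m = _
        rw [← div_div]
        ring
  have hS1' := div_le_div_of_nonneg_right hS1 hm.le
  have hK : (1 - δ) * (F m * ‖κ m‖ ^ 2) + ∑ p ∈ E, F p * ((1 - δ) * ‖κ p‖ ^ 2 - C ^ 2 / δ) ≥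
      (1 - δ) * ∑ i, F i * ‖κ i‖ ^ 2 - C ^ 2 / δ * FF := by
    have e1 : ∑ p ∈ E, F p * ((1 - δ) * ‖κ p‖ ^ 2 - C ^ 2 / δ) =
        (1 - δ) * ∑ p ∈ E, F p * ‖κ p‖ ^ 2 - C ^ 2 / δ * ∑ p ∈ E, F p := by
      rw [Finset.mul_sum, Finset.mul_sum, ← Finset.sum_sub_distrib]
      exact Finset.sum_congr rfl fun p _ => by ring
    have e2 : ∑ p ∈ E, F p ≤ FF :=
      Finset.sum_le_sum_of_subset_of_nonneg (Finset.erase_subset _ _) fun a _ _ => hF0 a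
    have e3 : ∑ i, F i * ‖κ i‖ ^ 2 = F m * ‖κ m‖ ^ 2 + ∑ p ∈ E, F p * ‖κ p‖ ^ 2 :=
      (Finset.add_sum_erase _ _ (Finset.mem_univ m)).symm
    have e4 := mul_le_mul_of_nonneg_left e2 (by positivity : 0 ≤ C ^ 2 / δ)
    rw [e1, e3]; linarith
  -- the linear terms in `κ`, from the maximum principle and from the torsion
  have hκ1 : 2 * C * ∑ i, F i * ‖κ i‖ ≤ δ * ∑ i, F i * ‖κ i‖ ^ 2 + C ^ 2 / δ * FF := by
    rw [hFF, Finset.mul_sum, Finset.mul_sum, Finset.mul_sum, ← Finset.sum_add_distrib]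
    refine Finset.sum_le_sum fun i _ => ?_
    have : 2 * C * ‖κ i‖ ≤ δ * ‖κ i‖ ^ 2 + C ^ 2 / δ := by
      have e : δ * ‖κ i‖ ^ 2 + C ^ 2 / δ - 2 * C * ‖κ i‖ = (δ * ‖κ i‖ - C) ^ 2 / δ := by
        field_simp; ring
      have : 0 ≤ (δ * ‖κ i‖ - C) ^ 2 / δ := by positivity
      linarith
    have := mul_le_mul_of_nonneg_left this (hF0 i)
    linarith
  have hexp : ∑ i, F i * (Lκ i - ‖κ i‖ ^ 2 - C * ‖κ i‖) =
      ∑ i, F i * Lκ i - ∑ i, F i * ‖κ i‖ ^ 2 - C * ∑ i, F i * ‖κ i‖ := by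
    rw [Finset.mul_sum, ← Finset.sum_sub_distrib, ← Finset.sum_sub_distrib]
    exact Finset.sum_congr rfl fun p _ => by ring
  have hexp' : ∑ i, F i * (Lκ i - 2 * δ * ‖κ i‖ ^ 2) =
      ∑ i, F i * Lκ i - 2 * δ * ∑ i, F i * ‖κ i‖ ^ 2 := by
    rw [Finset.mul_sum, ← Finset.sum_sub_distrib]
    exact Finset.sum_congr rfl fun p _ => by ring
  have hRR : 0 ≤ ∑ i, F i * R i := Finset.sum_nonneg fun i _ => mul_nonneg (hF0 i) (hR0 i)
  have hconst : 2 * (C ^ 2 / δ) * FF + 2 * C * FF + 2 * n * C ^ 2 * FF + 1 / 4 * C ^ 2 * FF ≤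
      (2 * n + 5) * C ^ 2 / δ * FF := by
    have h1 : C ^ 2 ≤ C ^ 2 / δ := le_div_self (by positivity) hδ0 hδ1
    have h2 : C ≤ C ^ 2 := by nlinarith
    have hn0 : 0 ≤ n := Nat.cast_nonneg _
    have : 2 * (C ^ 2 / δ) + 2 * C + 2 * n * C ^ 2 + 1 / 4 * C ^ 2 ≤
        (2 * n + 5) * C ^ 2 / δ := by
      rw [mul_div_assoc]
      nlinarith [mul_le_mul_of_nonneg_left h1 hn0]
    have := mul_le_mul_of_nonneg_right this hFF0
    linarith
  rw [hexp']
  linarith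

omit [DecidableEq ι] in
/-- The final absorption. The parameter `φ` is the value of the exponential function of `u` in
the test function, with `M` in the exponent, and `N` is the coefficient of `|Du|²`; the derivative
`Ψρ` of the right hand side in the gradient direction enters twice and cancels. What remains
bounds the sum of the derivatives of the operator. -/
lemma sum_deriv_le_of_absorption {F x Q P Lκ k : ι → ℝ} {m : ι} {C ε N M φ δ Lψ Ψρ d σ n : ℝ}
    (hx1 : 1 ≤ x m) (hC : 1 ≤ C) (hn : 0 ≤ n) (hN : 16 * C ^ 3 ≤ N)
    (hMN : 4 * N * C ≤ M) (hM : 4 * (2 * n + 5) * C ^ 2 + 2 ≤ M * ε) (hφ : M ≤ φ)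
    (hδ : δ = 1 / (4 * φ)) (hF : ∀ i, 1 / (2 * C * x m) ≤ F i) (hQ : ∀ i, 0 ≤ Q i)
    (hσ : 1 / C ≤ σ)
    (hthird : Lψ / x m - d ^ 2 / (σ * x m) + ∑ i, F i * (Lκ i - 2 * δ * k i ^ 2) ≤
      (2 * n + 5) * C ^ 2 / δ * ∑ i, F i + C)
    (hψ : -(x m * (N * Ψρ)) - C * x m * (1 + M * φ) - C * (1 + ∑ i, Q i + x m ^ 2) ≤ Lψ)
    (hκ : N * (1 / 2 * ∑ i, F i * (Q i + x i ^ 2) + Ψρ - C * (1 + ∑ i, F i))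
      + M * φ * (ε * ∑ i, F i - C) + M ^ 2 * φ * ∑ i, F i * P i ≤ ∑ i, F i * Lκ i)
    (hk : ∀ i, k i ^ 2 ≤ 2 * N ^ 2 * C * (1 + Q i + x i ^ 2) + 2 * M ^ 2 * φ ^ 2 * P i)
    (hd : d ^ 2 ≤ C * (1 + ∑ i, Q i + x m ^ 2)) :
    ∑ i, F i ≤ 2 * C * M + 2 * C + 2 * C ^ 2 + N * C := by
  have hC3 : 1 ≤ C ^ 3 := one_le_pow₀ hC
  have hN1 : 1 ≤ N := by linarith
  have hNC : 1 * 1 ≤ N * C := mul_le_mul hN1 hC zero_le_one (by linarith only [hN1])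
  have hM1 : 1 ≤ M := by linarith only [hNC, hMN]
  have hφ0 : 0 < φ := by linarith
  have hx0 : 0 < x m := by linarith
  have hF0 : ∀ i, 0 ≤ F i := fun i => le_trans (by positivity) (hF i)
  have hσ0 : 0 < σ := lt_of_lt_of_le (by positivity) hσ
  set FF := ∑ i, F i with hFF
  have hFF0 : 0 ≤ FF := Finset.sum_nonneg fun i _ => hF0 i
  set D := ∑ i, F i * (Q i + x i ^ 2) with hD
  set PP := ∑ i, F i * P i with hPP
  set QQ := ∑ i, Q i with hQQ
  have hQQ0 : 0 ≤ QQ := Finset.sum_nonneg fun i _ => hQ i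
  -- the good term `N D / 2` dominates `QQ / x m` and `x m`, because each `F i` is at least of
  -- order `1 / x m`
  have hD1 : (QQ + x m ^ 2) / (2 * C * x m) ≤ D := by
    have h1 : ∑ i, 1 / (2 * C * x m) * (Q i + x i ^ 2) ≤ D :=
      Finset.sum_le_sum fun i _ => mul_le_mul_of_nonneg_right (hF i)
        (add_nonneg (hQ i) (sq_nonneg _))
    refine le_trans ?_ h1
    rw [← Finset.mul_sum, Finset.sum_add_distrib, div_eq_mul_one_div, mul_comm]
    have : x m ^ 2 ≤ ∑ i, x i ^ 2 :=
      Finset.single_le_sum (f := fun i => x i ^ 2) (fun i _ => sq_nonneg _) (Finset.mem_univ m)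
    gcongr
  have hD0 : 0 ≤ D := le_trans (by positivity) hD1
  -- the gradient terms of the test function
  have hkk : 2 * δ * ∑ i, F i * k i ^ 2 ≤ N / 4 * (FF + D) + M ^ 2 * φ * PP := by
    have h1 : ∑ i, F i * k i ^ 2 ≤ 2 * N ^ 2 * C * (FF + D) + 2 * M ^ 2 * φ ^ 2 * PP := by
      rw [hFF, hD, hPP, ← Finset.sum_add_distrib, Finset.mul_sum, Finset.mul_sum,
        ← Finset.sum_add_distrib]
      refine Finset.sum_le_sum fun i _ => ?_
      have := mul_le_mul_of_nonneg_left (hk i) (hF0 i)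
      linarith
    have h2 : N ^ 2 * C / φ ≤ N / 4 := by
      rw [div_le_div_iff₀ hφ0 (by norm_num)]
      have : N * (4 * N * C) ≤ N * φ := by gcongr; exact hMN.trans hφ
      linarith only [this]
    calc 2 * δ * ∑ i, F i * k i ^ 2
        ≤ 2 * δ * (2 * N ^ 2 * C * (FF + D) + 2 * M ^ 2 * φ ^ 2 * PP) := by
          have : 0 ≤ δ := by rw [hδ]; positivity
          gcongr
      _ = N ^ 2 * C / φ * (FF + D) + M ^ 2 * φ * PP := by rw [hδ]; field_simp; ring
      _ ≤ _ := by gcongr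
  -- the terms quadratic in the second derivatives of `u`
  have hquad : C * (1 + QQ + x m ^ 2) / x m + d ^ 2 / (σ * x m) ≤ N / 4 * D + 2 * C ^ 2 := by
    have h1 : d ^ 2 / (σ * x m) ≤ C ^ 2 * (1 + QQ + x m ^ 2) / x m := by
      have h3 : 1 ≤ C * σ := by
        rw [div_le_iff₀ (by linarith)] at hσ; linarith
      rw [div_le_div_iff₀ (by positivity) hx0]
      calc d ^ 2 * x m ≤ C * (1 + QQ + x m ^ 2) * x m := by gcongr
        _ ≤ C * (1 + QQ + x m ^ 2) * x m * (C * σ) := le_mul_of_one_le_right (by positivity) h3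
        _ = _ := by ring
    have h2 : C * (1 + QQ + x m ^ 2) / x m ≤ C ^ 2 * (1 + QQ + x m ^ 2) / x m := by
      have : C ≤ C ^ 2 := by nlinarith
      gcongr
    have h3 : 2 * (C ^ 2 * (1 + QQ + x m ^ 2) / x m) ≤ N / 4 * D + 2 * C ^ 2 := by
      have h4 : 2 * C ^ 2 * ((QQ + x m ^ 2) / x m) ≤ N / 4 * D := by
        calc 2 * C ^ 2 * ((QQ + x m ^ 2) / x m)
            = 16 * C ^ 3 / 4 * ((QQ + x m ^ 2) / (2 * C * x m)) := by field_simp; ring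
          _ ≤ N / 4 * D := by gcongr
      have h5 : 2 * C ^ 2 * (1 / x m) ≤ 2 * C ^ 2 := by
        refine mul_le_of_le_one_right (by positivity) ?_
        rw [div_le_one hx0]; exact hx1
      calc 2 * (C ^ 2 * (1 + QQ + x m ^ 2) / x m)
          = 2 * C ^ 2 * ((QQ + x m ^ 2) / x m) + 2 * C ^ 2 * (1 / x m) := by ring
        _ ≤ _ := by linarith
    linarith
  have hψ' : -(N * Ψρ) - C * (1 + M * φ) - C * (1 + QQ + x m ^ 2) / x m ≤ Lψ / x m := by
    have := div_le_div_of_nonneg_right hψ hx0.le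
    refine le_trans (le_of_eq ?_) this
    field_simp
  have hsub : ∑ i, F i * (Lκ i - 2 * δ * k i ^ 2) =
      ∑ i, F i * Lκ i - 2 * δ * ∑ i, F i * k i ^ 2 := by
    rw [Finset.mul_sum, ← Finset.sum_sub_distrib]
    exact Finset.sum_congr rfl fun i _ => by ring
  rw [hsub] at hthird
  have hδφ : (2 * n + 5) * C ^ 2 / δ * FF = 4 * (2 * n + 5) * C ^ 2 * (φ * FF) := by
    rw [hδ]; field_simp
  rw [hδφ] at hthird
  -- the contributions `-N Ψρ` and `N Ψρ` of the right hand side and of `|Du|²` cancel in this sum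
  have hmain : M * φ * ε * FF - 4 * (2 * n + 5) * C ^ 2 * (φ * FF) - (N * C + N / 4) * FF ≤
      2 * C + 2 * C * (M * φ) + 2 * C ^ 2 + N * C := by
    linear_combination hthird + hψ' + hκ + hkk + hquad
  have h1 : (N * C + N / 4) * FF ≤ φ * FF := by
    have hNC' : N * 1 ≤ N * C := by gcongr
    have : N * C + N / 4 ≤ φ := by linarith only [hNC', hMN, hφ, hN1]
    gcongr
  -- `M ε` was chosen to beat the constants multiplying `φ FF`
  have h2 : (4 * (2 * n + 5) * C ^ 2 + 2) * (φ * FF) ≤ M * ε * (φ * FF) := by gcongr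
  have h3 : 2 * C + 2 * C * (M * φ) + 2 * C ^ 2 + N * C ≤
      φ * (2 * C * M + 2 * C + 2 * C ^ 2 + N * C) := by
    have : 0 ≤ (φ - 1) * (2 * C + 2 * C ^ 2 + N * C) := mul_nonneg (by linarith) (by positivity)
    linarith
  have h4 : φ * FF ≤ φ * (2 * C * M + 2 * C + 2 * C ^ 2 + N * C) := by linarith
  exact le_of_mul_le_mul_left h4 hφ0

end Absorption

/-! ### Directional Wirtinger calculus -/

section Wirtinger

open Filter Topology

variable {n : ℕ} {Y : Type*} [NormedAddCommGroup Y] [NormedSpace ℝ Y]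

/-- The real directional derivative along a constant vector field. -/
def dir (v : Cn n) (f : Cn n → Y) (x : Cn n) : Y := fderiv ℝ f x v

/-- The first order operator `(∂_v + c ∂_{iv}) / 2`. -/
def wirt (c : ℂ) (v : Cn n) (f : Cn n → ℂ) (x : Cn n) : ℂ :=
  (1 / 2 : ℂ) * (fderiv ℝ f x v + c * fderiv ℝ f x (Complex.I • v))

/-- The directional Wirtinger derivative `∂_v`, complex linear in `v`. -/
notation "∂[" v "]" => wirt (-Complex.I) v

/-- The directional Wirtinger derivative `∂̄_v`, conjugate linear in `v`. -/
notation "∂̄[" v "]" => wirt Complex.I v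

/-- The complex Hessian `∂̄_v ∂_v` in the direction `v`: a quarter of the Laplacian on the complex
line spanned by `v`. -/
def lap (v : Cn n) (f : Cn n → ℂ) (x : Cn n) : ℂ := ∂̄[v] (∂[v] f) x

variable {f g : Cn n → ℂ} {x v w : Cn n} {c d : ℂ}

lemma wirtinger_eq_del (j : Fin n) (f : Cn n → ℂ) :
    wirtinger j f = ∂[EuclideanSpace.single j 1] f := by
  funext x
  simp only [wirtinger, wirt]
  rw [show Complex.I • (EuclideanSpace.single j (1 : ℂ)) = EuclideanSpace.single j Complex.I by
    ext i; simp]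
  ring

lemma wirtingerBar_eq_delBar (j : Fin n) (f : Cn n → ℂ) :
    wirtingerBar j f = ∂̄[EuclideanSpace.single j 1] f := by
  funext x
  simp only [wirtingerBar, wirt]
  rw [show Complex.I • (EuclideanSpace.single j (1 : ℂ)) = EuclideanSpace.single j Complex.I by
    ext i; simp]

lemma contDiffAt_dir {f : Cn n → Y} {k m : ℕ∞ω} (hf : ContDiffAt ℝ k f x) (h : m + 1 ≤ k)
    (v : Cn n) : ContDiffAt ℝ m (dir v f) x :=
  (hf.fderiv_right h).clm_apply contDiffAt_const

lemma contDiffAt_wirt {k m : ℕ∞ω} (hf : ContDiffAt ℝ k f x) (h : m + 1 ≤ k) (c : ℂ) (v : Cn n) :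
    ContDiffAt ℝ m (wirt c v f) x :=
  contDiffAt_const.mul
    ((contDiffAt_dir hf h v).add (contDiffAt_const.mul (contDiffAt_dir hf h (Complex.I • v))))

lemma wirt_congr (h : f =ᶠ[𝓝 x] g) : wirt c v f =ᶠ[𝓝 x] wirt c v g := by
  filter_upwards [h.fderiv (𝕜 := ℝ)] with y hy
  simp only [wirt, hy]

lemma wirt_congr_at (h : f =ᶠ[𝓝 x] g) : wirt c v f x = wirt c v g x := (wirt_congr h).eq_of_nhds

lemma lap_congr_at (h : f =ᶠ[𝓝 x] g) : lap v f x = lap v g x := wirt_congr_at (wirt_congr h)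

@[simp] lemma wirt_const (a : ℂ) : wirt c v (fun _ : Cn n => a) = fun _ => 0 := by
  funext x; simp [wirt]

lemma wirt_add (hf : DifferentiableAt ℝ f x) (hg : DifferentiableAt ℝ g x) :
    wirt c v (fun y => f y + g y) x = wirt c v f x + wirt c v g x := by
  simp only [wirt, fderiv_fun_add hf hg, add_apply]; ring

lemma wirt_sub (hf : DifferentiableAt ℝ f x) (hg : DifferentiableAt ℝ g x) :
    wirt c v (fun y => f y - g y) x = wirt c v f x - wirt c v g x := by
  simp only [wirt, fderiv_fun_sub hf hg, sub_apply]; ring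

lemma wirt_mul (hf : DifferentiableAt ℝ f x) (hg : DifferentiableAt ℝ g x) :
    wirt c v (fun y => f y * g y) x = f x * wirt c v g x + wirt c v f x * g x := by
  simp only [wirt, fderiv_fun_mul hf hg, add_apply, smul_apply, smul_eq_mul]; ring

lemma wirt_const_mul (a : ℂ) (hf : DifferentiableAt ℝ f x) :
    wirt c v (fun y => a * f y) x = a * wirt c v f x := by
  rw [wirt_mul (by fun_prop) hf]; simp

lemma wirt_sum {ι : Type*} (s : Finset ι) {f : ι → Cn n → ℂ}
    (hf : ∀ i ∈ s, DifferentiableAt ℝ (f i) x) :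
    wirt c v (fun y => ∑ i ∈ s, f i y) x = ∑ i ∈ s, wirt c v (f i) x := by
  simp only [wirt, fderiv_fun_sum hf, sum_apply, Finset.mul_sum,
    ← Finset.sum_add_distrib]

lemma fderiv_conj (hf : DifferentiableAt ℝ f x) (v : Cn n) :
    fderiv ℝ (fun y => (starRingEnd ℂ) (f y)) x v = (starRingEnd ℂ) (fderiv ℝ f x v) := by
  have := (Complex.conjCLE.toContinuousLinearMap.hasFDerivAt.comp x hf.hasFDerivAt).fderiv
  simp only [Function.comp_def] at this
  change fderiv ℝ (fun y => Complex.conjCLE (f y)) x v = _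
  erw [this]
  simp

lemma wirt_conj (hf : DifferentiableAt ℝ f x) :
    wirt c v (fun y => (starRingEnd ℂ) (f y)) x =
      (starRingEnd ℂ) (wirt ((starRingEnd ℂ) c) v f x) := by
  simp only [wirt, fderiv_conj hf, map_mul, map_add, Complex.conj_conj, map_div₀, map_one,
    map_ofNat]

lemma del_conj (hf : DifferentiableAt ℝ f x) :
    ∂[v] (fun y => (starRingEnd ℂ) (f y)) x = (starRingEnd ℂ) (∂̄[v] f x) := by
  rw [wirt_conj hf]; simp

lemma delBar_conj (hf : DifferentiableAt ℝ f x) :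
    ∂̄[v] (fun y => (starRingEnd ℂ) (f y)) x = (starRingEnd ℂ) (∂[v] f x) := by
  rw [wirt_conj hf]; simp

lemma delBar_eq_conj_of_real {u : Cn n → ℝ} (hu : DifferentiableAt ℝ u x) :
    ∂̄[v] (fun y => (u y : ℂ)) x = (starRingEnd ℂ) (∂[v] (fun y => (u y : ℂ)) x) := by
  have : DifferentiableAt ℝ (fun y => (u y : ℂ)) x :=
    Complex.ofRealCLM.differentiableAt.comp x hu
  rw [← delBar_conj this]; simp

lemma dir_wirt (hf : ContDiffAt ℝ 2 f x) :
    fderiv ℝ (wirt c v f) x w = wirt c v (fun y => fderiv ℝ f y w) x := by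
  have h1 : ∀ v, DifferentiableAt ℝ (dir v f) x := fun v =>
    (contDiffAt_dir hf (m := 1) (by norm_num) v).differentiableAt (by norm_num)
  have hs : IsSymmSndFDerivAt ℝ f x := hf.isSymmSndFDerivAt (by simp)
  have hd : DifferentiableAt ℝ (fderiv ℝ f) x :=
    (hf.fderiv_right (m := 1) (by norm_num)).differentiableAt (by norm_num)
  have h2 : ∀ a b, fderiv ℝ (fun y => fderiv ℝ f y a) x b = fderiv ℝ (fderiv ℝ f) x b a := by
    intro a b
    rw [fderiv_clm_apply hd (by fun_prop)]
    simp
  have h3 : wirt c v f = fun y => (1 / 2 : ℂ) * (dir v f y + c * dir (Complex.I • v) f y) := rfl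
  rw [h3, fderiv_const_mul ((h1 _).fun_add ((h1 _).const_mul _)), fderiv_fun_add (h1 _)
    ((h1 _).const_mul _), fderiv_const_mul (h1 _)]
  simp only [wirt, smul_apply, add_apply, smul_eq_mul, h2]
  unfold dir
  rw [h2, h2, hs.eq w v, hs.eq w]

lemma wirt_comm (hf : ContDiffAt ℝ 2 f x) :
    wirt c v (wirt d w f) x = wirt d w (wirt c v f) x := by
  have h1 : ∀ v, DifferentiableAt ℝ (fun y => fderiv ℝ f y v) x := fun v =>
    (contDiffAt_dir hf (m := 1) (by norm_num) v).differentiableAt (by norm_num)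
  have e : wirt c v (wirt d w f) x = (1 / 2 : ℂ) * (fderiv ℝ (wirt d w f) x v +
    c * fderiv ℝ (wirt d w f) x (Complex.I • v)) := rfl
  rw [e, dir_wirt hf, dir_wirt hf, ← wirt_const_mul c (h1 _),
    ← wirt_add (h1 _) ((h1 _).const_mul c), ← wirt_const_mul _ ((h1 _).fun_add ((h1 _).const_mul c))]
  rfl

lemma eventually_contDiffAt {f : Cn n → Y} {k : ℕ} (hf : ContDiffAt ℝ k f x) :
    ∀ᶠ y in 𝓝 x, ContDiffAt ℝ k f y := hf.eventually (by simp)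

lemma wirt_comm_eventually {k : ℕ} (hk : 2 ≤ k) (hf : ContDiffAt ℝ k f x) :
    wirt c v (wirt d w f) =ᶠ[𝓝 x] wirt d w (wirt c v f) := by
  filter_upwards [eventually_contDiffAt hf] with y hy
  exact wirt_comm (hy.of_le (by exact_mod_cast hk))

lemma wirt_mul_eventually (hf : ContDiffAt ℝ 2 f x) (hg : ContDiffAt ℝ 2 g x) :
    wirt c v (fun y => f y * g y) =ᶠ[𝓝 x] fun y => f y * wirt c v g y + wirt c v f y * g y := by
  filter_upwards [eventually_contDiffAt (k := 2) hf, eventually_contDiffAt (k := 2) hg] with y h1 h2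
  exact wirt_mul (h1.differentiableAt (by norm_num)) (h2.differentiableAt (by norm_num))

lemma lap_mul (hf : ContDiffAt ℝ 2 f x) (hg : ContDiffAt ℝ 2 g x) :
    lap v (fun y => f y * g y) x = f x * lap v g x + lap v f x * g x +
      ∂[v] f x * ∂̄[v] g x + ∂̄[v] f x * ∂[v] g x := by
  have df := hf.differentiableAt (by norm_num)
  have dg := hg.differentiableAt (by norm_num)
  have df' := (contDiffAt_wirt hf (m := 1) (by norm_num) (-Complex.I) v).differentiableAt
    (by norm_num)
  have dg' := (contDiffAt_wirt hg (m := 1) (by norm_num) (-Complex.I) v).differentiableAt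
    (by norm_num)
  rw [lap, wirt_congr_at (wirt_mul_eventually hf hg), wirt_add (df.fun_mul dg') (df'.fun_mul dg),
    wirt_mul df dg', wirt_mul df' dg]
  simp only [lap]
  ring

lemma lap_add (hf : ContDiffAt ℝ 2 f x) (hg : ContDiffAt ℝ 2 g x) :
    lap v (fun y => f y + g y) x = lap v f x + lap v g x := by
  have df' := (contDiffAt_wirt hf (m := 1) (by norm_num) (-Complex.I) v).differentiableAt
    (by norm_num)
  have dg' := (contDiffAt_wirt hg (m := 1) (by norm_num) (-Complex.I) v).differentiableAt
    (by norm_num)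
  have : ∂[v] (fun y => f y + g y) =ᶠ[𝓝 x] fun y => ∂[v] f y + ∂[v] g y := by
    filter_upwards [eventually_contDiffAt (k := 2) hf, eventually_contDiffAt (k := 2) hg]
      with y h1 h2
    exact wirt_add (h1.differentiableAt (by norm_num)) (h2.differentiableAt (by norm_num))
  rw [lap, wirt_congr_at this, wirt_add df' dg']
  rfl

lemma lap_const_mul (a : ℂ) (hf : ContDiffAt ℝ 2 f x) :
    lap v (fun y => a * f y) x = a * lap v f x := by
  rw [lap_mul contDiffAt_const hf]; simp [lap]

lemma lap_sub (hf : ContDiffAt ℝ 2 f x) (hg : ContDiffAt ℝ 2 g x) :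
    lap v (fun y => f y - g y) x = lap v f x - lap v g x := by
  have := lap_add (v := v) hf ((contDiffAt_const (c := (-1 : ℂ))).mul hg)
  rw [lap_const_mul _ hg] at this
  simp only [neg_one_mul, ← sub_eq_add_neg] at this
  exact this

lemma lap_sum {ι : Type*} (s : Finset ι) {f : ι → Cn n → ℂ}
    (hf : ∀ i ∈ s, ContDiffAt ℝ 2 (f i) x) :
    lap v (fun y => ∑ i ∈ s, f i y) x = ∑ i ∈ s, lap v (f i) x := by
  classical
  induction s using Finset.induction_on with
  | empty => simp [lap]
  | insert a s ha ih =>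
    have h1 := hf a (Finset.mem_insert_self _ _)
    have h2 : ∀ i ∈ s, ContDiffAt ℝ 2 (f i) x := fun i hi => hf i (Finset.mem_insert_of_mem hi)
    simp only [Finset.sum_insert ha]
    rw [lap_add h1 (ContDiffAt.sum h2), ih h2]

lemma contDiffAt_conj {k : ℕ∞ω} (hf : ContDiffAt ℝ k f x) :
    ContDiffAt ℝ k (fun y => (starRingEnd ℂ) (f y)) x :=
  Complex.conjCLE.contDiff.contDiffAt.comp x hf

lemma contDiffAt_ofReal {k : ℕ∞ω} {u : Cn n → ℝ} (hf : ContDiffAt ℝ k u x) :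
    ContDiffAt ℝ k (fun y => (u y : ℂ)) x :=
  Complex.ofRealCLM.contDiff.contDiffAt.comp x hf

lemma lap_conj (hf : ContDiffAt ℝ 2 f x) :
    lap v (fun y => (starRingEnd ℂ) (f y)) x = (starRingEnd ℂ) (lap v f x) := by
  have : ∂[v] (fun y => (starRingEnd ℂ) (f y)) =ᶠ[𝓝 x]
      fun y => (starRingEnd ℂ) (∂̄[v] f y) := by
    filter_upwards [eventually_contDiffAt (k := 2) hf] with y h1
    exact del_conj (h1.differentiableAt (by norm_num))
  rw [lap, wirt_congr_at this, delBar_conj ((contDiffAt_wirt hf (m := 1) (by norm_num) _ v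
    ).differentiableAt (by norm_num)), wirt_comm hf]
  rfl

/-- `∂_v ∂̄_v` as a Laplacian on a complex line. -/
lemma lap_eq_dir (hf : ContDiffAt ℝ 2 f x) :
    lap v f x = (1 / 4 : ℂ) * (dir v (dir v f) x +
      dir (Complex.I • v) (dir (Complex.I • v) f) x) := by
  have hs : IsSymmSndFDerivAt ℝ f x := hf.isSymmSndFDerivAt (by simp)
  have hd : DifferentiableAt ℝ (fderiv ℝ f) x :=
    (hf.fderiv_right (m := 1) (by norm_num)).differentiableAt (by norm_num)
  have h2 : ∀ a b, fderiv ℝ (fun y => fderiv ℝ f y a) x b = fderiv ℝ (fderiv ℝ f) x b a := by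
    intro a b
    rw [fderiv_clm_apply hd (by fun_prop)]
    simp
  have e : lap v f x = (1 / 2 : ℂ) * (fderiv ℝ (∂[v] f) x v +
    Complex.I * fderiv ℝ (∂[v] f) x (Complex.I • v)) := rfl
  rw [e, dir_wirt hf, dir_wirt hf]
  simp only [wirt, h2]
  unfold dir
  rw [h2, h2, hs.eq v (Complex.I • v)]
  linear_combination (-1 / 4 : ℂ) * (fderiv ℝ (fderiv ℝ f) x (Complex.I • v) (Complex.I • v)) *
    Complex.I_sq

lemma dir_dir_comp {F : Type*} [NormedAddCommGroup F] [NormedSpace ℝ F] {Γ : Cn n → F} {H : F → Y}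
    (hΓ : ContDiffAt ℝ 2 Γ x) (hH : ContDiffAt ℝ 2 H (Γ x)) :
    dir w (dir w fun y => H (Γ y)) x =
      fderiv ℝ (fderiv ℝ H) (Γ x) (fderiv ℝ Γ x w) (fderiv ℝ Γ x w) +
        fderiv ℝ H (Γ x) (dir w (dir w Γ) x) := by
  have h1 : dir w (fun y => H (Γ y)) =ᶠ[𝓝 x] fun y => fderiv ℝ H (Γ y) (dir w Γ y) := by
    have hH' : ∀ᶠ z in 𝓝 (Γ x), ContDiffAt ℝ 2 H z := hH.eventually (by simp)
    filter_upwards [eventually_contDiffAt (k := 2) hΓ, hΓ.continuousAt.eventually hH'] with y h1 h2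
    unfold dir
    rw [fderiv_fun_comp y (h2.differentiableAt (by norm_num)) (h1.differentiableAt (by norm_num))]
    rfl
  have d1 : DifferentiableAt ℝ (dir w Γ) x :=
    (contDiffAt_dir hΓ (m := 1) (by norm_num) w).differentiableAt (by norm_num)
  have d2 : DifferentiableAt ℝ (fderiv ℝ H) (Γ x) :=
    (hH.fderiv_right (m := 1) (by norm_num)).differentiableAt (by norm_num)
  have d3 : DifferentiableAt ℝ Γ x := hΓ.differentiableAt (by norm_num)
  have e : dir w (dir w fun y => H (Γ y)) x = fderiv ℝ (dir w fun y => H (Γ y)) x w := rfl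
  have h4 := fderiv_fun_comp (𝕜 := ℝ) (g := fderiv ℝ H) x d2 d3
  have d4 : DifferentiableAt ℝ (fun y => fderiv ℝ H (Γ y)) x := d2.comp x d3
  rw [e, h1.fderiv_eq, fderiv_clm_apply d4 d1, h4]
  simp only [add_apply, ContinuousLinearMap.comp_apply, ContinuousLinearMap.flip_apply]
  rw [add_comm]
  rfl

/-- At a local minimum of a real function, the Wirtinger derivatives vanish and the complex
Hessian is nonnegative. -/
lemma wirt_eq_zero_of_isLocalMin {Z : Cn n → ℝ} (hmin : IsLocalMin Z x)
    (hZ : ContDiffAt ℝ 2 Z x) : wirt c v (fun y => (Z y : ℂ)) x = 0 := by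
  have h := hmin.fderiv_eq_zero
  have h2 : HasFDerivAt Z (0 : Cn n →L[ℝ] ℝ) x := by
    rw [← h]; exact (hZ.differentiableAt (by norm_num)).hasFDerivAt
  have h3 : fderiv ℝ (fun y => (Z y : ℂ)) x = 0 := by
    have := (Complex.ofRealCLM.hasFDerivAt.comp x h2).fderiv
    simpa [Function.comp_def] using this
  simp [wirt, h3]

lemma dir_dir_nonneg_of_isLocalMin {Z : Cn n → ℝ} (hmin : IsLocalMin Z x)
    (hZ : ContDiffAt ℝ 2 Z x) : 0 ≤ dir w (dir w Z) x := by
  by_contra hcon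
  push Not at hcon
  set h : ℝ → ℝ := fun t => -Z (x + t • w) with hh
  have hline : ∀ t : ℝ, HasDerivAt (fun t : ℝ => x + t • w) w t := fun t => by
    simpa using ((hasDerivAt_id t).smul_const w).const_add x
  have hcont : ContinuousAt (fun t : ℝ => x + t • w) 0 := (hline 0).continuousAt
  have hx0 : x + (0 : ℝ) • w = x := by simp
  have hev : ∀ᶠ t : ℝ in 𝓝 0, ContDiffAt ℝ 2 Z (x + t • w) :=
    hcont.eventually (by simp only [hx0]; exact eventually_contDiffAt (k := 2) hZ)
  have hd : ∀ᶠ t : ℝ in 𝓝 0, HasDerivAt h (-dir w Z (x + t • w)) t := by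
    filter_upwards [hev] with t ht
    exact (((ht.differentiableAt (by norm_num)).hasFDerivAt).comp_hasDerivAt t (hline t)).neg
  have hd1 : deriv h =ᶠ[𝓝 0] fun t => -dir w Z (x + t • w) := by
    filter_upwards [hd] with t ht using ht.deriv
  have hdd : deriv (deriv h) 0 = -dir w (dir w Z) x := by
    rw [hd1.deriv_eq]
    have d2 : DifferentiableAt ℝ (dir w Z) (x + (0 : ℝ) • w) := by
      rw [hx0]
      exact (contDiffAt_dir hZ (m := 1) (by norm_num) w).differentiableAt (by norm_num)
    have := ((d2.hasFDerivAt).comp_hasDerivAt (0 : ℝ) (hline 0)).neg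
    rw [hx0] at this
    exact this.deriv
  have hmax : IsLocalMax h 0 := by
    have : ∀ᶠ t : ℝ in 𝓝 0, Z x ≤ Z (x + t • w) := 
      hcont.eventually (p := fun y => Z x ≤ Z y) (by simp only [hx0]; exact hmin)
    filter_upwards [this] with t ht
    simpa [hh] using ht
  have hmin' := isLocalMin_of_deriv_deriv_pos (by rw [hdd]; linarith) hmax.deriv_eq_zero
    hd.self_of_nhds.continuousAt
  have hev : h =ᶠ[𝓝 0] fun _ => h 0 := by
    filter_upwards [hmin', hmax] with t h1 h2 using le_antisymm h2 h1
  have : deriv (deriv h) 0 = 0 := by rw [hev.deriv.deriv_eq]; simp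
  linarith

lemma dir_ofReal {Z : Cn n → ℝ} (hZ : DifferentiableAt ℝ Z x) :
    dir w (fun y => (Z y : ℂ)) x = ((dir w Z x : ℝ) : ℂ) := by
  have := (Complex.ofRealCLM.hasFDerivAt.comp x hZ.hasFDerivAt).fderiv
  unfold dir
  change fderiv ℝ (fun y => Complex.ofRealCLM (Z y)) x w = _
  simp only [Function.comp_def] at this
  rw [this]
  simp

lemma lap_ofReal {Z : Cn n → ℝ} (hZ : ContDiffAt ℝ 2 Z x) :
    lap v (fun y => (Z y : ℂ)) x = ((1 / 4 * (dir v (dir v Z) x +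
      dir (Complex.I • v) (dir (Complex.I • v) Z) x) : ℝ) : ℂ) := by
  rw [lap_eq_dir (contDiffAt_ofReal hZ)]
  have h1 : ∀ w, dir w (fun y => (Z y : ℂ)) =ᶠ[𝓝 x] fun y => ((dir w Z y : ℝ) : ℂ) := fun w => by
    filter_upwards [eventually_contDiffAt (k := 2) hZ] with y hy
    exact dir_ofReal (hy.differentiableAt (by norm_num))
  have h2 : ∀ w, dir w (dir w (fun y => (Z y : ℂ))) x = ((dir w (dir w Z) x : ℝ) : ℂ) := fun w => by
    rw [← dir_ofReal ((contDiffAt_dir hZ (m := 1) (by norm_num) w).differentiableAt (by norm_num))]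
    unfold dir
    exact congrArg (fun L : Cn n →L[ℝ] ℂ => L w) (h1 w).fderiv_eq
  rw [h2, h2]
  push_cast
  ring

lemma lap_re_nonneg_of_isLocalMin {Z : Cn n → ℝ} (hmin : IsLocalMin Z x)
    (hZ : ContDiffAt ℝ 2 Z x) : 0 ≤ (lap v (fun y => (Z y : ℂ)) x).re := by
  rw [lap_ofReal hZ, Complex.ofReal_re]
  have h1 := dir_dir_nonneg_of_isLocalMin (w := v) hmin hZ
  have h2 := dir_dir_nonneg_of_isLocalMin (w := Complex.I • v) hmin hZ
  linarith

/-- Third order derivatives commute. -/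
lemma del_delBar_del_comm {a b i : Cn n} (hf : ContDiffAt ℝ 3 f x) :
    ∂[i] (∂̄[b] (∂[a] f)) x = ∂[a] (∂̄[b] (∂[i] f)) x := by
  rw [wirt_congr_at (wirt_comm_eventually (k := 3) (by norm_num) hf),
    wirt_comm (contDiffAt_wirt hf (by norm_num) _ _),
    wirt_congr_at (wirt_comm_eventually (k := 3) (by norm_num) hf)]

lemma lap_del_comm {a i : Cn n} (hf : ContDiffAt ℝ 3 f x) :
    lap i (∂[a] f) x = ∂[a] (lap i f) x := by
  rw [lap, wirt_congr_at (wirt_comm_eventually (k := 3) (by norm_num) hf),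
    wirt_comm (contDiffAt_wirt hf (by norm_num) _ _)]
  rfl

lemma lap_lap_comm {a i : Cn n} (hf : ContDiffAt ℝ 4 f x) :
    lap i (lap a f) x = lap a (lap i f) x := by
  have h : ∀ c w, ContDiffAt ℝ 3 (wirt c w f) x := fun c w => contDiffAt_wirt hf (by norm_num) _ _
  have h1 : lap i (∂[a] f) =ᶠ[𝓝 x] ∂[a] (lap i f) := by
    filter_upwards [eventually_contDiffAt (k := 4) hf] with y hy
    exact lap_del_comm (hy.of_le (by norm_num))
  calc lap i (lap a f) x = ∂̄[a] (lap i (∂[a] f)) x := by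
        change ∂̄[i] (∂[i] (∂̄[a] (∂[a] f))) x = ∂̄[a] (∂̄[i] (∂[i] (∂[a] f))) x
        rw [wirt_congr_at (wirt_comm_eventually (k := 3) (by norm_num) (h _ _)),
          wirt_comm (contDiffAt_wirt (h _ _) (by norm_num) _ _)]
    _ = lap a (lap i f) x := wirt_congr_at h1

end Wirtinger

/-! ### Mixed discriminants and their derivatives at diagonal matrices -/

section MixedDet

open Filter Topology

variable {ι : Type*} [Fintype ι] [DecidableEq ι]

/-- The coefficient of `t ^ k` in `det (t • G + W)`, as a sum of determinants in which `k` rows are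
taken from `G` and the other ones from `W`. -/
def mixedDet {R : Type*} [CommRing R] (k : ℕ) (G W : Matrix ι ι R) : R :=
  ∑ S ∈ Finset.univ.powersetCard k, Matrix.det (Matrix.of fun a b => if a ∈ S then G a b else W a b)

lemma det_smul_add_eq_sum {R : Type*} [CommRing R] (G W : Matrix ι ι R) (t : R) :
    (t • G + W).det = ∑ k ∈ Finset.range (Fintype.card ι + 1), t ^ k * mixedDet k G W := by
  have h1 : (t • G + W).det = ∑ S : Finset ι, t ^ S.card *
      Matrix.det (Matrix.of fun a b => if a ∈ S then G a b else W a b) := by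
    have h2 := (Matrix.detRowAlternating (R := R) (n := ι)).map_add_univ (t • G) W
    refine h2.trans (Finset.sum_congr rfl fun S _ => ?_)
    have h3 := (Matrix.detRowAlternating (R := R) (n := ι)).toMultilinearMap.map_piecewise_smul
      (fun _ => t) (S.piecewise G W) S
    have h4 : (S.piecewise (t • G) W : ι → ι → R) =
        S.piecewise (fun i => t • (S.piecewise G W : ι → ι → R) i) (S.piecewise G W) := by
      funext i
      change (if i ∈ S then (t • G) i else W i) =
        if i ∈ S then t • (if i ∈ S then G i else W i) else (if i ∈ S then G i else W i)
      by_cases hi : i ∈ S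
      · simp only [hi, if_true]; rfl
      · simp only [hi, if_false]
    have h5 : (S.piecewise G W : ι → ι → R) =
        Matrix.of fun a b => if a ∈ S then G a b else W a b := by
      funext a b
      change (if a ∈ S then G a else W a) b = if a ∈ S then G a b else W a b
      by_cases ha : a ∈ S <;> simp only [ha, if_true, if_false]
    rw [Finset.prod_const, ← h4, h5] at h3
    exact h3
  rw [h1, ← Finset.powerset_univ, Finset.sum_powerset, Finset.card_univ]
  refine Finset.sum_congr rfl fun k _ => ?_
  rw [mixedDet, Finset.mul_sum]
  exact Finset.sum_congr rfl fun S hS => by rw [(Finset.mem_powersetCard.1 hS).2]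

lemma eq_of_sum_pow_eq {N : ℕ} {a b : ℕ → ℂ}
    (h : ∀ t : ℂ, ∑ k ∈ Finset.range N, t ^ k * a k = ∑ k ∈ Finset.range N, t ^ k * b k) {k : ℕ}
    (hk : k < N) : a k = b k := by
  have hp : (∑ k ∈ Finset.range N, Polynomial.monomial k (a k)) =
      ∑ k ∈ Finset.range N, Polynomial.monomial k (b k) := by
    refine Polynomial.funext fun t => ?_
    simp only [Polynomial.eval_finsetSum, Polynomial.eval_monomial]
    simpa only [mul_comm] using h t
  have := congrArg (fun p => p.coeff k) hp
  simpa [Polynomial.finsetSum_coeff, Polynomial.coeff_monomial, Finset.mem_range, hk] using this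

lemma mixedDet_mul_mul (A B G W : Matrix ι ι ℂ) {k : ℕ} (hk : k ≤ Fintype.card ι) :
    mixedDet k (A * G * B) (A * W * B) = A.det * B.det * mixedDet k G W := by
  refine eq_of_sum_pow_eq (N := Fintype.card ι + 1) (a := fun k => mixedDet k (A * G * B) (A * W * B))
    (b := fun k => A.det * B.det * mixedDet k G W) (fun t => ?_) (Nat.lt_succ_of_le hk)
  rw [← det_smul_add_eq_sum]
  have : t • (A * G * B) + A * W * B = A * (t • G + W) * B := by
    simp [mul_add, add_mul]
  rw [this, Matrix.det_mul, Matrix.det_mul, det_smul_add_eq_sum, Finset.mul_sum, Finset.sum_mul]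
  exact Finset.sum_congr rfl fun k _ => by ring

omit [Fintype ι] in
lemma of_ite_diagonal {R : Type*} [CommRing R] (S : Finset ι) (x : ι → R) :
    (Matrix.of fun a b => if a ∈ S then Matrix.diagonal x a b else (1 : Matrix ι ι R) a b) =
      Matrix.diagonal fun a => if a ∈ S then x a else 1 := by
  ext a b
  by_cases hab : a = b
  · subst hab; simp
  · simp [hab]

lemma mixedDet_diagonal_one (k : ℕ) (x : ι → ℝ) :
    mixedDet k (Matrix.diagonal fun a => (x a : ℂ)) 1 = (elemSymm k Finset.univ x : ℂ) := by
  unfold mixedDet elemSymm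
  push_cast
  refine Finset.sum_congr rfl fun S _ => ?_
  rw [of_ite_diagonal, Matrix.det_diagonal, Finset.prod_ite_mem]
  simp

/-- Leibniz' formula with all but one row diagonal. -/
lemma sum_perm_one {R : Type*} [CommRing R] (d : ι → R) (X : Matrix ι ι R) (a : ι) :
    ∑ σ : Equiv.Perm ι, ((Equiv.Perm.sign σ : ℤ) : R) * (X a (σ a) *
      ∏ c ∈ Finset.univ.erase a, Matrix.diagonal d c (σ c)) =
    X a a * ∏ c ∈ Finset.univ.erase a, d c := by
  rw [Finset.sum_eq_single 1]
  · simp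
  · intro σ _ hσ
    have : ∃ c ∈ Finset.univ.erase a, σ c ≠ c := by
      by_contra hcon
      push Not at hcon
      apply hσ
      have h1 : ∀ c, c ≠ a → σ c = c := fun c hc => hcon c (by simp [hc])
      ext c
      by_cases hc : c = a
      · subst hc
        by_contra hne
        have := h1 _ hne
        exact hne (by simpa using σ.injective this)
      · simp [h1 c hc]
    obtain ⟨c, hc, hcσ⟩ := this
    have h0 : Matrix.diagonal d c (σ c) = 0 := Matrix.diagonal_apply_ne _ hcσ.symm
    rw [Finset.prod_eq_zero hc h0]
    simp
  · simp

/-- Leibniz' formula with all but two rows diagonal. -/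
lemma sum_perm_two {R : Type*} [CommRing R] (d : ι → R) (X Y : Matrix ι ι R) {a b : ι}
    (hab : b ≠ a) :
    ∑ σ : Equiv.Perm ι, ((Equiv.Perm.sign σ : ℤ) : R) * (X a (σ a) * Y b (σ b) *
      ∏ c ∈ (Finset.univ.erase a).erase b, Matrix.diagonal d c (σ c)) =
    (X a a * Y b b - X a b * Y b a) * ∏ c ∈ (Finset.univ.erase a).erase b, d c := by
  have hne : (1 : Equiv.Perm ι) ≠ Equiv.swap a b := by
    intro h
    have := congrArg (fun σ : Equiv.Perm ι => σ a) h
    simp at this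
    exact hab this.symm
  rw [← Finset.sum_subset (Finset.subset_univ {1, Equiv.swap a b}), Finset.sum_pair hne]
  · have h1 : ∏ c ∈ (Finset.univ.erase a).erase b, Matrix.diagonal d c (Equiv.swap a b c) =
        ∏ c ∈ (Finset.univ.erase a).erase b, d c := by
      refine Finset.prod_congr rfl fun c hc => ?_
      simp only [Finset.mem_erase, Finset.mem_univ, and_true] at hc
      rw [Equiv.swap_apply_of_ne_of_ne hc.2 hc.1, Matrix.diagonal_apply_eq]
    rw [h1, Equiv.Perm.sign_swap hab.symm]
    simp
    ring
  · intro σ _ hσ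
    have : ∃ c ∈ (Finset.univ.erase a).erase b, σ c ≠ c := by
      by_contra hcon
      push Not at hcon
      have h1 : ∀ c, c ≠ a → c ≠ b → σ c = c := fun c hc hc' => hcon c (by simp [hc, hc'])
      have h2 : ∀ c, (c = a ∨ c = b) → (σ c = a ∨ σ c = b) := by
        intro c hc
        by_contra hn
        push Not at hn
        have := σ.injective (h1 (σ c) hn.1 hn.2)
        rw [this] at hn
        tauto
      apply hσ
      simp only [Finset.mem_insert, Finset.mem_singleton]
      rcases h2 a (Or.inl rfl) with ha | ha
      · left
        have hb : σ b = b := by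
          rcases h2 b (Or.inr rfl) with hb | hb
          · exact absurd (σ.injective (hb.trans ha.symm)) hab
          · exact hb
        ext c
        by_cases hca : c = a
        · simp [hca, ha]
        by_cases hcb : c = b
        · simp [hcb, hb]
        simp [h1 c hca hcb]
      · right
        have hb : σ b = a := by
          rcases h2 b (Or.inr rfl) with hb | hb
          · exact hb
          · exact absurd (σ.injective (hb.trans ha.symm)) hab
        ext c
        by_cases hca : c = a
        · simp [hca, ha]
        by_cases hcb : c = b
        · simp [hcb, hb]
        rw [Equiv.swap_apply_of_ne_of_ne hca hcb, h1 c hca hcb]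
    obtain ⟨c, hc, hcσ⟩ := this
    have h0 : Matrix.diagonal d c (σ c) = 0 := Matrix.diagonal_apply_ne _ hcσ.symm
    rw [Finset.prod_eq_zero hc h0]
    simp

variable {n : ℕ} {x₀ v : Cn n} {c : ℂ}

omit [Fintype ι] in
lemma wirt_prod (s : Finset ι) {h : ι → Cn n → ℂ} (hh : ∀ a ∈ s, DifferentiableAt ℝ (h a) x₀) :
    wirt c v (fun y => ∏ a ∈ s, h a y) x₀ =
      ∑ a ∈ s, wirt c v (h a) x₀ * ∏ b ∈ s.erase a, h b x₀ := by
  have h3 : ∀ w, fderiv ℝ (fun y => ∏ a ∈ s, h a y) x₀ w =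
      ∑ a ∈ s, (∏ b ∈ s.erase a, h b x₀) * fderiv ℝ (h a) x₀ w := fun w => by
    rw [fderiv_finsetProd hh]
    simp [sum_apply]
  simp only [wirt, h3, Finset.mul_sum, ← Finset.sum_add_distrib]
  exact Finset.sum_congr rfl fun a _ => by ring

omit [Fintype ι] in
lemma lap_prod (s : Finset ι) {h : ι → Cn n → ℂ} (hh : ∀ a ∈ s, ContDiffAt ℝ 2 (h a) x₀) :
    lap v (fun y => ∏ a ∈ s, h a y) x₀ =
      ∑ a ∈ s, lap v (h a) x₀ * ∏ b ∈ s.erase a, h b x₀ +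
      ∑ a ∈ s, ∑ b ∈ s.erase a, ∂[v] (h a) x₀ * ∂̄[v] (h b) x₀ *
        ∏ e ∈ (s.erase a).erase b, h e x₀ := by
  have h1 : ∂[v] (fun y => ∏ a ∈ s, h a y) =ᶠ[𝓝 x₀]
      fun y => ∑ a ∈ s, ∂[v] (h a) y * ∏ b ∈ s.erase a, h b y := by
    have : ∀ᶠ y in 𝓝 x₀, ∀ a ∈ s, ContDiffAt ℝ 2 (h a) y := by
      rw [Filter.eventually_all_finset]
      exact fun a ha => eventually_contDiffAt (k := 2) (hh a ha)
    filter_upwards [this] with y hy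
    exact wirt_prod s fun a ha => (hy a ha).differentiableAt (by norm_num)
  have d0 : ∀ a ∈ s, DifferentiableAt ℝ (h a) x₀ :=
    fun a ha => (hh a ha).differentiableAt (by norm_num)
  have d1 : ∀ a ∈ s, DifferentiableAt ℝ (∂[v] (h a)) x₀ := fun a ha =>
    (contDiffAt_wirt (hh a ha) (m := 1) (by norm_num) _ _).differentiableAt (by norm_num)
  have d2 : ∀ a, DifferentiableAt ℝ (fun y => ∏ b ∈ s.erase a, h b y) x₀ := fun a =>
    (contDiffAt_prod fun b hb => hh b (Finset.mem_of_mem_erase hb)).differentiableAt (by norm_num)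
  rw [lap, wirt_congr_at h1, wirt_sum s fun a ha => (d1 a ha).fun_mul (d2 a),
    ← Finset.sum_add_distrib]
  refine Finset.sum_congr rfl fun a ha => ?_
  rw [wirt_mul (d1 a ha) (d2 a), wirt_prod _ fun b hb => d0 b (Finset.mem_of_mem_erase hb),
    Finset.mul_sum, add_comm]
  simp only [lap, mul_assoc]

lemma det_eq_sum_rows (M : Matrix ι ι ℂ) :
    M.det = ∑ σ : Equiv.Perm ι, ((Equiv.Perm.sign σ : ℤ) : ℂ) * ∏ a, M a (σ a) := by
  rw [← Matrix.det_transpose, Matrix.det_apply']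
  rfl

lemma wirt_det {H : Cn n → Matrix ι ι ℂ} (hH : ∀ a b, ContDiffAt ℝ 2 (fun y => H y a b) x₀)
    {d : ι → ℂ} (hd : H x₀ = Matrix.diagonal d) :
    wirt c v (fun y => (H y).det) x₀ =
      ∑ a, wirt c v (fun y => H y a a) x₀ * ∏ b ∈ Finset.univ.erase a, d b := by
  have d0 : ∀ a b, DifferentiableAt ℝ (fun y => H y a b) x₀ :=
    fun a b => (hH a b).differentiableAt (by norm_num)
  have d1 : ∀ σ : Equiv.Perm ι, DifferentiableAt ℝ (fun y => ∏ a, H y a (σ a)) x₀ := fun σ =>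
    (contDiffAt_prod fun a _ => hH a (σ a)).differentiableAt (by norm_num)
  simp only [det_eq_sum_rows]
  rw [wirt_sum _ fun σ _ => (d1 σ).const_mul _]
  simp only [wirt_const_mul _ (d1 _), wirt_prod _ fun a _ => d0 a _, Finset.mul_sum]
  rw [Finset.sum_comm]
  refine Finset.sum_congr rfl fun a _ => ?_
  rw [← sum_perm_one d (fun a b => wirt c v (fun y => H y a b) x₀) a, hd]

lemma lap_det {H : Cn n → Matrix ι ι ℂ} (hH : ∀ a b, ContDiffAt ℝ 2 (fun y => H y a b) x₀)
    {d : ι → ℂ} (hd : H x₀ = Matrix.diagonal d) :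
    lap v (fun y => (H y).det) x₀ =
      ∑ a, lap v (fun y => H y a a) x₀ * ∏ b ∈ Finset.univ.erase a, d b +
      ∑ a, ∑ b ∈ Finset.univ.erase a,
        (∂[v] (fun y => H y a a) x₀ * ∂̄[v] (fun y => H y b b) x₀ -
          ∂[v] (fun y => H y a b) x₀ * ∂̄[v] (fun y => H y b a) x₀) *
        ∏ e ∈ (Finset.univ.erase a).erase b, d e := by
  have d1 : ∀ σ : Equiv.Perm ι, ContDiffAt ℝ 2 (fun y => ∏ a, H y a (σ a)) x₀ := fun σ =>
    contDiffAt_prod fun a _ => hH a (σ a)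
  simp only [det_eq_sum_rows]
  rw [lap_sum _ fun σ _ => contDiffAt_const.mul (d1 σ)]
  simp only [lap_const_mul _ (d1 _), lap_prod _ fun a _ => hH a _, mul_add, Finset.mul_sum,
    Finset.sum_add_distrib]
  congr 1
  · rw [Finset.sum_comm]
    refine Finset.sum_congr rfl fun a _ => ?_
    rw [← sum_perm_one d (fun a b => lap v (fun y => H y a b) x₀) a, hd]
  · rw [Finset.sum_comm]
    refine Finset.sum_congr rfl fun a _ => ?_
    rw [Finset.sum_comm]
    refine Finset.sum_congr rfl fun b hb => ?_
    rw [← sum_perm_two d (fun a b => ∂[v] (fun y => H y a b) x₀)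
      (fun a b => ∂̄[v] (fun y => H y a b) x₀) (Finset.ne_of_mem_erase hb), hd]

section Derivatives

variable {G Ω : Cn n → Matrix ι ι ℂ} {x : ι → ℝ} {j : ℕ}

omit [Fintype ι] in
lemma contDiffAt_of_ite {k : ℕ∞ω} (hG : ∀ a b, ContDiffAt ℝ k (fun y => G y a b) x₀)
    (hΩ : ∀ a b, ContDiffAt ℝ k (fun y => Ω y a b) x₀) (S : Finset ι) (a b : ι) :
    ContDiffAt ℝ k
      (fun y => (Matrix.of fun a b => if a ∈ S then G y a b else Ω y a b) a b) x₀ := by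
  simp only [Matrix.of_apply]
  by_cases ha : a ∈ S <;> simp only [ha, if_true, if_false]
  exacts [hG a b, hΩ a b]

omit [Fintype ι] in
lemma of_ite_eq_diagonal (hG : G x₀ = Matrix.diagonal fun a => (x a : ℂ)) (hΩ : Ω x₀ = 1)
    (S : Finset ι) : (Matrix.of fun a b => if a ∈ S then G x₀ a b else Ω x₀ a b) =
      Matrix.diagonal fun a => if a ∈ S then (x a : ℂ) else 1 := by
  rw [hG, hΩ, of_ite_diagonal]

omit [Fintype ι] in
lemma prod_ite_of_subset {R : Type*} [CommRing R] {S T U : Finset ι} (hU : U ∩ S = T) (x : ι → R) :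
    ∏ a ∈ U, (if a ∈ S then x a else 1) = ∏ a ∈ T, x a := by
  rw [Finset.prod_ite_mem, hU]

/-- The first derivative of `mixedDet` at a pair (diagonal, identity), when the second matrix is the
identity to first order. -/
lemma wirt_mixedDet (hG2 : ∀ a b, ContDiffAt ℝ 2 (fun y => G y a b) x₀)
    (hΩ2 : ∀ a b, ContDiffAt ℝ 2 (fun y => Ω y a b) x₀)
    (hG : G x₀ = Matrix.diagonal fun a => (x a : ℂ)) (hΩ : Ω x₀ = 1)
    (hdΩ : ∀ a b, wirt c v (fun y => Ω y a b) x₀ = 0) :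
    wirt c v (fun y => mixedDet (j + 1) (G y) (Ω y)) x₀ =
      ∑ a, (elemSymm j (Finset.univ.erase a) x : ℂ) * wirt c v (fun y => G y a a) x₀ := by
  unfold mixedDet
  rw [wirt_sum]
  swap
  · intro S _
    simp only [det_eq_sum_rows]
    refine DifferentiableAt.fun_sum fun σ _ => DifferentiableAt.const_mul ?_ _
    exact (contDiffAt_prod fun a _ => contDiffAt_of_ite hG2 hΩ2 S a (σ a)).differentiableAt
      (by norm_num)
  have h1 : ∀ S ∈ Finset.univ.powersetCard (j + 1), wirt c v
      (fun y => (Matrix.of fun a b => if a ∈ S then G y a b else Ω y a b).det) x₀ =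
      ∑ a ∈ S, wirt c v (fun y => G y a a) x₀ * ∏ b ∈ S.erase a, (x b : ℂ) := by
    intro S _
    rw [wirt_det (contDiffAt_of_ite hG2 hΩ2 S) (of_ite_eq_diagonal hG hΩ S),
      ← Finset.sum_subset (Finset.subset_univ S)]
    · refine Finset.sum_congr rfl fun a ha => ?_
      rw [prod_ite_of_subset (T := S.erase a) (by ext; simp)]
      simp [ha]
    · intro a _ ha
      simp [ha, hdΩ]
  rw [Finset.sum_congr rfl h1, sum_powersetCard_sum_erase _ _
    (fun a T => wirt c v (fun y => G y a a) x₀ * ∏ b ∈ T, (x b : ℂ))]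
  refine Finset.sum_congr rfl fun a _ => ?_
  rw [← Finset.mul_sum, mul_comm]
  simp [elemSymm]

/-- The second derivative of `mixedDet` at a pair (diagonal, identity), when the second matrix is the
identity to first order. -/
lemma lap_mixedDet (hG2 : ∀ a b, ContDiffAt ℝ 2 (fun y => G y a b) x₀)
    (hΩ2 : ∀ a b, ContDiffAt ℝ 2 (fun y => Ω y a b) x₀)
    (hG : G x₀ = Matrix.diagonal fun a => (x a : ℂ)) (hΩ : Ω x₀ = 1)
    (hdΩ : ∀ c a b, wirt c v (fun y => Ω y a b) x₀ = 0) :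
    lap v (fun y => mixedDet (j + 2) (G y) (Ω y)) x₀ =
      ∑ a, (elemSymm (j + 1) (Finset.univ.erase a) x : ℂ) * lap v (fun y => G y a a) x₀ +
      ∑ a, ∑ b ∈ Finset.univ.erase a, (elemSymm j ((Finset.univ.erase a).erase b) x : ℂ) *
        (∂[v] (fun y => G y a a) x₀ * ∂̄[v] (fun y => G y b b) x₀ -
          ∂[v] (fun y => G y a b) x₀ * ∂̄[v] (fun y => G y b a) x₀) +
      ∑ a, (elemSymm (j + 2) (Finset.univ.erase a) x : ℂ) * lap v (fun y => Ω y a a) x₀ := by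
  unfold mixedDet
  rw [lap_sum]
  swap
  · intro S _
    simp only [det_eq_sum_rows]
    refine ContDiffAt.sum fun σ _ => contDiffAt_const.mul ?_
    exact contDiffAt_prod fun a _ => contDiffAt_of_ite hG2 hΩ2 S a (σ a)
  set D : ι → ι → ℂ := fun a b => ∂[v] (fun y => G y a a) x₀ * ∂̄[v] (fun y => G y b b) x₀ -
          ∂[v] (fun y => G y a b) x₀ * ∂̄[v] (fun y => G y b a) x₀ with hD
  have h1 : ∀ S ∈ Finset.univ.powersetCard (j + 2), lap v
      (fun y => (Matrix.of fun a b => if a ∈ S then G y a b else Ω y a b).det) x₀ =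
      ∑ a ∈ S, lap v (fun y => G y a a) x₀ * ∏ b ∈ S.erase a, (x b : ℂ) +
      ∑ a ∈ Sᶜ, lap v (fun y => Ω y a a) x₀ * ∏ b ∈ S, (x b : ℂ) +
      ∑ a ∈ S, ∑ b ∈ S.erase a, D a b * ∏ e ∈ (S.erase a).erase b, (x e : ℂ) := by
    intro S _
    rw [lap_det (contDiffAt_of_ite hG2 hΩ2 S) (of_ite_eq_diagonal hG hΩ S)]
    congr 1
    · rw [← Finset.sum_add_sum_compl S]
      congr 1
      · refine Finset.sum_congr rfl fun a ha => ?_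
        rw [prod_ite_of_subset (T := S.erase a) (by ext; simp)]
        simp [ha]
      · refine Finset.sum_congr rfl fun a ha => ?_
        rw [Finset.mem_compl] at ha
        rw [prod_ite_of_subset (T := S)
          (by ext b; simp only [Finset.mem_inter, Finset.mem_erase, Finset.mem_univ, and_true]
              exact ⟨fun h => h.2, fun h => ⟨fun hb => ha (hb ▸ h), h⟩⟩)]
        simp [ha]
    · rw [← Finset.sum_subset (Finset.subset_univ S)]
      · refine Finset.sum_congr rfl fun a ha => ?_
        rw [← Finset.sum_subset (Finset.erase_subset_erase a (Finset.subset_univ S))]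
        · refine Finset.sum_congr rfl fun b hb => ?_
          rw [prod_ite_of_subset (T := (S.erase a).erase b) (by ext; simp)]
          simp [ha, Finset.mem_of_mem_erase hb, hD]
        · intro b hb hb'
          have : b ∉ S := fun h => hb' (Finset.mem_erase.2 ⟨Finset.ne_of_mem_erase hb, h⟩)
          simp [this, hdΩ]
      · intro a _ ha
        refine Finset.sum_eq_zero fun b hb => ?_
        simp [ha, hdΩ]
  rw [Finset.sum_congr rfl h1, Finset.sum_add_distrib, Finset.sum_add_distrib,
    sum_powersetCard_sum_erase _ Finset.univ
      (fun a T => lap v (fun y => G y a a) x₀ * ∏ b ∈ T, (x b : ℂ)),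
    sum_powersetCard_sum_erase _ Finset.univ
      (fun a T => ∑ b ∈ T, D a b * ∏ e ∈ T.erase b, (x e : ℂ)), add_right_comm]
  congr 1
  · congr 1
    · refine Finset.sum_congr rfl fun a _ => ?_
      rw [← Finset.mul_sum, mul_comm]
      simp [elemSymm]
    · refine Finset.sum_congr rfl fun a _ => ?_
      rw [sum_powersetCard_sum_erase _ (Finset.univ.erase a)
        (fun b T => D a b * ∏ e ∈ T, (x e : ℂ))]
      refine Finset.sum_congr rfl fun b _ => ?_
      rw [← Finset.mul_sum, mul_comm]
      simp [elemSymm, hD]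
  · rw [Finset.sum_comm' (t' := Finset.univ)
      (s' := fun a => (Finset.univ.erase a).powersetCard (j + 2))]
    · refine Finset.sum_congr rfl fun a _ => ?_
      rw [← Finset.mul_sum, mul_comm]
      simp [elemSymm]
    · intro S a
      simp only [Finset.mem_powersetCard, Finset.mem_compl, Finset.mem_univ, and_true,
        Finset.subset_univ, true_and]
      constructor
      · exact fun h => ⟨fun b hb => by
          simp only [Finset.mem_erase, Finset.mem_univ, and_true]
          exact fun hba => h.2 (hba ▸ hb), h.1⟩
      · exact fun h => ⟨h.2, fun ha => by simpa using h.1 ha⟩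

lemma wirt_det_of_eq_one (hΩ2 : ∀ a b, ContDiffAt ℝ 2 (fun y => Ω y a b) x₀) (hΩ : Ω x₀ = 1)
    (hdΩ : ∀ a b, wirt c v (fun y => Ω y a b) x₀ = 0) :
    wirt c v (fun y => (Ω y).det) x₀ = 0 := by
  rw [wirt_det hΩ2 (d := fun _ => 1) (by rw [hΩ, ← Matrix.diagonal_one])]
  simp [hdΩ]

lemma lap_det_of_eq_one (hΩ2 : ∀ a b, ContDiffAt ℝ 2 (fun y => Ω y a b) x₀) (hΩ : Ω x₀ = 1)
    (hdΩ : ∀ c a b, wirt c v (fun y => Ω y a b) x₀ = 0) :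
    lap v (fun y => (Ω y).det) x₀ = ∑ a, lap v (fun y => Ω y a a) x₀ := by
  rw [lap_det hΩ2 (d := fun _ => 1) (by rw [hΩ, ← Matrix.diagonal_one])]
  simp [hdΩ]

end Derivatives

end MixedDet

/-! ### Wedge products of (1,1)-forms as mixed discriminants -/

section Exterior

lemma add_pow_of_sq_zero {A : Type*} [Ring A] {x r : A} (hx : x * x = 0) (h : Commute x r) (m : ℕ) :
    (x + r) ^ (m + 1) = r ^ (m + 1) + ((m + 1 : ℕ) : A) * (x * r ^ m) := by
  induction m with
  | zero => simp [add_comm]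
  | succ m ih =>
    have h1 : r * (x * r ^ m) = x * r ^ (m + 1) := by
      rw [← mul_assoc, ← h.eq, mul_assoc, ← pow_succ']
    have h2 : x * (((m + 1 : ℕ) : A) * (x * r ^ m)) = 0 := by
      rw [← mul_assoc, ← Nat.cast_commute, mul_assoc, ← mul_assoc x, hx]; simp
    have h3 : r * (((m + 1 : ℕ) : A) * (x * r ^ m)) = ((m + 1 : ℕ) : A) * (x * r ^ (m + 1)) := by
      rw [← mul_assoc, ← Nat.cast_commute, mul_assoc, h1]
    rw [pow_succ' (x + r), ih, mul_add, add_mul, add_mul, h2, h3, ← pow_succ']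
    push_cast
    noncomm_ring

lemma sum_pow_of_sq_zero {A : Type*} [Ring A] {n : ℕ} (α : Fin n → A) (hsq : ∀ i, α i * α i = 0)
    (hc : ∀ i j, Commute (α i) (α j)) :
    (∑ i, α i) ^ n = (n.factorial : A) * (List.ofFn α).prod ∧ (∑ i, α i) ^ (n + 1) = 0 := by
  induction n with
  | zero => simp
  | succ n ih =>
    obtain ⟨h1, h2⟩ := ih (fun i => α i.succ) (fun i => hsq _) fun i j => hc _ _
    have hcom : Commute (α 0) (∑ i : Fin n, α i.succ) := Commute.sum_right _ _ _ fun i _ => hc _ _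
    rw [Fin.sum_univ_succ, add_pow_of_sq_zero (hsq 0) hcom, add_pow_of_sq_zero (hsq 0) hcom, h2]
    constructor
    · rw [h1, List.ofFn_succ, List.prod_cons, Nat.factorial_succ, zero_add, Nat.cast_mul, mul_assoc,
        ← mul_assoc (α 0), ← Nat.cast_commute, mul_assoc]
    · rw [pow_succ, h2]; simp

variable {n : ℕ}

/-- The evaluation of a covector at `∂/∂zʲ` (for `c = -√-1`) or `∂/∂z̄ʲ` (for `c = √-1`). -/
def evalDel (c : ℂ) (j : Fin n) : Covector n →ₗ[ℂ] ℂ :=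
  (1 / 2 : ℂ) • (LinearMap.applyₗ' ℂ (EuclideanSpace.single j (1 : ℂ) : Cn n) +
    c • LinearMap.applyₗ' ℂ (EuclideanSpace.single j Complex.I : Cn n))

lemma evalDel_dzForm (c : ℂ) (j k : Fin n) :
    evalDel c j (dzForm k) = (1 / 2 : ℂ) * (1 + c * Complex.I) * (1 : Matrix _ _ ℂ) k j := by
  have h0 : ∀ v, dzForm k v = v k := fun _ => rfl
  by_cases h : k = j
  · subst h; simp [evalDel, h0]; ring
  · simp [evalDel, h0, h]

lemma evalDel_dzBarForm (c : ℂ) (j k : Fin n) :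
    evalDel c j (dzBarForm k) = (1 / 2 : ℂ) * (1 - c * Complex.I) * (1 : Matrix _ _ ℂ) k j := by
  have h0 : ∀ v, dzBarForm k v = (starRingEnd ℂ) (v k) := fun _ => rfl
  by_cases h : k = j
  · subst h; simp [evalDel, h0]; ring
  · simp [evalDel, h0, h]

/-- The `(0,1)`-covector `√-1 ∑ₖ Hⱼₖ dz̄ᵏ`. -/
def rowForm (H : Matrix (Fin n) (Fin n) ℂ) (j : Fin n) : Covector n :=
  ∑ k, (Complex.I * H j k) • dzBarForm k

lemma evalDel_rowForm (c : ℂ) (H : Matrix (Fin n) (Fin n) ℂ) (j k : Fin n) :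
    evalDel c k (rowForm H j) = (1 / 2 : ℂ) * (1 - c * Complex.I) * (Complex.I * H j k) := by
  simp only [rowForm, map_sum, map_smul, evalDel_dzBarForm, smul_eq_mul]
  rw [Finset.sum_eq_single k]
  · simp; ring
  · intro b _ hb; simp [hb]
  · simp

lemma oneOneForm_eq_sum (H : Matrix (Fin n) (Fin n) ℂ) : oneOneForm H =
    ∑ j, ExteriorAlgebra.ι ℂ (dzForm j) * ExteriorAlgebra.ι ℂ (rowForm H j) := by
  refine Finset.sum_congr rfl fun j _ => ?_
  simp only [rowForm, map_sum, Finset.mul_sum, map_smul, mul_smul_comm]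

lemma ι_swap (x y : Covector n) : ExteriorAlgebra.ι ℂ x * ExteriorAlgebra.ι ℂ y =
    -(ExteriorAlgebra.ι ℂ y * ExteriorAlgebra.ι ℂ x) :=
  eq_neg_of_add_eq_zero_left (ExteriorAlgebra.ι_add_mul_swap x y)

lemma commute_ι_mul_ι (a b c d : Covector n) :
    Commute (ExteriorAlgebra.ι ℂ a * ExteriorAlgebra.ι ℂ b)
      (ExteriorAlgebra.ι ℂ c * ExteriorAlgebra.ι ℂ d) := by
  have h : ∀ z, Commute (ExteriorAlgebra.ι ℂ a * ExteriorAlgebra.ι ℂ b)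
      (ExteriorAlgebra.ι ℂ z) := fun z => by
    change _ * _ = _ * _
    rw [mul_assoc, ι_swap b z, mul_neg, ← mul_assoc, ι_swap a z, neg_mul, neg_neg, mul_assoc]
  exact (h c).mul_right (h d)

lemma commute_oneOneForm (H K : Matrix (Fin n) (Fin n) ℂ) :
    Commute (oneOneForm H) (oneOneForm K) := by
  rw [oneOneForm_eq_sum, oneOneForm_eq_sum]
  exact Commute.sum_right _ _ _ fun i _ => Commute.sum_left _ _ _ fun j _ => commute_ι_mul_ι _ _ _ _

lemma oneOneForm_smul_add (t : ℂ) (H K : Matrix (Fin n) (Fin n) ℂ) :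
    oneOneForm (t • H + K) = t • oneOneForm H + oneOneForm K := by
  simp only [oneOneForm, Finset.smul_sum, ← Finset.sum_add_distrib, smul_smul, ← add_smul]
  refine Finset.sum_congr rfl fun j _ => Finset.sum_congr rfl fun k _ => ?_
  congr 1
  simp
  ring

/-- The covectors `dz¹, β₁, dz², β₂, …` in this order, where `βⱼ = √-1 ∑ₖ Hⱼₖ dz̄ᵏ`. -/
def interleave (H : Matrix (Fin n) (Fin n) ℂ) (p : Fin (n * 2)) : Covector n :=
  if (finProdFinEquiv.symm p).2 = 0 then dzForm (finProdFinEquiv.symm p).1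
  else rowForm H (finProdFinEquiv.symm p).1

/-- The functionals `∂/∂z¹, ∂/∂z̄¹, ∂/∂z², ∂/∂z̄², …` on covectors. -/
def interleaveEval (n : ℕ) : Covector n →ₗ[ℂ] (Fin (n * 2) → ℂ) :=
  LinearMap.pi fun p => evalDel (if (finProdFinEquiv.symm p).2 = 0 then -Complex.I else Complex.I)
    (finProdFinEquiv.symm p).1

lemma interleave_apply (H : Matrix (Fin n) (Fin n) ℂ) (j : Fin n) (b : Fin 2) :
    interleave H (finProdFinEquiv (j, b)) = if b = 0 then dzForm j else rowForm H j := by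
  simp only [interleave, Equiv.symm_apply_apply]

lemma interleaveEval_apply (β : Covector n) (j : Fin n) (b : Fin 2) :
    interleaveEval n β (finProdFinEquiv (j, b)) =
      evalDel (if b = 0 then -Complex.I else Complex.I) j β := by
  simp only [interleaveEval, LinearMap.pi_apply, Equiv.symm_apply_apply]

/-- A functional on the exterior algebra which is nonzero on the top degree forms of type
`(n, n)`. -/
def topFunctional (n : ℕ) : ExteriorAlgebra ℂ (Covector n) →ₗ[ℂ] ℂ :=
  ExteriorAlgebra.liftAlternating
    (Pi.single (n * 2) (Matrix.detRowAlternating.compLinearMap (interleaveEval n)))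

/-- `Fin n ⊕ Fin n` as `Fin n × Fin 2`. -/
def sumEquivProdTwo (n : ℕ) : Fin n ⊕ Fin n ≃ Fin n × Fin 2 where
  toFun := Sum.elim (fun j => (j, 0)) fun j => (j, 1)
  invFun p := if p.2 = 0 then Sum.inl p.1 else Sum.inr p.1
  left_inv := by rintro (j | j) <;> simp
  right_inv := by
    rintro ⟨j, b⟩
    fin_cases b <;> simp

/-- The top power of a `(1,1)`-form is, up to a universal constant, its determinant. -/
lemma topFunctional_pow (H : Matrix (Fin n) (Fin n) ℂ) :
    topFunctional n (oneOneForm H ^ n) = n.factorial * (Complex.I ^ n * H.det) := by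
  have hprod : (List.ofFn fun j => ExteriorAlgebra.ι ℂ (dzForm j) *
      ExteriorAlgebra.ι ℂ (rowForm H j)).prod =
        ExteriorAlgebra.ιMulti ℂ (n * 2) (interleave H) := by
    rw [ExteriorAlgebra.ιMulti_apply, List.ofFn_mul, List.prod_flatten, List.map_ofFn]
    congr 1
    congr 1
    funext j
    have h0 : ∀ (b : Fin 2) h, finProdFinEquiv.symm (⟨j * 2 + b, h⟩ : Fin (n * 2)) = (j, b) :=
      fun b h => by
        rw [Equiv.symm_apply_eq]
        ext
        simp [finProdFinEquiv_apply_val]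
        ring
    simp [interleave, List.ofFn_succ, h0, Function.comp]
  have hsq : ∀ j, ExteriorAlgebra.ι ℂ (dzForm j) * ExteriorAlgebra.ι ℂ (rowForm H j) *
      (ExteriorAlgebra.ι ℂ (dzForm j) * ExteriorAlgebra.ι ℂ (rowForm H j)) = 0 := fun j => by
    rw [ι_swap (dzForm j), neg_mul_neg, mul_assoc, ← mul_assoc (ExteriorAlgebra.ι ℂ (dzForm j)),
      ι_swap (dzForm j), neg_mul, mul_assoc, ExteriorAlgebra.ι_sq_zero]
    simp
  have hdet : ((Matrix.of fun p q => interleaveEval n (interleave H p) q).submatrix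
      ((sumEquivProdTwo n).trans finProdFinEquiv) ((sumEquivProdTwo n).trans finProdFinEquiv)) =
      Matrix.fromBlocks (1 : Matrix (Fin n) (Fin n) ℂ) 0 0 (Complex.I • H) := by
    ext (a | a) (b | b) <;>
      simp only [Matrix.submatrix_apply, Matrix.of_apply, Equiv.trans_apply, interleave_apply,
        interleaveEval_apply, sumEquivProdTwo, Equiv.coe_fn_mk, Sum.elim_inl, Sum.elim_inr,
        if_true, one_ne_zero, if_false, evalDel_dzForm, evalDel_rowForm, Matrix.fromBlocks_apply₁₁,
        Matrix.fromBlocks_apply₁₂, Matrix.fromBlocks_apply₂₁, Matrix.fromBlocks_apply₂₂,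
        Matrix.zero_apply, Matrix.smul_apply, smul_eq_mul, Complex.I_mul_I, neg_mul] <;>
      ring
  rw [oneOneForm_eq_sum, (sum_pow_of_sq_zero _ hsq fun i j => commute_ι_mul_ι _ _ _ _).1, hprod,
    ← nsmul_eq_mul, map_nsmul, nsmul_eq_mul, topFunctional,
    ExteriorAlgebra.liftAlternating_apply_ιMulti, Pi.single_eq_same]
  congr 1
  change Matrix.det (Matrix.of fun p q => interleaveEval n (interleave H p) q) = _
  rw [← Matrix.det_submatrix_equiv_self ((sumEquivProdTwo n).trans finProdFinEquiv), hdet,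
    Matrix.det_fromBlocks_zero₂₁, Matrix.det_smul]
  simp

/-- The complex Hessian equation in terms of mixed discriminants. -/
lemma mixedDet_of_oneOneForm {G W : Matrix (Fin n) (Fin n) ℂ} {c : ℂ} {k : ℕ} (hk : k ≤ n)
    (h : oneOneForm G ^ k * oneOneForm W ^ (n - k) = c • oneOneForm W ^ n) :
    mixedDet k G W = (n.choose k : ℂ) * c * W.det := by
  -- compare the coefficients of `t ^ m` in the top power of `t • G + W`
  have h1 : ∀ t : ℂ, ∑ m ∈ Finset.range (n + 1), t ^ m *
      (n.factorial * (Complex.I ^ n * mixedDet m G W)) = ∑ m ∈ Finset.range (n + 1), t ^ m *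
        ((n.choose m : ℂ) * topFunctional n (oneOneForm G ^ m * oneOneForm W ^ (n - m))) := by
    intro t
    have h2 := topFunctional_pow (t • G + W)
    rw [det_smul_add_eq_sum, Fintype.card_fin, oneOneForm_smul_add,
      ((commute_oneOneForm G W).smul_left t).add_pow, map_sum] at h2
    rw [Finset.mul_sum, Finset.mul_sum] at h2
    refine (Finset.sum_congr rfl fun m _ => ?_).trans (h2.symm.trans
      (Finset.sum_congr rfl fun m _ => ?_))
    · ring
    · rw [smul_pow, smul_mul_assoc, ← Nat.cast_commute, ← nsmul_eq_mul, map_nsmul, nsmul_eq_mul,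
        map_smul, smul_eq_mul]
      ring
  have h3 := eq_of_sum_pow_eq h1 (Nat.lt_succ_of_le hk)
  rw [h, map_smul, topFunctional_pow, smul_eq_mul] at h3
  have h4 : (n.factorial : ℂ) * Complex.I ^ n ≠ 0 :=
    mul_ne_zero (by exact_mod_cast n.factorial_ne_zero) (pow_ne_zero _ Complex.I_ne_zero)
  refine mul_left_cancel₀ h4 ?_
  linear_combination h3

end Exterior

/-! ### Differentiating Hermitian forms along affine vector fields -/

section Quad

open Filter Topology

variable {n : ℕ} {x₀ v : Cn n} {ι : Type*}

section

variable [Fintype ι]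

lemma wirt_quad {c : ℂ} {A B : ι → Cn n → ℂ} {H : Cn n → Matrix ι ι ℂ}
    (hA : ∀ a, ContDiffAt ℝ 2 (A a) x₀) (hB : ∀ a, ContDiffAt ℝ 2 (B a) x₀)
    (hH : ∀ a b, ContDiffAt ℝ 2 (fun y => H y a b) x₀) :
    wirt c v (fun y => ∑ a, ∑ b, A a y * B b y * H y a b) x₀ =
      ∑ a, ∑ b, (A a x₀ * B b x₀ * wirt c v (fun y => H y a b) x₀ +
        (wirt c v (A a) x₀ * B b x₀ + A a x₀ * wirt c v (B b) x₀) * H x₀ a b) := by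
  have dA := fun a => (hA a).differentiableAt (by norm_num)
  have dB := fun a => (hB a).differentiableAt (by norm_num)
  have dH := fun a b => (hH a b).differentiableAt (by norm_num)
  have d1 := fun a b => ((dA a).fun_mul (dB b)).fun_mul (dH a b)
  rw [wirt_sum _ fun a _ => DifferentiableAt.fun_sum fun b _ => d1 a b]
  refine Finset.sum_congr rfl fun a _ => ?_
  rw [wirt_sum _ fun b _ => d1 a b]
  refine Finset.sum_congr rfl fun b _ => ?_
  rw [wirt_mul ((dA a).fun_mul (dB b)) (dH a b), wirt_mul (dA a) (dB b)]
  ring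

lemma lap_quad {A B : ι → Cn n → ℂ} {H : Cn n → Matrix ι ι ℂ}
    (hA : ∀ a, ContDiffAt ℝ 2 (A a) x₀) (hB : ∀ a, ContDiffAt ℝ 2 (B a) x₀)
    (hH : ∀ a b, ContDiffAt ℝ 2 (fun y => H y a b) x₀) :
    lap v (fun y => ∑ a, ∑ b, A a y * B b y * H y a b) x₀ =
      ∑ a, ∑ b, (A a x₀ * B b x₀ * lap v (fun y => H y a b) x₀ +
        (lap v (A a) x₀ * B b x₀ + A a x₀ * lap v (B b) x₀ + ∂[v] (A a) x₀ * ∂̄[v] (B b) x₀ +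
          ∂̄[v] (A a) x₀ * ∂[v] (B b) x₀) * H x₀ a b +
        (∂[v] (A a) x₀ * B b x₀ + A a x₀ * ∂[v] (B b) x₀) * ∂̄[v] (fun y => H y a b) x₀ +
        (∂̄[v] (A a) x₀ * B b x₀ + A a x₀ * ∂̄[v] (B b) x₀) * ∂[v] (fun y => H y a b) x₀) := by
  have dA := fun a => (hA a).differentiableAt (by norm_num)
  have dB := fun a => (hB a).differentiableAt (by norm_num)
  have d1 := fun a b => ((hA a).mul (hB b)).mul (hH a b)
  rw [lap_sum _ fun a _ => ContDiffAt.sum fun b _ => d1 a b]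
  refine Finset.sum_congr rfl fun a _ => ?_
  rw [lap_sum _ fun b _ => d1 a b]
  refine Finset.sum_congr rfl fun b _ => ?_
  rw [lap_mul ((hA a).mul (hB b)) (hH a b), lap_mul (hA a) (hB b), wirt_mul (dA a) (dB b),
    wirt_mul (dA a) (dB b)]
  ring

end

/-- The real-affine function `d + s ℓ(x - x₀) + t conj (ℓ (x - x₀))`. -/
def affineFn (ℓ : Cn n →L[ℂ] ℂ) (x₀ : Cn n) (d s t : ℂ) (x : Cn n) : ℂ :=
  d + s * ℓ (x - x₀) + t * (starRingEnd ℂ) (ℓ (x - x₀))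

variable {ℓ : Cn n →L[ℂ] ℂ} {d s t d' s' t' : ℂ}

lemma affineFn_self : affineFn ℓ x₀ d s t x₀ = d := by simp [affineFn]

lemma conj_affineFn (x : Cn n) : (starRingEnd ℂ) (affineFn ℓ x₀ d s t x) =
    affineFn ℓ x₀ ((starRingEnd ℂ) d) ((starRingEnd ℂ) t) ((starRingEnd ℂ) s) x := by
  simp [affineFn]; ring

lemma contDiffAt_affineFn {k : ℕ∞ω} {x : Cn n} : ContDiffAt ℝ k (affineFn ℓ x₀ d s t) x := by
  have h1 : ContDiffAt ℝ k (fun x => ℓ (x - x₀)) x :=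
    (ℓ.restrictScalars ℝ).contDiff.contDiffAt.comp x (contDiffAt_id.sub contDiffAt_const)
  exact (contDiffAt_const.add (contDiffAt_const.mul h1)).add
    (contDiffAt_const.mul (contDiffAt_conj h1))

lemma wirt_affineFn (hℓ : ℓ v = 1) (c : ℂ) : wirt c v (affineFn ℓ x₀ d s t) = fun _ =>
    1 / 2 * (1 + c * Complex.I) * s + 1 / 2 * (1 - c * Complex.I) * t := by
  funext x
  have h1 : HasFDerivAt (fun x => ℓ (x - x₀)) (ℓ.restrictScalars ℝ) x := by
    have := (ℓ.restrictScalars ℝ).hasFDerivAt.comp x ((hasFDerivAt_id (𝕜 := ℝ) x).sub_const x₀)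
    rwa [ContinuousLinearMap.comp_id] at this
  have h2 : HasFDerivAt (fun x => (starRingEnd ℂ) (ℓ (x - x₀)))
      (Complex.conjCLE.toContinuousLinearMap.comp (ℓ.restrictScalars ℝ)) x :=
    Complex.conjCLE.toContinuousLinearMap.hasFDerivAt.comp x h1
  have h3 := ((h1.const_mul s).const_add d).add (h2.const_mul t)
  have h4 : fderiv ℝ (affineFn ℓ x₀ d s t) x = _ := h3.fderiv
  simp only [wirt, h4]
  simp [hℓ]
  ring

lemma del_affineFn (hℓ : ℓ v = 1) : ∂[v] (affineFn ℓ x₀ d s t) = fun _ => s := by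
  rw [wirt_affineFn hℓ]; funext; linear_combination (t - s) / 2 * Complex.I_sq

lemma delBar_affineFn (hℓ : ℓ v = 1) : ∂̄[v] (affineFn ℓ x₀ d s t) = fun _ => t := by
  rw [wirt_affineFn hℓ]; funext; linear_combination (s - t) / 2 * Complex.I_sq

lemma lap_affineFn (hℓ : ℓ v = 1) (x : Cn n) : lap v (affineFn ℓ x₀ d s t) x = 0 := by
  rw [lap, del_affineFn hℓ]; simp

section

variable [Fintype ι]

lemma del_quad_affineFn (hℓ : ℓ v = 1) {H : Cn n → Matrix ι ι ℂ}
    (hH : ∀ a b, ContDiffAt ℝ 2 (fun y => H y a b) x₀) {d s t d' s' t' : ι → ℂ} :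
    ∂[v] (fun y => ∑ a, ∑ b, affineFn ℓ x₀ (d a) (s a) (t a) y *
      affineFn ℓ x₀ (d' b) (s' b) (t' b) y * H y a b) x₀ =
      ∑ a, ∑ b, (d a * d' b * ∂[v] (fun y => H y a b) x₀ +
        (s a * d' b + d a * s' b) * H x₀ a b) := by
  rw [wirt_quad (fun _ => contDiffAt_affineFn) (fun _ => contDiffAt_affineFn) hH]
  simp only [affineFn_self, del_affineFn hℓ]

lemma delBar_quad_affineFn (hℓ : ℓ v = 1) {H : Cn n → Matrix ι ι ℂ}
    (hH : ∀ a b, ContDiffAt ℝ 2 (fun y => H y a b) x₀) {d s t d' s' t' : ι → ℂ} :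
    ∂̄[v] (fun y => ∑ a, ∑ b, affineFn ℓ x₀ (d a) (s a) (t a) y *
      affineFn ℓ x₀ (d' b) (s' b) (t' b) y * H y a b) x₀ =
      ∑ a, ∑ b, (d a * d' b * ∂̄[v] (fun y => H y a b) x₀ +
        (t a * d' b + d a * t' b) * H x₀ a b) := by
  rw [wirt_quad (fun _ => contDiffAt_affineFn) (fun _ => contDiffAt_affineFn) hH]
  simp only [affineFn_self, delBar_affineFn hℓ]

lemma lap_quad_affineFn (hℓ : ℓ v = 1) {H : Cn n → Matrix ι ι ℂ}
    (hH : ∀ a b, ContDiffAt ℝ 2 (fun y => H y a b) x₀) {d s t d' s' t' : ι → ℂ} :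
    lap v (fun y => ∑ a, ∑ b, affineFn ℓ x₀ (d a) (s a) (t a) y *
      affineFn ℓ x₀ (d' b) (s' b) (t' b) y * H y a b) x₀ =
      ∑ a, ∑ b, (d a * d' b * lap v (fun y => H y a b) x₀ +
        (s a * t' b + t a * s' b) * H x₀ a b +
        (s a * d' b + d a * s' b) * ∂̄[v] (fun y => H y a b) x₀ +
        (t a * d' b + d a * t' b) * ∂[v] (fun y => H y a b) x₀) := by
  rw [lap_quad (fun _ => contDiffAt_affineFn) (fun _ => contDiffAt_affineFn) hH]
  simp only [affineFn_self, delBar_affineFn hℓ, del_affineFn hℓ, lap_affineFn hℓ]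
  refine Finset.sum_congr rfl fun a _ => Finset.sum_congr rfl fun b _ => ?_
  ring

end

/-- For an entrywise differentiable Hermitian matrix function, `∂̄ H_{ba}` is the conjugate of
`∂ H_{ab}`. -/
lemma delBar_eq_conj_of_isHermitian {H : Cn n → Matrix ι ι ℂ}
    (hH : ∀ a b, ContDiffAt ℝ 2 (fun y => H y a b) x₀) (hherm : ∀ᶠ x in 𝓝 x₀, (H x).IsHermitian)
    (a b : ι) : ∂̄[v] (fun y => H y a b) x₀ = (starRingEnd ℂ) (∂[v] (fun y => H y b a) x₀) := by
  rw [← delBar_conj ((hH b a).differentiableAt (by norm_num))]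
  refine wirt_congr_at ?_
  filter_upwards [hherm] with y hy
  exact (hy.apply a b).symm

lemma lap_conj_of_isHermitian {H : Cn n → Matrix ι ι ℂ}
    (hH : ∀ a b, ContDiffAt ℝ 2 (fun y => H y a b) x₀) (hherm : ∀ᶠ x in 𝓝 x₀, (H x).IsHermitian)
    (a : ι) : (((lap v (fun y => H y a a) x₀).re : ℝ) : ℂ) = lap v (fun y => H y a a) x₀ := by
  refine Complex.conj_eq_iff_re.1 ?_
  rw [← lap_conj (hH a a)]
  refine lap_congr_at ?_
  filter_upwards [hherm] with y hy
  exact hy.apply a a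

lemma quad_im_eq_zero [Fintype ι] {H : Matrix ι ι ℂ} (hH : H.IsHermitian) (y : ι → ℂ) :
    ((∑ a, ∑ b, y a * (starRingEnd ℂ) (y b) * H a b).re : ℂ) =
      ∑ a, ∑ b, y a * (starRingEnd ℂ) (y b) * H a b := by
  refine Complex.conj_eq_iff_re.1 ?_
  simp only [map_sum, map_mul, Complex.conj_conj]
  rw [Finset.sum_comm]
  refine Finset.sum_congr rfl fun a _ => Finset.sum_congr rfl fun b _ => ?_
  rw [show (starRingEnd ℂ) (H b a) = H a b from hH.apply a b]
  ring

lemma wirt_cexp {c : ℂ} {h : Cn n → ℂ} (hh : DifferentiableAt ℝ h x₀) :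
    wirt c v (fun y => Complex.exp (h y)) x₀ = Complex.exp (h x₀) * wirt c v h x₀ := by
  simp only [wirt, (hh.hasFDerivAt.cexp).fderiv, smul_apply, smul_eq_mul]
  ring

lemma lap_cexp {h : Cn n → ℂ} (hh : ContDiffAt ℝ 2 h x₀) :
    lap v (fun y => Complex.exp (h y)) x₀ =
      Complex.exp (h x₀) * (lap v h x₀ + ∂[v] h x₀ * ∂̄[v] h x₀) := by
  have h1 : ∂[v] (fun y => Complex.exp (h y)) =ᶠ[𝓝 x₀] fun y => Complex.exp (h y) * ∂[v] h y := by
    filter_upwards [eventually_contDiffAt (k := 2) hh] with y hy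
    exact wirt_cexp (hy.differentiableAt (by norm_num))
  rw [lap, wirt_congr_at h1, wirt_mul (hh.cexp.differentiableAt (by norm_num))
    ((contDiffAt_wirt hh (m := 1) (by norm_num) _ _).differentiableAt (by norm_num)),
    wirt_cexp (hh.differentiableAt (by norm_num)), lap]
  ring

end Quad

/-! ### The maximum principle for the largest eigenvalue -/

section MaxPrinciple

open Filter Topology

variable {n : ℕ} {x₀ v : Cn n} {ι : Type*} [Fintype ι] [DecidableEq ι] {ℓ : Cn n →L[ℂ] ℂ}
  {G Ω : Cn n → Matrix ι ι ℂ} {lam : ι → ℝ} {m : ι} {κ : Cn n → ℝ}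

lemma sum_sum_single (c : ι → ι → ℂ) : ∑ a, ∑ b, (Pi.single m (1 : ℂ) : ι → ℂ) a *
    (Pi.single m (1 : ℂ) : ι → ℂ) b * c a b = c m m := by
  simp [Pi.single_apply]

/-- The first and second order conditions at a point where the largest eigenvalue of `G` with
respect to `Ω`, multiplied by `exp κ`, has a local maximum. -/
lemma max_principle (hG : ∀ a b, ContDiffAt ℝ 2 (fun y => G y a b) x₀)
    (hΩ : ∀ a b, ContDiffAt ℝ 2 (fun y => Ω y a b) x₀)
    (hGh : ∀ᶠ x in 𝓝 x₀, (G x).IsHermitian) (hΩh : ∀ᶠ x in 𝓝 x₀, (Ω x).IsHermitian)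
    (hG0 : G x₀ = Matrix.diagonal fun a => (lam a : ℂ)) (hΩ0 : Ω x₀ = 1)
    (hlam : ∀ b, 0 ≤ lam b) (hm : 0 < lam m) (hκ : ContDiffAt ℝ 2 κ x₀) (hℓ : ℓ v = 1)
    (hmax : ∀ᶠ x in 𝓝 x₀, ∀ y : ι → ℂ,
      (∑ a, ∑ b, y a * (starRingEnd ℂ) (y b) * G x a b).re * Real.exp (κ x) ≤
        lam m * Real.exp (κ x₀) * (∑ a, ∑ b, y a * (starRingEnd ℂ) (y b) * Ω x a b).re) :
    ∂[v] (fun y => G y m m) x₀ - lam m * ∂[v] (fun y => Ω y m m) x₀ =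
      -(lam m * ∂[v] (fun y => (κ y : ℂ)) x₀) ∧
    (lap v (fun y => G y m m) x₀).re - lam m * (lap v (fun y => Ω y m m) x₀).re +
      (∑ b ∈ Finset.univ.erase m,
        (‖∂[v] (fun y => G y m b) x₀ - lam m * ∂[v] (fun y => Ω y m b) x₀‖ ^ 2 +
         ‖∂[v] (fun y => G y b m) x₀ - lam m * ∂[v] (fun y => Ω y b m) x₀‖ ^ 2)) / lam m +
      lam m * ((lap v (fun y => (κ y : ℂ)) x₀).re - ‖∂[v] (fun y => (κ y : ℂ)) x₀‖ ^ 2 +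
        2 * (∂[v] (fun y => Ω y m m) x₀ *
          (starRingEnd ℂ) (∂[v] (fun y => (κ y : ℂ)) x₀)).re) ≤ 0 := by
  set r : ι → ℂ := fun b => ∂[v] (fun y => G y m b) x₀ - lam m * ∂[v] (fun y => Ω y m b) x₀
    with hr
  set r' : ι → ℂ := fun b => ∂[v] (fun y => G y b m) x₀ - lam m * ∂[v] (fun y => Ω y b m) x₀
    with hr'
  set dκ := ∂[v] (fun y => (κ y : ℂ)) x₀ with hdκ
  set d : ι → ℂ := Pi.single m 1 with hd
  -- the variation of the eigenvector which makes the second order condition sharp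
  set s : ι → ℂ := fun b => if b = m then 0 else r b / lam m with hs
  set t : ι → ℂ := fun b => if b = m then 0 else (starRingEnd ℂ) (r' b) / lam m with ht
  set y : Cn n → ι → ℂ := fun x b => affineFn ℓ x₀ (d b) (s b) (t b) x with hy
  have hyc : ∀ x b, (starRingEnd ℂ) (y x b) = affineFn ℓ x₀ (d b) ((starRingEnd ℂ) (t b))
      ((starRingEnd ℂ) (s b)) x := fun x b => by
    rw [hy, conj_affineFn]
    congr 1
    by_cases hb : b = m <;> simp [hd, hb]
  set q : (Cn n → Matrix ι ι ℂ) → Cn n → ℂ := fun H x =>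
    ∑ a, ∑ b, y x a * (starRingEnd ℂ) (y x b) * H x a b with hq
  have hq' : ∀ H, q H = fun x => ∑ a, ∑ b, affineFn ℓ x₀ (d a) (s a) (t a) x *
      affineFn ℓ x₀ (d b) ((starRingEnd ℂ) (t b)) ((starRingEnd ℂ) (s b)) x * H x a b := by
    intro H
    funext x
    simp only [hq, hyc]
    rfl
  have hqC : ∀ H : Cn n → Matrix ι ι ℂ, (∀ a b, ContDiffAt ℝ 2 (fun y => H y a b) x₀) →
      ContDiffAt ℝ 2 (q H) x₀ := fun H hH => by
    rw [hq']
    exact ContDiffAt.sum fun a _ => ContDiffAt.sum fun b _ =>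
      (contDiffAt_affineFn.mul contDiffAt_affineFn).mul (hH a b)
  have hq0 : ∀ H : Cn n → Matrix ι ι ℂ, q H x₀ = H x₀ m m := fun H => by
    rw [hq']
    simp only [affineFn_self]
    exact sum_sum_single (H x₀)
  set E : Cn n → ℂ := fun x => Complex.exp ((κ x₀ : ℂ) - (κ x : ℂ)) with hE
  have hκc : ContDiffAt ℝ 2 (fun x => (κ x : ℂ)) x₀ := contDiffAt_ofReal hκ
  have hκs : ContDiffAt ℝ 2 (fun x => (κ x₀ : ℂ) - (κ x : ℂ)) x₀ := contDiffAt_const.sub hκc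
  have hEC : ContDiffAt ℝ 2 E x₀ := hκs.cexp
  have hE0 : E x₀ = 1 := by simp [hE]
  set Zc : Cn n → ℂ := fun x => lam m * (E x * q Ω x) - q G x with hZc
  have hZC : ContDiffAt ℝ 2 Zc x₀ :=
    (contDiffAt_const.mul (hEC.mul (hqC Ω hΩ))).sub (hqC G hG)
  -- `Z` is nonnegative near `x₀` and vanishes at `x₀`; its first and second order conditions are the
  -- assertions
  set Z : Cn n → ℝ := fun x => (Zc x).re with hZ
  have hZCr : ContDiffAt ℝ 2 Z x₀ := Complex.reCLM.contDiff.contDiffAt.comp x₀ hZC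
  have hZeq : (fun x => (Z x : ℂ)) =ᶠ[𝓝 x₀] Zc := by
    filter_upwards [hGh, hΩh] with x h1 h2
    refine Complex.conj_eq_iff_re.1 ?_
    have e1 := quad_im_eq_zero h1 (y x)
    have e2 := quad_im_eq_zero h2 (y x)
    simp only [hZc, hq, hE]
    rw [← e1, ← e2, ← Complex.ofReal_sub, ← Complex.ofReal_exp]
    simp only [map_sub, map_mul, Complex.conj_ofReal]
  have hZx₀ : Z x₀ = 0 := by
    simp [hZ, hZc, hE0, hq0, hG0, hΩ0]
  have hmin : IsLocalMin Z x₀ := by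
    filter_upwards [hmax, hΩh] with x hx h2
    rw [hZx₀]
    have h3 := hx (y x)
    have e2 := quad_im_eq_zero h2 (y x)
    have h4 : Z x = lam m * (Real.exp (κ x₀ - κ x) * (q Ω x).re) - (q G x).re := by
      simp only [hZ, hZc, hE]
      rw [show q Ω x = ((q Ω x).re : ℂ) from e2.symm, ← Complex.ofReal_sub, ← Complex.ofReal_exp,
        Complex.sub_re, ← Complex.ofReal_mul, ← Complex.ofReal_mul, Complex.ofReal_re,
        Complex.ofReal_re]
    rw [h4, Real.exp_sub, sub_nonneg]
    rw [← le_div_iff₀ (Real.exp_pos _)] at h3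
    refine h3.trans (le_of_eq ?_)
    simp only [hq]
    ring
  -- the conditions of a minimum, for the complex-valued function `Zc`, which equals `Z` near `x₀`
  have hdZ : ∂[v] Zc x₀ = 0 := by
    rw [← wirt_congr_at hZeq]; exact wirt_eq_zero_of_isLocalMin hmin hZCr
  have hlZ : 0 ≤ (lap v Zc x₀).re := by
    rw [← lap_congr_at hZeq]; exact lap_re_nonneg_of_isLocalMin hmin hZCr
  have hdE : ∀ c, wirt c v E x₀ = -wirt c v (fun x => (κ x : ℂ)) x₀ := fun c => by
    rw [hE, wirt_cexp (hκs.differentiableAt (by norm_num)),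
      wirt_sub (by fun_prop) (hκc.differentiableAt (by norm_num))]
    simp
  have hbar : ∂̄[v] (fun y => (κ y : ℂ)) x₀ = (starRingEnd ℂ) dκ :=
    delBar_eq_conj_of_real (hκ.differentiableAt (by norm_num))
  -- derivatives of the exponential factor
  have hlE : lap v E x₀ = ‖dκ‖ ^ 2 - lap v (fun x => (κ x : ℂ)) x₀ := by
    rw [hE, lap_cexp hκs, wirt_sub (by fun_prop) (hκc.differentiableAt (by norm_num)),
      wirt_sub (by fun_prop) (hκc.differentiableAt (by norm_num)), lap_sub contDiffAt_const hκc,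
      hbar, ← hdκ, ← Complex.mul_conj']
    simp [lap]
    ring
  have hs0 : s m = 0 := by simp [hs]
  have ht0 : t m = 0 := by simp [ht]
  have hsd : ∀ a, s a * d a = 0 := fun a => by
    by_cases ha : a = m
    · subst ha; simp [hs0]
    · simp [hd, ha]
  have htd : ∀ a, t a * d a = 0 := fun a => by
    by_cases ha : a = m
    · subst ha; simp [ht0]
    · simp [hd, ha]
  have hsd' : ∀ a, d a * (starRingEnd ℂ) (s a) = 0 := fun a => by
    by_cases ha : a = m
    · subst ha; simp [hs0]
    · simp [hd, ha]
  have htd' : ∀ a, d a * (starRingEnd ℂ) (t a) = 0 := fun a => by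
    by_cases ha : a = m
    · subst ha; simp [ht0]
    · simp [hd, ha]
  have hsum : ∀ c : ι → ι → ℂ, ∑ a, ∑ b, d a * d b * c a b = c m m := sum_sum_single
  have hdiag : ∀ (h : ι → ℝ) (c : ι → ι → ℂ),
      ∑ a, ∑ b, c a b * Matrix.diagonal (fun a => (h a : ℂ)) a b = ∑ a, c a a * h a :=
    fun h c => Finset.sum_congr rfl fun a _ => by
      rw [Finset.sum_eq_single a]
      · simp
      · intro b _ hb; simp [hb.symm]
      · simp
  -- derivatives of the quadratic forms along the varying vector `y`; the first derivative does not
  -- see the variation, since `H x₀` is diagonal and `s m = t m = 0`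
  have hdq : ∀ (H : Cn n → Matrix ι ι ℂ) (h : ι → ℝ),
      (∀ a b, ContDiffAt ℝ 2 (fun y => H y a b) x₀) →
      (H x₀ = Matrix.diagonal fun a => (h a : ℂ)) → ∂[v] (q H) x₀ = ∂[v] (fun y => H y m m) x₀ ∧
        ∂̄[v] (q H) x₀ = ∂̄[v] (fun y => H y m m) x₀ := by
    intro H h hH hh
    rw [hq', del_quad_affineFn hℓ hH, delBar_quad_affineFn hℓ hH, hh]
    simp only [Finset.sum_add_distrib, hdiag, hsum, hsd, htd, hsd', htd']
    simp
  have hdm : ∀ c : ι → ℂ, ∑ b, d b * c b = c m := fun c => by simp [hd, Pi.single_apply]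
  have hlq : ∀ (H : Cn n → Matrix ι ι ℂ) (h : ι → ℝ),
      (∀ a b, ContDiffAt ℝ 2 (fun y => H y a b) x₀) → (∀ᶠ x in 𝓝 x₀, (H x).IsHermitian) →
      (H x₀ = Matrix.diagonal fun a => (h a : ℂ)) →
      (lap v (q H) x₀).re = (lap v (fun y => H y m m) x₀).re + ∑ a, ((‖s a‖ ^ 2 + ‖t a‖ ^ 2) * h a +
        2 * ((starRingEnd ℂ) (s a) * ∂[v] (fun y => H y m a) x₀).re +
        2 * (t a * ∂[v] (fun y => H y a m) x₀).re) := by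
    intro H h hH hherm hh
    rw [hq', lap_quad_affineFn hℓ hH, hh]
    have e1 : ∑ a, ∑ b, (s a * d b + d a * (starRingEnd ℂ) (t b)) * ∂̄[v] (fun y => H y a b) x₀ =
        ∑ a, (starRingEnd ℂ) ((starRingEnd ℂ) (s a) * ∂[v] (fun y => H y m a) x₀) +
        ∑ a, (starRingEnd ℂ) (t a * ∂[v] (fun y => H y a m) x₀) := by
      simp only [delBar_eq_conj_of_isHermitian hH hherm, add_mul, Finset.sum_add_distrib]
      congr 1
      · refine Finset.sum_congr rfl fun a _ => ?_
        simp only [mul_assoc]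
        rw [← Finset.mul_sum, hdm]
        simp
      · simp only [mul_assoc]
        simp only [← Finset.mul_sum]
        rw [hdm]
        simp
    have e2 : ∑ a, ∑ b, (t a * d b + d a * (starRingEnd ℂ) (s b)) * ∂[v] (fun y => H y a b) x₀ =
        ∑ a, (t a * ∂[v] (fun y => H y a m) x₀) +
        ∑ a, ((starRingEnd ℂ) (s a) * ∂[v] (fun y => H y m a) x₀) := by
      simp only [add_mul, Finset.sum_add_distrib]
      congr 1
      · refine Finset.sum_congr rfl fun a _ => ?_
        simp only [mul_assoc]
        rw [← Finset.mul_sum, hdm]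
      · simp only [mul_assoc]
        simp only [← Finset.mul_sum]
        rw [hdm]
    simp only [Finset.sum_add_distrib, hdiag, hsum]
    simp only [← Finset.sum_add_distrib]
    rw [e1, e2]
    simp only [Finset.sum_add_distrib, Complex.add_re, Complex.re_sum, Complex.conj_re,
      Complex.mul_conj', ← Complex.ofReal_pow, ← Complex.ofReal_add, Complex.re_mul_ofReal,
      Complex.ofReal_re, ← Finset.mul_sum]
    ring
  have herase : ∀ (H : Cn n → Matrix ι ι ℂ) (h : ι → ℝ),
      ∑ a, ((‖s a‖ ^ 2 + ‖t a‖ ^ 2) * h a +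
        2 * ((starRingEnd ℂ) (s a) * ∂[v] (fun y => H y m a) x₀).re +
        2 * (t a * ∂[v] (fun y => H y a m) x₀).re) =
      ∑ a ∈ Finset.univ.erase m, ((‖s a‖ ^ 2 + ‖t a‖ ^ 2) * h a +
        2 * ((starRingEnd ℂ) (s a) * ∂[v] (fun y => H y m a) x₀).re +
        2 * (t a * ∂[v] (fun y => H y a m) x₀).re) := fun H h => by
    rw [← Finset.add_sum_erase _ _ (Finset.mem_univ m), hs0, ht0]
    simp
  obtain ⟨hΩ1, hΩ2⟩ := hdq Ω (fun _ => 1) hΩ (by rw [hΩ0]; simp)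
  obtain ⟨hG1, hG2⟩ := hdq G lam hG hG0
  have hΩl := (hlq Ω (fun _ => 1) hΩ hΩh (by rw [hΩ0]; simp)).trans
    (congrArg _ (herase Ω _))
  have hGl := (hlq G lam hG hGh hG0).trans (congrArg _ (herase G lam))
  have dE := hEC.differentiableAt (by norm_num)
  have dΩ := (hqC Ω hΩ).differentiableAt (by norm_num)
  have dG := (hqC G hG).differentiableAt (by norm_num)
  constructor
  · rw [hZc, wirt_sub ((dE.fun_mul dΩ).const_mul _) dG, wirt_const_mul _ (dE.fun_mul dΩ),
      wirt_mul dE dΩ, hE0, hdE, hq0, hΩ0, hΩ1, hG1] at hdZ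
    simp only [Matrix.one_apply_eq] at hdZ
    linear_combination -hdZ
  · rw [hZc, lap_sub (contDiffAt_const.mul (hEC.mul (hqC Ω hΩ))) (hqC G hG),
      lap_const_mul _ (hEC.mul (hqC Ω hΩ)), lap_mul hEC (hqC Ω hΩ), hE0, hlE, hdE, hdE, hq0, hΩ0,
      hΩ1, hΩ2, hbar, delBar_eq_conj_of_isHermitian hΩ hΩh, Complex.sub_re, hGl,
      Complex.re_ofReal_mul] at hlZ
    simp only [Matrix.one_apply_eq, one_mul, mul_one, Complex.add_re, hΩl, Complex.sub_re,
      ← hdκ] at hlZ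
    -- `s b` and `t b` optimize the quadratic polynomial on the left when `lam b = 0`; the terms with
    -- `lam b ≥ 0` have the right sign
    have hterm : ∀ b ∈ Finset.univ.erase m,
        lam m * ((‖s b‖ ^ 2 + ‖t b‖ ^ 2) +
          2 * ((starRingEnd ℂ) (s b) * ∂[v] (fun y => Ω y m b) x₀).re +
          2 * (t b * ∂[v] (fun y => Ω y b m) x₀).re) -
        ((‖s b‖ ^ 2 + ‖t b‖ ^ 2) * lam b +
          2 * ((starRingEnd ℂ) (s b) * ∂[v] (fun y => G y m b) x₀).re +
          2 * (t b * ∂[v] (fun y => G y b m) x₀).re) ≤ -((‖r b‖ ^ 2 + ‖r' b‖ ^ 2) / lam m) := by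
      intro b hb
      have hbm := Finset.ne_of_mem_erase hb
      have h1 : s b = r b / lam m := by simp [hs, hbm]
      have h2 : t b = (starRingEnd ℂ) (r' b) / lam m := by simp [ht, hbm]
      have n1 : ‖s b‖ ^ 2 = ‖r b‖ ^ 2 / lam m ^ 2 := by
        rw [h1, norm_div, Complex.norm_real, Real.norm_of_nonneg hm.le, div_pow]
      have n2 : ‖t b‖ ^ 2 = ‖r' b‖ ^ 2 / lam m ^ 2 := by
        rw [h2, norm_div, Complex.norm_real, Real.norm_of_nonneg hm.le, div_pow, Complex.norm_conj]
      have e1 : ((starRingEnd ℂ) (s b) * ∂[v] (fun y => G y m b) x₀).re -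
          lam m * ((starRingEnd ℂ) (s b) * ∂[v] (fun y => Ω y m b) x₀).re = ‖r b‖ ^ 2 / lam m := by
        rw [← Complex.re_ofReal_mul, ← Complex.sub_re]
        have : (starRingEnd ℂ) (s b) * ∂[v] (fun y => G y m b) x₀ -
            lam m * ((starRingEnd ℂ) (s b) * ∂[v] (fun y => Ω y m b) x₀) =
            ((‖r b‖ ^ 2 / lam m : ℝ) : ℂ) := by
          rw [h1, map_div₀, Complex.conj_ofReal]
          push_cast
          rw [← Complex.conj_mul', hr]
          ring
        rw [this, Complex.ofReal_re]
      have e2 : (t b * ∂[v] (fun y => G y b m) x₀).re -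
          lam m * (t b * ∂[v] (fun y => Ω y b m) x₀).re = ‖r' b‖ ^ 2 / lam m := by
        rw [← Complex.re_ofReal_mul, ← Complex.sub_re]
        have : t b * ∂[v] (fun y => G y b m) x₀ - lam m * (t b * ∂[v] (fun y => Ω y b m) x₀) =
            ((‖r' b‖ ^ 2 / lam m : ℝ) : ℂ) := by
          rw [h2]
          push_cast
          rw [← Complex.conj_mul', hr']
          ring
        rw [this, Complex.ofReal_re]
      have e3 : lam m * (‖s b‖ ^ 2 + ‖t b‖ ^ 2) = (‖r b‖ ^ 2 + ‖r' b‖ ^ 2) / lam m := by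
        rw [n1, n2]; field_simp
      have e4 : 0 ≤ (‖s b‖ ^ 2 + ‖t b‖ ^ 2) * lam b :=
        mul_nonneg (by positivity) (hlam b)
      have e5 : (‖r b‖ ^ 2 + ‖r' b‖ ^ 2) / lam m = ‖r b‖ ^ 2 / lam m + ‖r' b‖ ^ 2 / lam m :=
        add_div _ _ _
      linarith
    have hsumle := Finset.sum_le_sum hterm
    rw [Finset.sum_neg_distrib, ← Finset.sum_div, Finset.sum_sub_distrib, ← Finset.mul_sum] at hsumle
    have e1 : (((‖dκ‖ : ℂ)) ^ 2).re = ‖dκ‖ ^ 2 := by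
      rw [← Complex.ofReal_pow, Complex.ofReal_re]
    have e2 : (-dκ * (starRingEnd ℂ) (∂[v] (fun y => Ω y m m) x₀)).re =
        -(∂[v] (fun y => Ω y m m) x₀ * (starRingEnd ℂ) dκ).re := by
      simp; ring
    have e3 : (-(starRingEnd ℂ) dκ * ∂[v] (fun y => Ω y m m) x₀).re =
        -(∂[v] (fun y => Ω y m m) x₀ * (starRingEnd ℂ) dκ).re := by
      simp; ring
    rw [e1, e2, e3] at hlZ
    linarith

end MaxPrinciple

/-! ### Differentiating the equation -/

section Equation

open Filter Topology

variable {n : ℕ} {x₀ v : Cn n} {ι : Type*} [Fintype ι] [DecidableEq ι] {ℓ : Cn n →L[ℂ] ℂ}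
  {G W : Cn n → Matrix ι ι ℂ} {lam : ι → ℝ} {ψ : Cn n → ℝ} {j : ℕ}

lemma wirt_eq_of_del_delBar (c : ℂ) (v : Cn n) (f : Cn n → ℂ) (x : Cn n) :
    wirt c v f x = 1 / 2 * (1 + c * Complex.I) * ∂[v] f x +
      1 / 2 * (1 - c * Complex.I) * ∂̄[v] f x := by
  simp only [wirt]
  linear_combination (1 / 2 : ℂ) * c * fderiv ℝ f x (Complex.I • v) * Complex.I_sq

/-- A holomorphic change of frame `1 - ℓ(x - x₀) Θ`. -/
def frameChange (ℓ : Cn n →L[ℂ] ℂ) (x₀ : Cn n) (Θ : Matrix ι ι ℂ) (x : Cn n) : Matrix ι ι ℂ :=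
  Matrix.of fun a c => affineFn ℓ x₀ ((1 : Matrix ι ι ℂ) a c) (-Θ a c) 0 x

omit [Fintype ι] in
lemma frameChange_self (Θ : Matrix ι ι ℂ) : frameChange ℓ x₀ Θ x₀ = 1 := by
  ext a b; simp [frameChange, affineFn_self]

lemma frameChange_mul_mul_apply (Θ H : Matrix ι ι ℂ) (a b : ι) (x : Cn n) :
    (frameChange ℓ x₀ Θ x * H * (frameChange ℓ x₀ Θ x)ᴴ) a b =
      ∑ c, ∑ d, affineFn ℓ x₀ ((1 : Matrix ι ι ℂ) a c) (-Θ a c) 0 x *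
        affineFn ℓ x₀ ((1 : Matrix ι ι ℂ) b d) 0 (-(starRingEnd ℂ) (Θ b d)) x * H c d := by
  simp only [Matrix.mul_apply, Finset.sum_mul, Matrix.conjTranspose_apply, frameChange,
    Matrix.of_apply]
  rw [Finset.sum_comm]
  refine Finset.sum_congr rfl fun c _ => Finset.sum_congr rfl fun d _ => ?_
  have : star (affineFn ℓ x₀ ((1 : Matrix ι ι ℂ) b d) (-Θ b d) 0 x) =
      affineFn ℓ x₀ ((1 : Matrix ι ι ℂ) b d) 0 (-(starRingEnd ℂ) (Θ b d)) x := by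
    rw [← starRingEnd_apply, conj_affineFn]
    have h1 : (starRingEnd ℂ) ((1 : Matrix ι ι ℂ) b d) = (1 : Matrix ι ι ℂ) b d := by
      rw [Matrix.one_apply]; split_ifs <;> simp
    rw [h1, map_zero, map_neg]
  rw [this]
  ring

lemma contDiffAt_frameChange_mul_mul {H : Cn n → Matrix ι ι ℂ} (Θ : Matrix ι ι ℂ)
    (hH : ∀ a b, ContDiffAt ℝ 2 (fun y => H y a b) x₀) (a b : ι) :
    ContDiffAt ℝ 2 (fun x => (frameChange ℓ x₀ Θ x * H x * (frameChange ℓ x₀ Θ x)ᴴ) a b) x₀ := by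
  simp only [frameChange_mul_mul_apply]
  exact ContDiffAt.sum fun c _ => ContDiffAt.sum fun d _ =>
    (contDiffAt_affineFn.mul contDiffAt_affineFn).mul (hH c d)

lemma sum_one_mul_diagonal (p q : ι → ℂ) (h : ι → ℝ) :
    ∑ c, ∑ d, p c * q d * Matrix.diagonal (fun a => (h a : ℂ)) c d = ∑ c, p c * q c * h c :=
  Finset.sum_congr rfl fun a _ => by
    rw [Finset.sum_eq_single a]
    · simp
    · intro b _ hb; simp [hb.symm]
    · simp

lemma del_frameChange_mul_mul (hℓ : ℓ v = 1) {H : Cn n → Matrix ι ι ℂ} (Θ : Matrix ι ι ℂ)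
    {h : ι → ℝ} (hH : ∀ a b, ContDiffAt ℝ 2 (fun y => H y a b) x₀)
    (hh : H x₀ = Matrix.diagonal fun a => (h a : ℂ)) (a b : ι) :
    ∂[v] (fun x => (frameChange ℓ x₀ Θ x * H x * (frameChange ℓ x₀ Θ x)ᴴ) a b) x₀ =
      ∂[v] (fun x => H x a b) x₀ - Θ a b * h b := by
  simp only [frameChange_mul_mul_apply]
  rw [del_quad_affineFn hℓ hH, hh]
  simp only [mul_zero, add_zero, Finset.sum_add_distrib, sum_one_mul_diagonal]
  simp [Matrix.one_apply, sub_eq_add_neg]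

lemma lap_frameChange_mul_mul (hℓ : ℓ v = 1) {H : Cn n → Matrix ι ι ℂ} (Θ : Matrix ι ι ℂ)
    {h : ι → ℝ} (hH : ∀ a b, ContDiffAt ℝ 2 (fun y => H y a b) x₀)
    (hherm : ∀ᶠ x in 𝓝 x₀, (H x).IsHermitian)
    (hh : H x₀ = Matrix.diagonal fun a => (h a : ℂ)) (a : ι) :
    lap v (fun x => (frameChange ℓ x₀ Θ x * H x * (frameChange ℓ x₀ Θ x)ᴴ) a a) x₀ =
      (((lap v (fun x => H x a a) x₀).re -
        2 * (∑ c, (starRingEnd ℂ) (Θ a c) * ∂[v] (fun x => H x a c) x₀).re +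
        ∑ c, ‖Θ a c‖ ^ 2 * h c : ℝ) : ℂ) := by
  simp only [frameChange_mul_mul_apply]
  rw [lap_quad_affineFn hℓ hH, hh]
  simp only [mul_zero, zero_mul, add_zero, zero_add, Finset.sum_add_distrib, sum_one_mul_diagonal]
  have e1 : ∀ c : ι → ι → ℂ, ∑ d, ∑ e, (1 : Matrix ι ι ℂ) a d * (1 : Matrix ι ι ℂ) a e * c d e =
      c a a := fun c => by simp [Matrix.one_apply]
  rw [e1]
  have e2 : ∑ d, ∑ e, -Θ a d * (1 : Matrix ι ι ℂ) a e * ∂̄[v] (fun x => H x d e) x₀ =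
      -(starRingEnd ℂ) (∑ c, (starRingEnd ℂ) (Θ a c) * ∂[v] (fun x => H x a c) x₀) := by
    simp only [delBar_eq_conj_of_isHermitian hH hherm]
    simp [Matrix.one_apply]
  have e3 : ∑ d, ∑ e, (1 : Matrix ι ι ℂ) a d * -(starRingEnd ℂ) (Θ a e) *
      ∂[v] (fun x => H x d e) x₀ =
      -∑ c, (starRingEnd ℂ) (Θ a c) * ∂[v] (fun x => H x a c) x₀ := by
    simp [Matrix.one_apply]
  rw [e2, e3, ← lap_conj_of_isHermitian hH hherm]
  have e4 : ∀ z : ℂ, -(starRingEnd ℂ) z + -z = ((-(2 * z.re) : ℝ) : ℂ) := fun z => by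
    rw [← neg_add, add_comm, Complex.add_conj]; push_cast; ring
  rw [add_assoc, e4]
  push_cast
  have e5 : ∀ c, -Θ a c * -(starRingEnd ℂ) (Θ a c) * (h c : ℂ) = (‖Θ a c‖ : ℂ) ^ 2 * h c :=
    fun c => by rw [← Complex.mul_conj']; ring
  simp only [e5, Complex.ofReal_re]
  ring

/-- The first and second derivatives of the Hessian equation at a point where `W` is the identity
and `G` is diagonal. -/
lemma equation_deriv (hG : ∀ a b, ContDiffAt ℝ 2 (fun y => G y a b) x₀)
    (hW : ∀ a b, ContDiffAt ℝ 2 (fun y => W y a b) x₀)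
    (hGh : ∀ᶠ x in 𝓝 x₀, (G x).IsHermitian) (hWh : ∀ᶠ x in 𝓝 x₀, (W x).IsHermitian)
    (hG0 : G x₀ = Matrix.diagonal fun a => (lam a : ℂ)) (hW0 : W x₀ = 1)
    (hψ : ContDiffAt ℝ 2 ψ x₀) (hℓ : ℓ v = 1) (hj : j + 2 ≤ Fintype.card ι)
    (heq : ∀ᶠ x in 𝓝 x₀, mixedDet (j + 2) (G x) (W x) = (ψ x : ℂ) * (W x).det) :
    ∑ a, (elemSymm (j + 1) (Finset.univ.erase a) lam : ℂ) *
        (∂[v] (fun x => G x a a) x₀ - ∂[v] (fun x => W x a a) x₀ * lam a) =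
      ∂[v] (fun x => (ψ x : ℂ)) x₀ ∧
    ∑ a, elemSymm (j + 1) (Finset.univ.erase a) lam * ((lap v (fun x => G x a a) x₀).re -
        2 * (∑ c, (starRingEnd ℂ) (∂[v] (fun x => W x a c) x₀) * ∂[v] (fun x => G x a c) x₀).re +
        ∑ c, ‖∂[v] (fun x => W x a c) x₀‖ ^ 2 * lam c) +
      ∑ a, ∑ b ∈ Finset.univ.erase a, elemSymm j ((Finset.univ.erase a).erase b) lam *
        (((∂[v] (fun x => G x a a) x₀ - ∂[v] (fun x => W x a a) x₀ * lam a) *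
          (starRingEnd ℂ) (∂[v] (fun x => G x b b) x₀ - ∂[v] (fun x => W x b b) x₀ * lam b)).re -
        ‖∂[v] (fun x => G x a b) x₀ - ∂[v] (fun x => W x a b) x₀ * lam b‖ ^ 2) -
      ∑ a, elemSymm (j + 1) (Finset.univ.erase a) lam * lam a *
        ((lap v (fun x => W x a a) x₀).re - ∑ c, ‖∂[v] (fun x => W x a c) x₀‖ ^ 2) =
      (lap v (fun x => (ψ x : ℂ)) x₀).re := by
  -- the holomorphic frame in which the metric `Ω` is the identity to first order; there the
  -- derivatives of `mixedDet` at a pair (diagonal, identity) apply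
  set Θ : Matrix ι ι ℂ := Matrix.of fun a c => ∂[v] (fun x => W x a c) x₀ with hΘ
  set A := frameChange ℓ x₀ Θ with hA
  set G' : Cn n → Matrix ι ι ℂ := fun x => A x * G x * (A x)ᴴ with hG'
  set Ω : Cn n → Matrix ι ι ℂ := fun x => A x * W x * (A x)ᴴ with hΩ
  have hW0' : W x₀ = Matrix.diagonal fun a => (((fun _ => 1 : ι → ℝ) a : ℝ) : ℂ) := by
    rw [hW0]; simp
  have G'C : ∀ a b, ContDiffAt ℝ 2 (fun x => G' x a b) x₀ := contDiffAt_frameChange_mul_mul Θ hG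
  have ΩC : ∀ a b, ContDiffAt ℝ 2 (fun x => Ω x a b) x₀ := contDiffAt_frameChange_mul_mul Θ hW
  have G'0 : G' x₀ = Matrix.diagonal fun a => (lam a : ℂ) := by
    simp [hG', hA, frameChange_self, hG0]
  have Ω0 : Ω x₀ = 1 := by simp [hΩ, hA, frameChange_self, hW0]
  have G'h : ∀ᶠ x in 𝓝 x₀, (G' x).IsHermitian := by
    filter_upwards [hGh] with x hx using Matrix.isHermitian_mul_mul_conjTranspose _ hx
  have Ωh : ∀ᶠ x in 𝓝 x₀, (Ω x).IsHermitian := by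
    filter_upwards [hWh] with x hx using Matrix.isHermitian_mul_mul_conjTranspose _ hx
  have dΩ : ∀ a b, ∂[v] (fun x => Ω x a b) x₀ = 0 := fun a b => by
    rw [del_frameChange_mul_mul hℓ Θ hW hW0']; simp [hΘ]
  have dΩ' : ∀ c a b, wirt c v (fun x => Ω x a b) x₀ = 0 := fun c a b => by
    rw [wirt_eq_of_del_delBar, dΩ, delBar_eq_conj_of_isHermitian ΩC Ωh, dΩ]; simp
  have dG' : ∀ a b, ∂[v] (fun x => G' x a b) x₀ = ∂[v] (fun x => G x a b) x₀ - Θ a b * lam b :=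
    del_frameChange_mul_mul hℓ Θ hG hG0
  have heq' : (fun x => mixedDet (j + 2) (G' x) (Ω x)) =ᶠ[𝓝 x₀] fun x => (ψ x : ℂ) * (Ω x).det := by
    filter_upwards [heq] with x hx
    rw [hG', hΩ, mixedDet_mul_mul _ _ _ _ hj, hx, Matrix.det_mul, Matrix.det_mul]
    ring
  have hψc : ContDiffAt ℝ 2 (fun x => (ψ x : ℂ)) x₀ := contDiffAt_ofReal hψ
  have hdetC : ContDiffAt ℝ 2 (fun x => (Ω x).det) x₀ := by
    simp only [det_eq_sum_rows]
    exact ContDiffAt.sum fun σ _ => contDiffAt_const.mul (contDiffAt_prod fun a _ => ΩC a (σ a))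
  have hσ : (ψ x₀ : ℂ) = elemSymm (j + 2) Finset.univ lam := by
    have := heq.self_of_nhds
    rw [hG0, hW0, mixedDet_diagonal_one] at this
    simpa using this.symm
  constructor
  · have h1 := wirt_congr_at (c := -Complex.I) (v := v) heq'
    rw [wirt_mixedDet G'C ΩC G'0 Ω0 (dΩ' _), wirt_mul (hψc.differentiableAt (by norm_num))
      (hdetC.differentiableAt (by norm_num)), wirt_det_of_eq_one ΩC Ω0 (dΩ' _), Ω0] at h1
    simp only [dG'] at h1
    simpa [hΘ] using h1
  · have h1 := lap_congr_at (v := v) heq'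
    have hdet1 : ∀ c, wirt c v (fun x => (Ω x).det) x₀ = 0 := fun c =>
      wirt_det_of_eq_one ΩC Ω0 (dΩ' c)
    rw [lap_mixedDet G'C ΩC G'0 Ω0 dΩ', lap_mul hψc hdetC, hdet1, hdet1,
      lap_det_of_eq_one ΩC Ω0 dΩ', Ω0, hσ] at h1
    have lG : ∀ a, lap v (fun x => G' x a a) x₀ = _ :=
      lap_frameChange_mul_mul hℓ Θ hG hGh hG0
    have lΩ : ∀ a, lap v (fun x => Ω x a a) x₀ =
        (((lap v (fun x => W x a a) x₀).re - ∑ c, ‖Θ a c‖ ^ 2 : ℝ) : ℂ) := fun a => by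
      refine (lap_frameChange_mul_mul hℓ Θ hW hWh hW0' a).trans ?_
      congr 1
      have : (∑ c, (starRingEnd ℂ) (Θ a c) * ∂[v] (fun x => W x a c) x₀).re =
          ∑ c, ‖Θ a c‖ ^ 2 := by
        rw [Complex.re_sum]
        refine Finset.sum_congr rfl fun c _ => ?_
        rw [show ∂[v] (fun x => W x a c) x₀ = Θ a c from rfl, Complex.conj_mul',
          ← Complex.ofReal_pow, Complex.ofReal_re]
      rw [this]
      simp only [mul_one]
      ring
    have hD : ∀ a b, ∂[v] (fun x => G' x a a) x₀ * ∂̄[v] (fun x => G' x b b) x₀ -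
        ∂[v] (fun x => G' x a b) x₀ * ∂̄[v] (fun x => G' x b a) x₀ =
        ∂[v] (fun x => G' x a a) x₀ * (starRingEnd ℂ) (∂[v] (fun x => G' x b b) x₀) -
        ((‖∂[v] (fun x => G' x a b) x₀‖ ^ 2 : ℝ) : ℂ) := fun a b => by
      rw [delBar_eq_conj_of_isHermitian G'C G'h, delBar_eq_conj_of_isHermitian G'C G'h,
        Complex.mul_conj']
      push_cast
      rfl
    have h2 := congrArg Complex.re h1
    simp only [hD] at h2
    simp only [dG', lG, lΩ] at h2
    simp only [Complex.add_re, Complex.re_sum, Complex.re_ofReal_mul, Complex.sub_re,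
      Complex.ofReal_re, Matrix.det_one, mul_one, mul_zero, add_zero] at h2
    -- the second derivatives of the two determinants combine: `e_k(lam | a) = e_k - lam_a e_{k-1}(lam | a)`
    have h3 : ∀ y : ι → ℝ, ∑ a, elemSymm (j + 2) (Finset.univ.erase a) lam * y a =
        elemSymm (j + 2) Finset.univ lam * ∑ a, y a -
          ∑ a, elemSymm (j + 1) (Finset.univ.erase a) lam * lam a * y a := fun y => by
      rw [Finset.mul_sum, ← Finset.sum_sub_distrib]
      refine Finset.sum_congr rfl fun a _ => ?_
      rw [elemSymm_erase (j + 1) (Finset.mem_univ a)]; ring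
    rw [h3] at h2
    simp only [hΘ, Matrix.of_apply] at h2
    simp only [Complex.re_sum]
    linarith

end Equation

/-! ### The third order inequality at a maximum point -/

section ThirdOrder

open Filter Topology

variable {n : ℕ} {x₀ : Cn n} {ι : Type*} {v : ι → Cn n} {f : Cn n → ℂ}
  {X : Cn n → Matrix ι ι ℂ}

/-- The matrix of `X + √-1 ∂∂̄ f` with respect to the constant vector fields `v a`. -/
def addHess (v : ι → Cn n) (f : Cn n → ℂ) (X : Cn n → Matrix ι ι ℂ) (x : Cn n) : Matrix ι ι ℂ :=
  Matrix.of fun a b => X x a b + ∂̄[v b] (∂[v a] f) x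

lemma contDiffAt_addHess (hf : ContDiffAt ℝ 4 f x₀)
    (hX : ∀ a b, ContDiffAt ℝ 2 (fun y => X y a b) x₀) (a b : ι) :
    ContDiffAt ℝ 2 (fun y => addHess v f X y a b) x₀ :=
  (hX a b).add (contDiffAt_wirt (contDiffAt_wirt hf (m := 3) (by norm_num) _ _) (by norm_num) _ _)

/-- The derivatives of `X + √-1 ∂∂̄ f` commute up to derivatives of `X`. -/
lemma del_addHess_sub (hf : ContDiffAt ℝ 4 f x₀)
    (hX : ∀ a b, ContDiffAt ℝ 2 (fun y => X y a b) x₀) (a b c : ι) :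
    ∂[v c] (fun y => addHess v f X y a b) x₀ - ∂[v a] (fun y => addHess v f X y c b) x₀ =
      ∂[v c] (fun y => X y a b) x₀ - ∂[v a] (fun y => X y c b) x₀ := by
  have h1 : ∀ a b, DifferentiableAt ℝ (∂̄[v b] (∂[v a] f)) x₀ := fun a b =>
    (contDiffAt_wirt (contDiffAt_wirt hf (m := 3) (by norm_num) _ _) (m := 2) (by norm_num) _ _
      ).differentiableAt (by norm_num)
  have h2 : ∀ a b, DifferentiableAt ℝ (fun y => X y a b) x₀ := fun a b =>
    (hX a b).differentiableAt (by norm_num)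
  have h3 : ∀ a b c, ∂[v c] (fun y => addHess v f X y a b) x₀ =
      ∂[v c] (fun y => X y a b) x₀ + ∂[v c] (∂̄[v b] (∂[v a] f)) x₀ := fun a b c =>
    wirt_add (h2 a b) (h1 a b)
  rw [h3, h3, del_delBar_del_comm (hf.of_le (by norm_num))]
  ring

/-- The fourth derivatives of `f` commute, hence these second derivatives of `X + √-1 ∂∂̄ f` agree up
to derivatives of `X`. -/
lemma lap_addHess_sub (hf : ContDiffAt ℝ 4 f x₀)
    (hX : ∀ a b, ContDiffAt ℝ 2 (fun y => X y a b) x₀) (a c : ι) :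
    lap (v c) (fun y => addHess v f X y a a) x₀ - lap (v a) (fun y => addHess v f X y c c) x₀ =
      lap (v c) (fun y => X y a a) x₀ - lap (v a) (fun y => X y c c) x₀ := by
  have h1 : ∀ a, ContDiffAt ℝ 2 (lap (v a) f) x₀ := fun a =>
    contDiffAt_wirt (contDiffAt_wirt hf (m := 3) (by norm_num) _ _) (by norm_num) _ _
  have h3 : ∀ a c, lap (v c) (fun y => addHess v f X y a a) x₀ =
      lap (v c) (fun y => X y a a) x₀ + lap (v c) (lap (v a) f) x₀ := fun a c =>
    lap_add (hX a a) (h1 a)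
  rw [h3, h3, lap_lap_comm hf]
  ring

variable [Fintype ι] [DecidableEq ι] {W : Cn n → Matrix ι ι ℂ} {lam : ι → ℝ} {m : ι} {κ ψ : Cn n → ℝ}
  {ℓ : ι → Cn n →L[ℂ] ℂ} {j : ℕ}

/-- The maximum principle for the largest eigenvalue combined with the twice differentiated equation:
the terms with third derivatives of `f` disappear at the cost of `|∂κ|²`, with the small
factor `2 δ`. The bound `T * lam m` for the second derivatives of `X` allows `X` to depend on `f`. -/
lemma third_order_at_max (hf : ContDiffAt ℝ 4 f x₀)
    (hX : ∀ a b, ContDiffAt ℝ 2 (fun y => X y a b) x₀)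
    (hW : ∀ a b, ContDiffAt ℝ 2 (fun y => W y a b) x₀)
    (hGh : ∀ᶠ x in 𝓝 x₀, (addHess v f X x).IsHermitian)
    (hWh : ∀ᶠ x in 𝓝 x₀, (W x).IsHermitian)
    (hG0 : addHess v f X x₀ = Matrix.diagonal fun a => (lam a : ℂ)) (hW0 : W x₀ = 1)
    (hlam : ∀ b, 0 < lam b) (hlm : ∀ b, lam b ≤ lam m) (hm1 : 1 ≤ lam m)
    (hκ : ContDiffAt ℝ 2 κ x₀) (hℓ : ∀ i, ℓ i (v i) = 1)
    (hmax : ∀ᶠ x in 𝓝 x₀, ∀ y : ι → ℂ,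
      (∑ a, ∑ b, y a * (starRingEnd ℂ) (y b) * addHess v f X x a b).re * Real.exp (κ x) ≤
        lam m * Real.exp (κ x₀) * (∑ a, ∑ b, y a * (starRingEnd ℂ) (y b) * W x a b).re)
    (hψ : ContDiffAt ℝ 2 ψ x₀) (hj : j + 2 ≤ Fintype.card ι)
    (heq : ∀ᶠ x in 𝓝 x₀, mixedDet (j + 2) (addHess v f X x) (W x) = (ψ x : ℂ) * (W x).det)
    {T τ δ : ℝ} (hT : 1 ≤ T) (hdW : ∀ i a b, ‖∂[v i] (fun x => W x a b) x₀‖ ≤ T)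
    (hlW : ∀ i a, |(lap (v i) (fun x => W x a a) x₀).re| ≤ T)
    (hdX : ∀ i a b, ‖∂[v i] (fun x => X x a b) x₀‖ ≤ T)
    (hlX : ∀ i a, ‖lap (v i) (fun x => X x a a) x₀‖ ≤ T * lam m)
    (hτ : 0 ≤ τ) (hσ : elemSymm (j + 2) Finset.univ lam ≤ τ ^ (j + 1) * lam m)
    (hδ0 : 0 < δ) (hδ1 : δ ≤ 1) (hδ : (1 + 8 * Fintype.card ι) * τ ≤ δ * lam m) :
    (lap (v m) (fun x => (ψ x : ℂ)) x₀).re / lam m -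
      ‖∂[v m] (fun x => (ψ x : ℂ)) x₀‖ ^ 2 / (elemSymm (j + 2) Finset.univ lam * lam m)
      + ∑ i, elemSymm (j + 1) (Finset.univ.erase i) lam *
        ((lap (v i) (fun x => (κ x : ℂ)) x₀).re - 2 * δ * ‖∂[v i] (fun x => (κ x : ℂ)) x₀‖ ^ 2)
      ≤ (2 * Fintype.card ι + 5) * ((2 * Fintype.card ι + 4) * T ^ 2) ^ 2 / δ *
          ∑ i, elemSymm (j + 1) (Finset.univ.erase i) lam
        + (2 * Fintype.card ι + 4) * T ^ 2 := by
  set G := addHess v f X with hGdef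
  have hG : ∀ a b, ContDiffAt ℝ 2 (fun y => G y a b) x₀ := contDiffAt_addHess hf hX
  set N : ℝ := (Fintype.card ι : ℝ) with hN
  have hN0 : 0 ≤ N := by positivity
  have hTT : T ≤ T ^ 2 := by nlinarith
  have hmp := fun i => max_principle hG hW hGh hWh hG0 hW0 (fun b => (hlam b).le) (hlam m) hκ
    (hℓ i) hmax
  obtain ⟨hE1, hE2⟩ := equation_deriv hG hW hGh hWh hG0 hW0 hψ (hℓ m) hj heq
  have hF0 : ∀ a, 0 ≤ elemSymm (j + 1) (Finset.univ.erase a) lam :=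
    fun a => elemSymm_nonneg _ fun i _ => hlam i
  -- commutation of derivatives, up to bounded terms
  have hcomm : ∀ a b c, ‖∂[v c] (fun y => G y a b) x₀ - ∂[v a] (fun y => G y c b) x₀‖ ≤ 2 * T :=
    fun a b c => by
      rw [hGdef, del_addHess_sub hf hX]
      exact (norm_sub_le _ _).trans (by linarith [hdX c a b, hdX a c b])
  have hcomm2 : ∀ a, (lap (v m) (fun y => G y a a) x₀).re ≤
      (lap (v a) (fun y => G y m m) x₀).re + 2 * T * lam m := fun a => by
    have h1 := congrArg Complex.re (lap_addHess_sub (v := v) hf hX a m)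
    rw [Complex.sub_re, Complex.sub_re] at h1
    have h2 := (Complex.re_le_norm _).trans (hlX m a)
    have h3 := (Complex.abs_re_le_norm _).trans (hlX a m)
    have := neg_le_of_abs_le h3
    linarith
  have hTl : T ≤ T * lam m := le_mul_of_one_le_right (by linarith) hm1
  have hC0 : 4 * T ≤ (2 * N + 4) * T ^ 2 := by nlinarith
  have hCl : 4 * (T * lam m) ≤ (2 * N + 4) * T ^ 2 * lam m := by
    nlinarith [mul_le_mul_of_nonneg_right hC0 (hlam m).le]
  have hlmn : ‖(lam m : ℂ)‖ = lam m := by rw [Complex.norm_real, Real.norm_of_nonneg (hlam m).le]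
  have hlW' : ∀ i a b, ‖(lam m : ℂ) * ∂[v i] (fun x => W x a b) x₀‖ ≤ T * lam m := fun i a b => by
    rw [norm_mul, hlmn, mul_comm]
    exact mul_le_mul_of_nonneg_right (hdW i a b) (hlam m).le
  refine third_order_estimate (γ := fun a c => ∂[v m] (fun x => G x a c) x₀)
    (r := fun b i => ∂[v i] (fun y => G y m b) x₀ - lam m * ∂[v i] (fun y => W y m b) x₀)
    (r' := fun b i => ∂[v i] (fun y => G y b m) x₀ - lam m * ∂[v i] (fun y => W y b m) x₀)
    (t := fun a b => ∂[v m] (fun x => G x a b) x₀ - ∂[v m] (fun x => W x a b) x₀ * lam b)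
    (Lg := fun i => (lap (v i) (fun y => G y m m) x₀).re)
    hlam hm1 hj hτ hσ hδ0 hδ1 hδ (by nlinarith) ?_ ?_ ?_ ?_ ?_ ?_ ?_ ?_ hE1
  -- the second order condition at the maximum
  · intro i
    have h1 := (hmp i).2
    have h2 : -(T * ‖∂[v i] (fun x => (κ x : ℂ)) x₀‖) ≤ (∂[v i] (fun y => W y m m) x₀ *
        (starRingEnd ℂ) (∂[v i] (fun x => (κ x : ℂ)) x₀)).re := by
      refine neg_le_of_abs_le ((Complex.abs_re_le_norm _).trans ?_)
      rw [norm_mul, Complex.norm_conj]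
      exact mul_le_mul_of_nonneg_right (hdW _ _ _) (norm_nonneg _)
    have h3 := (le_abs_self _).trans (hlW i m)
    have h4 := mul_le_mul_of_nonneg_left h3 (hlam m).le
    have h5 : lam m * (2 * (T * ‖∂[v i] (fun x => (κ x : ℂ)) x₀‖)) ≤
        lam m * ((2 * N + 4) * T ^ 2 * ‖∂[v i] (fun x => (κ x : ℂ)) x₀‖) := by
      refine mul_le_mul_of_nonneg_left ?_ (hlam m).le
      rw [← mul_assoc]
      exact mul_le_mul_of_nonneg_right (by linarith) (norm_nonneg _)
    have h6 := mul_le_mul_of_nonneg_left h2 (hlam m).le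
    linarith
  -- the twice differentiated equation
  · have hkey : ∀ a, elemSymm (j + 1) (Finset.univ.erase a) lam *
        ((lap (v m) (fun x => G x a a) x₀).re - 2 * (∑ c, (starRingEnd ℂ)
          (∂[v m] (fun x => W x a c) x₀) * ∂[v m] (fun x => G x a c) x₀).re +
          ∑ c, ‖∂[v m] (fun x => W x a c) x₀‖ ^ 2 * lam c) -
        elemSymm (j + 1) (Finset.univ.erase a) lam * lam a *
        ((lap (v m) (fun x => W x a a) x₀).re - ∑ c, ‖∂[v m] (fun x => W x a c) x₀‖ ^ 2) ≤
        elemSymm (j + 1) (Finset.univ.erase a) lam * (lap (v a) (fun y => G y m m) x₀).re +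
        (2 * N + 4) * T ^ 2 * (elemSymm (j + 1) (Finset.univ.erase a) lam *
          ∑ c, ‖∂[v m] (fun x => G x a c) x₀‖) +
        (2 * N + 4) * T ^ 2 * lam m * elemSymm (j + 1) (Finset.univ.erase a) lam := by
      intro a
      have e1 : -(T * ∑ c, ‖∂[v m] (fun x => G x a c) x₀‖) ≤
          (∑ c, (starRingEnd ℂ) (∂[v m] (fun x => W x a c) x₀) *
            ∂[v m] (fun x => G x a c) x₀).re := by
        refine neg_le_of_abs_le ((Complex.abs_re_le_norm _).trans ((norm_sum_le _ _).trans ?_))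
        rw [Finset.mul_sum]
        refine Finset.sum_le_sum fun c _ => ?_
        rw [norm_mul, Complex.norm_conj]
        exact mul_le_mul_of_nonneg_right (hdW _ _ _) (norm_nonneg _)
      have hsq : ∀ c, ‖∂[v m] (fun x => W x a c) x₀‖ ^ 2 ≤ T ^ 2 := fun c =>
        pow_le_pow_left₀ (norm_nonneg _) (hdW _ _ _) 2
      have e2 : ∑ c, ‖∂[v m] (fun x => W x a c) x₀‖ ^ 2 * lam c ≤ N * (T ^ 2 * lam m) := by
        refine (Finset.sum_le_card_nsmul _ _ (T ^ 2 * lam m) fun c _ => ?_).trans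
          (by rw [nsmul_eq_mul, Finset.card_univ])
        exact mul_le_mul (hsq c) (hlm c) (hlam c).le (by positivity)
      have e3 : ∑ c, ‖∂[v m] (fun x => W x a c) x₀‖ ^ 2 ≤ N * T ^ 2 := by
        refine (Finset.sum_le_card_nsmul _ _ (T ^ 2) fun c _ => hsq c).trans
          (by rw [nsmul_eq_mul, Finset.card_univ])
      have e4 : -(lam a * ((lap (v m) (fun x => W x a a) x₀).re -
          ∑ c, ‖∂[v m] (fun x => W x a c) x₀‖ ^ 2)) ≤ lam m * (T + N * T ^ 2) := by
        have h1 := neg_le_of_abs_le (hlW m a)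
        have h2 : 0 ≤ T + N * T ^ 2 := by positivity
        refine le_trans ?_ (mul_le_mul_of_nonneg_right (hlm a) h2)
        rw [← mul_neg]
        exact mul_le_mul_of_nonneg_left (by linarith) (hlam a).le
      have e5 := hcomm2 a
      have e6 : 0 ≤ ∑ c, ‖∂[v m] (fun x => G x a c) x₀‖ :=
        Finset.sum_nonneg fun c _ => norm_nonneg _
      have e7 : 2 * T * ∑ c, ‖∂[v m] (fun x => G x a c) x₀‖ ≤
          (2 * N + 4) * T ^ 2 * ∑ c, ‖∂[v m] (fun x => G x a c) x₀‖ :=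
        mul_le_mul_of_nonneg_right (by linarith) e6
      have e8 : 2 * T * lam m + N * (T ^ 2 * lam m) + lam m * (T + N * T ^ 2) ≤
          (2 * N + 4) * T ^ 2 * lam m := by
        nlinarith [mul_le_mul_of_nonneg_right hTT (hlam m).le, mul_nonneg (sq_nonneg T) (hlam m).le]
      have e9 := mul_le_mul_of_nonneg_left (show (lap (v m) (fun x => G x a a) x₀).re -
          2 * (∑ c, (starRingEnd ℂ) (∂[v m] (fun x => W x a c) x₀) *
            ∂[v m] (fun x => G x a c) x₀).re +
          ∑ c, ‖∂[v m] (fun x => W x a c) x₀‖ ^ 2 * lam c -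
          lam a * ((lap (v m) (fun x => W x a a) x₀).re -
            ∑ c, ‖∂[v m] (fun x => W x a c) x₀‖ ^ 2) ≤
          (lap (v a) (fun y => G y m m) x₀).re +
          (2 * N + 4) * T ^ 2 * ∑ c, ‖∂[v m] (fun x => G x a c) x₀‖ +
          (2 * N + 4) * T ^ 2 * lam m by linarith) (hF0 a)
      linarith
    have hs := Finset.sum_le_sum fun a (_ : a ∈ Finset.univ) => hkey a
    simp only [Finset.sum_sub_distrib, Finset.sum_add_distrib, ← Finset.mul_sum] at hs
    have hneg : ∑ a, ∑ b ∈ Finset.univ.erase a, elemSymm j ((Finset.univ.erase a).erase b) lam *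
        (((∂[v m] (fun x => G x a a) x₀ - ∂[v m] (fun x => W x a a) x₀ * lam a) *
          (starRingEnd ℂ) (∂[v m] (fun x => G x b b) x₀ -
            ∂[v m] (fun x => W x b b) x₀ * lam b)).re -
        ‖∂[v m] (fun x => G x a b) x₀ - ∂[v m] (fun x => W x a b) x₀ * lam b‖ ^ 2) =
        -∑ a, ∑ b ∈ Finset.univ.erase a, elemSymm j ((Finset.univ.erase a).erase b) lam *
        (‖∂[v m] (fun x => G x a b) x₀ - ∂[v m] (fun x => W x a b) x₀ * lam b‖ ^ 2 -
          ((∂[v m] (fun x => G x a a) x₀ - ∂[v m] (fun x => W x a a) x₀ * lam a) *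
          (starRingEnd ℂ) (∂[v m] (fun x => G x b b) x₀ -
            ∂[v m] (fun x => W x b b) x₀ * lam b)).re) := by
      simp only [← Finset.sum_neg_distrib]
      refine Finset.sum_congr rfl fun a _ => Finset.sum_congr rfl fun b _ => ?_
      ring
    rw [hneg] at hE2
    have : 0 ≤ (2 * N + 4) * T ^ 2 := by positivity
    linarith
  -- off-diagonal third derivatives, compared with `r`
  · intro a c _
    have h1 := hcomm a c m
    have h2 := hlW' a m c
    calc ‖∂[v m] (fun x => G x a c) x₀‖ = ‖(∂[v m] (fun x => G x a c) x₀ -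
          ∂[v a] (fun y => G y m c) x₀) + (∂[v a] (fun y => G y m c) x₀ -
          lam m * ∂[v a] (fun y => W y m c) x₀) + lam m * ∂[v a] (fun y => W y m c) x₀‖ := by
          congr 1; ring
      _ ≤ _ := norm_add₃_le
      _ ≤ _ := by linarith
  -- third derivatives of the largest eigenvalue, by the first order condition
  · intro a
    have h1 := hcomm a m m
    have h2 := (hmp a).1
    have h3 := hlW' a m m
    calc ‖∂[v m] (fun x => G x a m) x₀‖ = ‖(∂[v m] (fun x => G x a m) x₀ -
          ∂[v a] (fun y => G y m m) x₀) + -(lam m * ∂[v a] (fun x => (κ x : ℂ)) x₀) +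
          lam m * ∂[v a] (fun y => W y m m) x₀‖ := by
          congr 1; linear_combination h2
      _ ≤ _ := norm_add₃_le
      _ ≤ _ := by rw [norm_neg, norm_mul, hlmn]; linarith
  -- diagonal third derivatives, compared with `r`
  · intro p _
    have h1 := hcomm p p m
    have h2 := hlW' p m p
    have h3 : ‖-(∂[v m] (fun x => W x p p) x₀ * lam p)‖ ≤ T * lam m := by
      rw [norm_neg, norm_mul, Complex.norm_real, Real.norm_of_nonneg (hlam p).le]
      exact mul_le_mul (hdW _ _ _) (hlm p) (hlam p).le (by linarith)
    calc _ = ‖(∂[v m] (fun x => G x p p) x₀ - ∂[v p] (fun y => G y m p) x₀) +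
          -(∂[v m] (fun x => W x p p) x₀ * lam p) +
          lam m * ∂[v p] (fun y => W y m p) x₀‖ := by
          congr 1; ring
      _ ≤ _ := norm_add₃_le
      _ ≤ _ := by linarith
  · intro p _
    ring
  -- mixed third derivatives, by the first order condition after commuting derivatives
  · intro p _
    have h1 := hcomm p m m
    have h2 := hlW' m p m
    have h3 := hlW' p m m
    calc _ = ‖(∂[v m] (fun x => G x p m) x₀ - ∂[v p] (fun y => G y m m) x₀) +
          -(lam m * ∂[v m] (fun y => W y p m) x₀) +
          lam m * ∂[v p] (fun y => W y m m) x₀‖ := by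
          congr 1; linear_combination (hmp p).1
      _ ≤ _ := norm_add₃_le
      _ ≤ _ := by rw [norm_neg]; linarith
  · linear_combination (hmp m).1

end ThirdOrder

/-! ### The test function: the squared length of the gradient -/

section GradientTerm

open Filter Topology

variable {n : ℕ} {x₀ : Cn n} {ι : Type*} [Fintype ι] {v : ι → Cn n}

lemma fderiv_smul_eq (f : Cn n → ℂ) (x : Cn n) (c : ℂ) (w : Cn n) :
    fderiv ℝ f x (c • w) = c * ∂[w] f x + (starRingEnd ℂ) c * ∂̄[w] f x := by
  have h : c • w = c.re • w + c.im • (Complex.I • w) := by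
    conv_lhs => rw [← Complex.re_add_im c, add_smul, mul_smul]
    rfl
  have hc : (starRingEnd ℂ) c = c.re - c.im * Complex.I := by
    apply Complex.ext <;> simp
  rw [h, map_add, map_smul, map_smul, hc]
  conv_rhs => rw [← Complex.re_add_im c]
  simp only [wirt, Complex.real_smul, Complex.add_re, Complex.add_im, Complex.mul_re,
    Complex.mul_im, Complex.ofReal_re, Complex.ofReal_im, Complex.I_re, Complex.I_im]
  push_cast
  linear_combination (c.im : ℂ) * fderiv ℝ f x (Complex.I • w) * Complex.I_sq

/-- The components of `∂f` with respect to the vectors `v a`. -/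
def frameGrad (v : ι → Cn n) (f : Cn n → ℂ) (x : Cn n) (a : ι) : ℂ := ∂[v a] f x

/-- The squared length of `∂f`, where the Hermitian form on covectors has matrix `B`. -/
def gradSq (v : ι → Cn n) (f : Cn n → ℂ) (B : Cn n → Matrix ι ι ℂ) (x : Cn n) : ℂ :=
  ∑ a, ∑ b, (starRingEnd ℂ) (frameGrad v f x a) * frameGrad v f x b * B x a b

variable [DecidableEq ι] {f : Cn n → ℂ} {B X : Cn n → Matrix ι ι ℂ} {lam : ι → ℝ} {T : ℝ}

omit [Fintype ι] [DecidableEq ι] in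
lemma contDiffAt_frameGrad (hf : ContDiffAt ℝ 4 f x₀) (a : ι) :
    ContDiffAt ℝ 3 (fun x => frameGrad v f x a) x₀ := contDiffAt_wirt hf (by norm_num) _ _

omit [DecidableEq ι] in
lemma contDiffAt_gradSq (hf : ContDiffAt ℝ 4 f x₀)
    (hB : ∀ a b, ContDiffAt ℝ 2 (fun y => B y a b) x₀) : ContDiffAt ℝ 2 (gradSq v f B) x₀ :=
  ContDiffAt.sum fun a _ => ContDiffAt.sum fun b _ =>
    ((contDiffAt_conj ((contDiffAt_frameGrad hf a).of_le (by norm_num))).mul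
      ((contDiffAt_frameGrad hf b).of_le (by norm_num))).mul (hB a b)

lemma del_gradSq (hf : ContDiffAt ℝ 4 f x₀)
    (hB : ∀ a b, ContDiffAt ℝ 2 (fun y => B y a b) x₀) (hB0 : B x₀ = 1) (w : Cn n) :
    ∂[w] (gradSq v f B) x₀ = ∑ a, ∑ b, (starRingEnd ℂ) (frameGrad v f x₀ a) *
        frameGrad v f x₀ b * ∂[w] (fun y => B y a b) x₀ +
      ∑ a, ((starRingEnd ℂ) (∂̄[w] (fun x => frameGrad v f x a) x₀) * frameGrad v f x₀ a +
        (starRingEnd ℂ) (frameGrad v f x₀ a) * ∂[w] (fun x => frameGrad v f x a) x₀) := by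
  have hp : ∀ a, ContDiffAt ℝ 2 (fun x => frameGrad v f x a) x₀ :=
    fun a => (contDiffAt_frameGrad hf a).of_le (by norm_num)
  have := wirt_quad (c := -Complex.I) (v := w)
    (A := fun a x => (starRingEnd ℂ) (frameGrad v f x a))
    (B := fun b x => frameGrad v f x b) (fun a => contDiffAt_conj (hp a)) hp hB
  rw [show gradSq v f B = fun y => ∑ a, ∑ b, (starRingEnd ℂ) (frameGrad v f y a) *
    frameGrad v f y b * B y a b from rfl, this, hB0]
  simp only [del_conj ((hp _).differentiableAt (by norm_num)), Finset.sum_add_distrib]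
  congr 1
  simp [Matrix.one_apply]
  rw [← Finset.sum_add_distrib]

lemma lap_gradSq (hf : ContDiffAt ℝ 4 f x₀)
    (hB : ∀ a b, ContDiffAt ℝ 2 (fun y => B y a b) x₀) (hB0 : B x₀ = 1) (w : Cn n) :
    (lap w (gradSq v f B) x₀).re =
      2 * (∑ a, (starRingEnd ℂ) (frameGrad v f x₀ a) * lap w (fun x => frameGrad v f x a) x₀).re +
      ∑ a, (‖∂[w] (fun x => frameGrad v f x a) x₀‖ ^ 2 +
        ‖∂̄[w] (fun x => frameGrad v f x a) x₀‖ ^ 2) +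
      (∑ a, ∑ b, ((starRingEnd ℂ) (frameGrad v f x₀ a) * frameGrad v f x₀ b *
          lap w (fun y => B y a b) x₀ +
        ((starRingEnd ℂ) (∂̄[w] (fun x => frameGrad v f x a) x₀) * frameGrad v f x₀ b +
          (starRingEnd ℂ) (frameGrad v f x₀ a) * ∂[w] (fun x => frameGrad v f x b) x₀) *
            ∂̄[w] (fun y => B y a b) x₀ +
        ((starRingEnd ℂ) (∂[w] (fun x => frameGrad v f x a) x₀) * frameGrad v f x₀ b +
          (starRingEnd ℂ) (frameGrad v f x₀ a) * ∂̄[w] (fun x => frameGrad v f x b) x₀) *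
            ∂[w] (fun y => B y a b) x₀)).re := by
  have hp : ∀ a, ContDiffAt ℝ 2 (fun x => frameGrad v f x a) x₀ :=
    fun a => (contDiffAt_frameGrad hf a).of_le (by norm_num)
  have := lap_quad (v := w)
    (A := fun a x => (starRingEnd ℂ) (frameGrad v f x a))
    (B := fun b x => frameGrad v f x b) (fun a => contDiffAt_conj (hp a)) hp hB
  rw [show gradSq v f B = fun y => ∑ a, ∑ b, (starRingEnd ℂ) (frameGrad v f y a) *
    frameGrad v f y b * B y a b from rfl, this, hB0]
  simp only [del_conj ((hp _).differentiableAt (by norm_num)),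
    delBar_conj ((hp _).differentiableAt (by norm_num)), lap_conj (hp _)]
  have e1 : ∀ c : ι → ι → ℂ, ∑ a, ∑ b, c a b * (1 : Matrix ι ι ℂ) a b = ∑ a, c a a := fun c => by
    simp [Matrix.one_apply]
  simp only [Finset.sum_add_distrib, e1, Complex.add_re]
  have e2 : ∀ z y : ℂ, ((starRingEnd ℂ) z * y).re = ((starRingEnd ℂ) y * z).re := fun z y => by
    simp; ring
  have e3 : ∀ z : ℂ, ((starRingEnd ℂ) z * z).re = ‖z‖ ^ 2 := fun z => by
    rw [Complex.conj_mul', ← Complex.ofReal_pow, Complex.ofReal_re]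
  simp only [Complex.re_sum, e3]
  simp only [e2 (lap w _ _)]
  ring

omit [Fintype ι] in
lemma delBar_frameGrad (hG0 : addHess v f X x₀ = Matrix.diagonal fun a => (lam a : ℂ)) (a i : ι) :
    ∂̄[v i] (fun x => frameGrad v f x a) x₀ =
      Matrix.diagonal (fun a => (lam a : ℂ)) a i - X x₀ a i := by
  rw [← hG0]
  simp only [addHess, Matrix.of_apply, add_sub_cancel_left]
  rfl

omit [Fintype ι] in
lemma norm_delBar_frameGrad_le (hG0 : addHess v f X x₀ = Matrix.diagonal fun a => (lam a : ℂ))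
    (hlam : ∀ i, 0 ≤ lam i) (hX0 : ∀ a b, ‖X x₀ a b‖ ≤ T) (a i : ι) :
    ‖∂̄[v i] (fun x => frameGrad v f x a) x₀‖ ≤ (if a = i then lam i else 0) + T := by
  rw [delBar_frameGrad hG0]
  refine (norm_sub_le _ _).trans (add_le_add ?_ (hX0 a i))
  by_cases h : a = i
  · subst h; simp [abs_of_nonneg (hlam a)]
  · simp [h]

lemma sum_norm_delBar_frameGrad_le
    (hG0 : addHess v f X x₀ = Matrix.diagonal fun a => (lam a : ℂ))
    (hlam : ∀ i, 0 ≤ lam i) (hX0 : ∀ a b, ‖X x₀ a b‖ ≤ T) (i : ι) :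
    ∑ a, ‖∂̄[v i] (fun x => frameGrad v f x a) x₀‖ ≤ lam i + Fintype.card ι * T := by
  refine (Finset.sum_le_sum fun a _ => norm_delBar_frameGrad_le hG0 hlam hX0 a i).trans ?_
  rw [Finset.sum_add_distrib]
  simp

omit [DecidableEq ι] in
lemma one_add_add_sum_sq_le (l : ℝ) (y : ι → ℝ) :
    (1 + l + ∑ a, y a) ^ 2 ≤ 3 * (Fintype.card ι + 1) * (1 + ∑ a, y a ^ 2 + l ^ 2) := by
  have h1 : (∑ a, y a) ^ 2 ≤ Fintype.card ι * ∑ a, y a ^ 2 := by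
    simpa using sq_sum_le_card_mul_sum_sq (s := Finset.univ) (f := y)
  have h2 : 0 ≤ ∑ a, y a ^ 2 := Finset.sum_nonneg fun a _ => sq_nonneg _
  have h3 : (0 : ℝ) ≤ Fintype.card ι := by positivity
  nlinarith [sq_nonneg (1 - l), sq_nonneg (1 - ∑ a, y a), sq_nonneg (l - ∑ a, y a),
    mul_nonneg h3 (sq_nonneg l)]

/-- The derivative of `|∂f|²` is linear in the second derivatives of `f`; the mixed ones are bounded
by the eigenvalues. -/
lemma norm_del_gradSq_le (hf : ContDiffAt ℝ 4 f x₀)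
    (hB : ∀ a b, ContDiffAt ℝ 2 (fun y => B y a b) x₀) (hB0 : B x₀ = 1)
    (hG0 : addHess v f X x₀ = Matrix.diagonal fun a => (lam a : ℂ))
    (hlam : ∀ i, 0 ≤ lam i) (hX0 : ∀ a b, ‖X x₀ a b‖ ≤ T) (hT : 1 ≤ T)
    (hp : ∀ a, ‖frameGrad v f x₀ a‖ ≤ T) (hdB : ∀ i a b, ‖∂[v i] (fun y => B y a b) x₀‖ ≤ T)
    (i : ι) : ‖∂[v i] (gradSq v f B) x₀‖ ≤ (Fintype.card ι + 1) ^ 2 * T ^ 3 *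
      (1 + lam i + ∑ a, ‖∂[v i] (fun x => frameGrad v f x a) x₀‖) := by
  set N : ℝ := (Fintype.card ι : ℝ) with hN
  have hN0 : 0 ≤ N := by positivity
  have hT0 : 0 ≤ T := by linarith
  rw [del_gradSq hf hB hB0]
  have h1 : ‖∑ a, ∑ b, (starRingEnd ℂ) (frameGrad v f x₀ a) *
        frameGrad v f x₀ b * ∂[v i] (fun y => B y a b) x₀‖ ≤ N * (N * T ^ 3) := by
    have e1 : ∑ _a : ι, ∑ _b : ι, T ^ 3 = N * (N * T ^ 3) := by
      simp only [Finset.sum_const, Finset.card_univ, nsmul_eq_mul, ← hN]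
    rw [← e1]
    refine norm_sum_le_of_le _ fun a _ => norm_sum_le_of_le _ fun b _ => ?_
    rw [norm_mul, norm_mul, Complex.norm_conj, pow_three, ← mul_assoc]
    exact mul_le_mul (mul_le_mul (hp a) (hp b) (norm_nonneg _) hT0) (hdB i a b) (norm_nonneg _)
      (by positivity)
  have h2 : ‖∑ a, ((starRingEnd ℂ) (∂̄[v i] (fun x => frameGrad v f x a) x₀) * frameGrad v f x₀ a +
        (starRingEnd ℂ) (frameGrad v f x₀ a) * ∂[v i] (fun x => frameGrad v f x a) x₀)‖ ≤
      T * (∑ a, ‖∂̄[v i] (fun x => frameGrad v f x a) x₀‖) +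
        T * ∑ a, ‖∂[v i] (fun x => frameGrad v f x a) x₀‖ := by
    rw [Finset.mul_sum, Finset.mul_sum, ← Finset.sum_add_distrib]
    refine norm_sum_le_of_le _ fun a _ => (norm_add_le _ _).trans ?_
    rw [norm_mul, norm_mul, Complex.norm_conj, Complex.norm_conj, mul_comm]
    exact add_le_add (mul_le_mul_of_nonneg_right (hp a) (norm_nonneg _))
      (mul_le_mul_of_nonneg_right (hp a) (norm_nonneg _))
  have h3 := sum_norm_delBar_frameGrad_le hG0 hlam hX0 i
  set S := ∑ a, ‖∂[v i] (fun x => frameGrad v f x a) x₀‖ with hS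
  have hS0 : 0 ≤ S := Finset.sum_nonneg fun a _ => norm_nonneg _
  have h4 : T ≤ T ^ 3 := by nlinarith [mul_nonneg hT0 hT0]
  have h5 : T * T ≤ T ^ 3 := by nlinarith [mul_nonneg hT0 hT0]
  have h6 : 1 ≤ (N + 1) ^ 2 := by nlinarith
  have h7 : T ^ 3 ≤ (N + 1) ^ 2 * T ^ 3 := le_mul_of_one_le_left (by positivity) h6
  calc _ ≤ N * (N * T ^ 3) + (T * (lam i + N * T) + T * S) :=
        (norm_add_le _ _).trans (add_le_add h1 (h2.trans (by gcongr)))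
    _ = N ^ 2 * T ^ 3 + N * (T * T) + T * lam i + T * S := by ring
    _ ≤ N ^ 2 * T ^ 3 + N * T ^ 3 + (N + 1) ^ 2 * T ^ 3 * lam i + (N + 1) ^ 2 * T ^ 3 * S := by
        have := hlam i
        gcongr
        · exact h4.trans h7
        · exact h4.trans h7
    _ ≤ _ := by nlinarith [mul_nonneg hN0 (pow_nonneg hT0 3), pow_nonneg hT0 3]

/-- `|∂f|²` yields all squares of second derivatives of `f`, besides the term with third derivatives
that the differentiated equation controls. -/
lemma le_lap_gradSq (hf : ContDiffAt ℝ 4 f x₀)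
    (hB : ∀ a b, ContDiffAt ℝ 2 (fun y => B y a b) x₀) (hB0 : B x₀ = 1)
    (hG0 : addHess v f X x₀ = Matrix.diagonal fun a => (lam a : ℂ))
    (hlam : ∀ i, 0 ≤ lam i) (hX0 : ∀ a b, ‖X x₀ a b‖ ≤ T) (hT : 1 ≤ T)
    (hp : ∀ a, ‖frameGrad v f x₀ a‖ ≤ T) (hdB : ∀ i a b, ‖∂[v i] (fun y => B y a b) x₀‖ ≤ T)
    (hdB' : ∀ i a b, ‖∂̄[v i] (fun y => B y a b) x₀‖ ≤ T)
    (hlB : ∀ i a b, ‖lap (v i) (fun y => B y a b) x₀‖ ≤ T) (i : ι) :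
    2 * (∑ a, (starRingEnd ℂ) (frameGrad v f x₀ a) *
        lap (v i) (fun x => frameGrad v f x a) x₀).re +
      1 / 2 * (∑ a, ‖∂[v i] (fun x => frameGrad v f x a) x₀‖ ^ 2 + lam i ^ 2) -
        10 * (Fintype.card ι + 1) ^ 3 * T ^ 4 ≤ (lap (v i) (gradSq v f B) x₀).re := by
  set N : ℝ := (Fintype.card ι : ℝ) with hN
  have hN0 : 0 ≤ N := by positivity
  have hT0 : 0 ≤ T := by linarith
  rw [lap_gradSq hf hB hB0]
  set y : ι → ℝ := fun a => ‖∂[v i] (fun x => frameGrad v f x a) x₀‖ with hy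
  set z : ι → ℝ := fun a => ‖∂̄[v i] (fun x => frameGrad v f x a) x₀‖ with hz
  have hy0 : ∀ a, 0 ≤ y a := fun a => norm_nonneg _
  have hz0 : ∀ a, 0 ≤ z a := fun a => norm_nonneg _
  have h1 : ‖∑ a, ∑ b, ((starRingEnd ℂ) (frameGrad v f x₀ a) * frameGrad v f x₀ b *
          lap (v i) (fun y => B y a b) x₀ +
        ((starRingEnd ℂ) (∂̄[v i] (fun x => frameGrad v f x a) x₀) * frameGrad v f x₀ b +
          (starRingEnd ℂ) (frameGrad v f x₀ a) * ∂[v i] (fun x => frameGrad v f x b) x₀) *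
            ∂̄[v i] (fun y => B y a b) x₀ +
        ((starRingEnd ℂ) (∂[v i] (fun x => frameGrad v f x a) x₀) * frameGrad v f x₀ b +
          (starRingEnd ℂ) (frameGrad v f x₀ a) * ∂̄[v i] (fun x => frameGrad v f x b) x₀) *
            ∂[v i] (fun y => B y a b) x₀)‖ ≤
      ∑ a, ∑ b : ι, (T * T * T + (z a * T + T * y b) * T + (y a * T + T * z b) * T) := by
    refine norm_sum_le_of_le _ fun a _ => norm_sum_le_of_le _ fun b _ => ?_
    refine norm_add₃_le.trans (add_le_add (add_le_add ?_ ?_) ?_)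
    · rw [norm_mul, norm_mul, Complex.norm_conj]
      exact mul_le_mul (mul_le_mul (hp a) (hp b) (norm_nonneg _) hT0) (hlB i a b) (norm_nonneg _)
        (by positivity)
    · rw [norm_mul]
      refine mul_le_mul ((norm_add_le _ _).trans ?_) (hdB' i a b) (norm_nonneg _) ?_
      · rw [norm_mul, norm_mul, Complex.norm_conj, Complex.norm_conj]
        exact add_le_add (mul_le_mul_of_nonneg_left (hp b) (hz0 a))
          (mul_le_mul_of_nonneg_right (hp a) (hy0 b))
      · exact add_nonneg (mul_nonneg (hz0 a) hT0) (mul_nonneg hT0 (hy0 b))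
    · rw [norm_mul]
      refine mul_le_mul ((norm_add_le _ _).trans ?_) (hdB i a b) (norm_nonneg _) ?_
      · rw [norm_mul, norm_mul, Complex.norm_conj, Complex.norm_conj]
        exact add_le_add (mul_le_mul_of_nonneg_left (hp b) (hy0 a))
          (mul_le_mul_of_nonneg_right (hp a) (hz0 b))
      · exact add_nonneg (mul_nonneg (hy0 a) hT0) (mul_nonneg hT0 (hz0 b))
  have h2 : ∑ a, ∑ b : ι, (T * T * T + (z a * T + T * y b) * T + (y a * T + T * z b) * T) =
      N ^ 2 * T ^ 3 + 2 * N * T ^ 2 * ∑ a, (y a + z a) := by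
    simp only [add_mul, Finset.sum_add_distrib, ← Finset.mul_sum, ← Finset.sum_mul,
      Finset.sum_const, Finset.card_univ, nsmul_eq_mul, ← hN]
    ring
  have h3 := (abs_le.1 ((Complex.abs_re_le_norm _).trans (h1.trans h2.le))).1
  have h4 : 2 * N * T ^ 2 * ∑ a, (y a + z a) ≤
      1 / 4 * ∑ a, (y a ^ 2 + z a ^ 2) + N * (8 * (N * T ^ 2) ^ 2) := by
    have : N * (8 * (N * T ^ 2) ^ 2) = ∑ _a : ι, 8 * (N * T ^ 2) ^ 2 := by simp [hN]
    rw [this, Finset.mul_sum, Finset.mul_sum, ← Finset.sum_add_distrib]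
    refine Finset.sum_le_sum fun a _ => ?_
    nlinarith [sq_nonneg (y a - 4 * (N * T ^ 2)), sq_nonneg (z a - 4 * (N * T ^ 2))]
  have h5 : 1 / 2 * lam i ^ 2 ≤ 3 / 4 * ∑ a, z a ^ 2 + 3 / 2 * T ^ 2 := by
    have e1 : z i ^ 2 ≤ ∑ a, z a ^ 2 :=
      Finset.single_le_sum (f := fun a => z a ^ 2) (fun a _ => sq_nonneg _) (Finset.mem_univ i)
    have e2 : lam i ≤ z i + T := by
      have := delBar_frameGrad hG0 i i
      rw [Matrix.diagonal_apply_eq, eq_sub_iff_add_eq] at this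
      calc lam i = ‖(lam i : ℂ)‖ := by rw [Complex.norm_real, Real.norm_of_nonneg (hlam i)]
        _ ≤ _ := by rw [← this]; exact (norm_add_le _ _).trans (by gcongr; exact hX0 i i)
    have e3 : lam i ^ 2 ≤ (z i + T) ^ 2 := pow_le_pow_left₀ (hlam i) e2 2
    nlinarith [sq_nonneg (z i - 2 * T)]
  have h6 : N ^ 2 * T ^ 3 + N * (8 * (N * T ^ 2) ^ 2) + 3 / 2 * T ^ 2 ≤
      10 * (N + 1) ^ 3 * T ^ 4 := by
    have e1 : T ^ 2 ≤ T ^ 4 := pow_le_pow_right₀ hT (by norm_num)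
    have e2 : T ^ 3 ≤ T ^ 4 := pow_le_pow_right₀ hT (by norm_num)
    have e4 : 0 ≤ T ^ 4 := by positivity
    calc _ ≤ N ^ 2 * T ^ 4 + N * (8 * (N * T ^ 2) ^ 2) + 3 / 2 * T ^ 4 := by gcongr
      _ = (N ^ 2 + 8 * N ^ 3 + 3 / 2) * T ^ 4 := by ring
      _ ≤ _ := by
        refine mul_le_mul_of_nonneg_right ?_ e4
        nlinarith [mul_nonneg hN0 hN0, pow_nonneg hN0 3]
  have h7 : 0 ≤ ∑ a, y a ^ 2 := Finset.sum_nonneg fun a _ => sq_nonneg _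
  have e1 : ∑ a, (y a ^ 2 + z a ^ 2) = ∑ a, y a ^ 2 + ∑ a, z a ^ 2 := Finset.sum_add_distrib
  have e2 : ∑ a, (‖∂[v i] (fun x => frameGrad v f x a) x₀‖ ^ 2 +
      ‖∂̄[v i] (fun x => frameGrad v f x a) x₀‖ ^ 2) = ∑ a, (y a ^ 2 + z a ^ 2) := rfl
  have e3 : ∑ a, ‖∂[v i] (fun x => frameGrad v f x a) x₀‖ ^ 2 = ∑ a, y a ^ 2 := rfl
  rw [e2, e3]
  linarith

end GradientTerm

/-! ### Composition with functions of the 1-jet -/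

section Composition

open Filter Topology

variable {n : ℕ} {x₀ w : Cn n} {F F' : Type*} [NormedAddCommGroup F] [NormedSpace ℝ F]
  [NormedAddCommGroup F'] [NormedSpace ℝ F']

/-- The operator `∂̄_w ∂_w` on vector valued functions. -/
def lapVec (w : Cn n) (Γ : Cn n → F) (x : Cn n) : F :=
  (1 / 4 : ℝ) • (dir w (dir w Γ) x + dir (Complex.I • w) (dir (Complex.I • w) Γ) x)

lemma lap_eq_lapVec {f : Cn n → ℂ} (hf : ContDiffAt ℝ 2 f x₀) : lap w f x₀ = lapVec w f x₀ := by
  rw [lap_eq_dir hf, lapVec, Complex.real_smul]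
  push_cast
  ring

lemma re_lap_ofReal_eq_lapVec {f : Cn n → ℝ} (hf : ContDiffAt ℝ 2 f x₀) :
    (lap w (fun y => (f y : ℂ)) x₀).re = lapVec w f x₀ := by
  rw [lap_ofReal hf, Complex.ofReal_re, lapVec, smul_eq_mul]

lemma dir_clm_comp (L : F →L[ℝ] F') {Γ : Cn n → F} (hΓ : DifferentiableAt ℝ Γ x₀) :
    dir w (fun y => L (Γ y)) x₀ = L (dir w Γ x₀) := by
  have := (L.hasFDerivAt.comp x₀ hΓ.hasFDerivAt).fderiv
  unfold dir
  rw [show (fun y => L (Γ y)) = L ∘ Γ from rfl, this]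
  rfl

lemma dir_dir_clm_comp (L : F →L[ℝ] F') {Γ : Cn n → F} (hΓ : ContDiffAt ℝ 2 Γ x₀) :
    dir w (dir w fun y => L (Γ y)) x₀ = L (dir w (dir w Γ) x₀) := by
  have h1 : dir w (fun y => L (Γ y)) =ᶠ[𝓝 x₀] fun y => L (dir w Γ y) := by
    filter_upwards [eventually_contDiffAt (k := 2) hΓ] with y hy
    exact dir_clm_comp L (hy.differentiableAt (by norm_num))
  rw [← dir_clm_comp L ((contDiffAt_dir hΓ (m := 1) (by norm_num) w).differentiableAt
    (by norm_num))]
  exact congrArg (fun L : Cn n →L[ℝ] F' => L w) h1.fderiv_eq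

lemma lapVec_clm_comp (L : F →L[ℝ] F') {Γ : Cn n → F} (hΓ : ContDiffAt ℝ 2 Γ x₀) :
    lapVec w (fun y => L (Γ y)) x₀ = L (lapVec w Γ x₀) := by
  simp only [lapVec, dir_dir_clm_comp L hΓ, map_smul, map_add]

lemma lapVec_id : lapVec w (fun y : Cn n => y) x₀ = 0 := by
  have : ∀ w : Cn n, dir w (fun y : Cn n => y) = fun _ => w := fun w => by
    funext y; simp [dir]
  simp only [lapVec, this]
  simp [dir]

lemma lap_comp {Γ : Cn n → F} {H : F → ℂ} (hΓ : ContDiffAt ℝ 2 Γ x₀)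
    (hH : ContDiffAt ℝ 2 H (Γ x₀)) :
    lap w (fun y => H (Γ y)) x₀ = (1 / 4 : ℂ) *
      (fderiv ℝ (fderiv ℝ H) (Γ x₀) (fderiv ℝ Γ x₀ w) (fderiv ℝ Γ x₀ w) +
        fderiv ℝ (fderiv ℝ H) (Γ x₀) (fderiv ℝ Γ x₀ (Complex.I • w))
          (fderiv ℝ Γ x₀ (Complex.I • w))) + fderiv ℝ H (Γ x₀) (lapVec w Γ x₀) := by
  rw [lap_eq_dir (f := fun y => H (Γ y)) (hH.comp x₀ hΓ), dir_dir_comp hΓ hH,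
    dir_dir_comp hΓ hH, lapVec, (fderiv ℝ H (Γ x₀)).map_smul, (fderiv ℝ H (Γ x₀)).map_add,
    Complex.real_smul]
  push_cast
  ring

lemma norm_lap_comp_sub_le {Γ : Cn n → F} {H : F → ℂ} (hΓ : ContDiffAt ℝ 2 Γ x₀)
    (hH : ContDiffAt ℝ 2 H (Γ x₀)) {T R : ℝ} (hT : ‖fderiv ℝ (fderiv ℝ H) (Γ x₀)‖ ≤ T)
    (h1 : ‖fderiv ℝ Γ x₀ w‖ ≤ R) (h2 : ‖fderiv ℝ Γ x₀ (Complex.I • w)‖ ≤ R) :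
    ‖lap w (fun y => H (Γ y)) x₀ - fderiv ℝ H (Γ x₀) (lapVec w Γ x₀)‖ ≤ T * R ^ 2 := by
  have hR : 0 ≤ R := (norm_nonneg _).trans h1
  have hT0 : 0 ≤ T := (norm_nonneg (fderiv ℝ (fderiv ℝ H) (Γ x₀))).trans hT
  have key : ∀ z : F, ‖z‖ ≤ R → ‖fderiv ℝ (fderiv ℝ H) (Γ x₀) z z‖ ≤ T * R ^ 2 := fun z hz => by
    refine (ContinuousLinearMap.le_opNorm₂ _ _ _).trans ?_
    rw [mul_assoc, sq]
    gcongr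
  rw [lap_comp hΓ hH, add_sub_cancel_right, norm_mul]
  have h3 := (norm_add_le (fderiv ℝ (fderiv ℝ H) (Γ x₀) (fderiv ℝ Γ x₀ w) (fderiv ℝ Γ x₀ w))
    (fderiv ℝ (fderiv ℝ H) (Γ x₀) (fderiv ℝ Γ x₀ (Complex.I • w))
      (fderiv ℝ Γ x₀ (Complex.I • w)))).trans (add_le_add (key _ h1) (key _ h2))
  have h4 : 0 ≤ T * R ^ 2 := by positivity
  norm_num
  linarith

lemma norm_wirt_le {f : Cn n → ℂ} {c : ℂ} (hc : ‖c‖ = 1) {R : ℝ} (h1 : ‖fderiv ℝ f x₀ w‖ ≤ R)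
    (h2 : ‖fderiv ℝ f x₀ (Complex.I • w)‖ ≤ R) : ‖wirt c w f x₀‖ ≤ R := by
  unfold wirt
  have h3 := norm_add_le (fderiv ℝ f x₀ w) (c * fderiv ℝ f x₀ (Complex.I • w))
  rw [norm_mul, hc, one_mul] at h3
  rw [norm_mul]
  norm_num
  linarith

lemma norm_wirt_comp_le {Γ : Cn n → F} {H : F → ℂ} (hΓ : ContDiffAt ℝ 2 Γ x₀)
    (hH : ContDiffAt ℝ 2 H (Γ x₀)) {c : ℂ} (hc : ‖c‖ = 1) {T R : ℝ}
    (hT : ‖fderiv ℝ H (Γ x₀)‖ ≤ T)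
    (h1 : ‖fderiv ℝ Γ x₀ w‖ ≤ R) (h2 : ‖fderiv ℝ Γ x₀ (Complex.I • w)‖ ≤ R) :
    ‖wirt c w (fun y => H (Γ y)) x₀‖ ≤ T * R := by
  have hT0 : 0 ≤ T := (norm_nonneg _).trans hT
  have h3 := fderiv_fun_comp x₀ (hH.differentiableAt (by norm_num))
    (hΓ.differentiableAt (by norm_num))
  have key : ∀ z, ‖fderiv ℝ Γ x₀ z‖ ≤ R → ‖fderiv ℝ (fun y => H (Γ y)) x₀ z‖ ≤ T * R :=
    fun z hz => by
      rw [h3, ContinuousLinearMap.comp_apply]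
      exact (ContinuousLinearMap.le_opNorm _ _).trans
        (mul_le_mul hT hz (norm_nonneg _) hT0)
  exact norm_wirt_le hc (key _ h1) (key _ h2)

/-- The derivative of a real function in terms of its `∂`-derivatives. -/
lemma re_fderiv_sum_smul {ι : Type*} (s : Finset ι) {ψ : Cn n → ℝ} (hψ : DifferentiableAt ℝ ψ x₀)
    (c : ι → ℂ) (v : ι → Cn n) :
    (fderiv ℝ (fun y => (ψ y : ℂ)) x₀ (∑ a ∈ s, c a • v a)).re =
      2 * (∑ a ∈ s, c a * ∂[v a] (fun y => (ψ y : ℂ)) x₀).re := by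
  rw [map_sum, Complex.re_sum, Complex.re_sum, Finset.mul_sum]
  refine Finset.sum_congr rfl fun a _ => ?_
  rw [fderiv_smul_eq, delBar_eq_conj_of_real hψ, ← map_mul, Complex.add_conj, Complex.ofReal_re]

end Composition

section Jet

open Filter Topology

variable {n : ℕ} {x₀ w : Cn n} {ι : Type*} [Fintype ι] {v : ι → Cn n} {f : Cn n → ℝ}

/-- The 1-jet of `f`, with `∂f` expressed in the frame `v`. -/
def jet (v : ι → Cn n) (f : Cn n → ℝ) (x : Cn n) : Cn n × (ι → ℂ) × ℝ :=
  (x, frameGrad v (fun y => (f y : ℂ)) x, f x)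

/-- The projection of a 1-jet to a component of `∂f`. -/
def jetGrad (n : ℕ) (a : ι) : Cn n × (ι → ℂ) × ℝ →L[ℝ] ℂ :=
  (ContinuousLinearMap.proj (R := ℝ) (φ := fun _ : ι => ℂ) a).comp
    ((ContinuousLinearMap.fst ℝ (ι → ℂ) ℝ).comp (ContinuousLinearMap.snd ℝ (Cn n) ((ι → ℂ) × ℝ)))

/-- The projection of a 1-jet to the value of `f`. -/
def jetValue (n : ℕ) (ι : Type*) [Fintype ι] : Cn n × (ι → ℂ) × ℝ →L[ℝ] ℝ :=
  (ContinuousLinearMap.snd ℝ (ι → ℂ) ℝ).comp (ContinuousLinearMap.snd ℝ (Cn n) ((ι → ℂ) × ℝ))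

lemma contDiffAt_jet (hf : ContDiffAt ℝ 4 f x₀) : ContDiffAt ℝ 2 (jet v f) x₀ :=
  contDiffAt_id.prodMk ((contDiffAt_pi.2 fun a =>
    ((contDiffAt_frameGrad (contDiffAt_ofReal hf) a).of_le (by norm_num))).prodMk
      (hf.of_le (by norm_num)))

lemma lapVec_jet (hf : ContDiffAt ℝ 4 f x₀) : lapVec w (jet v f) x₀ =
    (0, fun a => lap w (fun x => frameGrad v (fun y => (f y : ℂ)) x a) x₀,
      (lap w (fun y => (f y : ℂ)) x₀).re) := by
  have hJ := contDiffAt_jet (v := v) hf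
  have h1 := lapVec_clm_comp (w := w) (ContinuousLinearMap.fst ℝ (Cn n) ((ι → ℂ) × ℝ)) hJ
  have h2 := fun a => lapVec_clm_comp (w := w) (jetGrad n a) hJ
  have h3 := lapVec_clm_comp (w := w) (jetValue n ι) hJ
  refine Prod.ext ?_ (Prod.ext ?_ ?_)
  · exact h1.symm.trans lapVec_id
  · funext a
    exact (h2 a).symm.trans (lap_eq_lapVec ((contDiffAt_frameGrad (contDiffAt_ofReal hf) a).of_le
      (by norm_num))).symm
  · exact h3.symm.trans (re_lap_ofReal_eq_lapVec (hf.of_le (by norm_num))).symm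

lemma fderiv_jet (hf : ContDiffAt ℝ 4 f x₀) : fderiv ℝ (jet v f) x₀ w =
    (w, fun a => fderiv ℝ (fun x => frameGrad v (fun y => (f y : ℂ)) x a) x₀ w,
      fderiv ℝ f x₀ w) := by
  have hJ := (contDiffAt_jet (v := v) hf).differentiableAt (by norm_num)
  have h1 := dir_clm_comp (w := w) (ContinuousLinearMap.fst ℝ (Cn n) ((ι → ℂ) × ℝ)) hJ
  have h2 := fun a => dir_clm_comp (w := w) (jetGrad n a) hJ
  have h3 := dir_clm_comp (w := w) (jetValue n ι) hJ
  refine Prod.ext ?_ (Prod.ext ?_ ?_)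
  · refine h1.symm.trans ?_
    change fderiv ℝ (fun y : Cn n => y) x₀ w = w
    simp
  · funext a
    exact (h2 a).symm
  · exact h3.symm

lemma norm_triple_le {E₁ E₂ E₃ : Type*} [NormedAddCommGroup E₁] [NormedAddCommGroup E₂]
    [NormedAddCommGroup E₃] {R : ℝ} {a : E₁} {b : ι → E₂} {c : E₃} (hR : 0 ≤ R) (ha : ‖a‖ ≤ R)
    (hb : ∀ i, ‖b i‖ ≤ R) (hc : ‖c‖ ≤ R) : ‖(a, b, c)‖ ≤ R := by
  rw [Prod.norm_def, Prod.norm_def]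
  exact max_le ha (max_le ((pi_norm_le_iff_of_nonneg hR).2 hb) hc)

lemma fderiv_ofReal (hf : DifferentiableAt ℝ f x₀) :
    fderiv ℝ (fun y => (f y : ℂ)) x₀ w = (fderiv ℝ f x₀ w : ℝ) := dir_ofReal hf

variable [DecidableEq ι] {X B : Cn n → Matrix ι ι ℂ} {lam : ι → ℝ} {T : ℝ}

lemma norm_fderiv_jet_le (hf : ContDiffAt ℝ 4 f x₀)
    (hG0 : addHess v (fun y => (f y : ℂ)) X x₀ = Matrix.diagonal fun a => (lam a : ℂ))
    (hlam : ∀ i, 0 ≤ lam i) (hX0 : ∀ a b, ‖X x₀ a b‖ ≤ T) (hT : 1 ≤ T)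
    (hp : ∀ a, ‖frameGrad v (fun y => (f y : ℂ)) x₀ a‖ ≤ T) (hv : ∀ i, ‖v i‖ ≤ T) (i : ι) {c : ℂ}
    (hc : ‖c‖ = 1) : ‖fderiv ℝ (jet v f) x₀ (c • v i)‖ ≤ 2 * T *
      (1 + lam i + ∑ a, ‖∂[v i] (fun x => frameGrad v (fun y => (f y : ℂ)) x a) x₀‖) := by
  set S := ∑ a, ‖∂[v i] (fun x => frameGrad v (fun y => (f y : ℂ)) x a) x₀‖ with hS
  have hS0 : 0 ≤ S := Finset.sum_nonneg fun a _ => norm_nonneg _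
  have hl := hlam i
  have hTl : 0 ≤ T * lam i := mul_nonneg (by linarith) hl
  have hTS : S ≤ T * S := le_mul_of_one_le_left hS0 hT
  have hTl' : lam i ≤ T * lam i := le_mul_of_one_le_left hl hT
  rw [fderiv_jet hf]
  refine norm_triple_le (by positivity) ?_ (fun a => ?_) ?_
  · rw [norm_smul, hc, one_mul]
    linarith [hv i]
  · rw [fderiv_smul_eq]
    refine (norm_add_le _ _).trans ?_
    rw [norm_mul, norm_mul, Complex.norm_conj, hc, one_mul, one_mul]
    have h1 : ‖∂[v i] (fun x => frameGrad v (fun y => (f y : ℂ)) x a) x₀‖ ≤ S :=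
      Finset.single_le_sum (f := fun a => ‖∂[v i] (fun x => frameGrad v _ x a) x₀‖)
        (fun a _ => norm_nonneg _) (Finset.mem_univ a)
    have h2 := norm_delBar_frameGrad_le hG0 hlam hX0 a i
    have h3 : (if a = i then lam i else 0) ≤ lam i := by split_ifs <;> simp [hl]
    linarith
  · have hfd := hf.differentiableAt (by norm_num)
    have h1 : ‖fderiv ℝ f x₀ (c • v i)‖ = ‖fderiv ℝ (fun y => (f y : ℂ)) x₀ (c • v i)‖ := by
      rw [fderiv_ofReal hfd, Complex.norm_real]
    rw [h1, fderiv_smul_eq, delBar_eq_conj_of_real hfd, ← map_mul]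
    refine (norm_add_le _ _).trans ?_
    have h2 : ‖∂[v i] (fun y => (f y : ℂ)) x₀‖ ≤ T := hp i
    rw [Complex.norm_conj, norm_mul, hc, one_mul]
    linarith

end Jet

/-! ### The linearized operator on the test function -/

section TestFunction

open Filter Topology

variable {n : ℕ} {x₀ : Cn n} {ι : Type*} [Fintype ι] [DecidableEq ι] {v : ι → Cn n} {f : Cn n → ℝ}
  {X B W : Cn n → Matrix ι ι ℂ} {lam : ι → ℝ} {T : ℝ} {Ψ : Cn n × (ι → ℂ) × ℝ → ℝ} {F : ι → ℝ}
  {m : ι}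

omit [Fintype ι] [DecidableEq ι] in
lemma lap_frameGrad {f : Cn n → ℂ} (hf : ContDiffAt ℝ 4 f x₀)
    (hX : ∀ a b, ContDiffAt ℝ 2 (fun y => X y a b) x₀) (a i : ι) :
    lap (v i) (fun x => frameGrad v f x a) x₀ =
      ∂[v a] (fun y => addHess v f X y i i) x₀ - ∂[v a] (fun y => X y i i) x₀ := by
  rw [← wirt_sub ((contDiffAt_addHess hf hX i i).differentiableAt (by norm_num))
    ((hX i i).differentiableAt (by norm_num))]
  refine (lap_del_comm (hf.of_le (by norm_num))).trans ?_
  congr 1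
  funext y
  simp [addHess, lap]

/-- The derivative of `Ψ` with respect to `∂f` in the direction `∂|∂f|²`. This third order term
appears, with opposite signs, both in the derivative of the test function and in the second
derivative of the right hand side. -/
def gradPairing (v : ι → Cn n) (f : Cn n → ℝ) (B : Cn n → Matrix ι ι ℂ)
    (Ψ : Cn n × (ι → ℂ) × ℝ → ℝ) (x₀ : Cn n) : ℝ :=
  (fderiv ℝ (fun p => (Ψ p : ℂ)) (jet v f x₀)
    (0, fun a => ∂[v a] (gradSq v (fun y => (f y : ℂ)) B) x₀, 0)).re

omit [DecidableEq ι] in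
lemma fderiv_comp_jet (hf : ContDiffAt ℝ 4 f x₀) (hΨ : ContDiffAt ℝ 2 Ψ (jet v f x₀)) (w : Cn n) :
    fderiv ℝ (fun y => (Ψ (jet v f y) : ℂ)) x₀ w =
      fderiv ℝ (fun p => (Ψ p : ℂ)) (jet v f x₀) (fderiv ℝ (jet v f) x₀ w) := by
  have hΨc : DifferentiableAt ℝ (fun p => (Ψ p : ℂ)) (jet v f x₀) :=
    Complex.ofRealCLM.differentiableAt.comp _ (hΨ.differentiableAt (by norm_num))
  have := fderiv_fun_comp x₀ hΨc ((contDiffAt_jet hf).differentiableAt (by norm_num))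
  rw [this]
  rfl

/-- The derivative of the right hand side in the direction of the gradient of `f` is the pairing
with `∂|∂f|²`, up to bounded terms. -/
lemma gradPairing_le (hf : ContDiffAt ℝ 4 f x₀)
    (hB : ∀ a b, ContDiffAt ℝ 2 (fun y => B y a b) x₀) (hB0 : B x₀ = 1)
    (hΨ : ContDiffAt ℝ 2 Ψ (jet v f x₀)) (hT : 1 ≤ T) (hv : ∀ i, ‖v i‖ ≤ T)
    (hp : ∀ a, ‖frameGrad v (fun y => (f y : ℂ)) x₀ a‖ ≤ T)
    (hdB : ∀ i a b, ‖∂[v i] (fun y => B y a b) x₀‖ ≤ T)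
    (hdΨ : ‖fderiv ℝ (fun p => (Ψ p : ℂ)) (jet v f x₀)‖ ≤ T) :
    gradPairing v f B Ψ x₀ - 2 * (Fintype.card ι + 1) ^ 2 * T ^ 4 ≤
      2 * (∑ a, (starRingEnd ℂ) (frameGrad v (fun y => (f y : ℂ)) x₀ a) *
        ∂[v a] (fun y => (Ψ (jet v f y) : ℂ)) x₀).re := by
  set fc : Cn n → ℂ := fun y => (f y : ℂ) with hfc
  have hfC : ContDiffAt ℝ 4 fc x₀ := contDiffAt_ofReal hf
  have hfd := hf.differentiableAt (by norm_num)
  set N : ℝ := (Fintype.card ι : ℝ) with hN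
  have hN0 : 0 ≤ N := by positivity
  have hT0 : 0 ≤ T := by linarith
  set p := frameGrad v fc x₀ with hpdef
  set w₀ : Cn n := ∑ a, (starRingEnd ℂ) (p a) • v a with hw₀
  have hψ : DifferentiableAt ℝ (fun y => Ψ (jet v f y)) x₀ :=
    (hΨ.comp x₀ (contDiffAt_jet hf)).differentiableAt (by norm_num)
  have h1 : ∀ b, ∂[v b] (gradSq v fc B) x₀ - fderiv ℝ (fun x => frameGrad v fc x b) x₀ w₀ =
      ∑ a, ∑ c, (starRingEnd ℂ) (p a) * p c * ∂[v b] (fun y => B y a c) x₀ := fun b => by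
    rw [del_gradSq hfC hB hB0, hw₀, map_sum]
    have : ∀ a, fderiv ℝ (fun x => frameGrad v fc x b) x₀ ((starRingEnd ℂ) (p a) • v a) =
        (starRingEnd ℂ) (∂̄[v b] (fun x => frameGrad v fc x a) x₀) * frameGrad v fc x₀ a +
        (starRingEnd ℂ) (frameGrad v fc x₀ a) * ∂[v b] (fun x => frameGrad v fc x a) x₀ := by
      intro a
      rw [fderiv_smul_eq, Complex.conj_conj]
      have e1 : ∂[v a] (fun x => frameGrad v fc x b) x₀ = ∂[v b] (fun x => frameGrad v fc x a) x₀ :=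
        wirt_comm (hfC.of_le (by norm_num))
      have e2 : (starRingEnd ℂ) (∂̄[v b] (fun x => frameGrad v fc x a) x₀) =
          ∂̄[v a] (fun x => frameGrad v fc x b) x₀ := by
        rw [← del_conj ((contDiffAt_frameGrad hfC a).differentiableAt (by norm_num))]
        have : (fun y => (starRingEnd ℂ) (frameGrad v fc y a)) =ᶠ[𝓝 x₀] ∂̄[v a] fc := by
          filter_upwards [eventually_contDiffAt (k := 4) hf] with y hy
          exact (delBar_eq_conj_of_real (hy.differentiableAt (by norm_num))).symm
        rw [wirt_congr_at this]
        exact wirt_comm (hfC.of_le (by norm_num))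
      rw [e1, e2, add_comm, mul_comm (p a)]
    simp only [this]
    rw [add_sub_cancel_right]
  have h2 : ∀ b, ‖∂[v b] (gradSq v fc B) x₀ - fderiv ℝ (fun x => frameGrad v fc x b) x₀ w₀‖ ≤
      N ^ 2 * T ^ 3 := fun b => by
    have e1 : N ^ 2 * T ^ 3 = ∑ _a : ι, ∑ _b : ι, T ^ 3 := by
      simp only [Finset.sum_const, Finset.card_univ, nsmul_eq_mul, ← hN]
      ring
    rw [h1, e1]
    refine norm_sum_le_of_le _ fun a _ => norm_sum_le_of_le _ fun c _ => ?_
    rw [norm_mul, norm_mul, Complex.norm_conj, pow_three, ← mul_assoc]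
    exact mul_le_mul (mul_le_mul (hp a) (hp c) (norm_nonneg _) hT0) (hdB b a c) (norm_nonneg _)
      (by positivity)
  have h3 : ‖w₀‖ ≤ N * T ^ 2 := by
    have e1 : N * T ^ 2 = ∑ _a : ι, T ^ 2 := by
      simp only [Finset.sum_const, Finset.card_univ, nsmul_eq_mul, ← hN]
    rw [e1]
    refine norm_sum_le_of_le _ fun a _ => ?_
    rw [norm_smul, Complex.norm_conj, sq]
    exact mul_le_mul (hp a) (hv a) (norm_nonneg _) hT0
  have h4 : ‖fderiv ℝ f x₀ w₀‖ ≤ 2 * N * T ^ 2 := by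
    have e1 : fderiv ℝ f x₀ w₀ = (fderiv ℝ fc x₀ w₀).re := by
      rw [fderiv_ofReal hfd, Complex.ofReal_re]
    have e2 : N * T ^ 2 = ∑ _a : ι, T ^ 2 := by
      simp only [Finset.sum_const, Finset.card_univ, nsmul_eq_mul, ← hN]
    rw [e1, re_fderiv_sum_smul _ hfd, mul_assoc, Real.norm_eq_abs, abs_mul, abs_two, e2]
    refine mul_le_mul_of_nonneg_left ((Complex.abs_re_le_norm _).trans ?_) zero_le_two
    refine norm_sum_le_of_le _ fun a _ => ?_
    rw [norm_mul, Complex.norm_conj, sq]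
    exact mul_le_mul (hp a) (hp a) (norm_nonneg _) hT0
  have hT23 : T ^ 2 ≤ T ^ 3 := pow_le_pow_right₀ hT (by norm_num)
  have h5 : ‖((0 : Cn n), (fun a => ∂[v a] (gradSq v fc B) x₀), (0 : ℝ)) -
      fderiv ℝ (jet v f) x₀ w₀‖ ≤ 2 * (N + 1) ^ 2 * T ^ 3 := by
    rw [fderiv_jet hf]
    have hT3 : 0 ≤ T ^ 3 := by positivity
    have e1 : N * T ^ 2 ≤ N * T ^ 3 := mul_le_mul_of_nonneg_left hT23 hN0
    have e2 : 0 ≤ N * T ^ 3 := mul_nonneg hN0 hT3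
    have e3 : 0 ≤ N ^ 2 * T ^ 3 := by positivity
    refine norm_triple_le (by positivity) ?_ (fun b => ?_) ?_
    · simp only [zero_sub, norm_neg]
      nlinarith
    · refine (h2 b).trans ?_
      nlinarith
    · simp only [zero_sub, norm_neg]
      nlinarith
  rw [← re_fderiv_sum_smul _ hψ, ← hw₀, fderiv_comp_jet hf hΨ, gradPairing]
  have h6 := (Complex.re_le_norm _).trans ((ContinuousLinearMap.le_opNorm
    (fderiv ℝ (fun p => (Ψ p : ℂ)) (jet v f x₀)) _).trans
      (mul_le_mul hdΨ h5 (norm_nonneg _) hT0))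
  rw [map_sub, Complex.sub_re] at h6
  have : T * (2 * (N + 1) ^ 2 * T ^ 3) = 2 * (N + 1) ^ 2 * T ^ 4 := by ring
  linarith

/-- The linearized operator applied to `|∂f|²`. -/
lemma le_sum_lap_gradSq (hf : ContDiffAt ℝ 4 f x₀)
    (hX : ∀ a b, ContDiffAt ℝ 2 (fun y => X y a b) x₀)
    (hB : ∀ a b, ContDiffAt ℝ 2 (fun y => B y a b) x₀) (hB0 : B x₀ = 1)
    (hG0 : addHess v (fun y => (f y : ℂ)) X x₀ = Matrix.diagonal fun a => (lam a : ℂ))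
    (hlam : ∀ i, 0 ≤ lam i) (hΨ : ContDiffAt ℝ 2 Ψ (jet v f x₀)) (hT : 1 ≤ T)
    (hv : ∀ i, ‖v i‖ ≤ T) (hX0 : ∀ a b, ‖X x₀ a b‖ ≤ T)
    (hp : ∀ a, ‖frameGrad v (fun y => (f y : ℂ)) x₀ a‖ ≤ T)
    (hdX : ∀ i a b, ‖∂[v i] (fun x => X x a b) x₀‖ ≤ T)
    (hdW : ∀ i a b, ‖∂[v i] (fun x => W x a b) x₀‖ ≤ T)
    (hdB : ∀ i a b, ‖∂[v i] (fun y => B y a b) x₀‖ ≤ T)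
    (hdB' : ∀ i a b, ‖∂̄[v i] (fun y => B y a b) x₀‖ ≤ T)
    (hlB : ∀ i a b, ‖lap (v i) (fun y => B y a b) x₀‖ ≤ T)
    (hdΨ : ‖fderiv ℝ (fun p => (Ψ p : ℂ)) (jet v f x₀)‖ ≤ T) (hF : ∀ i, 0 ≤ F i)
    (hE1 : ∀ a, ∑ i, (F i : ℂ) * (∂[v a] (fun x => addHess v (fun y => (f y : ℂ)) X x i i) x₀ -
      ∂[v a] (fun x => W x i i) x₀ * lam i) = ∂[v a] (fun y => (Ψ (jet v f y) : ℂ)) x₀)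
    {S : ℝ} (hS : ∑ i, F i * lam i ≤ S) :
    1 / 2 * ∑ i, F i * (∑ a, ‖∂[v i] (fun x => frameGrad v (fun y => (f y : ℂ)) x a) x₀‖ ^ 2 +
      lam i ^ 2) + gradPairing v f B Ψ x₀ -
        14 * (Fintype.card ι + 1) ^ 3 * T ^ 4 * (1 + S + ∑ i, F i) ≤
      ∑ i, F i * (lap (v i) (gradSq v (fun y => (f y : ℂ)) B) x₀).re := by
  set fc : Cn n → ℂ := fun y => (f y : ℂ) with hfc
  have hfC : ContDiffAt ℝ 4 fc x₀ := contDiffAt_ofReal hf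
  set N : ℝ := (Fintype.card ι : ℝ) with hN
  have hN0 : 0 ≤ N := by positivity
  have hT0 : 0 ≤ T := by linarith
  have hS0 : 0 ≤ S := (Finset.sum_nonneg fun i _ => mul_nonneg (hF i) (hlam i)).trans hS
  have hFF0 : 0 ≤ ∑ i, F i := Finset.sum_nonneg fun i _ => hF i
  have h1 := Finset.sum_le_sum fun i (_ : i ∈ Finset.univ) => mul_le_mul_of_nonneg_left
    (le_lap_gradSq hfC hB hB0 hG0 hlam hX0 hT hp hdB hdB' hlB i) (hF i)
  have h2 := gradPairing_le hf hB hB0 hΨ hT hv hp hdB hdΨ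
  -- the third order terms
  have h3 : ∀ a, ‖∑ i, (F i : ℂ) * lap (v i) (fun x => frameGrad v fc x a) x₀ -
      ∂[v a] (fun y => (Ψ (jet v f y) : ℂ)) x₀‖ ≤ T * (S + ∑ i, F i) := fun a => by
    rw [← hE1 a, ← Finset.sum_sub_distrib]
    have e1 : ∀ i, (F i : ℂ) * lap (v i) (fun x => frameGrad v fc x a) x₀ -
        (F i : ℂ) * (∂[v a] (fun x => addHess v fc X x i i) x₀ -
          ∂[v a] (fun x => W x i i) x₀ * lam i) =
        F i * lam i * ∂[v a] (fun x => W x i i) x₀ - F i * ∂[v a] (fun y => X y i i) x₀ :=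
      fun i => by rw [lap_frameGrad hfC hX]; ring
    simp only [e1]
    calc _ ≤ ∑ i, (F i * lam i * T + F i * T) := by
          refine norm_sum_le_of_le _ fun i _ => (norm_sub_le _ _).trans ?_
          rw [norm_mul, norm_mul, norm_mul, Complex.norm_real, Complex.norm_real,
            Real.norm_of_nonneg (hF i), Real.norm_of_nonneg (hlam i)]
          have := hlam i
          have := hF i
          gcongr
          · exact hdW a i i
          · exact hdX a i i
      _ = T * (∑ i, F i * lam i + ∑ i, F i) := by
          rw [Finset.sum_add_distrib, ← Finset.sum_mul, ← Finset.sum_mul]; ring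
      _ ≤ _ := by gcongr
  have h4 : ∑ i, F i * (2 * (∑ a, (starRingEnd ℂ) (frameGrad v fc x₀ a) *
        lap (v i) (fun x => frameGrad v fc x a) x₀).re) =
      2 * (∑ a, (starRingEnd ℂ) (frameGrad v fc x₀ a) *
        ∂[v a] (fun y => (Ψ (jet v f y) : ℂ)) x₀).re +
      2 * (∑ a, (starRingEnd ℂ) (frameGrad v fc x₀ a) *
        (∑ i, (F i : ℂ) * lap (v i) (fun x => frameGrad v fc x a) x₀ -
          ∂[v a] (fun y => (Ψ (jet v f y) : ℂ)) x₀)).re := by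
    rw [← mul_add, ← Complex.add_re, ← Finset.sum_add_distrib]
    simp only [← mul_add, add_sub_cancel]
    simp only [Finset.mul_sum]
    rw [Finset.sum_comm, Complex.re_sum, Finset.mul_sum]
    simp only [Complex.re_sum, Finset.mul_sum]
    refine Finset.sum_congr rfl fun i _ => Finset.sum_congr rfl fun a _ => ?_
    rw [mul_left_comm ((starRingEnd ℂ) _), Complex.re_ofReal_mul]
    ring
  have h5 : -(N * (T * (T * (S + ∑ i, F i)))) ≤ (∑ a, (starRingEnd ℂ) (frameGrad v fc x₀ a) *
        (∑ i, (F i : ℂ) * lap (v i) (fun x => frameGrad v fc x a) x₀ -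
          ∂[v a] (fun y => (Ψ (jet v f y) : ℂ)) x₀)).re := by
    refine neg_le_of_abs_le ((Complex.abs_re_le_norm _).trans ?_)
    have e1 : N * (T * (T * (S + ∑ i, F i))) = ∑ _a : ι, T * (T * (S + ∑ i, F i)) := by
      simp only [Finset.sum_const, Finset.card_univ, nsmul_eq_mul, ← hN]
    rw [e1]
    refine norm_sum_le_of_le _ fun a _ => ?_
    rw [norm_mul, Complex.norm_conj]
    exact mul_le_mul (hp a) (h3 a) (norm_nonneg _) hT0
  have h6 : ∑ i, F i * (2 * (∑ a, (starRingEnd ℂ) (frameGrad v fc x₀ a) *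
        lap (v i) (fun x => frameGrad v fc x a) x₀).re +
      1 / 2 * (∑ a, ‖∂[v i] (fun x => frameGrad v fc x a) x₀‖ ^ 2 + lam i ^ 2) -
        10 * (N + 1) ^ 3 * T ^ 4) = ∑ i, F i * (2 * (∑ a, (starRingEnd ℂ) (frameGrad v fc x₀ a) *
        lap (v i) (fun x => frameGrad v fc x a) x₀).re) +
      1 / 2 * ∑ i, F i * (∑ a, ‖∂[v i] (fun x => frameGrad v fc x a) x₀‖ ^ 2 + lam i ^ 2) -
        10 * (N + 1) ^ 3 * T ^ 4 * ∑ i, F i := by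
    rw [Finset.mul_sum, Finset.mul_sum, ← Finset.sum_add_distrib, ← Finset.sum_sub_distrib]
    exact Finset.sum_congr rfl fun i _ => by ring
  rw [h6, h4] at h1
  have hc : T ^ 2 ≤ T ^ 4 := pow_le_pow_right₀ hT (by norm_num)
  have hN3 : (N + 1) ^ 2 ≤ (N + 1) ^ 3 := pow_le_pow_right₀ (by linarith) (by norm_num)
  have hN1 : N ≤ (N + 1) ^ 3 := by nlinarith
  have e1 : N * (T * (T * (S + ∑ i, F i))) ≤ (N + 1) ^ 3 * T ^ 4 * (S + ∑ i, F i) := by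
    calc _ = N * T ^ 2 * (S + ∑ i, F i) := by ring
      _ ≤ _ := by gcongr
  have e2 : 2 * (N + 1) ^ 2 * T ^ 4 ≤ 2 * (N + 1) ^ 3 * T ^ 4 := by gcongr
  have e3 : 0 ≤ (N + 1) ^ 3 * T ^ 4 * S := by positivity
  have e4 : 0 ≤ (N + 1) ^ 3 * T ^ 4 * ∑ i, F i := by positivity
  have e5 : 0 ≤ (N + 1) ^ 3 * T ^ 4 := by positivity
  linarith

end TestFunction

/-! ### The eigenvalue bound at a maximum point -/

section LocalEstimate

open Filter Topology

variable {n : ℕ} {x₀ : Cn n} {ι : Type*} [Fintype ι] {v : ι → Cn n} {f : Cn n → ℝ}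
  {X B W : Cn n → Matrix ι ι ℂ} {lam : ι → ℝ} {T : ℝ} {Ψ : Cn n × (ι → ℂ) × ℝ → ℝ}
  {m : ι} {A N M : ℝ}

/-- The logarithm `N |∂f|² + exp (M (A + 1 - f))` of the factor by which the eigenvalues of
`X + √-1 ∂∂̄f` are multiplied in the test function. -/
def testExp (v : ι → Cn n) (f : Cn n → ℝ) (B : Cn n → Matrix ι ι ℂ) (A N M : ℝ) (x : Cn n) : ℝ :=
  N * (gradSq v (fun y => (f y : ℂ)) B x).re + Real.exp (M * (A + 1 - f x))

lemma ofReal_testExp (hBh : ∀ᶠ x in 𝓝 x₀, (B x).IsHermitian) :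
    (fun x => (testExp v f B A N M x : ℂ)) =ᶠ[𝓝 x₀] fun x =>
      (N : ℂ) * gradSq v (fun y => (f y : ℂ)) B x + Complex.exp (M * (A + 1 - f x)) := by
  filter_upwards [hBh] with x hx
  have h := quad_im_eq_zero hx fun a => (starRingEnd ℂ) (frameGrad v (fun y => (f y : ℂ)) x a)
  simp only [Complex.conj_conj] at h
  have h2 : ((gradSq v (fun y => (f y : ℂ)) B x).re : ℂ) = gradSq v (fun y => (f y : ℂ)) B x :=
    h
  rw [testExp]
  push_cast
  rw [h2]

lemma contDiffAt_testExp (hf : ContDiffAt ℝ 4 f x₀)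
    (hB : ∀ a b, ContDiffAt ℝ 2 (fun y => B y a b) x₀) :
    ContDiffAt ℝ 2 (testExp v f B A N M) x₀ := by
  refine (contDiffAt_const.mul (Complex.reCLM.contDiff.contDiffAt.comp x₀
    (contDiffAt_gradSq (contDiffAt_ofReal hf) hB))).add ?_
  exact (contDiffAt_const.mul (contDiffAt_const.sub (hf.of_le (by norm_num)))).exp

lemma contDiffAt_expArg (hf : ContDiffAt ℝ 4 f x₀) :
    ContDiffAt ℝ 2 (fun x => (M : ℂ) * (A + 1 - f x)) x₀ :=
  contDiffAt_const.mul (contDiffAt_const.sub ((contDiffAt_ofReal hf).of_le (by norm_num)))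

lemma wirt_expArg {c : ℂ} {w : Cn n} (hf : ContDiffAt ℝ 4 f x₀) :
    wirt c w (fun x => (M : ℂ) * (A + 1 - f x)) x₀ = -(M * wirt c w (fun y => (f y : ℂ)) x₀) := by
  have h1 := (contDiffAt_ofReal hf).differentiableAt (by norm_num)
  rw [wirt_const_mul _ ((differentiableAt_const _).fun_sub h1),
    wirt_sub (differentiableAt_const _) h1, wirt_const]
  ring

lemma del_testExp (hf : ContDiffAt ℝ 4 f x₀) (hB : ∀ a b, ContDiffAt ℝ 2 (fun y => B y a b) x₀)
    (hBh : ∀ᶠ x in 𝓝 x₀, (B x).IsHermitian) (w : Cn n) :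
    ∂[w] (fun x => (testExp v f B A N M x : ℂ)) x₀ =
      N * ∂[w] (gradSq v (fun y => (f y : ℂ)) B) x₀ -
        (M * Real.exp (M * (A + 1 - f x₀)) : ℝ) * ∂[w] (fun y => (f y : ℂ)) x₀ := by
  have h1 := (contDiffAt_gradSq (v := v) (contDiffAt_ofReal hf) hB).differentiableAt (by norm_num)
  have h2 := (contDiffAt_expArg (M := M) (A := A) hf).differentiableAt (by norm_num)
  rw [wirt_congr_at (ofReal_testExp hBh), wirt_add (h1.const_mul _) h2.cexp,
    wirt_const_mul _ h1, wirt_cexp h2, wirt_expArg hf]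
  push_cast
  ring

lemma lap_testExp (hf : ContDiffAt ℝ 4 f x₀) (hB : ∀ a b, ContDiffAt ℝ 2 (fun y => B y a b) x₀)
    (hBh : ∀ᶠ x in 𝓝 x₀, (B x).IsHermitian) (w : Cn n) :
    (lap w (fun x => (testExp v f B A N M x : ℂ)) x₀).re =
      N * (lap w (gradSq v (fun y => (f y : ℂ)) B) x₀).re +
        Real.exp (M * (A + 1 - f x₀)) * (M ^ 2 * ‖∂[w] (fun y => (f y : ℂ)) x₀‖ ^ 2 -
          M * (lap w (fun y => (f y : ℂ)) x₀).re) := by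
  have h1 := contDiffAt_gradSq (v := v) (contDiffAt_ofReal hf) hB
  have h2 := contDiffAt_expArg (M := M) (A := A) hf
  have h3 : ContDiffAt ℝ 2 (fun y => (f y : ℂ)) x₀ := (contDiffAt_ofReal hf).of_le (by norm_num)
  rw [lap_congr_at (ofReal_testExp hBh), lap_add (contDiffAt_const.mul h1) h2.cexp,
    lap_const_mul _ h1, lap_cexp h2, wirt_expArg hf, wirt_expArg hf,
    lap_const_mul _ (contDiffAt_const.sub h3), lap_sub contDiffAt_const h3,
    delBar_eq_conj_of_real (hf.differentiableAt (by norm_num))]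
  have h4 : lap w (fun _ : Cn n => (A : ℂ) + 1) x₀ = 0 := by simp [lap]
  have h5 : Complex.exp (M * (A + 1 - f x₀)) = (Real.exp (M * (A + 1 - f x₀)) : ℝ) := by
    push_cast; rfl
  have h6 : -(M * ∂[w] (fun y => (f y : ℂ)) x₀) *
      -(M * (starRingEnd ℂ) (∂[w] (fun y => (f y : ℂ)) x₀)) =
      ((M ^ 2 * ‖∂[w] (fun y => (f y : ℂ)) x₀‖ ^ 2 : ℝ) : ℂ) := by
    push_cast
    rw [← Complex.mul_conj']
    ring
  rw [h4, h5, h6, Complex.add_re, Complex.re_ofReal_mul, Complex.re_ofReal_mul, Complex.add_re,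
    Complex.ofReal_re, Complex.re_ofReal_mul, Complex.sub_re, Complex.zero_re]
  ring

variable [DecidableEq ι]

omit [DecidableEq ι] in
lemma sq_one_add_add_sum_norm_le (i : ι) {R c : ℝ}
    (hR : R ≤ c * (1 + lam i +
      ∑ a, ‖∂[v i] (fun x => frameGrad v (fun y => (f y : ℂ)) x a) x₀‖)) (hR0 : 0 ≤ R) :
    R ^ 2 ≤ c ^ 2 * (3 * (Fintype.card ι + 1)) *
      (1 + ∑ a, ‖∂[v i] (fun x => frameGrad v (fun y => (f y : ℂ)) x a) x₀‖ ^ 2 + lam i ^ 2) := by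
  refine (pow_le_pow_left₀ hR0 hR 2).trans ?_
  rw [mul_pow, mul_assoc]
  exact mul_le_mul_of_nonneg_left (one_add_add_sum_sq_le _ _) (by positivity)

section RightHandSide

variable (hf : ContDiffAt ℝ 4 f x₀)
    (hG0 : addHess v (fun y => (f y : ℂ)) X x₀ = Matrix.diagonal fun a => (lam a : ℂ))
    (hlam : ∀ i, 0 ≤ lam i) (hΨ : ContDiffAt ℝ 2 Ψ (jet v f x₀)) (hT : 1 ≤ T)
    (hv : ∀ i, ‖v i‖ ≤ T) (hX0 : ∀ a b, ‖X x₀ a b‖ ≤ T)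
    (hp : ∀ a, ‖frameGrad v (fun y => (f y : ℂ)) x₀ a‖ ≤ T)
    (hdΨ : ‖fderiv ℝ (fun p => (Ψ p : ℂ)) (jet v f x₀)‖ ≤ T)
include hf hG0 hlam hΨ hT hv hX0 hp hdΨ

lemma norm_del_rhs_sq_le (i : ι) :
    ‖∂[v i] (fun x => (Ψ (jet v f x) : ℂ)) x₀‖ ^ 2 ≤ 12 * (Fintype.card ι + 1) * T ^ 4 *
      (1 + ∑ a, ‖∂[v i] (fun x => frameGrad v (fun y => (f y : ℂ)) x a) x₀‖ ^ 2 + lam i ^ 2) := by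
  have hΨc : ContDiffAt ℝ 2 (fun p => (Ψ p : ℂ)) (jet v f x₀) :=
    Complex.ofRealCLM.contDiff.contDiffAt.comp _ hΨ
  have h1 := norm_fderiv_jet_le hf hG0 hlam hX0 hT hp hv i (c := 1) (by simp)
  rw [one_smul] at h1
  have h2 := norm_fderiv_jet_le hf hG0 hlam hX0 hT hp hv i (c := Complex.I) (by simp)
  have h3 := norm_wirt_comp_le (contDiffAt_jet hf) hΨc (c := -Complex.I)
    (by simp) hdΨ h1 h2
  rw [← mul_assoc] at h3
  refine (sq_one_add_add_sum_norm_le i h3 (norm_nonneg _)).trans_eq ?_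
  ring

/-- The second derivative of the right hand side along `v m`, at a point where the derivative of
`G m m - lam m * W m m` is prescribed by the critical point equation of the test function. -/
lemma le_lap_rhs (hX : ∀ a b, ContDiffAt ℝ 2 (fun y => X y a b) x₀)
    (hdX : ∀ i a b, ‖∂[v i] (fun x => X x a b) x₀‖ ≤ T)
    (hdW : ∀ i a b, ‖∂[v i] (fun x => W x a b) x₀‖ ≤ T)
    (hddΨ : ‖fderiv ℝ (fderiv ℝ (fun p => (Ψ p : ℂ))) (jet v f x₀)‖ ≤ T)
    (hm1 : 1 ≤ lam m) {c : ℝ} (hc : 0 ≤ c)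
    (hcrit : ∀ a, ∂[v a] (fun x => addHess v (fun y => (f y : ℂ)) X x m m) x₀ -
      lam m * ∂[v a] (fun x => W x m m) x₀ = -(lam m * (N * ∂[v a] (gradSq v (fun y => (f y : ℂ)) B)
        x₀ - c * ∂[v a] (fun y => (f y : ℂ)) x₀))) :
    -(lam m * (N * gradPairing v f B Ψ x₀)) - 2 * T ^ 2 * lam m * (1 + c) -
        12 * (Fintype.card ι + 1) * T ^ 3 *
      (1 + ∑ a, ‖∂[v m] (fun x => frameGrad v (fun y => (f y : ℂ)) x a) x₀‖ ^ 2 + lam m ^ 2) ≤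
      (lap (v m) (fun x => (Ψ (jet v f x) : ℂ)) x₀).re := by
  have hT0 : 0 ≤ T := by linarith
  have hfC : ContDiffAt ℝ 4 (fun y => (f y : ℂ)) x₀ := contDiffAt_ofReal hf
  have hΨc : ContDiffAt ℝ 2 (fun p => (Ψ p : ℂ)) (jet v f x₀) :=
    Complex.ofRealCLM.contDiff.contDiffAt.comp _ hΨ
  have h1 := norm_fderiv_jet_le hf hG0 hlam hX0 hT hp hv m (c := 1) (by simp)
  rw [one_smul] at h1
  have h2 := norm_fderiv_jet_le hf hG0 hlam hX0 hT hp hv m (c := Complex.I) (by simp)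
  have h3 := norm_lap_comp_sub_le (contDiffAt_jet hf) hΨc hddΨ h1 h2
  have h4 := sq_one_add_add_sum_norm_le (f := f) (v := v) (x₀ := x₀) (lam := lam) m
    (c := 2 * T) le_rfl (by have := hlam m; positivity)
  have h5 := (abs_le.1 ((Complex.abs_re_le_norm _).trans h3)).1
  rw [Complex.sub_re, lapVec_jet hf] at h5
  set ρ' : ι → ℂ := fun a => ∂[v a] (gradSq v (fun y => (f y : ℂ)) B) x₀ with hρ'
  set l := (lap (v m) (fun y => (f y : ℂ)) x₀).re with hl
  set q : ι → ℂ := fun a => lam m * (c * ∂[v a] (fun y => (f y : ℂ)) x₀) +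
    lam m * ∂[v a] (fun x => W x m m) x₀ - ∂[v a] (fun y => X y m m) x₀ with hq
  have h6 : ((0 : Cn n), (fun a => lap (v m) (fun x => frameGrad v (fun y => (f y : ℂ)) x a) x₀), l)
      = (-(lam m * N)) • ((0 : Cn n), ρ', (0 : ℝ)) + (0, q, l) := by
    simp only [Prod.smul_mk, Prod.mk_add_mk, smul_zero, zero_add, add_zero]
    congr 2
    funext a
    rw [lap_frameGrad hfC hX]
    simp only [Pi.add_apply, Pi.smul_apply, Complex.real_smul, hq, hρ']
    push_cast
    linear_combination hcrit a
  have hl' : |l| ≤ lam m + T := by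
    have e1 : addHess v (fun y => (f y : ℂ)) X x₀ m m = lam m := by rw [hG0]; simp
    have e2 : l = lam m - (X x₀ m m).re := by
      have := congrArg Complex.re e1
      simp only [addHess, Matrix.of_apply, Complex.add_re, Complex.ofReal_re] at this
      rw [← this, add_sub_cancel_left]
      rfl
    rw [e2]
    have := abs_le.1 ((Complex.abs_re_le_norm _).trans (hX0 m m))
    rw [abs_le]
    constructor <;> linarith
  have hTl : T ≤ T * lam m := le_mul_of_one_le_right hT0 hm1
  have hlT : lam m ≤ T * lam m := le_mul_of_one_le_left (by linarith) hT
  have hcT : 0 ≤ c * (T * lam m) := by positivity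
  have hlmn : ‖(lam m : ℂ)‖ = lam m := by rw [Complex.norm_real, Real.norm_of_nonneg (hlam m)]
  have h7 : ‖((0 : Cn n), q, l)‖ ≤ 2 * T * lam m * (1 + c) := by
    refine norm_triple_le (by have := hlam m; positivity) ?_ (fun a => ?_) ?_
    · rw [norm_zero]; have := hlam m; positivity
    · refine (norm_sub_le _ _).trans ((add_le_add (norm_add_le _ _) le_rfl).trans ?_)
      rw [norm_mul, norm_mul, norm_mul, hlmn, Complex.norm_real, Real.norm_of_nonneg hc]
      have e1 : lam m * (c * ‖∂[v a] (fun y => (f y : ℂ)) x₀‖) ≤ lam m * (c * T) :=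
        mul_le_mul_of_nonneg_left (mul_le_mul_of_nonneg_left (hp a) hc) (hlam m)
      have e2 := mul_le_mul_of_nonneg_left (hdW a m m) (hlam m)
      have e3 := hdX a m m
      nlinarith
    · rw [Real.norm_eq_abs]
      nlinarith
  have h8 := (abs_le.1 ((Complex.abs_re_le_norm _).trans ((ContinuousLinearMap.le_opNorm
    (fderiv ℝ (fun p => (Ψ p : ℂ)) (jet v f x₀)) _).trans
      (mul_le_mul hdΨ h7 (norm_nonneg _) hT0)))).1
  rw [h6, map_add, map_smul, Complex.add_re, Complex.smul_re, smul_eq_mul] at h5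
  have h9 : (fderiv ℝ (fun p => (Ψ p : ℂ)) (jet v f x₀) (0, ρ', 0)).re =
    gradPairing v f B Ψ x₀ := rfl
  rw [h9] at h5
  have h10 := mul_le_mul_of_nonneg_left h4 hT0
  nlinarith

end RightHandSide

end LocalEstimate

section EigenvalueBound

open Filter Topology

variable {n : ℕ} {ι : Type*} [Fintype ι] [DecidableEq ι]

/-- The situation at a maximum point `x₀` of the test function: `v` is a frame of constant vector
fields in which `W x₀ = B x₀ = 1` and `X + √-1 ∂∂̄f` is diagonal at `x₀` with largest eigenvalue
`lam m`, and `f` solves the Hessian equation with right hand side `Ψ`, a function of the 1-jet of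
`f`. Here `X` is `χ(·, f)`, `W` is the metric and `B` its dual. All data are bounded by `T` at `x₀`;
the bound for the second derivatives of `X`, which involve those of `f`, is linear in `lam`. -/
structure MaxPointData (k : ℕ) (ε A T N M : ℝ) (f : Cn n → ℝ) (X W B : Cn n → Matrix ι ι ℂ)
    (Ψ : Cn n × (ι → ℂ) × ℝ → ℝ) (v : ι → Cn n) (x₀ : Cn n) (lam : ι → ℝ) (m : ι) : Prop where
  f_contDiffAt : ContDiffAt ℝ 4 f x₀
  X_contDiffAt : ∀ a b, ContDiffAt ℝ 2 (fun x => X x a b) x₀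
  W_contDiffAt : ∀ a b, ContDiffAt ℝ 2 (fun x => W x a b) x₀
  B_contDiffAt : ∀ a b, ContDiffAt ℝ 2 (fun x => B x a b) x₀
  Ψ_contDiffAt : ContDiffAt ℝ 2 Ψ (jet v f x₀)
  addHess_isHermitian : ∀ᶠ x in 𝓝 x₀, (addHess v (fun y => (f y : ℂ)) X x).IsHermitian
  W_isHermitian : ∀ᶠ x in 𝓝 x₀, (W x).IsHermitian
  B_isHermitian : ∀ᶠ x in 𝓝 x₀, (B x).IsHermitian
  addHess_eq : addHess v (fun y => (f y : ℂ)) X x₀ = Matrix.diagonal fun a => (lam a : ℂ)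
  W_eq : W x₀ = 1
  B_eq : B x₀ = 1
  lam_pos : ∀ a, 0 < lam a
  lam_le : ∀ a, lam a ≤ lam m
  exists_dual : ∀ a, ∃ ℓ : Cn n →L[ℂ] ℂ, ℓ (v a) = 1
  equation : ∀ᶠ x in 𝓝 x₀, mixedDet k (addHess v (fun y => (f y : ℂ)) X x) (W x) =
    (Ψ (jet v f x) : ℂ) * (W x).det
  isMax : ∀ᶠ x in 𝓝 x₀, ∀ y : ι → ℂ,
    (∑ a, ∑ b, y a * (starRingEnd ℂ) (y b) * addHess v (fun y => (f y : ℂ)) X x a b).re *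
      Real.exp (testExp v f B A N M x) ≤
    lam m * Real.exp (testExp v f B A N M x₀) *
      (∑ a, ∑ b, y a * (starRingEnd ℂ) (y b) * W x a b).re
  abs_f_le : |f x₀| ≤ A
  le_X : ∀ a, ε ≤ (X x₀ a a).re
  norm_v : ∀ i, ‖v i‖ ≤ T
  norm_grad : ∀ a, ‖frameGrad v (fun y => (f y : ℂ)) x₀ a‖ ≤ T
  norm_X : ∀ a b, ‖X x₀ a b‖ ≤ T
  norm_del_X : ∀ i a b, ‖∂[v i] (fun x => X x a b) x₀‖ ≤ T
  norm_lap_X : ∀ i a, ‖lap (v i) (fun x => X x a a) x₀‖ ≤ T * (1 + lam i)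
  norm_del_W : ∀ i a b, ‖∂[v i] (fun x => W x a b) x₀‖ ≤ T
  norm_lap_W : ∀ i a b, ‖lap (v i) (fun x => W x a b) x₀‖ ≤ T
  norm_del_B : ∀ i a b, ‖∂[v i] (fun x => B x a b) x₀‖ ≤ T
  norm_delBar_B : ∀ i a b, ‖∂̄[v i] (fun x => B x a b) x₀‖ ≤ T
  norm_lap_B : ∀ i a b, ‖lap (v i) (fun x => B x a b) x₀‖ ≤ T
  norm_fderiv_Ψ : ‖fderiv ℝ (fun p => (Ψ p : ℂ)) (jet v f x₀)‖ ≤ T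
  norm_fderiv_fderiv_Ψ : ‖fderiv ℝ (fderiv ℝ (fun p => (Ψ p : ℂ))) (jet v f x₀)‖ ≤ T
  inv_le_Ψ : 1 / T ≤ Ψ (jet v f x₀)
  Ψ_le : Ψ (jet v f x₀) ≤ T

namespace MaxPointData

variable {k : ℕ} {ε A T N M : ℝ} {f : Cn n → ℝ} {X W B : Cn n → Matrix ι ι ℂ}
  {Ψ : Cn n × (ι → ℂ) × ℝ → ℝ} {v : ι → Cn n} {x₀ : Cn n} {lam : ι → ℝ} {m : ι}

/-- The equation at the maximum point, in terms of eigenvalues. -/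
lemma elemSymm_eq (h : MaxPointData k ε A T N M f X W B Ψ v x₀ lam m) :
    elemSymm k Finset.univ lam = Ψ (jet v f x₀) := by
  have := h.equation.self_of_nhds
  rw [h.addHess_eq, h.W_eq, mixedDet_diagonal_one, Matrix.det_one, mul_one] at this
  exact_mod_cast this

/-- The first order condition at the maximum point. -/
lemma crit (h : MaxPointData k ε A T N M f X W B Ψ v x₀ lam m) (a : ι) :
    ∂[v a] (fun x => addHess v (fun y => (f y : ℂ)) X x m m) x₀ -
      lam m * ∂[v a] (fun x => W x m m) x₀ =
      -(lam m * ∂[v a] (fun x => (testExp v f B A N M x : ℂ)) x₀) := by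
  obtain ⟨ℓ, hℓ⟩ := h.exists_dual a
  exact (max_principle (contDiffAt_addHess (contDiffAt_ofReal h.f_contDiffAt) h.X_contDiffAt)
    h.W_contDiffAt h.addHess_isHermitian h.W_isHermitian h.addHess_eq h.W_eq
    (fun b => (h.lam_pos b).le) (h.lam_pos m)
    (contDiffAt_testExp h.f_contDiffAt h.B_contDiffAt) hℓ h.isMax).1

/-- The linearized operator applied to `f`: the strict positivity of `X` gives the good term
`-ε ∑ F`. -/
lemma sum_mul_lap (h : MaxPointData k ε A T N M f X W B Ψ v x₀ lam m) {F : ι → ℝ}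
    (hF : ∀ i, 0 ≤ F i) : ∑ i, F i * (lap (v i) (fun y => (f y : ℂ)) x₀).re ≤
      ∑ i, F i * lam i - ε * ∑ i, F i := by
  rw [Finset.mul_sum, ← Finset.sum_sub_distrib]
  refine Finset.sum_le_sum fun i _ => ?_
  have e1 : addHess v (fun y => (f y : ℂ)) X x₀ i i = lam i := by rw [h.addHess_eq]; simp
  have e2 : (lap (v i) (fun y => (f y : ℂ)) x₀).re = lam i - (X x₀ i i).re := by
    have := congrArg Complex.re e1
    simp only [addHess, Matrix.of_apply, Complex.add_re, Complex.ofReal_re] at this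
    rw [← this, add_sub_cancel_left]
    rfl
  rw [e2]
  nlinarith [h.le_X i, hF i]

/-- The linearized operator applied to the exponent of the test function. -/
lemma le_sum_lap_testExp {j : ℕ} (h : MaxPointData (j + 2) ε A T N M f X W B Ψ v x₀ lam m)
    (hj : j + 2 ≤ Fintype.card ι) (hT : 1 ≤ T) (hN : 0 ≤ N) (hM : 0 ≤ M) {C φ : ℝ}
    (hC : 28 * (Fintype.card ι + 1) ^ 4 * T ^ 5 ≤ C) (hφ : φ = Real.exp (M * (A + 1 - f x₀)))
    {F : ι → ℝ} (hF : F = fun i => elemSymm (j + 1) (Finset.univ.erase i) lam) :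
    N * (1 / 2 * ∑ i, F i * (∑ a, ‖∂[v i] (fun x => frameGrad v (fun y => (f y : ℂ)) x a) x₀‖ ^ 2 +
      lam i ^ 2) + gradPairing v f B Ψ x₀ - C * (1 + ∑ i, F i))
      + M * φ * (ε * ∑ i, F i - C) +
        M ^ 2 * φ * ∑ i, F i * ‖∂[v i] (fun y => (f y : ℂ)) x₀‖ ^ 2 ≤
      ∑ i, F i * (lap (v i) (fun x => (testExp v f B A N M x : ℂ)) x₀).re := by
  have hF0 : ∀ i, 0 ≤ F i := fun i => by
    rw [hF]; exact elemSymm_nonneg _ fun i _ => h.lam_pos i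
  set c : ℝ := (Fintype.card ι : ℝ) with hc
  have hc0 : 0 ≤ c := by positivity
  have hT0 : 0 ≤ T := by linarith
  have hFF : 0 ≤ ∑ i, F i := Finset.sum_nonneg fun i _ => hF0 i
  have hS : ∑ i, F i * lam i ≤ c * T := by
    have h1 := sum_mul_elemSymm_erase (j + 1) Finset.univ lam
    rw [h.elemSymm_eq] at h1
    simp only [hF, mul_comm (elemSymm _ _ _)]
    rw [h1]
    have h2 : (((j + 1 : ℕ) : ℝ) + 1) ≤ c := by
      rw [hc]; exact_mod_cast hj
    have h3 : 0 ≤ Ψ (jet v f x₀) := le_trans (by positivity) h.inv_le_Ψ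
    exact mul_le_mul h2 h.Ψ_le h3 hc0
  have hE1 : ∀ a, ∑ i, (F i : ℂ) * (∂[v a] (fun x => addHess v (fun y => (f y : ℂ)) X x i i) x₀ -
      ∂[v a] (fun x => W x i i) x₀ * lam i) = ∂[v a] (fun y => (Ψ (jet v f y) : ℂ)) x₀ := fun a => by
    obtain ⟨ℓ, hℓ⟩ := h.exists_dual a
    rw [hF]
    exact (equation_deriv (contDiffAt_addHess (contDiffAt_ofReal h.f_contDiffAt) h.X_contDiffAt)
      h.W_contDiffAt h.addHess_isHermitian h.W_isHermitian h.addHess_eq h.W_eq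
      (h.Ψ_contDiffAt.comp x₀ (contDiffAt_jet h.f_contDiffAt)) hℓ hj h.equation).1
  have h1 := le_sum_lap_gradSq h.f_contDiffAt h.X_contDiffAt h.B_contDiffAt h.B_eq h.addHess_eq
    (fun i => (h.lam_pos i).le) h.Ψ_contDiffAt hT h.norm_v h.norm_X h.norm_grad h.norm_del_X
    h.norm_del_W h.norm_del_B h.norm_delBar_B h.norm_lap_B h.norm_fderiv_Ψ hF0 hE1 hS
  have h2 := h.sum_mul_lap hF0
  have h3 : ∑ i, F i * (lap (v i) (fun x => (testExp v f B A N M x : ℂ)) x₀).re =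
      N * ∑ i, F i * (lap (v i) (gradSq v (fun y => (f y : ℂ)) B) x₀).re +
      M ^ 2 * φ * ∑ i, F i * ‖∂[v i] (fun y => (f y : ℂ)) x₀‖ ^ 2 -
      M * φ * ∑ i, F i * (lap (v i) (fun y => (f y : ℂ)) x₀).re := by
    rw [Finset.mul_sum, Finset.mul_sum, Finset.mul_sum, ← Finset.sum_add_distrib,
      ← Finset.sum_sub_distrib]
    refine Finset.sum_congr rfl fun i _ => ?_
    rw [lap_testExp h.f_contDiffAt h.B_contDiffAt h.B_isHermitian, ← hφ]
    ring
  have hφ0 : 0 ≤ φ := by rw [hφ]; positivity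
  have hT4 : 0 ≤ T ^ 4 := by positivity
  have hTT : T ^ 4 ≤ T ^ 5 := pow_le_pow_right₀ hT (by norm_num)
  have hcc : (c + 1) ^ 3 ≤ (c + 1) ^ 4 := pow_le_pow_right₀ (by linarith) (by norm_num)
  have e1 : 14 * (c + 1) ^ 3 * T ^ 4 * (1 + c * T + ∑ i, F i) ≤ C * (1 + ∑ i, F i) := by
    have hcT : 1 + c * T ≤ (c + 1) * T := by linarith
    have hpos : 0 ≤ (c + 1) ^ 4 * T ^ 5 := by positivity
    calc _ ≤ 14 * (c + 1) ^ 3 * T ^ 4 * ((c + 1) * T * (1 + ∑ i, F i)) := by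
          refine mul_le_mul_of_nonneg_left ?_ (by positivity)
          have h1cT : 1 ≤ (c + 1) * T := by nlinarith
          linarith [mul_le_mul_of_nonneg_right h1cT hFF]
      _ = 14 * (c + 1) ^ 4 * T ^ 5 * (1 + ∑ i, F i) := by ring
      _ ≤ _ := mul_le_mul_of_nonneg_right (by linarith) (by linarith)
  have e2 : c * T ≤ C := by
    refine le_trans ?_ hC
    have : c ≤ 28 * (c + 1) ^ 4 := by nlinarith [pow_nonneg hc0 2, pow_nonneg hc0 3, pow_nonneg hc0 4]
    have h5 : T ≤ T ^ 5 := le_self_pow₀ hT (by norm_num)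
    exact mul_le_mul this h5 hT0 (by positivity)
  have e3 : M * φ * ∑ i, F i * (lap (v i) (fun y => (f y : ℂ)) x₀).re ≤
      M * φ * (C - ε * ∑ i, F i) := mul_le_mul_of_nonneg_left (by linarith) (by positivity)
  have e4 := mul_le_mul_of_nonneg_left (h1.trans' (sub_le_sub_left e1 _)) hN
  rw [h3]
  linarith

lemma le_elemSymm_erase {j : ℕ} (h : MaxPointData (j + 2) ε A T N M f X W B Ψ v x₀ lam m)
    (hT : 1 ≤ T) {τ : ℝ} (hτ0 : 0 ≤ τ) (hτ : τ ≤ 1 / 2) (hm1 : 1 ≤ lam m)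
    (hm : T ≤ τ ^ (j + 1) * lam m) (i : ι) :
    1 / (2 * T * lam m) ≤ elemSymm (j + 1) (Finset.univ.erase i) lam := by
  have h1 := le_mul_elemSymm_erase (j := j) h.lam_pos hτ0
    (by rw [h.elemSymm_eq]; exact h.Ψ_le.trans hm)
  rw [h.elemSymm_eq] at h1
  have h2 := elemSymm_erase_sub_erase (j := j) (x := lam) (p := i) (m := m)
  have h3 : elemSymm (j + 1) (Finset.univ.erase m) lam ≤
      elemSymm (j + 1) (Finset.univ.erase i) lam := by
    rcases eq_or_ne i m with rfl | hne
    · rfl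
    · rw [← sub_nonneg, h2 hne]
      exact mul_nonneg (sub_nonneg.2 (h.lam_le i)) (elemSymm_nonneg _ fun i _ => h.lam_pos i)
  refine le_trans ?_ h3
  have hlm := h.lam_pos m
  have h4 : τ / lam m ≤ 1 / 2 := (div_le_self hτ0 hm1).trans hτ
  have h6 : 1 / T * (1 / 2) ≤ Ψ (jet v f x₀) * (1 - τ / lam m) :=
    mul_le_mul h.inv_le_Ψ (by linarith) (by norm_num) (le_trans (by positivity) h.inv_le_Ψ)
  rw [← div_div, div_le_iff₀ hlm, mul_comm (2 : ℝ), ← div_div, div_eq_mul_one_div (1 / T),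
    mul_comm _ (lam m)]
  exact h6.trans h1

/-- The third order inequality with `δ = 1 / (4 φ)`, where `φ` is the exponential function of `f` in
the test function. -/
lemma third_order {j : ℕ} (h : MaxPointData (j + 2) ε A T N M f X W B Ψ v x₀ lam m)
    (hj : j + 2 ≤ Fintype.card ι) (hT : 1 ≤ T) {τ φ : ℝ} (hτ0 : 0 ≤ τ) (hφ : 1 ≤ φ)
    (hτφ : (1 + 8 * Fintype.card ι) * τ * (4 * φ) ≤ 1) (hm1 : 1 ≤ lam m)
    (hm : T ≤ τ ^ (j + 1) * lam m) :
    (lap (v m) (fun x => (Ψ (jet v f x) : ℂ)) x₀).re / lam m -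
      ‖∂[v m] (fun x => (Ψ (jet v f x) : ℂ)) x₀‖ ^ 2 /
        (elemSymm (j + 2) Finset.univ lam * lam m)
      + ∑ i, elemSymm (j + 1) (Finset.univ.erase i) lam *
        ((lap (v i) (fun x => (testExp v f B A N M x : ℂ)) x₀).re - 2 * (1 / (4 * φ)) *
          ‖∂[v i] (fun x => (testExp v f B A N M x : ℂ)) x₀‖ ^ 2)
      ≤ (2 * Fintype.card ι + 5) * ((2 * Fintype.card ι + 4) * (2 * T) ^ 2) ^ 2 / (1 / (4 * φ)) *
          ∑ i, elemSymm (j + 1) (Finset.univ.erase i) lam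
        + (2 * Fintype.card ι + 4) * (2 * T) ^ 2 := by
  choose ℓ hℓ using h.exists_dual
  have hψ : ContDiffAt ℝ 2 (fun x => Ψ (jet v f x)) x₀ :=
    h.Ψ_contDiffAt.comp x₀ (contDiffAt_jet h.f_contDiffAt)
  have hκ : ContDiffAt ℝ 2 (testExp v f B A N M) x₀ :=
    contDiffAt_testExp h.f_contDiffAt h.B_contDiffAt
  have hσ : elemSymm (j + 2) Finset.univ lam ≤ τ ^ (j + 1) * lam m := by
    rw [h.elemSymm_eq]; exact h.Ψ_le.trans hm
  refine third_order_at_max (T := 2 * T) (τ := τ) (κ := testExp v f B A N M)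
    (ψ := fun x => Ψ (jet v f x))
    (contDiffAt_ofReal h.f_contDiffAt) h.X_contDiffAt
    h.W_contDiffAt h.addHess_isHermitian h.W_isHermitian h.addHess_eq h.W_eq h.lam_pos h.lam_le
    hm1 hκ hℓ h.isMax hψ hj h.equation (by linarith)
    (fun i a b => (h.norm_del_W i a b).trans (by linarith))
    (fun i a => (Complex.abs_re_le_norm _).trans ((h.norm_lap_W i a a).trans (by linarith)))
    (fun i a b => (h.norm_del_X i a b).trans (by linarith)) ?_ hτ0 hσ (by positivity) ?_ ?_
  · intro i a
    refine (h.norm_lap_X i a).trans ?_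
    have h1 : 1 + lam i ≤ 2 * lam m := by linarith [h.lam_le i]
    have h2 := mul_le_mul_of_nonneg_left h1 (show 0 ≤ T by linarith)
    linarith
  · rw [div_le_one (by positivity)]; linarith
  · rw [div_mul_eq_mul_div, one_mul, le_div_iff₀ (by positivity)]
    exact hτφ.trans hm1

set_option maxHeartbeats 400000 in
/-- The bound for the trace of the linearized operator. -/
lemma sum_elemSymm_erase_le {j : ℕ} (h : MaxPointData (j + 2) ε A T N M f X W B Ψ v x₀ lam m)
    (hj : j + 2 ≤ Fintype.card ι) (hT : 1 ≤ T) {C τ : ℝ}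
    (hC : C = 100 * (Fintype.card ι + 1) ^ 5 * T ^ 6) (hN : N = 16 * C ^ 3)
    (hMN : 4 * N * C ≤ M) (hMε : 4 * (2 * Fintype.card ι + 5) * C ^ 2 + 2 ≤ M * ε)
    (hτ0 : 0 ≤ τ) (hτ : τ ≤ 1 / 2)
    (hτφ : (1 + 8 * Fintype.card ι) * τ * (4 * Real.exp (M * (2 * A + 1))) ≤ 1)
    (hm1 : 1 ≤ lam m) (hm : T ≤ τ ^ (j + 1) * lam m) :
    ∑ i, elemSymm (j + 1) (Finset.univ.erase i) lam ≤ 2 * C * M + 2 * C + 2 * C ^ 2 + N * C := by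
  set c : ℝ := (Fintype.card ι : ℝ) with hc
  have hc0 : 0 ≤ c := by positivity
  have hT0 : 0 ≤ T := by linarith
  have hlam0 : ∀ i, 0 ≤ lam i := fun i => (h.lam_pos i).le
  set σ := elemSymm (j + 2) Finset.univ lam with hσ
  have hσΨ : σ = Ψ (jet v f x₀) := h.elemSymm_eq
  have hστ : σ ≤ τ ^ (j + 1) * lam m := by rw [hσΨ]; exact h.Ψ_le.trans hm
  have hc1 : 1 ≤ (c + 1) ^ 5 := one_le_pow₀ (by linarith)
  have hc4 : (c + 1) ^ 4 ≤ (c + 1) ^ 5 := pow_le_pow_right₀ (by linarith) (by norm_num)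
  have hcc : c + 1 ≤ (c + 1) ^ 5 := le_self_pow₀ (by linarith) (by norm_num)
  have hT1 : T ≤ T ^ 6 := le_self_pow₀ hT (by norm_num)
  have hT2 : T ^ 2 ≤ T ^ 6 := pow_le_pow_right₀ hT (by norm_num)
  have hT3 : T ^ 3 ≤ T ^ 6 := pow_le_pow_right₀ hT (by norm_num)
  have hT4 : T ^ 4 ≤ T ^ 6 := pow_le_pow_right₀ hT (by norm_num)
  have hT5 : T ^ 5 ≤ T ^ 6 := pow_le_pow_right₀ hT (by norm_num)
  have hC5 : 28 * (c + 1) ^ 4 * T ^ 5 ≤ C := by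
    rw [hC]; gcongr; norm_num
  have hTC : T ≤ C := by
    rw [hC]
    calc T ≤ 1 * 1 * T ^ 6 := by linarith
      _ ≤ _ := by gcongr; norm_num
  have hC1 : 1 ≤ C := hT.trans hTC
  have hN0 : 0 ≤ N := by rw [hN]; positivity
  have hM0 : 0 ≤ M := le_trans (by positivity) hMN
  set φ := Real.exp (M * (A + 1 - f x₀)) with hφ
  have habs := abs_le.1 h.abs_f_le
  have hMφ : M ≤ φ := by
    have h1 : M * 1 ≤ M * (A + 1 - f x₀) := mul_le_mul_of_nonneg_left (by linarith) hM0
    have h2 := Real.add_one_le_exp (M * (A + 1 - f x₀))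
    linarith
  have hφle : φ ≤ Real.exp (M * (2 * A + 1)) :=
    Real.exp_le_exp.2 (mul_le_mul_of_nonneg_left (by linarith) hM0)
  have hM1 : 1 ≤ M := by
    have h1 : 1 ≤ C ^ 3 := one_le_pow₀ hC1
    have h2 : N * 1 ≤ N * C := mul_le_mul_of_nonneg_left hC1 hN0
    linarith
  have hφ0 : 0 < φ := by positivity
  have hdel := fun i => del_testExp (A := A) (N := N) (M := M) h.f_contDiffAt h.B_contDiffAt
    h.B_isHermitian (v := v) (v i)
  set Q : ι → ℝ := fun i => ∑ a, ‖∂[v i] (fun x => frameGrad v (fun y => (f y : ℂ)) x a) x₀‖ ^ 2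
    with hQ
  have hQ0 : ∀ i, 0 ≤ Q i := fun i => Finset.sum_nonneg fun a _ => sq_nonneg _
  have hQm : Q m ≤ ∑ i, Q i := Finset.single_le_sum (fun i _ => hQ0 i) (Finset.mem_univ m)
  have hmul : ∀ {a y z : ℝ}, a ≤ C → 0 ≤ y → y ≤ z → a * y ≤ C * z := fun ha hy hyz =>
    (mul_le_mul_of_nonneg_right ha hy).trans (mul_le_mul_of_nonneg_left hyz (by linarith))
  -- `C` dominates all constants of the preceding estimates; `Q i` is the squared length of the second
  -- derivatives of `f` in the direction `i`
  refine sum_deriv_le_of_absorption (m := m) (x := lam) (Q := Q)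
    (P := fun i => ‖∂[v i] (fun y => (f y : ℂ)) x₀‖ ^ 2)
    (Lκ := fun i => (lap (v i) (fun x => (testExp v f B A N M x : ℂ)) x₀).re)
    (k := fun i => ‖∂[v i] (fun x => (testExp v f B A N M x : ℂ)) x₀‖)
    (φ := φ) (δ := 1 / (4 * φ)) (Lψ := (lap (v m) (fun x => (Ψ (jet v f x) : ℂ)) x₀).re)
    (Ψρ := gradPairing v f B Ψ x₀) (d := ‖∂[v m] (fun x => (Ψ (jet v f x) : ℂ)) x₀‖)
    (σ := σ) (n := c) hm1 hC1 hc0 hN.ge hMN hMε hMφ rfl ?_ hQ0 ?_ ?_ ?_ ?_ ?_ ?_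
  · intro i
    refine le_trans ?_ (h.le_elemSymm_erase hT hτ0 hτ hm1 hm i)
    gcongr
  · rw [hσΨ]; exact (one_div_le_one_div_of_le (by linarith) hTC).trans h.inv_le_Ψ
  · have h1 := h.third_order hj hT hτ0 (hM1.trans hMφ) (le_trans (by gcongr) hτφ) hm1 hm
    have h2 : (2 * c + 4) * (2 * T) ^ 2 ≤ C := by
      rw [hC]
      calc (2 * c + 4) * (2 * T) ^ 2 = (8 * c + 16) * T ^ 2 := by ring
        _ ≤ 100 * (c + 1) * T ^ 2 := mul_le_mul_of_nonneg_right (by linarith) (sq_nonneg T)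
        _ ≤ _ := by gcongr
    refine h1.trans (add_le_add ?_ h2)
    have h3 : 0 ≤ ∑ i, elemSymm (j + 1) (Finset.univ.erase i) lam :=
      Finset.sum_nonneg fun i _ => elemSymm_nonneg _ fun i _ => h.lam_pos i
    gcongr
  · have h1 := le_lap_rhs (N := N) (B := B) (c := M * φ) h.f_contDiffAt h.addHess_eq hlam0
      h.Ψ_contDiffAt hT h.norm_v h.norm_X h.norm_grad h.norm_fderiv_Ψ h.X_contDiffAt
      h.norm_del_X h.norm_del_W h.norm_fderiv_fderiv_Ψ hm1 (by positivity)
      (fun a => by rw [h.crit a, hdel a])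
    have h2 : 2 * T ^ 2 * (lam m * (1 + M * φ)) ≤ C * (lam m * (1 + M * φ)) := by
      refine hmul ?_ (by have := hlam0 m; positivity) le_rfl
      rw [hC]
      calc 2 * T ^ 2 ≤ 100 * 1 * T ^ 6 := by linarith [pow_nonneg hT0 6]
        _ ≤ _ := by gcongr
    have h3 : 12 * (c + 1) * T ^ 3 * (1 + Q m + lam m ^ 2) ≤ C * (1 + ∑ i, Q i + lam m ^ 2) := by
      refine hmul ?_ (by have := hQ0 m; positivity) (by linarith)
      rw [hC]
      gcongr
      norm_num
    refine le_trans ?_ h1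
    change _ ≤ -(lam m * (N * gradPairing v f B Ψ x₀)) - 2 * T ^ 2 * lam m * (1 + M * φ) -
        12 * (c + 1) * T ^ 3 * (1 + Q m + lam m ^ 2)
    linarith
  · exact h.le_sum_lap_testExp hj hT hN0 hM0 hC5 hφ rfl
  · intro i
    have h1 := norm_del_gradSq_le (contDiffAt_ofReal h.f_contDiffAt) h.B_contDiffAt h.B_eq
      h.addHess_eq hlam0 h.norm_X hT h.norm_grad h.norm_del_B i
    have h2 := sq_one_add_add_sum_norm_le i h1 (norm_nonneg _)
    have h3 : (((c + 1) ^ 2 * T ^ 3) ^ 2 * (3 * (c + 1))) * (1 + Q i + lam i ^ 2) ≤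
        C * (1 + Q i + lam i ^ 2) := by
      refine hmul ?_ (by have := hQ0 i; positivity) le_rfl
      rw [hC]
      have : 0 ≤ (c + 1) ^ 5 * T ^ 6 := by positivity
      linarith
    have h4 := h2.trans h3
    rw [hdel i]
    have h5 : ‖(N : ℂ) * ∂[v i] (gradSq v (fun y => (f y : ℂ)) B) x₀ -
        ((M * φ : ℝ) : ℂ) * ∂[v i] (fun y => (f y : ℂ)) x₀‖ ^ 2 ≤
        (N * ‖∂[v i] (gradSq v (fun y => (f y : ℂ)) B) x₀‖ +
          M * φ * ‖∂[v i] (fun y => (f y : ℂ)) x₀‖) ^ 2 := by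
      refine pow_le_pow_left₀ (norm_nonneg _) ((norm_sub_le _ _).trans_eq ?_) 2
      rw [norm_mul, norm_mul, Complex.norm_real, Complex.norm_real, Real.norm_of_nonneg hN0,
        Real.norm_of_nonneg (by positivity)]
    refine h5.trans ?_
    have h6 := mul_le_mul_of_nonneg_left h4 (sq_nonneg N)
    have h7 := sq_nonneg (N * ‖∂[v i] (gradSq v (fun y => (f y : ℂ)) B) x₀‖ -
          M * φ * ‖∂[v i] (fun y => (f y : ℂ)) x₀‖)
    linarith
  · have h1 := norm_del_rhs_sq_le h.f_contDiffAt h.addHess_eq hlam0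
      h.Ψ_contDiffAt hT h.norm_v h.norm_X h.norm_grad h.norm_fderiv_Ψ m
    refine h1.trans (hmul ?_ (by have := hQ0 m; positivity) (by linarith))
    rw [hC]
    gcongr
    norm_num

end MaxPointData

/-- The eigenvalues are bounded at a maximum point of the test function, if its parameters are
chosen large enough. -/
theorem exists_eigenvalue_bound (n : ℕ) (ι : Type*) [Fintype ι] [DecidableEq ι] {k : ℕ} (hk : 1 ≤ k)
    (hkn : k ≤ Fintype.card ι) {ε T : ℝ} (A : ℝ) (hε : 0 < ε) (hT : 1 ≤ T) :
    ∃ N M Λ : ℝ, 0 ≤ N ∧ 0 ≤ M ∧ ∀ (f : Cn n → ℝ) (X W B : Cn n → Matrix ι ι ℂ)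
      (Ψ : Cn n × (ι → ℂ) × ℝ → ℝ) (v : ι → Cn n) (x₀ : Cn n) (lam : ι → ℝ) (m : ι),
      MaxPointData k ε A T N M f X W B Ψ v x₀ lam m → lam m ≤ Λ := by
  obtain rfl | ⟨j, rfl⟩ : k = 1 ∨ ∃ j, k = j + 2 := by
    rcases hk.eq_or_lt with h | h
    · exact Or.inl h.symm
    · exact Or.inr ⟨k - 2, by omega⟩
  -- for `k = 1` the equation itself bounds the trace
  · refine ⟨0, 0, T, le_rfl, le_rfl, fun f X W B Ψ v x₀ lam m h => ?_⟩
    have h1 := h.elemSymm_eq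
    have h2 : elemSymm 1 Finset.univ lam = ∑ i, lam i := by
      simp [elemSymm, Finset.powersetCard_one]
    rw [h2] at h1
    calc lam m ≤ ∑ i, lam i :=
          Finset.single_le_sum (fun i _ => (h.lam_pos i).le) (Finset.mem_univ m)
      _ ≤ T := h1.le.trans h.Ψ_le
  · set C : ℝ := 100 * (Fintype.card ι + 1) ^ 5 * T ^ 6 with hC
    set N : ℝ := 16 * C ^ 3 with hN
    set M : ℝ := 4 * N * C + (4 * (2 * Fintype.card ι + 5) * C ^ 2 + 2) / ε with hM
    set D : ℝ := 2 * C * M + 2 * C + 2 * C ^ 2 + N * C with hD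
    set E : ℝ := 4 * Real.exp (M * (2 * A + 1)) with hE
    have hC0 : 0 < C := by positivity
    have hN0 : 0 < N := by positivity
    have hM0 : 0 < M := by positivity
    have hD0 : 0 < D := by positivity
    have hE0 : 0 < E := by positivity
    -- the denominator makes `τ ≤ 1 / 2`, makes `τ` small against the oscillation of the test function,
    -- and makes `τ C D < 1`
    set τ : ℝ := 1 / (2 + (1 + 8 * Fintype.card ι) * E + C * (D + 1)) with hτ
    have hτ0 : 0 < τ := by positivity
    have hτden : τ * (2 + (1 + 8 * Fintype.card ι) * E + C * (D + 1)) = 1 := by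
      rw [hτ]; field_simp
    have p1 : 0 ≤ τ * ((1 + 8 * Fintype.card ι) * E) := by positivity
    have p2 : 0 ≤ τ * (C * (D + 1)) := by positivity
    refine ⟨N, M, max 1 (T / τ ^ (j + 1)), hN0.le, hM0.le, fun f X W B Ψ v x₀ lam m h => ?_⟩
    by_contra! hlt
    have hm1 : 1 ≤ lam m := (le_max_left _ _).trans hlt.le
    have hm2 : T ≤ τ ^ (j + 1) * lam m := by
      rw [mul_comm, ← div_le_iff₀ (by positivity)]
      exact (le_max_right _ _).trans hlt.le
    have h1 := h.sum_elemSymm_erase_le hkn hT hC hN (le_add_of_nonneg_right (by positivity))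
      (by
        rw [hM, add_mul, div_mul_cancel₀ _ hε.ne']
        exact le_add_of_nonneg_left (by positivity))
      hτ0.le (by linarith) (by linarith) hm1 hm2
    have h2 := elemSymm_le_mul_sum_erase (j := j) (m := m) h.lam_pos hkn hτ0.le
      (by rw [h.elemSymm_eq]; exact h.Ψ_le.trans hm2)
    rw [h.elemSymm_eq] at h2
    have h3 := h.inv_le_Ψ.trans (h2.trans (mul_le_mul_of_nonneg_left h1 hτ0.le))
    -- `1 / T ≤ τ D` contradicts the choice of `τ`
    have hTC : T ≤ C := by
      have hT1 : T ≤ T ^ 6 := le_self_pow₀ hT (by norm_num)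
      have hc1 : (1 : ℝ) ≤ (Fintype.card ι + 1) ^ 5 := one_le_pow₀ (by simp)
      rw [hC]
      calc T ≤ 1 * 1 * T ^ 6 := by linarith
        _ ≤ _ := by gcongr; norm_num
    rw [div_le_iff₀ (by linarith)] at h3
    have h4 : τ * D * T ≤ τ * D * C := mul_le_mul_of_nonneg_left hTC (by positivity)
    have h5 : 0 < τ * C := by positivity
    have h6 : τ * D * C = τ * (C * (D + 1)) - τ * C := by ring
    have h7 : τ * (2 + (1 + 8 * Fintype.card ι) * E + C * (D + 1)) =
      2 * τ + τ * ((1 + 8 * Fintype.card ι) * E) + τ * (C * (D + 1)) := by ring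
    linarith

end EigenvalueBound

/-! ### Simultaneous diagonalization -/

section LinearAlgebra

variable {n : ℕ}

/-- The Hermitian form `∑ y_a ȳ_b H_{ab}` of a matrix. -/
def quad (H : Matrix (Fin n) (Fin n) ℂ) (y : Fin n → ℂ) : ℝ := (y ⬝ᵥ (H *ᵥ star y)).re

lemma quad_eq_sum (H : Matrix (Fin n) (Fin n) ℂ) (y : Fin n → ℂ) :
    quad H y = (∑ a, ∑ b, y a * (starRingEnd ℂ) (y b) * H a b).re := by
  simp only [quad, dotProduct, Matrix.mulVec, Finset.mul_sum, Pi.star_apply]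
  congr 1
  exact Finset.sum_congr rfl fun a _ => Finset.sum_congr rfl fun b _ => by
    rw [starRingEnd_apply]; ring

lemma quad_mul_mul (V H : Matrix (Fin n) (Fin n) ℂ) (y : Fin n → ℂ) :
    quad (V * H * Vᴴ) y = quad H (y ᵥ* V) := by
  rw [quad, quad, Matrix.star_vecMul, ← Matrix.mulVec_mulVec, ← Matrix.mulVec_mulVec,
    Matrix.dotProduct_mulVec]

lemma quad_add (G H : Matrix (Fin n) (Fin n) ℂ) (y : Fin n → ℂ) :
    quad (G + H) y = quad G y + quad H y := by
  simp [quad, Matrix.add_mulVec]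

lemma quad_smul (H : Matrix (Fin n) (Fin n) ℂ) (r : ℝ) (y : Fin n → ℂ) :
    quad H ((r : ℂ) • y) = r ^ 2 * quad H y := by
  have : star ((r : ℂ) • y) = (r : ℂ) • star y := by simp
  rw [quad, this, Matrix.mulVec_smul, smul_dotProduct, dotProduct_smul, smul_smul, smul_eq_mul,
    ← Complex.ofReal_mul, Complex.re_ofReal_mul, quad]
  ring

lemma quad_single (H : Matrix (Fin n) (Fin n) ℂ) (a : Fin n) :
    quad H (Pi.single a 1) = (H a a).re := by
  simp [quad]

lemma quad_diagonal (lam : Fin n → ℝ) (y : Fin n → ℂ) :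
    quad (Matrix.diagonal fun a => (lam a : ℂ)) y = ∑ a, lam a * ‖y a‖ ^ 2 := by
  rw [quad, dotProduct, Complex.re_sum]
  refine Finset.sum_congr rfl fun a _ => ?_
  rw [Matrix.mulVec_diagonal, Pi.star_apply, mul_left_comm, Complex.re_ofReal_mul,
    ← starRingEnd_apply, Complex.mul_conj']
  norm_cast

lemma quad_one (y : Fin n → ℂ) : quad 1 y = ∑ a, ‖y a‖ ^ 2 := by
  have := quad_diagonal (fun _ => 1) y
  simpa using this

lemma quad_pos {H : Matrix (Fin n) (Fin n) ℂ} (hH : H.PosDef) {y : Fin n → ℂ} (hy : y ≠ 0) :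
    0 < quad H y := by
  have h := hH.re_dotProduct_pos (x := star y) (by simpa using hy)
  simpa [quad] using h

lemma exists_unitary_diagonalization {H : Matrix (Fin n) (Fin n) ℂ} (hH : H.IsHermitian) :
    ∃ V : Matrix (Fin n) (Fin n) ℂ, V * Vᴴ = 1 ∧
      V * H * Vᴴ = Matrix.diagonal fun a => (hH.eigenvalues a : ℂ) := by
  refine ⟨star (hH.eigenvectorUnitary : Matrix (Fin n) (Fin n) ℂ), ?_, ?_⟩
  · rw [← Matrix.star_eq_conjTranspose, star_star]
    exact Unitary.coe_star_mul_self hH.eigenvectorUnitary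
  · have h := hH.conjStarAlgAut_star_eigenvectorUnitary
    rw [Unitary.conjStarAlgAut_apply] at h
    rw [← Matrix.star_eq_conjTranspose]
    simpa [Function.comp_def] using h

lemma quad_nonneg {H : Matrix (Fin n) (Fin n) ℂ} (hH : H.PosDef) (y : Fin n → ℂ) :
    0 ≤ quad H y := by
  rcases eq_or_ne y 0 with rfl | hy
  · simp [quad]
  · exact (quad_pos hH hy).le

lemma posDef_of_quad_pos {H : Matrix (Fin n) (Fin n) ℂ} (hH : H.IsHermitian)
    (h : ∀ y, y ≠ 0 → 0 < quad H y) : H.PosDef := by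
  refine Matrix.PosDef.of_dotProduct_mulVec_pos hH fun y hy => Complex.pos_iff.2 ⟨?_, ?_⟩
  · have := h (star y) (by simpa using hy)
    simpa [quad] using this
  · exact (hH.im_star_dotProduct_mulVec_self y).symm

/-- A basis that is orthonormal for `W` and orthogonal for `H`. -/
lemma exists_simultaneous_diagonalization {W H : Matrix (Fin n) (Fin n) ℂ} (hW : W.PosDef)
    (hH : H.IsHermitian) : ∃ (V : Matrix (Fin n) (Fin n) ℂ) (lam : Fin n → ℝ),
      V * W * Vᴴ = 1 ∧ V * H * Vᴴ = Matrix.diagonal fun a => (lam a : ℂ) := by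
  obtain ⟨D, hD⟩ : ∃ D : Matrix (Fin n) (Fin n) ℂ, D * W * Dᴴ = 1 := by
    obtain ⟨V, -, hV⟩ := exists_unitary_diagonalization hW.1
    refine ⟨(Matrix.diagonal fun a => ((√(hW.1.eigenvalues a) : ℝ) : ℂ)⁻¹) * V, ?_⟩
    rw [Matrix.conjTranspose_mul, show ∀ E : Matrix (Fin n) (Fin n) ℂ,
      E * V * W * (Vᴴ * Eᴴ) = E * (V * W * Vᴴ) * Eᴴ from fun E => by
        simp only [Matrix.mul_assoc], hV, Matrix.diagonal_conjTranspose, Matrix.diagonal_mul_diagonal,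
      Matrix.diagonal_mul_diagonal, ← Matrix.diagonal_one]
    congr 1
    funext a
    have h1 := hW.eigenvalues_pos a
    have h2 : ((√(hW.1.eigenvalues a) : ℝ) : ℂ) ≠ 0 := by
      exact_mod_cast (Real.sqrt_pos.2 h1).ne'
    have h3 : (hW.1.eigenvalues a : ℂ) = (√(hW.1.eigenvalues a) : ℝ) * (√(hW.1.eigenvalues a) : ℝ) := by
      rw [← Complex.ofReal_mul, Real.mul_self_sqrt h1.le]
    rw [Pi.star_apply, star_inv₀, ← starRingEnd_apply, Complex.conj_ofReal, h3]
    field_simp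
  obtain ⟨V, hV, hV'⟩ := exists_unitary_diagonalization (Matrix.isHermitian_mul_mul_conjTranspose D hH)
  refine ⟨V * D, (Matrix.isHermitian_mul_mul_conjTranspose D hH).eigenvalues, ?_, ?_⟩
  · rw [Matrix.conjTranspose_mul, show V * D * W * (Dᴴ * Vᴴ) = V * (D * W * Dᴴ) * Vᴴ by
      simp only [Matrix.mul_assoc], hD, Matrix.mul_one, hV]
  · rw [Matrix.conjTranspose_mul, show V * D * H * (Dᴴ * Vᴴ) = V * (D * H * Dᴴ) * Vᴴ by
      simp only [Matrix.mul_assoc], hV']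

section OrthonormalFrame

variable {V W : Matrix (Fin n) (Fin n) ℂ} (h : V * W * Vᴴ = 1)
include h

lemma isUnit_det_of_mul_mul_eq_one : IsUnit V.det := by
  have := congrArg Matrix.det h
  rw [Matrix.det_mul, Matrix.det_mul, Matrix.det_one, mul_assoc] at this
  exact IsUnit.of_mul_eq_one _ this

lemma mul_mul_conjTranspose_self : V * (W * Vᴴ) = 1 := by rw [← Matrix.mul_assoc, h]

lemma mul_conjTranspose_mul_self : (W * Vᴴ) * V = 1 :=
  mul_eq_one_comm.1 (mul_mul_conjTranspose_self h)

lemma inv_eq_conjTranspose_mul : W⁻¹ = Vᴴ * V := by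
  refine Matrix.inv_eq_right_inv ?_
  rw [← Matrix.mul_assoc, mul_conjTranspose_mul_self h]

lemma norm_apply_sq_le (a b : Fin n) : ‖V a b‖ ^ 2 ≤ (W⁻¹ b b).re := by
  rw [inv_eq_conjTranspose_mul h, Matrix.mul_apply, Complex.re_sum]
  have h1 : ∀ a, (Vᴴ b a * V a b).re = ‖V a b‖ ^ 2 := fun a => by
    rw [Matrix.conjTranspose_apply, ← starRingEnd_apply, Complex.conj_mul']
    norm_cast
  simp only [h1]
  exact Finset.single_le_sum (f := fun a => ‖V a b‖ ^ 2) (fun a _ => sq_nonneg _)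
    (Finset.mem_univ a)

lemma trace_inv_mul_inv_mul {H : Matrix (Fin n) (Fin n) ℂ} {lam : Fin n → ℝ}
    (hH : V * H * Vᴴ = Matrix.diagonal fun a => (lam a : ℂ)) :
    (W⁻¹ * H * W⁻¹ * H).trace.re = ∑ a, lam a ^ 2 := by
  rw [inv_eq_conjTranspose_mul h, show Vᴴ * V * H * (Vᴴ * V) * H = Vᴴ * ((V * H * Vᴴ) * (V * H)) by
      simp only [Matrix.mul_assoc], Matrix.trace_mul_comm, Matrix.mul_assoc, Matrix.mul_assoc V H,
      ← Matrix.mul_assoc V H, hH, Matrix.diagonal_mul_diagonal, Matrix.trace_diagonal,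
      Complex.re_sum]
  refine Finset.sum_congr rfl fun a _ => ?_
  rw [← Complex.ofReal_mul, Complex.ofReal_re, sq]

end OrthonormalFrame

lemma trace_congr_invariant {P H W : Matrix (Fin n) (Fin n) ℂ} (hP : IsUnit P.det) :
    ((P * W * Pᴴ)⁻¹ * (P * H * Pᴴ) * (P * W * Pᴴ)⁻¹ * (P * H * Pᴴ)).trace =
      (W⁻¹ * H * W⁻¹ * H).trace := by
  have hPH : IsUnit (Pᴴ).det := by
    rw [Matrix.det_conjTranspose]
    exact hP.star
  have e1 : (P * W * Pᴴ)⁻¹ * (P * H * Pᴴ) = (Pᴴ)⁻¹ * (W⁻¹ * H) * Pᴴ := by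
    rw [Matrix.mul_inv_rev, Matrix.mul_inv_rev]
    simp only [Matrix.mul_assoc]
    rw [← Matrix.mul_assoc P⁻¹ P, Matrix.nonsing_inv_mul _ hP, Matrix.one_mul]
  rw [e1, Matrix.mul_assoc _ (P * W * Pᴴ)⁻¹, e1, show (Pᴴ)⁻¹ * (W⁻¹ * H) * Pᴴ *
    ((Pᴴ)⁻¹ * (W⁻¹ * H) * Pᴴ) = (Pᴴ)⁻¹ * ((W⁻¹ * H) * (Pᴴ * (Pᴴ)⁻¹) * (W⁻¹ * H) * Pᴴ) by
      simp only [Matrix.mul_assoc], Matrix.mul_nonsing_inv _ hPH, Matrix.trace_mul_comm]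
  simp only [Matrix.mul_assoc, Matrix.one_mul]
  rw [Matrix.mul_nonsing_inv _ hPH, Matrix.mul_one]

lemma quad_inv_congr {P W : Matrix (Fin n) (Fin n) ℂ} (hP : IsUnit P.det) (p : Fin n → ℂ) :
    star (P *ᵥ p) ⬝ᵥ ((P * W * Pᴴ)⁻¹ *ᵥ (P *ᵥ p)) = star p ⬝ᵥ (W⁻¹ *ᵥ p) := by
  have hPH : IsUnit (Pᴴ).det := by
    rw [Matrix.det_conjTranspose]
    exact hP.star
  rw [Matrix.mul_inv_rev, Matrix.mul_inv_rev, Matrix.star_mulVec, ← Matrix.dotProduct_mulVec,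
    Matrix.mulVec_mulVec, Matrix.mulVec_mulVec]
  congr 2
  rw [show Pᴴ * ((Pᴴ)⁻¹ * (W⁻¹ * P⁻¹)) * P = (Pᴴ * (Pᴴ)⁻¹) * W⁻¹ * (P⁻¹ * P) by
    simp only [Matrix.mul_assoc], Matrix.nonsing_inv_mul _ hP, Matrix.mul_nonsing_inv _ hPH,
    Matrix.mul_one, Matrix.one_mul]

end LinearAlgebra

/-! ### Changes of holomorphic charts -/

section HolomorphicChange

open Filter Topology

variable {n : ℕ} {x v : Cn n} {c : ℂ} {F : Cn n → ℂ} {τ : Cn n → Cn n}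

lemma del_smul (f : Cn n → ℂ) (x : Cn n) (c : ℂ) (w : Cn n) :
    ∂[c • w] f x = c * ∂[w] f x := by
  have h := fderiv_smul_eq f x (Complex.I * c) w
  rw [map_mul, Complex.conj_I] at h
  rw [wirt, fderiv_smul_eq, ← mul_smul, h]
  linear_combination (-(1 / 2) * c * ∂[w] f x + 1 / 2 * (starRingEnd ℂ) c * ∂̄[w] f x) * Complex.I_sq

lemma delBar_smul (f : Cn n → ℂ) (x : Cn n) (c : ℂ) (w : Cn n) :
    ∂̄[c • w] f x = (starRingEnd ℂ) c * ∂̄[w] f x := by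
  have h := fderiv_smul_eq f x (Complex.I * c) w
  rw [map_mul, Complex.conj_I] at h
  rw [wirt, fderiv_smul_eq, ← mul_smul, h]
  linear_combination (1 / 2 * c * ∂[w] f x - 1 / 2 * (starRingEnd ℂ) c * ∂̄[w] f x) * Complex.I_sq

lemma wirt_sum_dir {ι : Type*} (s : Finset ι) (c : ℂ) (w : ι → Cn n) (f : Cn n → ℂ) (x : Cn n) :
    wirt c (∑ k ∈ s, w k) f x = ∑ k ∈ s, wirt c (w k) f x := by
  simp only [wirt, Finset.smul_sum, map_sum, Finset.mul_sum, ← Finset.sum_add_distrib, mul_add]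

lemma del_sum_smul {ι : Type*} (s : Finset ι) (c : ι → ℂ) (w : ι → Cn n) (f : Cn n → ℂ)
    (x : Cn n) : ∂[∑ k ∈ s, c k • w k] f x = ∑ k ∈ s, c k * ∂[w k] f x := by
  rw [wirt_sum_dir]
  exact Finset.sum_congr rfl fun k _ => del_smul _ _ _ _

lemma delBar_sum_smul {ι : Type*} (s : Finset ι) (c : ι → ℂ) (w : ι → Cn n) (f : Cn n → ℂ)
    (x : Cn n) : ∂̄[∑ k ∈ s, c k • w k] f x = ∑ k ∈ s, (starRingEnd ℂ) (c k) * ∂̄[w k] f x := by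
  rw [wirt_sum_dir]
  exact Finset.sum_congr rfl fun k _ => delBar_smul _ _ _ _

lemma wirt_comp_holomorphic (hF : DifferentiableAt ℝ F (τ x)) (hτ : DifferentiableAt ℂ τ x) :
    wirt c v (fun y => F (τ y)) x = wirt c (fderiv ℂ τ x v) F (τ x) := by
  have h1 := fderiv_fun_comp x hF (hτ.restrictScalars ℝ)
  have h2 : ∀ w, fderiv ℝ τ x w = fderiv ℂ τ x w := fun w => by
    rw [hτ.fderiv_restrictScalars ℝ]; rfl
  simp only [wirt, h1, ContinuousLinearMap.comp_apply, h2, map_smul]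

lemma delBar_eq_zero (hF : DifferentiableAt ℂ F x) : ∂̄[v] F x = 0 := by
  have h2 : ∀ w, fderiv ℝ F x w = fderiv ℂ F x w := fun w => by
    rw [hF.fderiv_restrictScalars ℝ]; rfl
  simp only [wirt, h2, map_smul, smul_eq_mul]
  linear_combination (1 / 2 * fderiv ℂ F x v) * Complex.I_sq

/-- The Jacobian matrix of a holomorphic map; the rows are the images of the coordinate vectors. -/
def jacobian (τ : Cn n → Cn n) (x : Cn n) : Matrix (Fin n) (Fin n) ℂ :=
  Matrix.of fun j k => fderiv ℂ τ x (EuclideanSpace.single j 1) k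

lemma fderiv_single_eq (τ : Cn n → Cn n) (x : Cn n) (j : Fin n) :
    fderiv ℂ τ x (EuclideanSpace.single j 1) =
      ∑ k, jacobian τ x j k • (EuclideanSpace.single k (1 : ℂ) : Cn n) := by
  ext i
  simp [jacobian, Finset.sum_apply, Pi.single_apply]

lemma wirtinger_comp_holomorphic (hF : DifferentiableAt ℝ F (τ x)) (hτ : DifferentiableAt ℂ τ x)
    (j : Fin n) : wirtinger j (fun y => F (τ y)) x =
      ∑ k, jacobian τ x j k * wirtinger k F (τ x) := by
  simp only [wirtinger_eq_del]
  rw [wirt_comp_holomorphic hF hτ, fderiv_single_eq, del_sum_smul]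

/-- The complex Hessian transforms as a Hermitian form, since the second derivatives of a holomorphic
map do not enter it. -/
lemma hessian_comp_holomorphic (hF : ContDiffAt ℝ 2 F (τ x)) (hτ : ContDiffAt ℂ 2 τ x)
    (j k : Fin n) : wirtingerBar k (wirtinger j (fun y => F (τ y))) x =
      (jacobian τ x * Matrix.of (fun a b => wirtingerBar b (wirtinger a F) (τ x)) *
        (jacobian τ x)ᴴ) j k := by
  have h1 : wirtinger j (fun y => F (τ y)) =ᶠ[𝓝 x]
      fun y => ∑ a, jacobian τ y j a * wirtinger a F (τ y) := by
    have e1 : ∀ᶠ y in 𝓝 x, ContDiffAt ℝ 2 F (τ y) :=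
      hτ.continuousAt.eventually (hF.eventually (by simp))
    filter_upwards [e1, hτ.eventually (by simp)] with y hy1 hy2
    exact wirtinger_comp_holomorphic (hy1.differentiableAt (by norm_num))
      (hy2.differentiableAt (by norm_num)) j
  have hJ : ∀ a, DifferentiableAt ℂ (fun y => jacobian τ y j a) x := fun a => by
    have e1 : ContDiffAt ℂ 1 (fderiv ℂ τ) x := hτ.fderiv_right (by norm_num)
    have e2 := (e1.differentiableAt (by norm_num)).clm_apply
      (differentiableAt_const (c := (EuclideanSpace.single j (1 : ℂ) : Cn n)))
    exact (EuclideanSpace.proj (𝕜 := ℂ) a : Cn n →L[ℂ] ℂ).differentiableAt.comp x e2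
  have hτd : DifferentiableAt ℂ τ x := hτ.differentiableAt (by norm_num)
  have hG : ∀ a, DifferentiableAt ℝ (wirtinger a F) (τ x) := fun a => by
    rw [wirtinger_eq_del]
    exact (contDiffAt_wirt hF (m := 1) (by norm_num) _ _).differentiableAt (by norm_num)
  have hGτ : ∀ a, DifferentiableAt ℝ (fun y => wirtinger a F (τ y)) x := fun a =>
    (hG a).fun_comp' x (hτd.restrictScalars ℝ)
  have hJr := fun a => (hJ a).restrictScalars ℝ
  rw [wirtingerBar_eq_delBar, wirt_congr_at h1, wirt_sum _ fun a _ => (hJr a).fun_mul (hGτ a),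
    Matrix.mul_apply]
  simp only [Matrix.mul_apply, Finset.sum_mul, Matrix.of_apply, Matrix.conjTranspose_apply]
  rw [Finset.sum_comm]
  refine Finset.sum_congr rfl fun a _ => ?_
  rw [wirt_mul (hJr a) (hGτ a), delBar_eq_zero (hJ a),
    wirt_comp_holomorphic (F := wirtinger a F) (hG a) hτd, fderiv_single_eq, delBar_sum_smul, zero_mul]
  simp only [add_zero, Finset.mul_sum, wirtingerBar_eq_delBar]
  refine Finset.sum_congr rfl fun b _ => ?_
  rw [starRingEnd_apply]
  ring

end HolomorphicChange

section Charts

open Filter Topology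

variable {n : ℕ} {M : Type*} [TopologicalSpace M] [ChartedSpace (Cn n) M]
  {e e' : OpenPartialHomeomorph M (Cn n)} {x : Cn n}

lemma contDiffAt_transition (he : e ∈ holCharts n M) (he' : e' ∈ holCharts n M)
    (hx : x ∈ e.target) (hx' : e.symm x ∈ e'.source) :
    ContDiffAt ℂ ω (fun y => e' (e.symm y)) x := by
  have h := StructureGroupoid.compatible_of_mem_maximalAtlas
    (IsManifold.mem_maximalAtlas_iff.1 he) (IsManifold.mem_maximalAtlas_iff.1 he')
  have h1 := ((mem_groupoid_of_pregroupoid (PG := contDiffPregroupoid ω 𝓘(ℂ, Cn n))).1 h).1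
  have h2 : ContDiffOn ℂ ω (fun y => e' (e.symm y)) (e.symm ≫ₕ e').source := by
    simpa [contDiffPregroupoid, Function.comp_def] using h1
  exact h2.contDiffAt ((e.symm ≫ₕ e').open_source.mem_nhds (by simp [hx, hx']))

variable [IsManifold 𝓘(ℂ, Cn n) ω M]

lemma contDiffAt_comp_symm {u : M → ℝ} (hu : ContMDiff 𝓘(ℝ, Cn n) 𝓘(ℝ, ℝ) 4 u)
    (he : e ∈ holCharts n M) (hx : x ∈ e.target) :
    ContDiffAt ℝ 4 (fun y => u (e.symm y)) x := by
  set z := e.symm x with hz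
  set c := chartAt (Cn n) z with hc
  have hcm : c ∈ holCharts n M := IsManifold.chart_mem_maximalAtlas z
  have hzc : z ∈ c.source := mem_chart_source _ z
  have h1 := ((contMDiffAt_iff.1 (hu z)).2).contDiffAt (by simp)
  have h2 : ContDiffAt ℝ 4 (fun y => u (c.symm y)) (c z) := by
    simpa [Function.comp_def, chartAt_self_eq] using h1
  have h3 : ContDiffAt ℝ 4 (fun y => c (e.symm y)) x :=
    ((contDiffAt_transition he hcm hx hzc).restrict_scalars ℝ).of_le le_top
  refine (h2.comp x h3).congr_of_eventuallyEq ?_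
  have h4 : ∀ᶠ y in 𝓝 x, e.symm y ∈ c.source :=
    (e.symm.continuousAt hx).eventually (c.open_source.mem_nhds hzc)
  filter_upwards [h4] with y hy
  simp [c.left_inv hy]

omit [IsManifold 𝓘(ℂ, Cn n) ω M] in
lemma mdifferentiable_of_mem_holCharts (he : e ∈ holCharts n M) :
    e.MDifferentiable 𝓘(ℂ, Cn n) 𝓘(ℂ, Cn n) :=
  ⟨(contMDiffOn_of_mem_maximalAtlas he).mdifferentiableOn (by simp),
    (contMDiffOn_symm_of_mem_maximalAtlas he).mdifferentiableOn (by simp)⟩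

/-- The tangent vector with components `y` in the chart `e`. -/
def tangentVec (e : OpenPartialHomeomorph M (Cn n)) (x : Cn n) (y : Fin n → ℂ) :
    Tangent n (e.symm x) :=
  mfderiv 𝓘(ℂ, Cn n) 𝓘(ℂ, Cn n) e.symm x (WithLp.toLp 2 y : Cn n)

omit [IsManifold 𝓘(ℂ, Cn n) ω M] in
lemma sum_smul_coordVec (y : Fin n → ℂ) : ∑ j, y j • coordVec e x j = tangentVec e x y := by
  have h : (WithLp.toLp 2 y : Cn n) = ∑ j, y j • (EuclideanSpace.single j (1 : ℂ) : Cn n) := by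
    ext i
    simp [Finset.sum_apply, Pi.single_apply]
  rw [tangentVec, h]
  simp only [coordVec]
  exact (Eq.trans (map_sum (mfderiv 𝓘(ℂ, Cn n) 𝓘(ℂ, Cn n) e.symm x) _ _)
    (Finset.sum_congr rfl fun j _ => map_smul (mfderiv 𝓘(ℂ, Cn n) 𝓘(ℂ, Cn n) e.symm x) _ _)).symm

omit [IsManifold 𝓘(ℂ, Cn n) ω M] in
lemma quad_coeff (h : SesqForm n (e.symm x)) (y : Fin n → ℂ) :
    quad (coeff e x h) y = (h (tangentVec e x y) (tangentVec e x y)).re := by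
  rw [← sum_smul_coordVec, quad_eq_sum]
  congr 1
  simp only [map_sum, map_smulₛₗ, LinearMap.sum_apply, LinearMap.smul_apply, coeff,
    Matrix.of_apply, smul_eq_mul, RingHom.id_apply, Finset.mul_sum]
  rw [Finset.sum_comm]
  refine Finset.sum_congr rfl fun a _ => Finset.sum_congr rfl fun b _ => by ring

omit [IsManifold 𝓘(ℂ, Cn n) ω M] in
lemma tangentVec_ne_zero (he : e ∈ holCharts n M) (hx : x ∈ e.target) {y : Fin n → ℂ}
    (hy : y ≠ 0) : tangentVec e x y ≠ 0 := by
  intro h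
  have h1 := (mdifferentiable_of_mem_holCharts he).comp_symm_deriv hx
  have h2 := congrArg (fun L : Cn n →L[ℂ] Cn n => L (WithLp.toLp 2 y : Cn n)) h1
  have h3 : (WithLp.toLp 2 y : Cn n) = 0 := by
    refine h2.symm.trans ?_
    change mfderiv 𝓘(ℂ, Cn n) 𝓘(ℂ, Cn n) e (e.symm x) (tangentVec e x y) = 0
    rw [h]
    exact map_zero _
  exact hy (by simpa using congrArg WithLp.ofLp h3)

omit [IsManifold 𝓘(ℂ, Cn n) ω M] in
lemma coeff_isHermitian {h : SesqForm n (e.symm x)}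
    (hh : ∀ v w, h w v = (starRingEnd ℂ) (h v w)) : (coeff e x h).IsHermitian := by
  ext a b
  simp only [coeff, Matrix.conjTranspose_apply, Matrix.of_apply]
  rw [hh]
  simp

omit [IsManifold 𝓘(ℂ, Cn n) ω M] in
lemma coeff_metric_posDef (met : HermitianMetric n M) (he : e ∈ holCharts n M) (hx : x ∈ e.target) :
    (coeff e x (met.form (e.symm x))).PosDef := by
  refine posDef_of_quad_pos (coeff_isHermitian (met.hermitian _)) fun y hy => ?_
  rw [quad_coeff]
  exact met.pos _ _ (tangentVec_ne_zero he hx hy)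

omit [IsManifold 𝓘(ℂ, Cn n) ω M] in
lemma form_congr (h : (z : M) → SesqForm n z) {z z' : M} (hz : z = z') (v w : Cn n) :
    h z v w = h z' v w := by subst hz; rfl

omit [ChartedSpace (Cn n) M] [IsManifold 𝓘(ℂ, Cn n) ω M] in
lemma comp_symm_eventuallyEq (hx : x ∈ e.target) (hx' : e.symm x ∈ e'.source) (u : M → ℝ) :
    (fun y => (u (e.symm y) : ℂ)) =ᶠ[𝓝 x] fun y => (u (e'.symm (e' (e.symm y))) : ℂ) := by
  have h4 : ∀ᶠ y in 𝓝 x, e.symm y ∈ e'.source :=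
    (e.symm.continuousAt hx).eventually (e'.open_source.mem_nhds hx')
  filter_upwards [h4] with y hy
  rw [e'.left_inv hy]

section Transition

variable (he : e ∈ holCharts n M) (he' : e' ∈ holCharts n M) (hx : x ∈ e.target)
    (hx' : e.symm x ∈ e'.source)
include he he' hx hx'

omit [IsManifold 𝓘(ℂ, Cn n) ω M] in
lemma coordVec_transition (j : Fin n) : (coordVec e x j : Cn n) =
    tangentVec e' (e' (e.symm x)) (jacobian (fun y => e' (e.symm y)) x j) := by
  have hτ := (contDiffAt_transition he he' hx hx').differentiableAt (by simp)
  have h1 : e.symm =ᶠ[𝓝 x] e'.symm ∘ (fun y => e' (e.symm y)) := by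
    have h4 : ∀ᶠ y in 𝓝 x, e.symm y ∈ e'.source :=
      (e.symm.continuousAt hx).eventually (e'.open_source.mem_nhds hx')
    filter_upwards [h4] with y hy
    simp [e'.left_inv hy]
  have h2 : MDifferentiableAt 𝓘(ℂ, Cn n) 𝓘(ℂ, Cn n) e'.symm (e' (e.symm x)) :=
    (mdifferentiable_of_mem_holCharts he').mdifferentiableAt_symm (e'.map_source hx')
  have h3 : (mfderiv 𝓘(ℂ, Cn n) 𝓘(ℂ, Cn n) e.symm x : Cn n →L[ℂ] Cn n) =
      (mfderiv 𝓘(ℂ, Cn n) 𝓘(ℂ, Cn n) e'.symm (e' (e.symm x)) : Cn n →L[ℂ] Cn n).comp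
        (fderiv ℂ (fun y => e' (e.symm y)) x) := by
    refine Eq.trans h1.mfderiv_eq ?_
    refine Eq.trans (mfderiv_comp x (g := e'.symm) h2 hτ.mdifferentiableAt) ?_
    rw [mfderiv_eq_fderiv]
    rfl
  have h5 := congrArg (fun L : Cn n →L[ℂ] Cn n => L (EuclideanSpace.single j (1 : ℂ))) h3
  refine h5.trans ?_
  rfl

omit [IsManifold 𝓘(ℂ, Cn n) ω M] in
/-- The coefficients of a sesquilinear form in two charts. -/
lemma coeff_transition (h : (z : M) → SesqForm n z) :
    coeff e x (h (e.symm x)) = jacobian (fun y => e' (e.symm y)) x *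
      coeff e' (e' (e.symm x)) (h (e'.symm (e' (e.symm x)))) *
        (jacobian (fun y => e' (e.symm y)) x)ᴴ := by
  ext a b
  have h1 : coeff e x (h (e.symm x)) a b = h (e'.symm (e' (e.symm x)))
      (tangentVec e' (e' (e.symm x)) (jacobian (fun y => e' (e.symm y)) x a))
      (tangentVec e' (e' (e.symm x)) (jacobian (fun y => e' (e.symm y)) x b)) := by
    refine Eq.trans ?_ (form_congr h (e'.left_inv hx').symm _ _)
    rw [← coordVec_transition he he' hx hx', ← coordVec_transition he he' hx hx']
    rfl
  rw [h1, ← sum_smul_coordVec, ← sum_smul_coordVec]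
  simp only [map_sum, map_smulₛₗ, LinearMap.sum_apply, LinearMap.smul_apply, coeff,
    Matrix.of_apply, smul_eq_mul, RingHom.id_apply, Finset.mul_sum, Matrix.mul_apply,
    Finset.sum_mul, Matrix.conjTranspose_apply]
  refine Finset.sum_congr rfl fun c _ => Finset.sum_congr rfl fun d _ => ?_
  rw [starRingEnd_apply]
  ring

lemma grad_transition {u : M → ℝ} (hu : ContMDiff 𝓘(ℝ, Cn n) 𝓘(ℝ, ℝ) 4 u) :
    grad u e x = jacobian (fun y => e' (e.symm y)) x *ᵥ grad u e' (e' (e.symm x)) := by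
  have hτ := contDiffAt_transition he he' hx hx'
  have hF := contDiffAt_ofReal (contDiffAt_comp_symm hu he' (e'.map_source hx'))
  funext j
  rw [grad, wirtinger_eq_del, wirt_congr_at (comp_symm_eventuallyEq hx hx' u), ← wirtinger_eq_del,
    wirtinger_comp_holomorphic (F := fun y => (u (e'.symm y) : ℂ))
      (hF.differentiableAt (by norm_num)) (hτ.differentiableAt (by simp))]
  rfl

lemma hess_transition {u : M → ℝ} (hu : ContMDiff 𝓘(ℝ, Cn n) 𝓘(ℝ, ℝ) 4 u) :
    hess u e x = jacobian (fun y => e' (e.symm y)) x * hess u e' (e' (e.symm x)) *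
      (jacobian (fun y => e' (e.symm y)) x)ᴴ := by
  have hτ := contDiffAt_transition he he' hx hx'
  have hF := contDiffAt_ofReal (contDiffAt_comp_symm hu he' (e'.map_source hx'))
  ext j k
  have h := hessian_comp_holomorphic (F := fun y => (u (e'.symm y) : ℂ)) (hF.of_le (by norm_num))
    (hτ.of_le le_top) j k
  rw [wirtingerBar_eq_delBar, wirtinger_eq_del] at h
  rw [hess, Matrix.of_apply, wirtingerBar_eq_delBar, wirtinger_eq_del,
    wirt_congr_at (wirt_congr (comp_symm_eventuallyEq hx hx' u)), h]
  rfl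

omit [IsManifold 𝓘(ℂ, Cn n) ω M] in
lemma isUnit_det_jacobian (met : HermitianMetric n M) :
    IsUnit (jacobian (fun y => e' (e.symm y)) x).det := by
  have h1 := (coeff_metric_posDef met he hx).det_pos.ne'
  rw [coeff_transition he he' hx hx', Matrix.det_mul, Matrix.det_mul] at h1
  exact (left_ne_zero_of_mul (left_ne_zero_of_mul h1)).isUnit

end Transition

end Charts

/-! ### Uniform bounds on compact sets -/

section CompactBounds

open Filter Topology

variable {n : ℕ} {P E : Type*} [NormedAddCommGroup P] [NormedSpace ℝ P] [NormedAddCommGroup E]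
  [NormedSpace ℝ E]

/-- `H` and its derivatives of order at most two are bounded by `T` at `q`. -/
def JetBound (T : ℝ) (H : E → ℂ) (q : E) : Prop :=
  ‖H q‖ ≤ T ∧ ‖fderiv ℝ H q‖ ≤ T ∧ ‖fderiv ℝ (fderiv ℝ H) q‖ ≤ T

lemma JetBound.mono {T T' : ℝ} {H : E → ℂ} {q : E} (h : JetBound T H q) (hT : T ≤ T') :
    JetBound T' H q :=
  ⟨h.1.trans hT, h.2.1.trans hT, h.2.2.trans hT⟩

/-- The partial derivatives of order at most two are bounded on compact sets. -/
lemma exists_partial_bound {H : P × E → ℂ} {K : Set (P × E)} (hK : IsCompact K)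
    (hH : ∀ q ∈ K, ContDiffAt ℝ 2 H q) :
    ∃ T : ℝ, ∀ p y, (p, y) ∈ K → JetBound T (fun y => H (p, y)) y := by
  have hD : ∀ q ∈ K, ContDiffAt ℝ 1 (fderiv ℝ H) q := fun q hq =>
    (hH q hq).fderiv_right (by norm_num)
  have hDD : ∀ q ∈ K, ContDiffAt ℝ 0 (fderiv ℝ (fderiv ℝ H)) q := fun q hq =>
    (hD q hq).fderiv_right (by norm_num)
  obtain ⟨T₁, h₁⟩ := hK.exists_bound_of_continuousOn
    fun q hq => (hH q hq).continuousAt.continuousWithinAt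
  obtain ⟨T₂, h₂⟩ := hK.exists_bound_of_continuousOn
    fun q hq => (hD q hq).continuousAt.continuousWithinAt
  obtain ⟨T₃, h₃⟩ := hK.exists_bound_of_continuousOn (f := fderiv ℝ (fderiv ℝ H))
    fun q hq => (hDD q hq).continuousAt.continuousWithinAt
  refine ⟨max T₁ (max T₂ T₃), fun p y hq => ?_⟩
  have hι : ∀ y : E, HasFDerivAt (fun y : E => (p, y)) (ContinuousLinearMap.inr ℝ P E) y :=
    fun y => hasFDerivAt_prodMk_right p y
  have e1 : ∀ᶠ y in 𝓝 y, fderiv ℝ (fun y => H (p, y)) y =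
      (fderiv ℝ H (p, y)).comp (ContinuousLinearMap.inr ℝ P E) := by
    have : ∀ᶠ y in 𝓝 y, ContDiffAt ℝ 2 H (p, y) :=
      (hι y).continuousAt.eventually ((hH _ hq).eventually (by simp))
    filter_upwards [this] with y hy
    exact ((hy.differentiableAt (by norm_num)).hasFDerivAt.comp y (hι y)).fderiv
  have e2 : ∀ z w, fderiv ℝ (fderiv ℝ (fun y => H (p, y))) y z w =
      fderiv ℝ (fderiv ℝ H) (p, y) (0, z) (0, w) := fun z w => by
    have h := ((hD _ hq).differentiableAt (by norm_num)).hasFDerivAt.comp y (hι y)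
    rw [EventuallyEq.fderiv_eq e1]
    have h2 := (h.clm_comp (hasFDerivAt_const (ContinuousLinearMap.inr ℝ P E) y)).fderiv
    simp only [Function.comp_def] at h2
    rw [h2]
    simp
  have hpair : ∀ z : E, ‖((0 : P), z)‖ = ‖z‖ := fun z => by simp [Prod.norm_def]
  refine ⟨(h₁ _ hq).trans (le_max_left _ _), ?_, ?_⟩
  · refine ContinuousLinearMap.opNorm_le_bound _ ((norm_nonneg _).trans
      ((h₂ _ hq).trans ((le_max_left _ _).trans (le_max_right _ _)))) fun z => ?_
    rw [e1.self_of_nhds, ContinuousLinearMap.comp_apply]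
    refine (ContinuousLinearMap.le_opNorm _ _).trans ?_
    rw [ContinuousLinearMap.inr_apply, hpair]
    exact mul_le_mul_of_nonneg_right
      ((h₂ _ hq).trans ((le_max_left _ _).trans (le_max_right _ _))) (norm_nonneg _)
  · have h3 := (h₃ _ hq).trans ((le_max_right T₂ T₃).trans (le_max_right T₁ _))
    refine ContinuousLinearMap.opNorm_le_bound₂ _ ((norm_nonneg _).trans h3) fun z w => ?_
    rw [e2]
    refine (ContinuousLinearMap.le_opNorm₂ _ _ _).trans ?_
    rw [hpair, hpair]
    gcongr

lemma exists_partial_bound_family {ι : Type*} [Finite ι] {H : ι → P × E → ℂ} {K : Set (P × E)}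
    (hK : IsCompact K) (hH : ∀ i, ∀ q ∈ K, ContDiffAt ℝ 2 (H i) q) :
    ∃ T : ℝ, ∀ i p y, (p, y) ∈ K → JetBound T (fun y => H i (p, y)) y := by
  choose T hT using fun i => exists_partial_bound hK (hH i)
  obtain ⟨T', hT'⟩ := (Set.finite_range T).bddAbove
  have h : ∀ i, T i ≤ T' := fun i => hT' (Set.mem_range_self i)
  exact ⟨T', fun i p y hq => (hT i p y hq).mono (h i)⟩

variable {x₀ w : Cn n} {h : Cn n → ℂ} {T R : ℝ}

lemma norm_wirt_le_mul {c : ℂ} (hc : ‖c‖ = 1) (h1 : ‖fderiv ℝ h x₀‖ ≤ T) (hw : ‖w‖ ≤ R) :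
    ‖wirt c w h x₀‖ ≤ T * R := by
  have hT0 : 0 ≤ T := (norm_nonneg _).trans h1
  refine norm_wirt_le hc ?_ ?_
  · exact (ContinuousLinearMap.le_opNorm _ _).trans (mul_le_mul h1 hw (norm_nonneg _) hT0)
  · refine (ContinuousLinearMap.le_opNorm _ _).trans (mul_le_mul h1 ?_ (norm_nonneg _) hT0)
    rwa [norm_smul, Complex.norm_I, one_mul]

lemma norm_lap_le_mul (hh : ContDiffAt ℝ 2 h x₀) (h2 : ‖fderiv ℝ (fderiv ℝ h) x₀‖ ≤ T)
    (hw : ‖w‖ ≤ R) : ‖lap w h x₀‖ ≤ T * R ^ 2 := by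
  have h3 := norm_lap_comp_sub_le (Γ := fun y : Cn n => y) (w := w) contDiffAt_id hh h2
    (R := R) (by simpa using hw) (by simpa [norm_smul] using hw)
  rwa [lapVec_id, map_zero, sub_zero] at h3

lemma lapVec_graph {f : Cn n → ℝ} (hf : ContDiffAt ℝ 2 f x₀) :
    lapVec w (fun y => (y, f y)) x₀ = (0, (lap w (fun y => (f y : ℂ)) x₀).re) := by
  have hΓ : ContDiffAt ℝ 2 (fun y => (y, f y)) x₀ := contDiffAt_id.prodMk hf
  have h1 := lapVec_clm_comp (w := w) (ContinuousLinearMap.fst ℝ (Cn n) ℝ) hΓ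
  have h2 := lapVec_clm_comp (w := w) (ContinuousLinearMap.snd ℝ (Cn n) ℝ) hΓ
  refine Prod.ext (h1.symm.trans lapVec_id) ?_
  exact h2.symm.trans (re_lap_ofReal_eq_lapVec hf).symm

section Graph

variable {f : Cn n → ℝ} {H : Cn n × ℝ → ℂ} (hf : ContDiffAt ℝ 2 f x₀)
  (hH : ContDiffAt ℝ 2 H (x₀, f x₀)) (h1 : ‖fderiv ℝ H (x₀, f x₀)‖ ≤ T) (hw : ‖w‖ ≤ R)
  (hp : ‖∂[w] (fun y => (f y : ℂ)) x₀‖ ≤ R)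
include hf hw hp

lemma norm_fderiv_graph_le {c : ℂ} (hc : ‖c‖ = 1) :
    ‖fderiv ℝ (fun y => (y, f y)) x₀ (c • w)‖ ≤ 2 * R := by
  have hR : 0 ≤ R := (norm_nonneg _).trans hw
  have hfd := hf.differentiableAt (by norm_num)
  have e1 : fderiv ℝ (fun y => (y, f y)) x₀ (c • w) = (c • w, fderiv ℝ f x₀ (c • w)) := by
    have := ((hasFDerivAt_id x₀).prodMk hfd.hasFDerivAt).fderiv
    exact congrArg (fun L : Cn n →L[ℝ] Cn n × ℝ => L (c • w)) this
  rw [e1, Prod.norm_def]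
  refine max_le ?_ ?_
  · rw [norm_smul, hc, one_mul]
    linarith
  · have h1 : ‖fderiv ℝ f x₀ (c • w)‖ = ‖fderiv ℝ (fun y => (f y : ℂ)) x₀ (c • w)‖ := by
      rw [fderiv_ofReal hfd, Complex.norm_real]
    change ‖fderiv ℝ f x₀ (c • w)‖ ≤ _
    rw [h1, fderiv_smul_eq, delBar_eq_conj_of_real hfd, ← map_mul]
    refine (norm_add_le _ _).trans ?_
    rw [Complex.norm_conj, norm_mul, hc, one_mul]
    linarith

include hH h1

lemma norm_wirt_graph_le {c : ℂ} (hc : ‖c‖ = 1) :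
    ‖wirt c w (fun y => H (y, f y)) x₀‖ ≤ T * (2 * R) := by
  have h3 := norm_fderiv_graph_le hf hw hp (c := 1) (by simp)
  rw [one_smul] at h3
  exact norm_wirt_comp_le (Γ := fun y => (y, f y)) (contDiffAt_id.prodMk hf) hH hc h1 h3
    (norm_fderiv_graph_le hf hw hp (by simp))

lemma norm_lap_graph_le (h2 : ‖fderiv ℝ (fderiv ℝ H) (x₀, f x₀)‖ ≤ T) {l : ℝ}
    (hl : |(lap w (fun y => (f y : ℂ)) x₀).re| ≤ l) :
    ‖lap w (fun y => H (y, f y)) x₀‖ ≤ T * (2 * R) ^ 2 + T * l := by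
  have hT0 : 0 ≤ T := (norm_nonneg _).trans h1
  have h3 := norm_fderiv_graph_le hf hw hp (c := 1) (by simp)
  rw [one_smul] at h3
  have h4 := norm_lap_comp_sub_le (Γ := fun y => (y, f y)) (contDiffAt_id.prodMk hf) hH h2 h3
    (norm_fderiv_graph_le hf hw hp (by simp))
  have h5 : ‖fderiv ℝ H (x₀, f x₀) (lapVec w (fun y => (y, f y)) x₀)‖ ≤ T * l := by
    refine (ContinuousLinearMap.le_opNorm _ _).trans (mul_le_mul h1 ?_ (norm_nonneg _) hT0)
    rw [lapVec_graph hf, Prod.norm_def]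
    exact max_le (by simpa using (abs_nonneg _).trans hl) hl
  exact (norm_le_norm_sub_add _ _).trans (add_le_add h4 h5)

end Graph

end CompactBounds

section MatrixSmoothness

variable {n : ℕ} {E : Type*} [NormedAddCommGroup E] [NormedSpace ℝ E] {q : E} {k : ℕ∞ω}

lemma contDiffAt_det {M : E → Matrix (Fin n) (Fin n) ℂ}
    (hM : ∀ a b, ContDiffAt ℝ k (fun y => M y a b) q) : ContDiffAt ℝ k (fun y => (M y).det) q := by
  simp only [Matrix.det_apply, Units.smul_def, zsmul_eq_mul]
  exact ContDiffAt.sum fun σ _ => contDiffAt_const.mul (contDiffAt_prod fun a _ => hM _ a)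

lemma contDiffAt_inv_apply {M : E → Matrix (Fin n) (Fin n) ℂ}
    (hM : ∀ a b, ContDiffAt ℝ k (fun y => M y a b) q) (h : (M q).det ≠ 0) (a b : Fin n) :
    ContDiffAt ℝ k (fun y => (M y)⁻¹ a b) q := by
  have h1 : ∀ y, (M y)⁻¹ a b = ((M y).det)⁻¹ * ((M y).updateRow b (Pi.single a 1)).det := fun y => by
    rw [Matrix.inv_def, Matrix.smul_apply, Matrix.adjugate_apply, Ring.inverse_eq_inv', smul_eq_mul]
  simp only [h1]
  refine ((contDiffAt_det hM).inv h).mul (contDiffAt_det fun c d => ?_)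
  simp only [Matrix.updateRow_apply]
  split_ifs
  · exact contDiffAt_const
  · exact hM c d

lemma contDiffAt_mul_apply {M N : E → Matrix (Fin n) (Fin n) ℂ}
    (hM : ∀ a b, ContDiffAt ℝ k (fun y => M y a b) q)
    (hN : ∀ a b, ContDiffAt ℝ k (fun y => N y a b) q) (a b : Fin n) :
    ContDiffAt ℝ k (fun y => (M y * N y) a b) q := by
  simp only [Matrix.mul_apply]
  exact ContDiffAt.sum fun c _ => (hM a c).mul (hN c b)

lemma contDiffAt_conjTranspose_apply {M : E → Matrix (Fin n) (Fin n) ℂ}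
    (hM : ∀ a b, ContDiffAt ℝ k (fun y => M y a b) q) (a b : Fin n) :
    ContDiffAt ℝ k (fun y => (M y)ᴴ a b) q :=
  Complex.conjCLE.contDiff.contDiffAt.comp q (hM b a)

lemma contDiffAt_const_mul_mul_const (A C : Matrix (Fin n) (Fin n) ℂ)
    {M : E → Matrix (Fin n) (Fin n) ℂ} (hM : ∀ a b, ContDiffAt ℝ k (fun y => M y a b) q)
    (a b : Fin n) : ContDiffAt ℝ k (fun y => (A * M y * C) a b) q :=
  contDiffAt_mul_apply (M := fun y => A * M y) (N := fun _ => C)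
    (contDiffAt_mul_apply (M := fun _ => A) (fun _ _ => contDiffAt_const) hM)
    (fun _ _ => contDiffAt_const) a b

end MatrixSmoothness

/-! ### The equation in a coordinate domain -/

section LocalData

open Filter Topology

variable {n : ℕ}

/-- The coordinate expressions of the metric, of the family of `(1,1)`-forms and of the right hand
side of the equation, on an open set of `ℂⁿ`. -/
structure LocalData (n : ℕ) where
  dom : Set (Cn n)
  W : Cn n → Matrix (Fin n) (Fin n) ℂ
  X : Cn n × ℝ → Matrix (Fin n) (Fin n) ℂ
  Ψ : Cn n × (Fin n → ℂ) × ℝ → ℝ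
  isOpen_dom : IsOpen dom
  contDiffOn_W : ∀ a b, ContDiffOn ℝ ∞ (fun x => W x a b) dom
  contDiffOn_X : ∀ a b, ContDiffOn ℝ ∞ (fun p => X p a b) (dom ×ˢ Set.univ)
  contDiffOn_Ψ : ContDiffOn ℝ ∞ Ψ (dom ×ˢ Set.univ)
  posDef_W : ∀ x ∈ dom, (W x).PosDef
  pos_Ψ : ∀ x ∈ dom, ∀ q, 0 < Ψ (x, q)

/-- The coordinate components of `∂f`. -/
def gradVec (f : Cn n → ℝ) (x : Cn n) : Fin n → ℂ :=
  fun a => wirtinger a (fun y => (f y : ℂ)) x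

/-- The coordinate components of `∂∂̄f`. -/
def hessMat (f : Cn n → ℝ) (x : Cn n) : Matrix (Fin n) (Fin n) ℂ :=
  Matrix.of fun a b => wirtingerBar b (wirtinger a fun y => (f y : ℂ)) x

/-- The vectors whose components are the rows of `V`. -/
def frameVec (V : Matrix (Fin n) (Fin n) ℂ) (a : Fin n) : Cn n := WithLp.toLp 2 (V a)

lemma frameVec_eq_sum (V : Matrix (Fin n) (Fin n) ℂ) (a : Fin n) :
    frameVec V a = ∑ k, V a k • (EuclideanSpace.single k (1 : ℂ) : Cn n) := by
  ext i
  simp [frameVec, Finset.sum_apply, Pi.single_apply]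

variable {f : Cn n → ℝ} {x : Cn n} {V : Matrix (Fin n) (Fin n) ℂ}

lemma del_frameVec (V : Matrix (Fin n) (Fin n) ℂ) (a : Fin n) (h : Cn n → ℂ) :
    ∂[frameVec V a] h = fun x => ∑ k, V a k * wirtinger k h x := by
  funext x
  rw [frameVec_eq_sum, del_sum_smul]
  simp only [wirtinger_eq_del]

lemma frameGrad_frameVec (V : Matrix (Fin n) (Fin n) ℂ) (f : Cn n → ℝ) (x : Cn n) :
    frameGrad (frameVec V) (fun y => (f y : ℂ)) x = V *ᵥ gradVec f x := by
  funext a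
  rw [frameGrad, del_frameVec]
  rfl

lemma addHess_frameVec (hf : ContDiffAt ℝ 4 f x) (X : Cn n → Matrix (Fin n) (Fin n) ℂ) :
    addHess (frameVec V) (fun y => (f y : ℂ)) (fun y => V * X y * Vᴴ) x =
      V * (X x + hessMat f x) * Vᴴ := by
  have hfC : ContDiffAt ℝ 4 (fun y => (f y : ℂ)) x := contDiffAt_ofReal hf
  have hd : ∀ k, DifferentiableAt ℝ (wirtinger k fun y => (f y : ℂ)) x := fun k => by
    rw [wirtinger_eq_del]
    exact (contDiffAt_wirt hfC (m := 3) (by norm_num) _ _).differentiableAt (by norm_num)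
  rw [Matrix.mul_add, Matrix.add_mul]
  ext a b
  rw [addHess, Matrix.of_apply, Matrix.add_apply]
  congr 1
  rw [del_frameVec, wirt_sum _ fun k _ => (hd k).const_mul _, Matrix.mul_apply]
  simp only [wirt_const_mul _ (hd _), frameVec_eq_sum V b, delBar_sum_smul, Matrix.mul_apply,
    Finset.sum_mul, Finset.mul_sum, hessMat, Matrix.of_apply, wirtingerBar_eq_delBar,
    Matrix.conjTranspose_apply, starRingEnd_apply]
  rw [Finset.sum_comm]
  exact Finset.sum_congr rfl fun k _ => Finset.sum_congr rfl fun l _ => by ring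

lemma gradSq_frameVec (hV : IsUnit V.det) (f : Cn n → ℝ) (W : Cn n → Matrix (Fin n) (Fin n) ℂ)
    (x : Cn n) : gradSq (frameVec V) (fun y => (f y : ℂ)) (fun y => (V⁻¹)ᴴ * (W y)⁻¹ * V⁻¹) x =
      star (gradVec f x) ⬝ᵥ ((W x)⁻¹ *ᵥ gradVec f x) := by
  have h1 : ∀ (p : Fin n → ℂ) (B : Matrix (Fin n) (Fin n) ℂ),
      ∑ a, ∑ b, (starRingEnd ℂ) (p a) * p b * B a b = star p ⬝ᵥ (B *ᵥ p) := fun p B => by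
    simp only [dotProduct, Matrix.mulVec, Finset.mul_sum, Pi.star_apply, starRingEnd_apply]
    exact Finset.sum_congr rfl fun a _ => Finset.sum_congr rfl fun b _ => by ring
  rw [gradSq, h1, frameGrad_frameVec, Matrix.star_mulVec, ← Matrix.dotProduct_mulVec,
    Matrix.mulVec_mulVec, Matrix.mulVec_mulVec]
  have hVH : IsUnit (Vᴴ).det := by
    rw [Matrix.det_conjTranspose]
    exact hV.star
  congr 2
  rw [Matrix.conjTranspose_nonsing_inv, show Vᴴ * ((Vᴴ)⁻¹ * (W x)⁻¹ * V⁻¹) * V =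
    (Vᴴ * (Vᴴ)⁻¹) * (W x)⁻¹ * (V⁻¹ * V) by simp only [Matrix.mul_assoc],
    Matrix.nonsing_inv_mul _ hV, Matrix.mul_nonsing_inv _ hVH, Matrix.mul_one, Matrix.one_mul]

namespace LocalData

variable (D : LocalData n)

/-- The coefficients of `χ(·, f) + √-1 ∂∂̄f`. -/
def g (f : Cn n → ℝ) (x : Cn n) : Matrix (Fin n) (Fin n) ℂ := D.X (x, f x) + hessMat f x

/-- The squared length `|∂f|²`. -/
def gradLenSq (f : Cn n → ℝ) (x : Cn n) : ℝ :=
  (star (gradVec f x) ⬝ᵥ ((D.W x)⁻¹ *ᵥ gradVec f x)).re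

/-- The exponent `N |∂f|² + exp (M (A + 1 - f))` of the test function. -/
def exponent (A N M : ℝ) (f : Cn n → ℝ) (x : Cn n) : ℝ :=
  N * D.gradLenSq f x + Real.exp (M * (A + 1 - f x))

/-- `χ(·, f)` in the frame `V`. -/
def frameX (V : Matrix (Fin n) (Fin n) ℂ) (q : Cn n × ℝ) : Matrix (Fin n) (Fin n) ℂ :=
  V * D.X q * Vᴴ

/-- The metric in the frame `V`. -/
def frameW (V : Matrix (Fin n) (Fin n) ℂ) (x : Cn n) : Matrix (Fin n) (Fin n) ℂ :=
  V * D.W x * Vᴴ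

/-- The metric on covectors in the coframe dual to a frame with inverse matrix `U`. -/
def frameB (U : Matrix (Fin n) (Fin n) ℂ) (x : Cn n) : Matrix (Fin n) (Fin n) ℂ :=
  Uᴴ * (D.W x)⁻¹ * U

/-- The right hand side as a function of the components of `∂f` in a frame with inverse matrix `U`,
normalized so that the Hessian equation takes the form `mixedDet k g W = Ψ det W`. -/
def frameΨ (k : ℕ) (U : Matrix (Fin n) (Fin n) ℂ) (q : Cn n × (Fin n → ℂ) × ℝ) : ℝ :=
  n.choose k * D.Ψ (q.1, U *ᵥ q.2.1, q.2.2)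

/-- `f` is an admissible solution of the Hessian equation with the given a priori bounds. -/
structure IsSolution (k : ℕ) (ε A B : ℝ) (f : Cn n → ℝ) : Prop where
  contDiffAt : ∀ x ∈ D.dom, ContDiffAt ℝ 4 f x
  posDef : ∀ x ∈ D.dom, (D.g f x).PosDef
  equation : ∀ x ∈ D.dom, mixedDet k (D.g f x) (D.W x) =
    n.choose k * (D.Ψ (x, gradVec f x, f x) : ℂ) * (D.W x).det
  le_X : ∀ x ∈ D.dom, ∀ y, ε * quad (D.W x) y ≤ quad (D.X (x, f x)) y
  abs_le : ∀ x ∈ D.dom, |f x| ≤ A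
  gradLen_le : ∀ x ∈ D.dom, √(D.gradLenSq f x) ≤ B

variable {D} {K : Set (Cn n)}

/-- Frames that are orthonormal for the metric are bounded over a compact set, together with their
inverses: in such a frame `W⁻¹ = Vᴴ V`, and `V⁻¹ = W Vᴴ`. -/
lemma exists_frame_bound (hK : IsCompact K) (hKD : K ⊆ D.dom) :
    ∃ R : ℝ, 0 ≤ R ∧ ∀ x ∈ K, ∀ V : Matrix (Fin n) (Fin n) ℂ, V * D.W x * Vᴴ = 1 →
      (∀ a b, ‖V a b‖ ≤ R) ∧ ∀ a b, ‖V⁻¹ a b‖ ≤ R := by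
  have hW : ∀ x ∈ K, ∀ a b, ContDiffAt ℝ ∞ (fun x => D.W x a b) x := fun x hx a b =>
    (D.contDiffOn_W a b).contDiffAt (D.isOpen_dom.mem_nhds (hKD hx))
  choose R₁ hR₁ using fun a b => hK.exists_bound_of_continuousOn
    fun x hx => (hW x hx a b).continuousAt.continuousWithinAt
  choose R₂ hR₂ using fun a b => hK.exists_bound_of_continuousOn (f := fun x => (D.W x)⁻¹ a b)
    fun x hx => (contDiffAt_inv_apply (hW x hx)
      (D.posDef_W x (hKD hx)).det_pos.ne' a b).continuousAt.continuousWithinAt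
  obtain ⟨R₃, hR₃⟩ := (Set.finite_range fun p : Fin n × Fin n =>
    max (R₁ p.1 p.2) (R₂ p.1 p.2)).bddAbove
  set R := max 1 R₃ with hR
  have h1 : ∀ a b, max (R₁ a b) (R₂ a b) ≤ R := fun a b =>
    (hR₃ (Set.mem_range_self (a, b))).trans (le_max_right _ _)
  have hR1 : 1 ≤ R := le_max_left _ _
  have hR0 : 0 ≤ R := by linarith
  refine ⟨R + n * R ^ 2, by positivity, fun x hx V hV => ?_⟩
  have h2 : ∀ a b, ‖V a b‖ ≤ R := fun a b => by
    have e1 := (norm_apply_sq_le hV a b).trans ((Complex.re_le_norm _).trans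
      ((hR₂ b b x hx).trans ((le_max_right _ _).trans (h1 b b))))
    nlinarith [norm_nonneg (V a b)]
  refine ⟨fun a b => (h2 a b).trans (le_add_of_nonneg_right (by positivity)), fun a b => ?_⟩
  rw [Matrix.inv_eq_right_inv (mul_mul_conjTranspose_self hV), Matrix.mul_apply]
  have e1 : (n : ℝ) * R ^ 2 = ∑ _c : Fin n, R ^ 2 := by simp
  refine (norm_sum_le_of_le _ fun c _ => ?_).trans
    (e1.ge.trans (le_add_of_nonneg_left hR0))
  rw [norm_mul, Matrix.conjTranspose_apply, norm_star, sq]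
  exact mul_le_mul ((hR₁ a c x hx).trans ((le_max_left _ _).trans (h1 a c))) (h2 b c)
    (norm_nonneg _) hR0

lemma two_le_infty : (2 : ℕ∞ω) ≤ ∞ :=
  WithTop.coe_le_coe.2 le_top

/-- The space of pairs consisting of a frame and its inverse. Functions are used in place of
matrices because matrices carry no global norm. -/
abbrev FramePair (n : ℕ) : Type := (Fin n → Fin n → ℂ) × (Fin n → Fin n → ℂ)

/-- Bounds for the data in all orthonormal frames over a compact set. -/
lemma exists_jet_bound (hK : IsCompact K) (hKD : K ⊆ D.dom) {k : ℕ} (hkn : k ≤ n) (A B : ℝ) :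
    ∃ T : ℝ, 1 ≤ T ∧ ∀ x ∈ K, ∀ V : Matrix (Fin n) (Fin n) ℂ, V * D.W x * Vᴴ = 1 →
      (∀ a, ‖frameVec V a‖ ≤ T) ∧
      (∀ a b, JetBound T (fun y => D.frameW V y a b) x) ∧
      (∀ a b, JetBound T (fun y => D.frameB V⁻¹ y a b) x) ∧
      (∀ s, |s| ≤ A → ∀ a b, JetBound T (fun q => D.frameX V q a b) (x, s)) ∧
      (∀ s p, |s| ≤ A → (∀ a, ‖p a‖ ≤ B) →
        JetBound T (fun q => (D.frameΨ k V⁻¹ q : ℂ)) (x, p, s) ∧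
          1 / T ≤ D.frameΨ k V⁻¹ (x, p, s)) := by
  obtain ⟨R, hR0, hR⟩ := exists_frame_bound hK hKD
  set KP : Set (FramePair n) := Metric.closedBall 0 R ×ˢ Metric.closedBall 0 R with hKP
  have hKPc : IsCompact KP := (isCompact_closedBall _ _).prod (isCompact_closedBall _ _)
  have hV1 : ∀ {E : Type} [NormedAddCommGroup E] [NormedSpace ℝ E] (q : FramePair n × E)
      (a b : Fin n),
      ContDiffAt ℝ ∞ (fun q : FramePair n × E => Matrix.of q.1.1 a b) q := fun q a b => by
    simp only [Matrix.of_apply]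
    fun_prop
  have hV2 : ∀ {E : Type} [NormedAddCommGroup E] [NormedSpace ℝ E] (q : FramePair n × E)
      (a b : Fin n),
      ContDiffAt ℝ ∞ (fun q : FramePair n × E => Matrix.of q.1.2 a b) q := fun q a b => by
    simp only [Matrix.of_apply]
    fun_prop
  have hW : ∀ q : FramePair n × Cn n, q.2 ∈ K → ∀ a b,
      ContDiffAt ℝ ∞ (fun q : FramePair n × Cn n => D.W q.2 a b) q :=
    fun q hq a b => ContDiffAt.comp q ((D.contDiffOn_W a b).contDiffAt
      (D.isOpen_dom.mem_nhds (hKD hq))) contDiffAt_snd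
  obtain ⟨T₁, hT₁⟩ := exists_partial_bound_family (ι := Fin n × Fin n)
    (H := fun i (q : FramePair n × Cn n) => D.frameW (Matrix.of q.1.1) q.2 i.1 i.2) (hKPc.prod hK)
    fun i q hq => (contDiffAt_mul_apply (contDiffAt_mul_apply (hV1 q) (hW q hq.2))
      (contDiffAt_conjTranspose_apply (hV1 q)) i.1 i.2).of_le (two_le_infty)
  obtain ⟨T₂, hT₂⟩ := exists_partial_bound_family (ι := Fin n × Fin n)
    (H := fun i (q : FramePair n × Cn n) => D.frameB (Matrix.of q.1.2) q.2 i.1 i.2) (hKPc.prod hK)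
    fun i q hq => (contDiffAt_mul_apply (contDiffAt_mul_apply
      (contDiffAt_conjTranspose_apply (hV2 q)) (contDiffAt_inv_apply (hW q hq.2)
        (D.posDef_W _ (hKD hq.2)).det_pos.ne')) (hV2 q) i.1 i.2).of_le (two_le_infty)
  obtain ⟨T₃, hT₃⟩ := exists_partial_bound_family (ι := Fin n × Fin n)
    (H := fun i (q : FramePair n × (Cn n × ℝ)) => D.frameX (Matrix.of q.1.1) q.2 i.1 i.2)
    (hKPc.prod (hK.prod (isCompact_closedBall (0 : ℝ) A)))
    fun i q hq => (contDiffAt_mul_apply (contDiffAt_mul_apply (hV1 q)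
      (fun a b => ContDiffAt.comp q ((D.contDiffOn_X a b).contDiffAt
        ((D.isOpen_dom.prod isOpen_univ).mem_nhds ⟨hKD hq.2.1, Set.mem_univ _⟩)) contDiffAt_snd))
      (contDiffAt_conjTranspose_apply (hV1 q)) i.1 i.2).of_le (two_le_infty)
  have hΨ : ∀ q : FramePair n × (Cn n × (Fin n → ℂ) × ℝ), q.2.1 ∈ K → ContDiffAt ℝ ∞
      (fun q : FramePair n × (Cn n × (Fin n → ℂ) × ℝ) => (D.frameΨ k (Matrix.of q.1.2) q.2 : ℂ)) q := by
    intro q hq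
    refine Complex.ofRealCLM.contDiff.contDiffAt.comp q (contDiffAt_const.mul ?_)
    refine ContDiffAt.comp q (D.contDiffOn_Ψ.contDiffAt ((D.isOpen_dom.prod isOpen_univ).mem_nhds
        ⟨hKD hq, Set.mem_univ _⟩)) (f := fun q : FramePair n × (Cn n × (Fin n → ℂ) × ℝ) =>
          (q.2.1, Matrix.of q.1.2 *ᵥ q.2.2.1, q.2.2.2)) ?_
    refine contDiffAt_snd.fst.prodMk (ContDiffAt.prodMk ?_ contDiffAt_snd.snd.snd)
    refine contDiffAt_pi.2 fun a => ?_
    simp only [Matrix.mulVec, dotProduct]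
    refine ContDiffAt.sum fun b _ => (hV2 q a b).mul ?_
    fun_prop
  have hKΨ := hKPc.prod (hK.prod ((isCompact_closedBall (0 : Fin n → ℂ) |B|).prod
    (isCompact_closedBall (0 : ℝ) A)))
  have hΨ0 : ∀ q : FramePair n × (Cn n × (Fin n → ℂ) × ℝ), q.2.1 ∈ K →
      0 < D.frameΨ k (Matrix.of q.1.2) q.2 := fun q hq =>
    mul_pos (by exact_mod_cast Nat.choose_pos hkn) (D.pos_Ψ _ (hKD hq) _)
  obtain ⟨T₄, hT₄⟩ := exists_partial_bound (hKΨ) fun q hq => (hΨ q hq.2.1).of_le (two_le_infty)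
  obtain ⟨T₅, hT₅⟩ := hKΨ.exists_bound_of_continuousOn fun q hq =>
    ((hΨ q hq.2.1).continuousAt.inv₀
      (by exact_mod_cast (hΨ0 q hq.2.1).ne')).continuousWithinAt
  obtain ⟨T₆, hT₆⟩ := (isCompact_closedBall (0 : Fin n → Fin n → ℂ) R).exists_bound_of_continuousOn
    (f := fun V a => frameVec (Matrix.of V) a) (by
      refine Continuous.continuousOn (continuous_pi fun a => ?_)
      exact (PiLp.continuous_toLp 2 _).comp (continuous_apply a))
  set T := max 1 (max T₁ (max T₂ (max T₃ (max T₄ (max T₅ T₆))))) with hT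
  have hT1 : 1 ≤ T := by simp [hT]
  refine ⟨T, hT1, fun x hx V hV => ?_⟩
  obtain ⟨h1, h2⟩ := hR x hx V hV
  let V' : Fin n → Fin n → ℂ := fun a b => V a b
  let U' : Fin n → Fin n → ℂ := fun a b => V⁻¹ a b
  have hVb : V' ∈ Metric.closedBall (0 : Fin n → Fin n → ℂ) R := by
    rw [mem_closedBall_zero_iff, pi_norm_le_iff_of_nonneg hR0]
    exact fun a => (pi_norm_le_iff_of_nonneg hR0).2 fun b => h1 a b
  have hUb : U' ∈ Metric.closedBall (0 : Fin n → Fin n → ℂ) R := by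
    rw [mem_closedBall_zero_iff, pi_norm_le_iff_of_nonneg hR0]
    exact fun a => (pi_norm_le_iff_of_nonneg hR0).2 fun b => h2 a b
  have hs' : ∀ s : ℝ, |s| ≤ A → s ∈ Metric.closedBall (0 : ℝ) A := fun s hs => by simpa using hs
  have hTT : T₁ ≤ T ∧ T₂ ≤ T ∧ T₃ ≤ T ∧ T₄ ≤ T ∧ T₅ ≤ T ∧ T₆ ≤ T := by
    simp [hT]
  obtain ⟨t1, t2, t3, t4, t5, t6⟩ := hTT
  refine ⟨fun a => ?_, fun a b => ?_, fun a b => ?_, fun s hs a b => ?_, fun s p hs hp => ?_⟩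
  · exact (norm_le_pi_norm (fun a => frameVec V a) a).trans ((hT₆ _ hVb).trans t6)
  · exact (hT₁ (a, b) (V', U') x ⟨⟨hVb, hUb⟩, hx⟩).mono t1
  · exact (hT₂ (a, b) (V', U') x ⟨⟨hVb, hUb⟩, hx⟩).mono t2
  · exact (hT₃ (a, b) (V', U') (x, s) ⟨⟨hVb, hUb⟩, hx, hs' s hs⟩).mono t3
  · have hp' : p ∈ Metric.closedBall (0 : Fin n → ℂ) |B| := by
      rw [mem_closedBall_zero_iff, pi_norm_le_iff_of_nonneg (abs_nonneg _)]
      exact fun a => (hp a).trans (le_abs_self _)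
    refine ⟨(hT₄ (V', U') (x, p, s) ⟨⟨hVb, hUb⟩, hx, hp', hs' s hs⟩).mono t4, ?_⟩
    have h3 := (hT₅ ((V', U'), (x, p, s)) ⟨⟨hVb, hUb⟩, hx, hp', hs' s hs⟩).trans t5
    have h4 := hΨ0 ((V', U'), (x, p, s)) hx
    rw [Pi.inv_apply, norm_inv, Complex.norm_real, Real.norm_of_nonneg h4.le] at h3
    rw [one_div]
    exact inv_le_of_inv_le₀ h4 h3

end LocalData

end LocalData

section FrameAtMaximum

open Filter Topology

variable {n : ℕ}

namespace LocalData

variable {D : LocalData n} {K : Set (Cn n)} {k : ℕ} {ε A B : ℝ} {f : Cn n → ℝ} {x : Cn n}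
  {V : Matrix (Fin n) (Fin n) ℂ}

lemma contDiffAt_frameW (hx : x ∈ D.dom) (a b : Fin n) :
    ContDiffAt ℝ 2 (fun y => D.frameW V y a b) x :=
  contDiffAt_const_mul_mul_const V Vᴴ (fun a b =>
    ((D.contDiffOn_W a b).contDiffAt (D.isOpen_dom.mem_nhds hx)).of_le two_le_infty) a b

lemma contDiffAt_frameB {U : Matrix (Fin n) (Fin n) ℂ} (hx : x ∈ D.dom) (a b : Fin n) :
    ContDiffAt ℝ 2 (fun y => D.frameB U y a b) x :=
  contDiffAt_const_mul_mul_const Uᴴ U (contDiffAt_inv_apply (fun a b =>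
    ((D.contDiffOn_W a b).contDiffAt (D.isOpen_dom.mem_nhds hx)).of_le two_le_infty)
      (D.posDef_W x hx).det_pos.ne') a b

lemma contDiffAt_frameX {s : ℝ} (hx : x ∈ D.dom) (a b : Fin n) :
    ContDiffAt ℝ 2 (fun q => D.frameX V q a b) (x, s) :=
  contDiffAt_const_mul_mul_const V Vᴴ (fun a b =>
    ((D.contDiffOn_X a b).contDiffAt ((D.isOpen_dom.prod isOpen_univ).mem_nhds
      ⟨hx, Set.mem_univ _⟩)).of_le two_le_infty) a b

lemma contDiffAt_frameΨ {U : Matrix (Fin n) (Fin n) ℂ} {q : (Fin n → ℂ) × ℝ} (hx : x ∈ D.dom) :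
    ContDiffAt ℝ 2 (D.frameΨ k U) (x, q) := by
  refine contDiffAt_const.mul ?_
  refine ContDiffAt.comp (x, q) ((D.contDiffOn_Ψ.contDiffAt ((D.isOpen_dom.prod
    isOpen_univ).mem_nhds ⟨hx, Set.mem_univ _⟩)).of_le two_le_infty)
      (f := fun q : Cn n × (Fin n → ℂ) × ℝ => (q.1, U *ᵥ q.2.1, q.2.2)) ?_
  refine contDiffAt_fst.prodMk (ContDiffAt.prodMk ?_ contDiffAt_snd.snd)
  refine contDiffAt_pi.2 fun a => ?_
  simp only [Matrix.mulVec, dotProduct]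
  refine ContDiffAt.sum fun b _ => contDiffAt_const.mul ?_
  fun_prop

lemma testExp_frame (hV : IsUnit V.det) (A N M : ℝ) (f : Cn n → ℝ) (x : Cn n) :
    testExp (frameVec V) f (D.frameB V⁻¹) A N M x = D.exponent A N M f x := by
  have h := gradSq_frameVec hV f D.W x
  rw [testExp, exponent, gradLenSq, ← h]
  rfl

lemma gradLenSq_eq (hV : V * D.W x * Vᴴ = 1) :
    D.gradLenSq f x = ∑ a, ‖(V *ᵥ gradVec f x) a‖ ^ 2 := by
  rw [gradLenSq, inv_eq_conjTranspose_mul hV, ← Matrix.mulVec_mulVec, Matrix.dotProduct_mulVec,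
    ← Matrix.star_mulVec, dotProduct, Complex.re_sum]
  refine Finset.sum_congr rfl fun a _ => ?_
  rw [Pi.star_apply, ← starRingEnd_apply, Complex.conj_mul']
  norm_cast

lemma IsSolution.norm_mulVec_gradVec_le (h : D.IsSolution k ε A B f) (hx : x ∈ D.dom)
    (hV : V * D.W x * Vᴴ = 1) (a : Fin n) : ‖(V *ᵥ gradVec f x) a‖ ≤ B := by
  refine le_trans ?_ (h.gradLen_le x hx)
  rw [gradLenSq_eq hV]
  refine Real.le_sqrt_of_sq_le ?_
  exact Finset.single_le_sum (f := fun a => ‖(V *ᵥ gradVec f x) a‖ ^ 2)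
    (fun a _ => sq_nonneg _) (Finset.mem_univ a)

lemma IsSolution.le_frameX (h : D.IsSolution k ε A B f) (hx : x ∈ D.dom)
    (hV : V * D.W x * Vᴴ = 1) (a : Fin n) : ε ≤ (D.frameX V (x, f x) a a).re := by
  have h1 := h.le_X x hx (Pi.single a 1 ᵥ* V)
  rw [← quad_mul_mul, ← quad_mul_mul, hV, quad_single, quad_single] at h1
  simpa [frameX] using h1

lemma IsSolution.addHess_eq (h : D.IsSolution k ε A B f) (hx : x ∈ D.dom) :
    addHess (frameVec V) (fun y => (f y : ℂ)) (fun y => D.frameX V (y, f y)) x =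
      V * D.g f x * Vᴴ :=
  addHess_frameVec (h.contDiffAt x hx) fun y => D.X (y, f y)

lemma IsSolution.equation_frame (h : D.IsSolution k ε A B f) (hkn : k ≤ n) (hV : IsUnit V.det)
    (hx : x ∈ D.dom) : mixedDet k (V * D.g f x * Vᴴ) (D.frameW V x) =
      (D.frameΨ k V⁻¹ (jet (frameVec V) f x) : ℂ) * (D.frameW V x).det := by
  rw [frameW, mixedDet_mul_mul _ _ _ _ (by simpa using hkn), h.equation x hx, Matrix.det_mul,
    Matrix.det_mul, frameΨ, jet, frameGrad_frameVec, Matrix.mulVec_mulVec,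
    Matrix.nonsing_inv_mul _ hV, Matrix.one_mulVec]
  push_cast
  ring

lemma frameB_eq_one (hV : V * D.W x * Vᴴ = 1) : D.frameB V⁻¹ x = 1 := by
  have hu := isUnit_det_of_mul_mul_eq_one hV
  have hVH : IsUnit (Vᴴ).det := by
    rw [Matrix.det_conjTranspose]
    exact hu.star
  rw [frameB, inv_eq_conjTranspose_mul hV, Matrix.conjTranspose_nonsing_inv, Matrix.mul_assoc,
    Matrix.mul_assoc, Matrix.mul_nonsing_inv _ hu, Matrix.mul_one, Matrix.nonsing_inv_mul _ hVH]

/-- At a maximum point of the test function, a frame that is orthonormal for the metric and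
diagonalizes the solution satisfies the hypotheses of the eigenvalue bound. -/
lemma exists_maxPointData (hK : IsCompact K) (hKD : K ⊆ D.dom) (hkn : k ≤ n) (A B : ℝ) :
    ∃ T₁ : ℝ, 1 ≤ T₁ ∧ ∀ T, T₁ ≤ T → ∀ (ε N M S : ℝ) (f : Cn n → ℝ), D.IsSolution k ε A B f →
      ∀ x ∈ K, ∀ (V : Matrix (Fin n) (Fin n) ℂ) (lam : Fin n → ℝ) (m : Fin n),
      V * D.W x * Vᴴ = 1 → V * D.g f x * Vᴴ = Matrix.diagonal (fun a => (lam a : ℂ)) →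
      (∀ a, lam a ≤ lam m) →
      (∀ y ∈ D.dom, ∀ z, quad (D.g f y) z * Real.exp (D.exponent A N M f y) ≤
        S * quad (D.W y) z) → S ≤ lam m * Real.exp (D.exponent A N M f x) →
      MaxPointData k ε A T N M f (fun y => D.frameX V (y, f y)) (D.frameW V) (D.frameB V⁻¹)
        (D.frameΨ k V⁻¹) (frameVec V) x lam m := by
  obtain ⟨T₀, hT₀1, hT₀⟩ := exists_jet_bound hK hKD hkn A B
  set R := max T₀ B with hR
  have hTR : T₀ ≤ R := le_max_left _ _
  have hR1 : 1 ≤ R := hT₀1.trans hTR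
  have hRR : R ≤ R ^ 3 := le_self_pow₀ hR1 (by norm_num)
  have hR2 : R ^ 2 ≤ R ^ 3 := pow_le_pow_right₀ hR1 (by norm_num)
  refine ⟨5 * R ^ 3, by linarith, fun T hT ε N M S f hf x hxK V lam m hVW hVg hlm hmax hS => ?_⟩
  have hx := hKD hxK
  have hu := isUnit_det_of_mul_mul_eq_one hVW
  have hdom : ∀ᶠ y in 𝓝 x, y ∈ D.dom := D.isOpen_dom.mem_nhds hx
  have hfx := hf.contDiffAt x hx
  have habs := hf.abs_le x hx
  obtain ⟨hv, hjW, hjB, hjX, hjΨ⟩ := hT₀ x hxK V hVW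
  have hvR : ∀ a, ‖frameVec V a‖ ≤ R := fun a => (hv a).trans hTR
  have hp : ∀ a, ‖frameGrad (frameVec V) (fun y => (f y : ℂ)) x a‖ ≤ B := fun a => by
    rw [frameGrad_frameVec]
    exact hf.norm_mulVec_gradVec_le hx hVW a
  have hpR : ∀ a, ‖∂[frameVec V a] (fun y => (f y : ℂ)) x‖ ≤ R := fun a =>
    (hp a).trans (le_max_right _ _)
  obtain ⟨hjΨ1, hjΨ2⟩ := hjΨ (f x) _ habs hp
  have hjX' := fun a b => (hjX (f x) habs a b).mono hTR
  have hfC : ContDiffAt ℝ 2 f x := hfx.of_le (by norm_num)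
  have hX : ∀ a b, ContDiffAt ℝ 2 (fun y => D.frameX V (y, f y) a b) x := fun a b =>
    ContDiffAt.comp x (g := fun q => D.frameX V q a b) (f := fun y => (y, f y))
      (contDiffAt_frameX hx a b) (contDiffAt_id.prodMk hfC)
  have hG := hf.addHess_eq (V := V) hx
  -- positivity of the solution form on the vectors of the frame
  have hpos : ∀ a, 0 < lam a := fun a => by
    have h1 := quad_pos (hf.posDef x hx) (y := Pi.single a 1 ᵥ* V) (by
      intro h0
      have h1 : (Pi.single a 1 : Fin n → ℂ) ᵥ* V ᵥ* V⁻¹ = 0 := by rw [h0, Matrix.zero_vecMul]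
      rw [Matrix.vecMul_vecMul, Matrix.mul_nonsing_inv _ hu, Matrix.vecMul_one] at h1
      simpa using congrFun h1 a)
    rw [← quad_mul_mul, hVg, quad_single] at h1
    simpa using h1
  -- the second derivatives of `f` in the frame are bounded by the eigenvalues
  have hlap : ∀ i, |(lap (frameVec V i) (fun y => (f y : ℂ)) x).re| ≤ lam i + R := fun i => by
    have e1 : D.frameX V (x, f x) i i + lap (frameVec V i) (fun y => (f y : ℂ)) x = lam i := by
      have := congrFun (congrFun (hG.trans hVg) i) i
      rw [Matrix.diagonal_apply_eq] at this
      exact this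
    have e2 := congrArg Complex.re e1
    rw [Complex.add_re, Complex.ofReal_re] at e2
    have e3 := abs_le.1 ((Complex.abs_re_le_norm _).trans (hjX' i i).1)
    have e4 := hpos i
    rw [abs_le]
    constructor <;> linarith
  have hexp : ∀ y, testExp (frameVec V) f (D.frameB V⁻¹) A N M y = D.exponent A N M f y :=
    testExp_frame hu A N M f
  exact
  { f_contDiffAt := hfx
    X_contDiffAt := hX
    W_contDiffAt := contDiffAt_frameW hx
    B_contDiffAt := contDiffAt_frameB hx
    Ψ_contDiffAt := contDiffAt_frameΨ hx
    addHess_isHermitian := by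
      filter_upwards [hdom] with y hy
      rw [hf.addHess_eq hy]
      exact Matrix.isHermitian_mul_mul_conjTranspose _ (hf.posDef y hy).1
    W_isHermitian := by
      filter_upwards [hdom] with y hy
      exact Matrix.isHermitian_mul_mul_conjTranspose _ (D.posDef_W y hy).1
    B_isHermitian := by
      filter_upwards [hdom] with y hy
      exact Matrix.isHermitian_conjTranspose_mul_mul _ (D.posDef_W y hy).1.inv
    addHess_eq := hG.trans hVg
    W_eq := hVW
    B_eq := frameB_eq_one hVW
    lam_pos := hpos
    lam_le := hlm
    exists_dual := fun a => by
      have h0 : frameVec V a ≠ 0 := by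
        intro h0
        have h1 : V a = 0 := by simpa [frameVec] using h0
        have h2 := congrFun (congrFun (Matrix.mul_nonsing_inv V hu) a) a
        rw [Matrix.mul_apply] at h2
        simp [h1] at h2
      exact SeparatingDual.exists_eq_one h0
    equation := by
      filter_upwards [hdom] with y hy
      rw [hf.addHess_eq hy]
      exact hf.equation_frame hkn hu hy
    isMax := by
      filter_upwards [hdom] with y hy z
      rw [hf.addHess_eq hy, hexp, hexp, ← quad_eq_sum, ← quad_eq_sum, quad_mul_mul, frameW,
        quad_mul_mul]
      refine (hmax y hy _).trans (mul_le_mul_of_nonneg_right hS ?_)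
      exact quad_nonneg (D.posDef_W y hy) _
    abs_f_le := habs
    le_X := hf.le_frameX hx hVW
    norm_v := fun i => (hvR i).trans (by linarith)
    norm_grad := fun a => (hpR a).trans (by linarith)
    norm_X := fun a b => (hjX' a b).1.trans (by linarith)
    norm_del_X := fun i a b => by
      have := norm_wirt_graph_le hfC (contDiffAt_frameX (V := V) hx a b) (hjX' a b).2.1 (hvR i)
        (hpR i) (c := -Complex.I) (by simp)
      refine this.trans ?_
      linarith
    norm_lap_X := fun i a => by
      have := norm_lap_graph_le hfC (contDiffAt_frameX (V := V) hx a a) (hjX' a a).2.1 (hvR i)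
        (hpR i) (hjX' a a).2.2 (hlap i)
      refine this.trans ?_
      have h1 := hpos i
      -- second derivatives of `χ(·, f)` contain those of `f`, hence the growth in `lam i`
      have h2 : R * lam i ≤ R ^ 3 * lam i := mul_le_mul_of_nonneg_right hRR h1.le
      have h3 : 5 * R ^ 3 * (1 + lam i) ≤ T * (1 + lam i) :=
        mul_le_mul_of_nonneg_right hT (by linarith)
      have h4 : 0 ≤ R ^ 3 * lam i := by positivity
      linarith
    norm_del_W := fun i a b => by
      have := norm_wirt_le_mul (c := -Complex.I) (by simp) ((hjW a b).mono hTR).2.1 (hvR i)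
      linarith
    norm_lap_W := fun i a b => by
      have := norm_lap_le_mul (contDiffAt_frameW (V := V) hx a b) ((hjW a b).mono hTR).2.2 (hvR i)
      linarith
    norm_del_B := fun i a b => by
      have := norm_wirt_le_mul (c := -Complex.I) (by simp) ((hjB a b).mono hTR).2.1 (hvR i)
      linarith
    norm_delBar_B := fun i a b => by
      have := norm_wirt_le_mul (c := Complex.I) (by simp) ((hjB a b).mono hTR).2.1 (hvR i)
      linarith
    norm_lap_B := fun i a b => by
      have := norm_lap_le_mul (contDiffAt_frameB (U := V⁻¹) hx a b) ((hjB a b).mono hTR).2.2 (hvR i)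
      linarith
    norm_fderiv_Ψ := hjΨ1.2.1.trans (by linarith)
    norm_fderiv_fderiv_Ψ := hjΨ1.2.2.trans (by linarith)
    inv_le_Ψ := (one_div_le_one_div_of_le (by linarith) (by linarith)).trans hjΨ2
    Ψ_le := by
      have := hjΨ1.1
      rw [Complex.norm_real] at this
      exact (Real.le_norm_self _).trans (this.trans (by linarith)) }

end LocalData

end FrameAtMaximum

/-! ### The estimate on the manifold -/

section Global

open Filter Topology

variable {n : ℕ} {M : Type*} [TopologicalSpace M] [ChartedSpace (Cn n) M]

/-- The data of the equation in a holomorphic chart. -/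
def chartData (met : HermitianMetric n M) (χ : RealFormFamily n M) (ψ : PositiveRHS n M)
    {e : OpenPartialHomeomorph M (Cn n)} (he : e ∈ holCharts n M) : LocalData n where
  dom := e.target
  W x := coeff e x (met.form (e.symm x))
  X p := coeff e p.1 (χ.form (e.symm p.1) p.2)
  Ψ p := ψ.toFun (e.symm p.1) (coordCovec e p.1 p.2.1) p.2.2
  isOpen_dom := e.open_target
  contDiffOn_W := met.smooth e he
  contDiffOn_X := χ.smooth e he
  contDiffOn_Ψ := ψ.smooth e he
  posDef_W _ hx := coeff_metric_posDef met he hx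
  pos_Ψ _ _ _ := ψ.pos _ _ _

/-- A compact manifold is covered by finitely many compact subsets of charts. -/
lemma exists_compact_cover [CompactSpace M] : ∃ (t : Finset M) (K : M → Set (Cn n)),
    (∀ i, IsCompact (K i)) ∧ (∀ i, K i ⊆ (chartAt (Cn n) i).target) ∧
      ∀ z : M, ∃ i ∈ t, z ∈ (chartAt (Cn n) i).source ∧ chartAt (Cn n) i z ∈ K i := by
  choose K hK hzK hKt using fun i : M => exists_compact_subset (chartAt (Cn n) i).open_target
    (mem_chart_target (Cn n) i)
  obtain ⟨t, ht⟩ := CompactSpace.elim_nhds_subcover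
    (fun i => (chartAt (Cn n) i).source ∩ chartAt (Cn n) i ⁻¹' interior (K i)) fun i =>
      ((chartAt (Cn n) i).isOpen_inter_preimage isOpen_interior).mem_nhds
        ⟨mem_chart_source _ i, hzK i⟩
  refine ⟨t, K, hK, hKt, fun z => ?_⟩
  have hz : z ∈ ⋃ i ∈ t, (chartAt (Cn n) i).source ∩ chartAt (Cn n) i ⁻¹' interior (K i) := by
    rw [ht]; trivial
  simp only [Set.mem_iUnion] at hz
  obtain ⟨i, hi, hz1, hz2⟩ := hz
  exact ⟨i, hi, hz1, interior_subset hz2⟩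

variable [IsManifold 𝓘(ℂ, Cn n) ω M] {met : HermitianMetric n M} {χ : RealFormFamily n M}
  {ψ : PositiveRHS n M} {u : M → ℝ} {e e' : OpenPartialHomeomorph M (Cn n)} {x : Cn n} {k : ℕ}
  {ε A B : ℝ}

/-- In each chart the hypotheses on `u` become those on a local solution. -/
lemma isSolution_chartData (hkn : k ≤ n) (hu : ContMDiff 𝓘(ℝ, Cn n) 𝓘(ℝ, ℝ) 4 u)
    (hpsh : IsChiPSH χ u) (hsol : SolvesHessianEq met χ ψ k u) (hge : ChiGe met χ ε u)
    (hA : ∀ z, |u z| ≤ A) (hB : ∀ e ∈ holCharts n M, ∀ x ∈ e.target, gradNorm met u e x ≤ B)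
    (he : e ∈ holCharts n M) :
    (chartData met χ ψ he).IsSolution k ε A B (fun x => u (e.symm x)) where
  contDiffAt x hx := contDiffAt_comp_symm hu he hx
  posDef := hpsh e he
  equation x hx := mixedDet_of_oneOneForm hkn (hsol e he x hx)
  le_X x hx y := by
    have h := hge (e.symm x) (tangentVec e x y)
    rw [← quad_coeff, ← quad_coeff] at h
    exact h
  abs_le x _ := hA _
  gradLen_le := hB e he

section Invariance

variable (he : e ∈ holCharts n M) (he' : e' ∈ holCharts n M) (hx : x ∈ e.target)
    (hx' : e.symm x ∈ e'.source)
include he he' hx hx'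

omit [IsManifold 𝓘(ℂ, Cn n) ω M] in
lemma quad_metric_transition (y : Fin n → ℂ) :
    quad ((chartData met χ ψ he).W x) y =
      quad ((chartData met χ ψ he').W (e' (e.symm x)))
        (y ᵥ* jacobian (fun y => e' (e.symm y)) x) := by
  rw [← quad_mul_mul]
  exact congrArg (fun H => quad H y) (coeff_transition he he' hx hx' met.form)

lemma quad_g_transition (hu : ContMDiff 𝓘(ℝ, Cn n) 𝓘(ℝ, ℝ) 4 u) (y : Fin n → ℂ) :
    quad ((chartData met χ ψ he).g (fun x => u (e.symm x)) x) y =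
      quad ((chartData met χ ψ he').g (fun x => u (e'.symm x)) (e' (e.symm x)))
        (y ᵥ* jacobian (fun y => e' (e.symm y)) x) := by
  rw [← quad_mul_mul, LocalData.g, LocalData.g, Matrix.mul_add, Matrix.add_mul, quad_add, quad_add]
  congr 2
  · exact coeff_transition he he' hx hx' fun z => χ.form z (u z)
  · exact hess_transition he he' hx hx' hu

lemma exponent_transition (hu : ContMDiff 𝓘(ℝ, Cn n) 𝓘(ℝ, ℝ) 4 u) (A N L : ℝ) :
    (chartData met χ ψ he).exponent A N L (fun x => u (e.symm x)) x =
      (chartData met χ ψ he').exponent A N L (fun x => u (e'.symm x)) (e' (e.symm x)) := by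
  have h1 : (chartData met χ ψ he).gradLenSq (fun x => u (e.symm x)) x =
      (chartData met χ ψ he').gradLenSq (fun x => u (e'.symm x)) (e' (e.symm x)) := by
    change (star (grad u e x) ⬝ᵥ ((coeff e x (met.form (e.symm x)))⁻¹ *ᵥ grad u e x)).re = _
    rw [coeff_transition he he' hx hx' met.form, grad_transition he he' hx hx' hu,
      quad_inv_congr (isUnit_det_jacobian he he' hx hx' met)]
    rfl
  simp only [LocalData.exponent, h1, e'.left_inv hx']

lemma hessNorm_transition (hu : ContMDiff 𝓘(ℝ, Cn n) 𝓘(ℝ, ℝ) 4 u) :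
    hessNorm met u e x = hessNorm met u e' (e' (e.symm x)) := by
  rw [hessNorm, coeff_transition he he' hx hx' met.form, hess_transition he he' hx hx' hu,
    trace_congr_invariant (isUnit_det_jacobian he he' hx hx' met)]
  rfl

end Invariance

end Global

namespace LocalData

open Filter Topology

variable {n : ℕ} {D : LocalData n} {f : Cn n → ℝ} {x : Cn n} {k : ℕ} {ε A B : ℝ}

lemma gradLenSq_nonneg (hx : x ∈ D.dom) : 0 ≤ D.gradLenSq f x := by
  obtain ⟨V, -, hV, -⟩ := exists_simultaneous_diagonalization (D.posDef_W x hx) (D.posDef_W x hx).1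
  rw [gradLenSq_eq hV]
  exact Finset.sum_nonneg fun a _ => sq_nonneg _

lemma exponent_nonneg (hx : x ∈ D.dom) {N M : ℝ} (hN : 0 ≤ N) : 0 ≤ D.exponent A N M f x :=
  add_nonneg (mul_nonneg hN (gradLenSq_nonneg hx)) (Real.exp_pos _).le

lemma IsSolution.exponent_le (h : D.IsSolution k ε A B f) (hx : x ∈ D.dom) {N M : ℝ} (hN : 0 ≤ N)
    (hM : 0 ≤ M) : D.exponent A N M f x ≤ N * B ^ 2 + Real.exp (M * (2 * A + 1)) := by
  refine add_le_add (mul_le_mul_of_nonneg_left (Real.sqrt_le_iff.1 (h.gradLen_le x hx)).2 hN)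
    (Real.exp_le_exp.2 (mul_le_mul_of_nonneg_left ?_ hM))
  linarith [(_root_.abs_le.1 (h.abs_le x hx)).1]

lemma IsSolution.continuousOn_testFunction (h : D.IsSolution k ε A B f) (N M : ℝ) :
    ContinuousOn (fun q : Cn n × (Fin n → ℂ) => quad (D.g f q.1) q.2 *
      Real.exp (D.exponent A N M f q.1) / quad (D.W q.1) q.2) (D.dom ×ˢ Metric.sphere 0 1) := by
  have hquad : ∀ {H : Cn n → Matrix (Fin n) (Fin n) ℂ} {q : Cn n × (Fin n → ℂ)},
      (∀ a b, ContinuousAt (fun x => H x a b) q.1) →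
      ContinuousAt (fun q : Cn n × (Fin n → ℂ) => quad (H q.1) q.2) q := by
    intro H q hH
    simp only [quad_eq_sum]
    refine Complex.continuous_re.continuousAt.comp ?_
    refine tendsto_finsetSum _ fun a _ => tendsto_finsetSum _ fun b _ => ?_
    refine Tendsto.mul ?_ ((hH a b).comp continuousAt_fst)
    exact (Continuous.continuousAt (by fun_prop))
  rintro q ⟨hq1, hq2⟩
  have hq0 : q.2 ≠ 0 := ne_zero_of_mem_unit_sphere ⟨q.2, hq2⟩
  have hfx := h.contDiffAt q.1 hq1
  have hfC : ContDiffAt ℝ 4 (fun y => (f y : ℂ)) q.1 := contDiffAt_ofReal hfx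
  have hW : ∀ a b, ContDiffAt ℝ ∞ (fun x => D.W x a b) q.1 := fun a b =>
    (D.contDiffOn_W a b).contDiffAt (D.isOpen_dom.mem_nhds hq1)
  have hg : ∀ a b, ContinuousAt (fun x => D.g f x a b) q.1 := fun a b => by
    refine ContinuousAt.add ?_ ?_
    · exact ContinuousAt.comp (g := fun p => D.X p a b) (f := fun y => (y, f y))
        ((D.contDiffOn_X a b).contDiffAt ((D.isOpen_dom.prod isOpen_univ).mem_nhds
          ⟨hq1, Set.mem_univ _⟩)).continuousAt (continuousAt_id.prodMk hfx.continuousAt)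
    · simp only [hessMat, Matrix.of_apply, wirtingerBar_eq_delBar, wirtinger_eq_del]
      exact (contDiffAt_wirt (contDiffAt_wirt hfC (m := 3) (by norm_num) _ _) (m := 2)
        (by norm_num) _ _).continuousAt
  have hp : ∀ a, ContinuousAt (fun x => gradVec f x a) q.1 := fun a => by
    simp only [gradVec, wirtinger_eq_del]
    exact (contDiffAt_wirt hfC (m := 3) (by norm_num) _ _).continuousAt
  have hlen : ContinuousAt (fun x => D.gradLenSq f x) q.1 := by
    simp only [gradLenSq, dotProduct, Matrix.mulVec, Pi.star_apply]
    refine Complex.continuous_re.continuousAt.comp ?_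
    refine tendsto_finsetSum _ fun a _ => ((hp a).star).mul (tendsto_finsetSum _ fun b _ => ?_)
    exact ((contDiffAt_inv_apply hW (D.posDef_W q.1 hq1).det_pos.ne' a b).continuousAt).mul (hp b)
  have hexp : ContinuousAt (fun x => Real.exp (D.exponent A N M f x)) q.1 := by
    refine Real.continuous_exp.continuousAt.comp ((continuousAt_const.mul hlen).add ?_)
    exact Real.continuous_exp.continuousAt.comp
      (continuousAt_const.mul (continuousAt_const.sub hfx.continuousAt))
  refine ContinuousAt.continuousWithinAt (((hquad hg).mul
    (ContinuousAt.comp (g := fun x => Real.exp (D.exponent A N M f x)) hexp continuousAt_fst)).div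
      (hquad fun a b => (hW a b).continuousAt) (quad_pos (D.posDef_W _ hq1) hq0).ne')

/-- A Rayleigh quotient is at most the largest eigenvalue. -/
lemma quad_le_mul_quad {V G W : Matrix (Fin n) (Fin n) ℂ} {lam : Fin n → ℝ} {m : Fin n}
    (hW : V * W * Vᴴ = 1) (hG : V * G * Vᴴ = Matrix.diagonal fun a => (lam a : ℂ))
    (hm : ∀ a, lam a ≤ lam m) (y : Fin n → ℂ) : quad G y ≤ lam m * quad W y := by
  have hu := isUnit_det_of_mul_mul_eq_one hW
  have hy : y = (y ᵥ* V⁻¹) ᵥ* V := by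
    rw [Matrix.vecMul_vecMul, Matrix.nonsing_inv_mul _ hu, Matrix.vecMul_one]
  rw [hy, ← quad_mul_mul V G, ← quad_mul_mul V W, hW, hG, quad_diagonal, quad_one, Finset.mul_sum]
  exact Finset.sum_le_sum fun a _ => mul_le_mul_of_nonneg_right (hm a) (sq_nonneg _)

/-- A bound for `χ + √-1 ∂∂̄f` gives a bound for `∂∂̄f`. -/
lemma IsSolution.sqrt_trace_le (h : D.IsSolution k ε A B f) (hx : x ∈ D.dom) {S T : ℝ}
    (hS : ∀ y, quad (D.g f x) y ≤ S * quad (D.W x) y)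
    (hT : ∀ V : Matrix (Fin n) (Fin n) ℂ, V * D.W x * Vᴴ = 1 → ∀ a,
      ‖D.frameX V (x, f x) a a‖ ≤ T) (hH : (hessMat f x).IsHermitian) :
    √(((D.W x)⁻¹ * hessMat f x * (D.W x)⁻¹ * hessMat f x).trace.re) ≤ √(n * (S + T) ^ 2) := by
  obtain ⟨V, μ, hV, hμ⟩ := exists_simultaneous_diagonalization (D.posDef_W x hx) hH
  rw [trace_inv_mul_inv_mul hV hμ]
  refine Real.sqrt_le_sqrt ?_
  have h1 : ∀ a, μ a ^ 2 ≤ (S + T) ^ 2 := fun a => by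
    have e1 := hS (Pi.single a 1 ᵥ* V)
    have e2 := quad_nonneg (h.posDef x hx) (Pi.single a 1 ᵥ* V)
    rw [← quad_mul_mul] at e1 e2
    rw [← quad_mul_mul, hV, quad_single 1 a] at e1
    have e3 : quad (V * D.g f x * Vᴴ) (Pi.single a 1) =
        (D.frameX V (x, f x) a a).re + μ a := by
      rw [g, Matrix.mul_add, Matrix.add_mul, quad_add, hμ, quad_single, quad_single]
      simp [frameX]
    have e4 := _root_.abs_le.1 ((Complex.abs_re_le_norm _).trans (hT V hV a))
    rw [e3] at e1 e2
    simp only [Matrix.one_apply_eq, Complex.one_re, mul_one] at e1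
    exact sq_le_sq' (by linarith) (by linarith)
  calc ∑ a, μ a ^ 2 ≤ ∑ _a : Fin n, (S + T) ^ 2 := Finset.sum_le_sum fun a _ => h1 a
    _ = _ := by simp

end LocalData

section Estimate

open Filter Topology

variable {n : ℕ} {M : Type*} [TopologicalSpace M] [ChartedSpace (Cn n) M]
  [IsManifold 𝓘(ℂ, Cn n) ω M] {met : HermitianMetric n M} {χ : RealFormFamily n M}
  {ψ : PositiveRHS n M} {u : M → ℝ} {k : ℕ} {ε A B : ℝ}

lemma chartAt_mem_holCharts (i : M) : chartAt (Cn n) i ∈ holCharts n M :=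
  IsManifold.chart_mem_maximalAtlas i

/-- The data of the equation in the chart at `i`. -/
abbrev dataAt (met : HermitianMetric n M) (χ : RealFormFamily n M) (ψ : PositiveRHS n M) (i : M) :
    LocalData n := chartData met χ ψ (chartAt_mem_holCharts i)

/-- A bound for a Rayleigh quotient on the unit sphere bounds the quadratic form everywhere. -/
lemma quad_mul_le_of_forall_sphere {G W : Matrix (Fin n) (Fin n) ℂ} (hW : W.PosDef) {E S : ℝ}
    (h : ∀ y ∈ Metric.sphere (0 : Fin n → ℂ) 1, quad G y * E / quad W y ≤ S) (y : Fin n → ℂ) :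
    quad G y * E ≤ S * quad W y := by
  rcases eq_or_ne y 0 with rfl | hy0
  · simp [quad]
  have hr : 0 < ‖y‖ := norm_pos_iff.2 hy0
  have hy' : ((‖y‖⁻¹ : ℝ) : ℂ) • y ∈ Metric.sphere (0 : Fin n → ℂ) 1 := by
    rw [mem_sphere_zero_iff_norm, norm_smul, Complex.norm_real, norm_inv, norm_norm,
      inv_mul_cancel₀ hr.ne']
  have h1 := h _ hy'
  rwa [quad_smul, quad_smul, mul_assoc,
    mul_div_mul_left _ _ (pow_ne_zero 2 (inv_ne_zero hr.ne')), div_le_iff₀ (quad_pos hW hy0)] at h1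

/-- The test function attains its maximum over the unit sphere bundle, at a point in one of the
compact sets of the cover. -/
lemma exists_isMax {t : Finset M} {K : M → Set (Cn n)} (hK : ∀ i, IsCompact (K i))
    (hKt : ∀ i, K i ⊆ (chartAt (Cn n) i).target)
    (hcov : ∀ z : M, ∃ i ∈ t, z ∈ (chartAt (Cn n) i).source ∧ chartAt (Cn n) i z ∈ K i)
    (hu : ContMDiff 𝓘(ℝ, Cn n) 𝓘(ℝ, ℝ) 4 u)
    (hsol : ∀ (e : OpenPartialHomeomorph M (Cn n)) (he : e ∈ holCharts n M),
      (chartData met χ ψ he).IsSolution k ε A B (fun x => u (e.symm x)))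
    (hn : 0 < n) (z₀ : M) (N L : ℝ) :
    ∃ S : ℝ, ∃ i ∈ t, ∃ x ∈ K i, ∃ y : Fin n → ℂ, y ≠ 0 ∧
      S * quad ((dataAt met χ ψ i).W x) y =
        quad ((dataAt met χ ψ i).g (fun x => u ((chartAt (Cn n) i).symm x)) x) y *
        Real.exp ((dataAt met χ ψ i).exponent A N L (fun x => u ((chartAt (Cn n) i).symm x)) x) ∧
      ∀ (e : OpenPartialHomeomorph M (Cn n)) (he : e ∈ holCharts n M), ∀ x ∈ e.target, ∀ y,
        quad ((chartData met χ ψ he).g (fun x => u (e.symm x)) x) y *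
          Real.exp ((chartData met χ ψ he).exponent A N L (fun x => u (e.symm x)) x) ≤
        S * quad ((chartData met χ ψ he).W x) y := by
  set θ : M → Cn n × (Fin n → ℂ) → ℝ := fun i q =>
    quad ((dataAt met χ ψ i).g (fun x => u ((chartAt (Cn n) i).symm x)) q.1) q.2 *
      Real.exp ((dataAt met χ ψ i).exponent A N L (fun x => u ((chartAt (Cn n) i).symm x)) q.1) /
        quad ((dataAt met χ ψ i).W q.1) q.2 with hθ
  have hWpos : ∀ i, ∀ x ∈ K i, ((dataAt met χ ψ i).W x).PosDef := fun i x hx =>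
    (dataAt met χ ψ i).posDef_W x (hKt i hx)
  set I : Set ℝ := ⋃ i ∈ t, θ i '' (K i ×ˢ Metric.sphere 0 1) with hI
  have hIc : IsCompact I := t.isCompact_biUnion fun i _ =>
    ((hK i).prod (isCompact_sphere 0 1)).image_of_continuousOn
      (((hsol _ (chartAt_mem_holCharts i)).continuousOn_testFunction N L).mono
        (Set.prod_mono (hKt i) subset_rfl))
  have hIne : I.Nonempty := by
    obtain ⟨i, hi, -, hz⟩ := hcov z₀
    refine ⟨θ i (_, Pi.single ⟨0, hn⟩ 1), Set.mem_biUnion hi ⟨_, ⟨hz, ?_⟩, rfl⟩⟩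
    rw [mem_sphere_zero_iff_norm, Pi.norm_single, norm_one]
  obtain ⟨S, hSI, hSmax⟩ := hIc.exists_isGreatest hIne
  simp only [hI, Set.mem_iUnion] at hSI
  obtain ⟨i, hi, ⟨x, y⟩, ⟨hx, hy⟩, hS⟩ := hSI
  have hy0 : y ≠ 0 := ne_zero_of_mem_unit_sphere ⟨y, hy⟩
  refine ⟨S, i, hi, x, hx, y, hy0, ?_, fun e he x hx y => ?_⟩
  · rw [← hS, hθ]
    exact div_mul_cancel₀ _ (quad_pos (hWpos i x hx) hy0).ne'
  · -- the inequality over the compact sets of the cover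
    have hcomp : ∀ i ∈ t, ∀ x ∈ K i, ∀ y : Fin n → ℂ,
        quad ((dataAt met χ ψ i).g (fun x => u ((chartAt (Cn n) i).symm x)) x) y *
        Real.exp ((dataAt met χ ψ i).exponent A N L (fun x => u ((chartAt (Cn n) i).symm x)) x) ≤
        S * quad ((dataAt met χ ψ i).W x) y := by
      intro i hi x hx y
      refine quad_mul_le_of_forall_sphere (hWpos i x hx) (fun y hy => ?_) y
      have h1 : θ i (x, y) ∈ I := by
        rw [hI]
        exact Set.mem_iUnion₂.2 ⟨i, hi, Set.mem_image_of_mem (θ i) (Set.mk_mem_prod hx hy)⟩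
      have h2 := hSmax h1
      rwa [hθ] at h2
    obtain ⟨i, hi, hz1, hz2⟩ := hcov (e.symm x)
    rw [quad_g_transition he (chartAt_mem_holCharts i) hx hz1 hu,
      quad_metric_transition he (chartAt_mem_holCharts i) hx hz1,
      exponent_transition he (chartAt_mem_holCharts i) hx hz1 hu]
    exact hcomp i hi _ hz2 _

end Estimate

end HessianEstimate

end

theorem theorem1 (n k : ℕ) (hk : 1 ≤ k) (hkn : k ≤ n)
    (M : Type*) [TopologicalSpace M] [T2Space M] [CompactSpace M]
    [ChartedSpace (HessianEstimate.Cn n) M]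
    [IsManifold 𝓘(ℂ, HessianEstimate.Cn n) ω M]
    (met : HessianEstimate.HermitianMetric n M) (χ : HessianEstimate.RealFormFamily n M)
    (ψ : HessianEstimate.PositiveRHS n M) (ε : ℝ) (hε : 0 < ε) (A B : ℝ) :
    ∃ C : ℝ, ∀ u : M → ℝ,
      ContMDiff 𝓘(ℝ, HessianEstimate.Cn n) 𝓘(ℝ, ℝ) 4 u →
      HessianEstimate.IsChiPSH χ u →
      HessianEstimate.SolvesHessianEq met χ ψ k u →
      HessianEstimate.ChiGe met χ ε u →
      (∀ z, |u z| ≤ A) →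
      (∀ e ∈ HessianEstimate.holCharts n M, ∀ x ∈ e.target,
        HessianEstimate.gradNorm met u e x ≤ B) →
      ∀ e ∈ HessianEstimate.holCharts n M, ∀ x ∈ e.target,
        HessianEstimate.hessNorm met u e x ≤ C := by
  open HessianEstimate in
  obtain ⟨t, K, hK, hKt, hcov⟩ := exists_compact_cover (n := n) (M := M)
  choose T₁ hT₁1 hT₁ using fun i => (dataAt met χ ψ i).exists_maxPointData (hK i) (hKt i) hkn A B
  choose T₂ hT₂1 hT₂ using fun i => (dataAt met χ ψ i).exists_jet_bound (hK i) (hKt i) hkn A B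
  obtain ⟨T', hT'⟩ := (t.image fun i => max (T₁ i) (T₂ i)).exists_le
  set T := max 1 T' with hTdef
  have hT : ∀ i ∈ t, T₁ i ≤ T ∧ T₂ i ≤ T := fun i hi => by
    have := (hT' _ (Finset.mem_image_of_mem _ hi)).trans (le_max_right 1 T')
    exact ⟨(le_max_left _ _).trans this, (le_max_right _ _).trans this⟩
  obtain ⟨N, L, Λ, hN, hL, hΛ⟩ := exists_eigenvalue_bound n (Fin n) hk (by simpa using hkn) A hε
    (le_max_left 1 T')
  -- `|∂u|² ≤ B²` and `-u ≤ A` bound the exponential factor of the test function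
  set S₀ := max Λ 0 * Real.exp (N * B ^ 2 + Real.exp (L * (2 * A + 1))) with hS₀
  refine ⟨√(n * (S₀ + T) ^ 2), fun u hu hpsh hsol hge hA hB e he x hx => ?_⟩
  have hloc : ∀ (e : OpenPartialHomeomorph M (Cn n)) (he : e ∈ holCharts n M),
      (chartData met χ ψ he).IsSolution k ε A B (fun x => u (e.symm x)) := fun e he =>
    isSolution_chartData hkn hu hpsh hsol hge hA hB he
  obtain ⟨S, i, hi, x₁, hx₁, y, hy, hSy, hmax⟩ :=
    exists_isMax hK hKt hcov hu hloc (by omega) (e.symm x) N L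
  -- the maximum value is controlled by the largest eigenvalue at the maximum point
  have hS : S ≤ S₀ := by
    have hdom := hKt i hx₁
    have hsi := hloc _ (chartAt_mem_holCharts i)
    obtain ⟨V, lam, hVW, hVg⟩ := exists_simultaneous_diagonalization
      ((dataAt met χ ψ i).posDef_W x₁ hdom) (hsi.posDef x₁ hdom).1
    have : Nonempty (Fin n) := ⟨⟨0, by omega⟩⟩
    obtain ⟨m, hm⟩ := Finite.exists_max lam
    have hW0 := quad_pos ((dataAt met χ ψ i).posDef_W x₁ hdom) hy
    have hS1 : S ≤ lam m * Real.exp ((dataAt met χ ψ i).exponent A N L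
        (fun x => u ((chartAt (Cn n) i).symm x)) x₁) := by
      refine le_of_mul_le_mul_right ?_ hW0
      rw [hSy]
      have h1 := mul_le_mul_of_nonneg_right (LocalData.quad_le_mul_quad hVW hVg hm y)
        (Real.exp_pos ((dataAt met χ ψ i).exponent A N L
          (fun x => u ((chartAt (Cn n) i).symm x)) x₁)).le
      linarith
    have h2 := hΛ _ _ _ _ _ _ _ _ _ (hT₁ i T (hT i hi).1 ε N L S _ hsi x₁ hx₁ V lam m hVW hVg hm
      (hmax _ (chartAt_mem_holCharts i)) hS1)
    refine hS1.trans (mul_le_mul (h2.trans (le_max_left _ _))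
      (Real.exp_le_exp.2 (hsi.exponent_le hdom hN hL)) (Real.exp_pos _).le (le_max_right _ _))
  obtain ⟨j, hj, hz1, hz2⟩ := hcov (e.symm x)
  have hdom := hKt j hz2
  have hsj := hloc _ (chartAt_mem_holCharts j)
  rw [hessNorm_transition he (chartAt_mem_holCharts j) hx hz1 hu]
  refine hsj.sqrt_trace_le hdom (fun y => ?_) (fun V hV a => ?_) ?_
  · have h1 := hmax _ (chartAt_mem_holCharts j) _ hdom y
    have h2 := Real.one_le_exp ((dataAt met χ ψ j).exponent_nonneg (A := A) (M := L)
      (f := fun x => u ((chartAt (Cn n) j).symm x)) hdom hN)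
    have h3 := quad_nonneg (hsj.posDef _ hdom) y
    have h4 := quad_nonneg ((dataAt met χ ψ j).posDef_W _ hdom) y
    calc _ ≤ _ := le_mul_of_one_le_right h3 h2
      _ ≤ _ := h1
      _ ≤ _ := mul_le_mul_of_nonneg_right hS h4
  · exact (((hT₂ j _ hz2 V hV).2.2.2.1 _ (hA _) a a).mono (hT j hj).2).1
  · have h1 := (hsj.posDef _ hdom).1
    have h2 : ((dataAt met χ ψ j).X (chartAt (Cn n) j (e.symm x),
        u ((chartAt (Cn n) j).symm (chartAt (Cn n) j (e.symm x))))).IsHermitian :=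
      coeff_isHermitian (χ.hermitian _ _)
    have h3 := h1.sub h2
    rwa [LocalData.g, add_sub_cancel_left] at h3
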